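/- An instance of Euclidean $k$-supplier in $\mathbb R^d$ consists of a finite nonempty family $\mathcal C$ of points of $\mathbb R^d$ (clients), a finite family $\mathcal F$ of points of $\mathbb R^d$ (candidate centers) and an integer $k$ with $1\le k\le|\mathcal F|$. The cost of $F\subseteq\mathcal F$ with $|F|=k$ is $\mathrm{cost}(F)=\max_{p\in\mathcal C}\min_{f\in F}\|p-f\|_2$, and the goal is to minimize $\mathrm{cost}(F)$ over all $F \subseteq \mathcal F$ with $|F|=k$. Theorem. There is an algorithm that, given $0<\varepsilon\le 1$, $d\ge 1$ and an instance $(\mathcal C,\mathcal F,k)$ of Euclidean $k$-supplier in $\mathbb R^d$, finds $F\subseteq\mathcal F$ with $|F|=k$ and $$\mathrm{cost}(F)\le(1+\varepsilon)\cdot\min\{\mathrm{cost}(T): T\subseteq\mathcal F,\ |T|=k\}$$ in time $$O\Big(|\mathcal C|\cdot|\mathcal F|+2^{O\left((2/\varepsilon)^{O(d)}\cdot k^{1-1/d}\cdot\log k+d\log d\right)}\Big),$$ where every $O(\cdot)$ hides only an absolute constant, independent of $d$, $\varepsilon$, $k$ and the instance. The model of computation is a deterministic real RAM in which each elementary operation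 on integers (addition, subtraction, comparison, memory access) or on reals (the four arithmetic operations, comparison, memory access) costs one step, as does each access to a coordinate of an input point and each evaluation of the Euclidean distance of two input points. -/

import Mathlib

/-- An instance of the Euclidean `k`-supplier problem: a dimension, a number `k` of centers,
a finite family of clients and a finite family of candidate centers (facilities). A finite set
of points is a family without repetitions. -/
structure KSupplier where
  dim : ℕ
  k : ℕ
  numClients : ℕ
  numFacilities : ℕ
  client : Fin numClients → EuclideanSpace ℝ (Fin dim)
  facility : Fin numFacilities → EuclideanSpace ℝ (Fin dim)

namespace KSupplier

/-- `cost S = max_{p a client} d(p, S)`, where `d(p, S)` is the distance from `p` to the nearest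
facility of `S`. -/
noncomputable def cost (I : KSupplier) (S : Finset (Fin I.numFacilities)) : ℝ :=
  ⨆ p : Fin I.numClients, Metric.infDist (I.client p) (I.facility '' (S : Set (Fin I.numFacilities)))

/-- The maximum and the minimum in the problem are over nonempty sets. -/
structure WellPosed (I : KSupplier) : Prop where
  dim_pos : 1 ≤ I.dim
  clients_pos : 1 ≤ I.numClients
  k_pos : 1 ≤ I.k
  k_le : I.k ≤ I.numFacilities

/-- `S` consists of `k` facilities and its cost is at most `α` times the cost of every set of
`k` facilities, i.e. at most `α` times the optimum. -/
def IsApproxSolution (I : KSupplier) (α : ℝ) (S : Finset (Fin I.numFacilities)) : Prop :=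
  S.card = I.k ∧ ∀ T : Finset (Fin I.numFacilities), T.card = I.k → I.cost S ≤ α * I.cost T

/-- The input points as one sequence: first the clients, then the facilities. Indices that are
out of range denote the origin. -/
noncomputable def point (I : KSupplier) (i : ℕ) : EuclideanSpace ℝ (Fin I.dim) :=
  if h : i < I.numClients then I.client ⟨i, h⟩
  else if h' : i - I.numClients < I.numFacilities then I.facility ⟨i - I.numClients, h'⟩
  else 0

/-- The `a`-th coordinate of the `i`-th input point (`0` if there is no such coordinate). -/
noncomputable def coord (I : KSupplier) (i a : ℕ) : ℝ :=
  if h : a < I.dim then I.point i ⟨a, h⟩ else 0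

end KSupplier

/-! A deterministic real RAM, presented through structured programs. The memory consists of
arrays of natural numbers and arrays of real numbers (a program can mention only finitely many
of them), all cells of which are addressable by computed indices. Every elementary operation
costs one step: reading or writing a cell, reading an input parameter, addition and truncated
subtraction of natural numbers, the four arithmetic operations on real numbers, a comparison,
a branching, and the evaluation of a coordinate of an input point or of the distance of two input
points. There is no rounding of real numbers, no multiplication of natural numbers, and there are
no real constants. -/
namespace RealRAM

/-- Expressions of type natural number. -/
inductive NatExpr : Type
  | lit (n : ℕ)
  | dim
  | k
  | numClients
  | numFacilities
  | get (A : ℕ) (i : NatExpr)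
  | add (a b : NatExpr)
  | sub (a b : NatExpr)

/-- Expressions of type real number; `eps` is the accuracy parameter, part of the input. -/
inductive RealExpr : Type
  | eps
  | cast (a : NatExpr)
  | get (A : ℕ) (i : NatExpr)
  | dist (p q : NatExpr)
  | coord (p a : NatExpr)
  | add (x y : RealExpr)
  | sub (x y : RealExpr)
  | mul (x y : RealExpr)
  | div (x y : RealExpr)

/-- Tests. -/
inductive Test : Type
  | natLt (a b : NatExpr)
  | realLt (x y : RealExpr)
  | neg (b : Test)
  | conj (b c : Test)

/-- Programs: `setNat A i e` is the assignment `A[i] := e` to a cell of a natural number array,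
`setReal A i x` the same for real arrays, and `loop b c` is "while `b` do `c`". -/
inductive Program : Type
  | skip
  | setNat (A : ℕ) (i e : NatExpr)
  | setReal (A : ℕ) (i : NatExpr) (x : RealExpr)
  | seq (c c' : Program)
  | cond (b : Test) (c c' : Program)
  | loop (b : Test) (c : Program)

/-- The contents of the memory: `nat A i` and `real A i` are the `i`-th cells of the `A`-th
arrays. -/
structure State where
  nat : ℕ → ℕ → ℕ
  real : ℕ → ℕ → ℝ

/-- At the start all cells contain `0`. -/
def State.init : State := ⟨fun _ _ => 0, fun _ _ => 0⟩

/-- Writing `v` to the cell `A[i]`. -/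
def State.setNat (s : State) (A i v : ℕ) : State :=
  { s with nat := fun B j => if B = A ∧ j = i then v else s.nat B j }

/-- Writing `v` to the cell `A[i]`. -/
noncomputable def State.setReal (s : State) (A i : ℕ) (v : ℝ) : State :=
  { s with real := fun B j => if B = A ∧ j = i then v else s.real B j }

/-- Value of an expression. -/
def NatExpr.eval (I : KSupplier) (s : State) : NatExpr → ℕ
  | .lit n => n
  | .dim => I.dim
  | .k => I.k
  | .numClients => I.numClients
  | .numFacilities => I.numFacilities
  | .get A i => s.nat A (i.eval I s)
  | .add a b => a.eval I s + b.eval I s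
  | .sub a b => a.eval I s - b.eval I s

/-- Number of steps for evaluating an expression: its number of nodes. -/
def NatExpr.steps : NatExpr → ℕ
  | .lit _ => 1
  | .dim => 1
  | .k => 1
  | .numClients => 1
  | .numFacilities => 1
  | .get _ i => i.steps + 1
  | .add a b => a.steps + b.steps + 1
  | .sub a b => a.steps + b.steps + 1

/-- Value of an expression. -/
noncomputable def RealExpr.eval (I : KSupplier) (ε : ℝ) (s : State) : RealExpr → ℝ
  | .eps => ε
  | .cast a => (a.eval I s : ℝ)
  | .get A i => s.real A (i.eval I s)
  | .dist p q => Dist.dist (I.point (p.eval I s)) (I.point (q.eval I s))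
  | .coord p a => I.coord (p.eval I s) (a.eval I s)
  | .add x y => x.eval I ε s + y.eval I ε s
  | .sub x y => x.eval I ε s - y.eval I ε s
  | .mul x y => x.eval I ε s * y.eval I ε s
  | .div x y => x.eval I ε s / y.eval I ε s

/-- Number of steps for evaluating an expression: its number of nodes. -/
def RealExpr.steps : RealExpr → ℕ
  | .eps => 1
  | .cast a => a.steps + 1
  | .get _ i => i.steps + 1
  | .dist p q => p.steps + q.steps + 1
  | .coord p a => p.steps + a.steps + 1
  | .add x y => x.steps + y.steps + 1
  | .sub x y => x.steps + y.steps + 1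
  | .mul x y => x.steps + y.steps + 1
  | .div x y => x.steps + y.steps + 1

/-- Outcome of a test. -/
def Test.Holds (I : KSupplier) (ε : ℝ) (s : State) : Test → Prop
  | .natLt a b => a.eval I s < b.eval I s
  | .realLt x y => x.eval I ε s < y.eval I ε s
  | .neg b => ¬ b.Holds I ε s
  | .conj b c => b.Holds I ε s ∧ c.Holds I ε s

/-- Number of steps for evaluating a test: its number of nodes. -/
def Test.steps : Test → ℕ
  | .natLt a b => a.steps + b.steps + 1
  | .realLt x y => x.steps + y.steps + 1
  | .neg b => b.steps + 1
  | .conj b c => b.steps + c.steps + 1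

/-- `Exec I ε c s s' t`: on the input `(I, ε)`, the program `c` started in the state `s` halts in
the state `s'` after exactly `t` steps. -/
inductive Exec (I : KSupplier) (ε : ℝ) : Program → State → State → ℕ → Prop
  | skip (s : State) : Exec I ε .skip s s 1
  | setNat (s : State) (A : ℕ) (i e : NatExpr) :
      Exec I ε (.setNat A i e) s (s.setNat A (i.eval I s) (e.eval I s)) (i.steps + e.steps + 1)
  | setReal (s : State) (A : ℕ) (i : NatExpr) (x : RealExpr) :
      Exec I ε (.setReal A i x) s (s.setReal A (i.eval I s) (x.eval I ε s)) (i.steps + x.steps + 1)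
  | seq {c c' : Program} {s s' s'' : State} {t t' : ℕ} :
      Exec I ε c s s' t → Exec I ε c' s' s'' t' → Exec I ε (.seq c c') s s'' (t + t')
  | condTrue {b : Test} {c c' : Program} {s s' : State} {t : ℕ} :
      b.Holds I ε s → Exec I ε c s s' t → Exec I ε (.cond b c c') s s' (b.steps + 1 + t)
  | condFalse {b : Test} {c c' : Program} {s s' : State} {t : ℕ} :
      ¬ b.Holds I ε s → Exec I ε c' s s' t → Exec I ε (.cond b c c') s s' (b.steps + 1 + t)
  | loopTrue {b : Test} {c : Program} {s s' s'' : State} {t t' : ℕ} :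
      b.Holds I ε s → Exec I ε c s s' t → Exec I ε (.loop b c) s' s'' t' →
        Exec I ε (.loop b c) s s'' (b.steps + 1 + t + t')
  | loopFalse {b : Test} {c : Program} {s : State} :
      ¬ b.Holds I ε s → Exec I ε (.loop b c) s s (b.steps + 1)

/-- The output of a computation: the set of facilities whose indices are in the first `k` cells
of the natural number array `0`. -/
def State.output (s : State) (I : KSupplier) : Finset (Fin I.numFacilities) :=
  Finset.univ.filter fun j => ∃ i ∈ Finset.range I.k, s.nat 0 i = (j : ℕ)

end RealRAM

/-! Write n for the number of clients, m for the number of facilities, D = (128/ε)^d and kk = min(k,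
n); kk facilities already do whatever k can, as one facility per client suffices (`feas_cost`). The
algorithm splits into three cases. The split is forced by the requirement that n·m carry only an
absolute constant.

If kk = 1, the best single facility is found directly in O(n·m).

If one side has w < D points, an exact optimum is affordable in O(n·m + 2^{O(w)}). The optimum is
one of the n·m distances, and it is found by bisection at approximate medians. At a threshold t a
point of the long side matters only through its pattern, the set of short-side points within
distance t, so at most 2^w representatives have to be kept for the decision problem. A round costs
O(X + 64^w) when X candidate distances remain, and it discards a sixteenth of them. Points whose
distances have all been decided keep their pattern and are remembered in a table, so that no round
touches all points. The O(X) terms form a geometric series, and the potential in `ends_sSearch`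
bounds the 64^w terms. The median comes from a merge sort that drops every other element after every
two merging levels; this takes linear time and loses only a controlled fraction of the rank
information (`Sketch`).

Otherwise both sides have at least D points, and an approximate optimum is found on nets. Farthest
point traversal yields R with R ≤ opt ≤ 3R and kk centers (`ends_radius`). Around them nets of
resolution about εR consist of at most kk·⌊D⌋ clients and facilities. Building them takes O((n +
m)(kk + D)), which is O(n·m) precisely because kk and D do not exceed n and m. The thresholds on the
nets are at most 4R and are tried one after the other by a dynamic program.

The dynamic program decides on the facilities in a fixed order and discards a partial solution if it
can no longer be completed to a cover or if one already listed is no larger and covers as much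
(`Dominates`). Its cost is governed by the number of partial solutions that survive at once
(`FrontBound`), which is small because of the order. With l about kk^{1/d} and H = 8R, the
facilities of the net are carved into balls of radius at most H·l, each surrounded by a shell of
width H. Ball growing chooses the radii so that the shells contain only a fraction of about (log
a)/l of the a net facilities (`lt_of_growth`, `Clusters.next`). The shell facilities come first,
then one cluster after the other, each by increasing distance from its center. Two facilities
sharing a client are at distance at most H. Hence, among the facilities decided so far, only those
in shells and those in an annulus of width H of the current cluster can share a client with a
facility still to come. Two viable partial solutions with equal size that agree on this window
dominate each other (`Layout.frontBound`). The window has about kk·D·(log a)/l shell points and, by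
comparing volumes, at most about d·(130/ε)^d·l^{d-1} annulus points (`shellBound`). For l about
kk^{1/d} both are at most (2/ε)^{O(d)}·k^{1-1/d}·log k (`exists_window`), and the running time is 2
to the power of a constant multiple of this.

The programs are verified by triples with step counts (`Ends`): loop-free code is evaluated
symbolically, and loops use an invariant together with a potential or a uniform bound. -/

set_option linter.unusedSimpArgs false

/-! ### Programs: loop-free code, frames and Hoare triples with running times -/

namespace RealRAM

infixr:60 " ;; " => Program.seq

/-- The scalar variable stored in cell `0` of a natural number array. -/
abbrev NatExpr.var (A : ℕ) : NatExpr := .get A (.lit 0)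

/-- The scalar variable stored in cell `0` of a real array. -/
abbrev RealExpr.var (A : ℕ) : RealExpr := .get A (.lit 0)

/-- Assignment to a scalar variable. -/
abbrev assign (A : ℕ) (e : NatExpr) : Program := .setNat A (.lit 0) e

/-- Assignment to a scalar real variable. -/
abbrev rassign (A : ℕ) (x : RealExpr) : Program := .setReal A (.lit 0) x

/-- `a ≤ b` as a test. -/
abbrev Test.natLe (a b : NatExpr) : Test := .neg (.natLt b a)

/-- `x ≤ y` as a test. -/
abbrev Test.realLe (x y : RealExpr) : Test := .neg (.realLt y x)

/-- `for i := lo; i < hi; i := i + 1 do c`. -/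
def forUp (i : ℕ) (lo hi : NatExpr) (c : Program) : Program :=
  assign i lo ;; .loop (.natLt (.var i) hi) (c ;; assign i (.add (.var i) (.lit 1)))

namespace State

@[simp] theorem nat_setNat_same (s : State) (A i v : ℕ) :
    (s.setNat A i v).nat A = Function.update (s.nat A) i v := by
  funext j; by_cases h : j = i <;> simp [State.setNat, h]

@[simp] theorem nat_setNat_ne (s : State) {A B : ℕ} (i v : ℕ) (h : B ≠ A) :
    (s.setNat A i v).nat B = s.nat B := by
  funext j; simp [State.setNat, h]

@[simp] theorem real_setNat (s : State) (A i v : ℕ) : (s.setNat A i v).real = s.real := rfl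

@[simp] theorem real_setReal_same (s : State) (A i : ℕ) (v : ℝ) :
    (s.setReal A i v).real A = Function.update (s.real A) i v := by
  funext j; by_cases h : j = i <;> simp [State.setReal, h]

@[simp] theorem real_setReal_ne (s : State) {A B : ℕ} (i : ℕ) (v : ℝ) (h : B ≠ A) :
    (s.setReal A i v).real B = s.real B := by
  funext j; simp [State.setReal, h]

@[simp] theorem nat_setReal (s : State) (A i : ℕ) (v : ℝ) : (s.setReal A i v).nat = s.nat := rfl

end State

namespace Program

/-- Whether a program may write to a natural number array. -/
def writesNat (A : ℕ) : Program → Bool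
  | .skip => false
  | .setNat B _ _ => A == B
  | .setReal _ _ _ => false
  | .seq c c' => c.writesNat A || c'.writesNat A
  | .cond _ c c' => c.writesNat A || c'.writesNat A
  | .loop _ c => c.writesNat A

/-- Whether a program may write to a real array. -/
def writesReal (A : ℕ) : Program → Bool
  | .skip => false
  | .setNat _ _ _ => false
  | .setReal B _ _ => A == B
  | .seq c c' => c.writesReal A || c'.writesReal A
  | .cond _ c c' => c.writesReal A || c'.writesReal A
  | .loop _ c => c.writesReal A

/-- Whether a program is free of loops. -/
def loopFree : Program → Bool
  | .loop _ _ => false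
  | .seq c c' => c.loopFree && c'.loopFree
  | .cond _ c c' => c.loopFree && c'.loopFree
  | _ => true

open Classical in
/-- The effect of a loop-free program. -/
noncomputable def run (I : KSupplier) (ε : ℝ) : Program → State → State
  | .skip, s => s
  | .setNat A i e, s => s.setNat A (i.eval I s) (e.eval I s)
  | .setReal A i x, s => s.setReal A (i.eval I s) (x.eval I ε s)
  | .seq c c', s => c'.run I ε (c.run I ε s)
  | .cond b c c', s => if b.Holds I ε s then c.run I ε s else c'.run I ε s
  | .loop _ _, s => s

/-- A bound for the number of steps of a loop-free program. -/
def bound : Program → ℕ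
  | .skip => 1
  | .setNat _ i e => i.steps + e.steps + 1
  | .setReal _ i x => i.steps + x.steps + 1
  | .seq c c' => c.bound + c'.bound
  | .cond b c c' => b.steps + 1 + (c.bound + c'.bound)
  | .loop _ _ => 0

/-- Two states agree on the arrays that a program does not write. -/
structure Frame (c : Program) (s s' : State) : Prop where
  nat : ∀ A, c.writesNat A = false → s'.nat A = s.nat A
  real : ∀ A, c.writesReal A = false → s'.real A = s.real A

theorem Frame.refl (c : Program) (s : State) : c.Frame s s := ⟨fun _ _ => rfl, fun _ _ => rfl⟩

theorem Frame.trans {c : Program} {s s' s'' : State} (h : c.Frame s s') (h' : c.Frame s' s'') :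
    c.Frame s s'' :=
  ⟨fun A hA => (h'.nat A hA).trans (h.nat A hA), fun A hA => (h'.real A hA).trans (h.real A hA)⟩

theorem Frame.mono {c c' : Program} {s s' : State} (h : c.Frame s s')
    (hn : ∀ A, c'.writesNat A = false → c.writesNat A = false)
    (hr : ∀ A, c'.writesReal A = false → c.writesReal A = false) : c'.Frame s s' :=
  ⟨fun A hA => h.nat A (hn A hA), fun A hA => h.real A (hr A hA)⟩

end Program

variable {I : KSupplier} {ε : ℝ}

/-- Since `writesNat` and `writesReal` are Boolean functions of the syntax, that a concrete program
leaves an array alone is proved by `rfl` wherever it is needed. This is also why all arrays have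
literal numbers. Natural and real arrays are numbered independently, so equal numbers of different
kinds do not clash. -/
theorem Exec.frame {c : Program} {s s' : State} {t : ℕ} (h : Exec I ε c s s' t) :
    c.Frame s s' := by
  induction h with
  | skip s => exact .refl _ _
  | setNat s A i e =>
    refine ⟨fun B hB => State.nat_setNat_ne _ _ _ ?_, fun _ _ => rfl⟩
    simpa [Program.writesNat] using hB
  | setReal s A i x =>
    refine ⟨fun _ _ => rfl, fun B hB => State.real_setReal_ne _ _ _ ?_⟩
    simpa [Program.writesReal] using hB
  | seq _ _ h1 h2 =>
    refine (h1.mono ?_ ?_).trans (h2.mono ?_ ?_) <;>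
      simp +contextual [Program.writesNat, Program.writesReal]
  | condTrue _ _ h | condFalse _ _ h =>
    refine h.mono ?_ ?_ <;> simp +contextual [Program.writesNat, Program.writesReal]
  | loopTrue _ _ _ h1 h2 =>
    refine Program.Frame.trans (h1.mono ?_ ?_) h2 <;>
      simp +contextual [Program.writesNat, Program.writesReal]
  | loopFalse _ => exact .refl _ _

/-- Loop-free code always halts, and its effect is a function. `bound` charges a conditional for
both branches, which keeps it a plain sum. -/
theorem exec_run : ∀ (c : Program) (_ : c.loopFree = true) (s : State),
    ∃ t ≤ c.bound, Exec I ε c s (c.run I ε s) t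
  | .skip, _, s => ⟨1, le_rfl, .skip s⟩
  | .setNat A i e, _, s => ⟨_, le_rfl, .setNat s A i e⟩
  | .setReal A i x, _, s => ⟨_, le_rfl, .setReal s A i x⟩
  | .seq c c', h, s => by
    simp only [Program.loopFree, Bool.and_eq_true] at h
    obtain ⟨t, ht, he⟩ := exec_run c h.1 s
    obtain ⟨t', ht', he'⟩ := exec_run c' h.2 (c.run I ε s)
    exact ⟨t + t', Nat.add_le_add ht ht', .seq he he'⟩
  | .cond b c c', h, s => by
    simp only [Program.loopFree, Bool.and_eq_true] at h
    by_cases hb : b.Holds I ε s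
    · obtain ⟨t, ht, he⟩ := exec_run c h.1 s
      refine ⟨b.steps + 1 + t, by simp only [Program.bound]; omega, ?_⟩
      simpa [Program.run, hb] using Exec.condTrue (c' := c') hb he
    · obtain ⟨t, ht, he⟩ := exec_run c' h.2 s
      refine ⟨b.steps + 1 + t, by simp only [Program.bound]; omega, ?_⟩
      simpa [Program.run, hb] using Exec.condFalse (c := c) hb he
  | .loop _ _, h, _ => by simp [Program.loopFree] at h

theorem run_nat {c : Program} {s : State} {A : ℕ} (h : c.writesNat A = false)
    (hc : c.loopFree = true) : (c.run I ε s).nat A = s.nat A := by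
  obtain ⟨_, _, h'⟩ := exec_run (I := I) (ε := ε) c hc s
  exact h'.frame.nat A h

/-- Started in the state `s`, the program `c` halts within `n` steps, in a state satisfying `Q`. -/
def Ends (I : KSupplier) (ε : ℝ) (c : Program) (s : State) (n : ℕ) (Q : State → Prop) : Prop :=
  ∃ s' t, Exec I ε c s s' t ∧ t ≤ n ∧ Q s'

attribute [simp] NatExpr.eval RealExpr.eval Test.Holds Program.run NatExpr.steps RealExpr.steps
  Test.steps Program.bound

namespace Ends

variable {c c' : Program} {s : State} {n m : ℕ} {Q R : State → Prop}

theorem mono (h : Ends I ε c s n Q) (hn : n ≤ m) (hQ : ∀ s', c.Frame s s' → Q s' → R s') :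
    Ends I ε c s m R := by
  obtain ⟨s', t, he, ht, hq⟩ := h
  exact ⟨s', t, he, ht.trans hn, hQ _ he.frame hq⟩

theorem le (h : Ends I ε c s n Q) (hn : n ≤ m) : Ends I ε c s m Q := h.mono hn fun _ _ h => h

theorem post (h : Ends I ε c s n Q) (hQ : ∀ s', c.Frame s s' → Q s' → R s') :
    Ends I ε c s n R := h.mono le_rfl hQ

theorem straight (hc : c.loopFree = true) (hn : c.bound ≤ n) (hQ : Q (c.run I ε s)) :
    Ends I ε c s n Q := by
  obtain ⟨t, ht, he⟩ := exec_run (I := I) (ε := ε) c hc s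
  exact ⟨_, t, he, ht.trans hn, hQ⟩

theorem seq {n' : ℕ} (h : Ends I ε c s n R)
    (h' : ∀ s', c.Frame s s' → R s' → Ends I ε c' s' n' Q) (hm : n + n' ≤ m) :
    Ends I ε (c ;; c') s m Q := by
  obtain ⟨s', t, he, ht, hr⟩ := h
  obtain ⟨s'', t', he', ht', hq⟩ := h' s' he.frame hr
  exact ⟨s'', t + t', .seq he he', (Nat.add_le_add ht ht').trans hm, hq⟩

theorem step {n' : ℕ} (hc : c.loopFree = true) (h : Ends I ε c' (c.run I ε s) n' Q)
    (hm : c.bound + n' ≤ m) : Ends I ε (c ;; c') s m Q := by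
  obtain ⟨t, ht, he⟩ := exec_run (I := I) (ε := ε) c hc s
  obtain ⟨s'', t', he', ht', hq⟩ := h
  exact ⟨s'', t + t', .seq he he', (Nat.add_le_add ht ht').trans hm, hq⟩

theorem cond {b : Test} (h : b.Holds I ε s → Ends I ε c s n Q)
    (h' : ¬ b.Holds I ε s → Ends I ε c' s n Q) (hm : b.steps + 1 + n ≤ m) :
    Ends I ε (.cond b c c') s m Q := by
  by_cases hb : b.Holds I ε s
  · obtain ⟨s', t, he, ht, hq⟩ := h hb
    exact ⟨s', _, .condTrue hb he, by omega, hq⟩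
  · obtain ⟨s', t, he, ht, hq⟩ := h' hb
    exact ⟨s', _, .condFalse hb he, by omega, hq⟩

/-- The rule for loops: the potential `P` pays for the steps. -/
theorem loop {b : Test} (Inv : State → Prop) (P : State → ℕ) (h : Inv s)
    (hstep : ∀ s', c.Frame s s' → Inv s' → b.Holds I ε s' →
      ∃ n, Ends I ε c s' n fun s'' => Inv s'' ∧ P s'' + n + b.steps + 1 ≤ P s')
    (hm : P s + b.steps + 1 ≤ m) :
    Ends I ε (.loop b c) s m fun s' => Inv s' ∧ ¬ b.Holds I ε s' := by
  -- Termination and running time come from the same induction: each round lowers the potential by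
  -- more than its own cost.
  have key : ∀ p : ℕ, ∀ s', P s' = p → c.Frame s s' → Inv s' →
      Ends I ε (.loop b c) s' (p + b.steps + 1) fun s' => Inv s' ∧ ¬ b.Holds I ε s' := by
    intro p
    induction p using Nat.strong_induction_on with
    | _ p ih =>
      intro s' hp hf hI
      by_cases hb : b.Holds I ε s'
      · obtain ⟨n, s'', t, he, ht, hI', hP⟩ := hstep s' hf hI hb
        obtain ⟨s3, t3, he3, ht3, hq⟩ := ih (P s'') (by omega) s'' rfl (hf.trans he.frame) hI'
        exact ⟨s3, _, .loopTrue hb he he3, by omega, hq⟩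
      · exact ⟨s', _, .loopFalse hb, by omega, hI, hb⟩
  exact (key _ s rfl (.refl _ _) h).le hm

/-- The rule for `for` loops with a uniform bound for the body. -/
theorem forUp {i : ℕ} {lo hi : NatExpr} {k a b : ℕ} (Inv : ℕ → State → Prop)
    (hlo : lo.eval I s = a) (hab : a ≤ b) (hi' : c.writesNat i = false)
    (hhi : ∀ s', (forUp i lo hi c).Frame s s' → hi.eval I s' = b)
    (h0 : Inv a (s.setNat i 0 a))
    (hstep : ∀ j s', a ≤ j → j < b → (RealRAM.forUp i lo hi c).Frame s s' → s'.nat i 0 = j →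
      Inv j s' → Ends I ε c s' k fun s'' => Inv (j + 1) (s''.setNat i 0 (j + 1)))
    (hm : (b - a) * (k + hi.steps + 10) + lo.steps + hi.steps + 10 ≤ m) :
    Ends I ε (RealRAM.forUp i lo hi c) s m fun s' => Inv b s' ∧ s'.nat i 0 = b := by
  have hs0 : (assign i lo).run I ε s = s.setNat i 0 a := by
    simp [Program.run, NatExpr.eval, hlo]
  have hfr0 : (RealRAM.forUp i lo hi c).Frame s (s.setNat i 0 a) := by
    refine ⟨fun A hA => State.nat_setNat_ne _ _ _ ?_, fun _ _ => rfl⟩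
    simp only [RealRAM.forUp, Program.writesNat, Bool.or_eq_false_iff] at hA
    simpa using hA.1
  refine Ends.step (n' := (b - a) * (k + hi.steps + 10) + hi.steps + 5) rfl ?_
    (by simp only [Program.bound, NatExpr.steps]; omega)
  rw [hs0]
  -- The frame relation to the start is part of the invariant, because the value of `hi` is known
  -- only for states that agree with `s` off the written arrays.
  refine (Ends.loop (c := c ;; assign i (.add (.var i) (.lit 1))) (b := .natLt (.var i) hi)
    (fun s' => (RealRAM.forUp i lo hi c).Frame s s' ∧
      ∃ j, a ≤ j ∧ j ≤ b ∧ s'.nat i 0 = j ∧ Inv j s')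
    (fun s' => (b - s'.nat i 0) * (k + hi.steps + 10)) ?_ ?_ ?_).post ?_
  · refine ⟨hfr0, a, le_rfl, hab, ?_, h0⟩
    simp [State.nat_setNat_same]
  · rintro s' - ⟨hf, j, haj, hjb, hij, hI⟩ hb
    have hjb' : j < b := by
      simpa [Test.Holds, NatExpr.eval, hij, hhi s' hf] using hb
    refine ⟨k + 6, Ends.seq (hstep j s' haj hjb' hf hij hI)
      (fun s'' hf'' hI'' => Ends.straight (n := 6) rfl
        (by simp [Program.bound, NatExpr.steps]) ?_) le_rfl⟩
    have hij'' : s''.nat i 0 = j := by rw [hf''.nat i hi', hij]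
    have hrun : (assign i (.add (.var i) (.lit 1))).run I ε s'' = s''.setNat i 0 (j + 1) := by
      simp [Program.run, NatExpr.eval, hij'']
    rw [hrun]
    have hval : (s''.setNat i 0 (j + 1)).nat i 0 = j + 1 := by simp [State.nat_setNat_same]
    refine ⟨⟨?_, j + 1, by omega, by omega, hval, hI''⟩, ?_⟩
    · refine hf.trans ((hf''.mono ?_ ?_).trans ⟨fun A hA => State.nat_setNat_ne _ _ _ ?_,
        fun _ _ => rfl⟩)
      · intro A hA
        simp only [RealRAM.forUp, Program.writesNat, Bool.or_eq_false_iff] at hA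
        exact hA.2.1
      · intro A hA
        simp only [RealRAM.forUp, Program.writesReal, Bool.or_eq_false_iff] at hA
        exact hA.2.1
      · simp only [RealRAM.forUp, Program.writesNat, Bool.or_eq_false_iff] at hA
        simpa using hA.1
    · rw [hval, hij]
      have : (b - j) = (b - (j + 1)) + 1 := by omega
      rw [this, Nat.add_mul]
      simp only [Test.steps, NatExpr.steps]
      omega
  · simp only [State.nat_setNat_same, Function.update_self, Test.steps, NatExpr.steps]
    omega
  · rintro s' - ⟨⟨hf, j, haj, hjb, hij, hI⟩, hb⟩
    have hjb' : ¬ j < b := by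
      simpa [Test.Holds, NatExpr.eval, hij, hhi s' hf] using hb
    obtain rfl : j = b := by omega
    exact ⟨hI, hij⟩

end Ends

end RealRAM

/-! ### An approximate median in linear time -/

namespace RealRAM

variable {I : KSupplier} {ε : ℝ}

open Classical in
/-- The number of indices `i < n` for which `A i` satisfies `D`. -/
noncomputable def cnt (D : ℝ → Prop) (A : ℕ → ℝ) (n : ℕ) : ℕ := Nat.count (fun i => D (A i)) n

open Classical in
theorem cnt_succ (D : ℝ → Prop) (A : ℕ → ℝ) (n : ℕ) :
    cnt D A (n + 1) = cnt D A n + if D (A n) then 1 else 0 := Nat.count_succ _ _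

open Classical in
theorem cnt_zero (D : ℝ → Prop) (A : ℕ → ℝ) : cnt D A 0 = 0 := Nat.count_zero _

theorem cnt_congr {D : ℝ → Prop} {A B : ℕ → ℝ} {n : ℕ} (h : ∀ i < n, A i = B i) :
    cnt D A n = cnt D B n := by
  induction n with
  | zero => simp [cnt_zero]
  | succ n ih => rw [cnt_succ, cnt_succ, ih fun i hi => h i (by omega), h n (by omega)]

theorem cnt_mono (D : ℝ → Prop) (A : ℕ → ℝ) {n m : ℕ} (h : n ≤ m) : cnt D A n ≤ cnt D A m := by
  induction m, h using Nat.le_induction with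
  | base => exact le_rfl
  | succ m _ ih => rw [cnt_succ]; omega

theorem cnt_pos {D : ℝ → Prop} {A : ℕ → ℝ} {n i : ℕ} (hi : i < n) (h : D (A i)) :
    0 < cnt D A n := by
  have h1 := cnt_mono D A (show i + 1 ≤ n from hi)
  rw [cnt_succ, if_pos h] at h1
  omega

theorem exists_of_cnt_pos {D : ℝ → Prop} {A : ℕ → ℝ} {n : ℕ} (h : 0 < cnt D A n) :
    ∃ i < n, D (A i) := by
  by_contra! hc
  induction n with
  | zero => simp [cnt_zero] at h
  | succ n ih =>
    rw [cnt_succ, if_neg (hc n (by omega))] at h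
    exact ih h fun i hi => hc i (by omega)

theorem cnt_add_not (D : ℝ → Prop) (A : ℕ → ℝ) (n : ℕ) :
    cnt D A n + cnt (fun x => ¬ D x) A n = n := by
  induction n with
  | zero => simp [cnt_zero]
  | succ n ih => rw [cnt_succ, cnt_succ]; split_ifs <;> omega

/-- The blocks of length `r` of `A` below `len` are sorted. -/
def BlockSorted (A : ℕ → ℝ) (r len : ℕ) : Prop :=
  ∀ c x y, r * c ≤ x → x ≤ y → y < r * (c + 1) → y < len → A x ≤ A y

theorem cnt_ge_of_sorted {A : ℕ → ℝ} {n q : ℕ} (h : ∀ x y, x ≤ y → y < n → A x ≤ A y) (hq : q < n) :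
    q + 1 ≤ cnt (fun v => v ≤ A q) A n := by
  have h1 : ∀ k ≤ q + 1, cnt (fun v => v ≤ A q) A k = k := by
    intro k
    induction k with
    | zero => simp [cnt_zero]
    | succ k ih =>
      intro hk
      rw [cnt_succ, ih (by omega), if_pos (h k q (by omega) hq)]
  rw [← h1 (q + 1) le_rfl]
  exact cnt_mono _ _ hq

theorem cnt_lt_le_of_sorted {A : ℕ → ℝ} {n q : ℕ} (h : ∀ x y, x ≤ y → y < n → A x ≤ A y)
    (hq : q < n) : cnt (fun v => v < A q) A n ≤ q := by
  have h1 : ∀ k, q ≤ k → k ≤ n → cnt (fun v => v < A q) A k ≤ q := by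
    intro k hk
    induction k, hk using Nat.le_induction with
    | base =>
      intro _
      have := cnt_add_not (fun v => v < A q) A q
      omega
    | succ k hk ih =>
      intro hkn
      rw [cnt_succ, if_neg (not_lt.2 (h q k hk (by omega)))]
      exact ih (by omega)
  exact h1 n hq.le le_rfl

/-- Keeping every other element of a block-sorted array approximately halves counts. -/
theorem cnt_halve {D : ℝ → Prop} (hD : ∀ x y, x ≤ y → D y → D x) {A B : ℕ → ℝ} {R g : ℕ}
    (hA : BlockSorted A (2 * R) (2 * R * g)) (hB : ∀ z < R * g, B z = A (2 * z + 1)) :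
    2 * cnt D B (R * g) ≤ cnt D A (2 * R * g) ∧
      cnt D A (2 * R * g) ≤ 2 * cnt D B (R * g) + g := by
  -- In a sorted block a downward closed `D` holds on an initial segment. An initial segment of
  -- length p contains ⌊p/2⌋ of the kept (odd) positions, so each block contributes an error of at
  -- most one.
  have key : ∀ c ≤ g, 2 * cnt D B (R * c) ≤ cnt D A (2 * R * c) ∧
      cnt D A (2 * R * c) ≤ 2 * cnt D B (R * c) + c := by
    intro c
    induction c with
    | zero => simp [cnt_zero]
    | succ c ih =>
      intro hc
      obtain ⟨ih1, ih2⟩ := ih (by omega)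
      have hRc : R * (c + 1) = R * c + R := by ring
      have hRg : R * (c + 1) ≤ R * g := Nat.mul_le_mul_left _ hc
      have h2 : 2 * R * c = 2 * (R * c) := by ring
      have h2' : 2 * R * (c + 1) = 2 * (R * c) + 2 * R := by ring
      have h2g : 2 * R * g = 2 * (R * g) := by ring
      -- The second alternative says that the allowance of one for this block has been used. It was
      -- used at an element violating `D`, so by sortedness no further element of the block counts.
      have inner : ∀ z ≤ R, 2 * cnt D B (R * c + z) ≤ cnt D A (2 * (R * c + z)) ∧
          (cnt D A (2 * (R * c + z)) ≤ 2 * cnt D B (R * c + z) + c ∨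
            (cnt D A (2 * (R * c + z)) ≤ 2 * cnt D B (R * c + z) + c + 1 ∧ 0 < z ∧
              ¬ D (A (2 * (R * c + z) - 1)))) := by
        intro z
        induction z with
        | zero =>
          intro _
          simp only [add_zero]
          rw [← h2]
          exact ⟨ih1, .inl ih2⟩
        | succ z ihz =>
          intro hz
          obtain ⟨i1, i2⟩ := ihz (by omega)
          have e1 : 2 * (R * c + (z + 1)) = 2 * (R * c + z) + 1 + 1 := by ring
          have e2 : R * c + (z + 1) = R * c + z + 1 := by ring
          have hs : A (2 * (R * c + z)) ≤ A (2 * (R * c + z) + 1) :=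
            hA c _ _ (by omega) (by omega) (by omega) (by omega)
          have hprev : 0 < z → A (2 * (R * c + z) - 1) ≤ A (2 * (R * c + z)) := fun h0 =>
            hA c _ _ (by omega) (by omega) (by omega) (by omega)
          rw [e1, e2, cnt_succ, cnt_succ, cnt_succ, hB (R * c + z) (by omega)]
          have e3 : 2 * (R * c + z) + 1 + 1 - 1 = 2 * (R * c + z) + 1 := by omega
          rw [e3]
          by_cases hd1 : D (A (2 * (R * c + z) + 1))
          · have hd0 := hD _ _ hs hd1
            simp only [hd0, hd1, if_true]
            refine ⟨by omega, ?_⟩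
            rcases i2 with i2 | ⟨-, hz0, i3⟩
            · left; omega
            · exact absurd (hD _ _ (hprev hz0) hd0) i3
          · by_cases hd0 : D (A (2 * (R * c + z)))
            · simp only [hd0, hd1, if_true, if_false]
              refine ⟨by omega, .inr ⟨?_, by omega, not_false⟩⟩
              rcases i2 with i2 | ⟨-, hz0, i3⟩
              · omega
              · exact absurd (hD _ _ (hprev hz0) hd0) i3
            · simp only [hd0, hd1, if_false]
              refine ⟨by omega, ?_⟩
              rcases i2 with i2 | ⟨i2, hz0, i3⟩
              · left; omega
              · right; exact ⟨by omega, by omega, not_false⟩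
      obtain ⟨j1, j2⟩ := inner R le_rfl
      rw [hRc, h2', show 2 * (R * c) + 2 * R = 2 * (R * c + R) by ring]
      exact ⟨j1, by omega⟩
  exact key g le_rfl

-- Merging, thinning and the choice of the pivot

notation "aV" => (1 : ℕ)
notation "aW" => (2 : ℕ)
notation "rT" => (3 : ℕ)
notation "nX" => (1 : ℕ)
notation "nLen" => (2 : ℕ)
notation "nRun" => (3 : ℕ)
notation "nRR" => (4 : ℕ)
notation "nO" => (5 : ℕ)
notation "nI" => (6 : ℕ)
notation "nJ" => (7 : ℕ)
notation "nMid" => (8 : ℕ)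
notation "nEnd" => (9 : ℕ)
notation "nQ" => (10 : ℕ)
notation "nE" => (11 : ℕ)

/-- One element is moved from the two heads of the current pair of blocks. -/
def mergeStep : Program :=
  .cond (.natLt (.var nO) (.var nEnd)) .skip
    (assign nI (.var nO) ;; assign nMid (.add (.var nO) (.var nRR)) ;; assign nJ (.var nMid) ;;
      assign nEnd (.add (.var nMid) (.var nRR))) ;;
  .cond (.conj (.natLt (.var nI) (.var nMid)) (.neg (.conj (.natLt (.var nJ) (.var nEnd))
      (.realLt (.get aV (.var nJ)) (.get aV (.var nI))))))
    (.setReal aW (.var nO) (.get aV (.var nI)) ;; assign nI (.add (.var nI) (.lit 1)))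
    (.setReal aW (.var nO) (.get aV (.var nJ)) ;; assign nJ (.add (.var nJ) (.lit 1)))

/-- Merging of consecutive blocks of the array `aV`. -/
def mergePass : Program :=
  assign nEnd (.lit 0) ;; assign nI (.lit 0) ;; assign nMid (.lit 0) ;; assign nJ (.lit 0) ;;
  forUp nO (.lit 0) (.var nLen) mergeStep ;;
  forUp nO (.lit 0) (.var nLen) (.setReal aV (.var nO) (.get aW (.var nO)))

/-- The invariant of the merging loop. -/
structure MergeInv (A W : ℕ → ℝ) (r o i j mid e c : ℕ) : Prop where
  he : e = 2 * r * c
  o_le : o ≤ e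
  i_le : i ≤ mid
  le_j : mid ≤ j
  j_le : j ≤ e
  sum : i + j = o + mid
  mid_eq : 0 < c → e = mid + r ∧ mid ≤ i + r
  count : ∀ D : ℝ → Prop, cnt D W o + cnt D A mid = cnt D A i + cnt D A j
  sorted : BlockSorted W (2 * r) o
  head_i : ∀ x < o, e ≤ x + 2 * r → i < mid → W x ≤ A i
  head_j : ∀ x < o, e ≤ x + 2 * r → j < e → W x ≤ A j

/-- Only the earlier elements of the output block being filled, those with `e ≤ x + 2 * r`, have to
be compared with the new one. This block has index `c - 1`, as `e = 2 * r * c` is its end. -/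
theorem BlockSorted.update {W : ℕ → ℝ} {r o c e : ℕ} {v : ℝ} (h : BlockSorted W (2 * r) o)
    (he : e = 2 * r * c) (ho : o < e) (ho' : e ≤ o + 2 * r)
    (hv : ∀ x < o, e ≤ x + 2 * r → W x ≤ v) :
    BlockSorted (Function.update W o v) (2 * r) (o + 1) := by
  intro b x y hx hxy hy hyo
  by_cases hyo' : y = o
  · subst hyo'
    by_cases hxy' : x = y
    · subst hxy'; exact le_rfl
    · have hb : c ≤ b + 1 := by
        by_contra hb
        have : 2 * r * (b + 1) ≤ 2 * r * (c - 1) := Nat.mul_le_mul_left _ (by omega)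
        have h3 : 2 * r * c = 2 * r * (c - 1) + 2 * r := by
          conv_lhs => rw [show c = (c - 1) + 1 by omega]
          ring
        omega
      have h1 : 2 * r * c ≤ 2 * r * (b + 1) := Nat.mul_le_mul_left _ hb
      have h2 : 2 * r * (b + 1) = 2 * r * b + 2 * r := by ring
      rw [Function.update_of_ne hxy', Function.update_self]
      exact hv x (by omega) (by omega)
  · rw [Function.update_of_ne hyo', Function.update_of_ne (by omega)]
    exact h b x y hx hxy hy (by omega)

/-- The written element is at most the other head by `hij`, and at most its own successor because
input block `2 * (c - 1)` is sorted. `take_j` is the mirror image with input block `2 * (c - 1) +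
1`. -/
theorem MergeInv.take_i {A W : ℕ → ℝ} {r o i j mid e c len : ℕ} (h : MergeInv A W r o i j mid e c)
    (hA : BlockSorted A r len) (ho : o < e) (hel : e ≤ len) (hi : i < mid)
    (hij : j < e → A i ≤ A j) :
    MergeInv A (Function.update W o (A i)) r (o + 1) (i + 1) j mid e c := by
  have hc : 0 < c := by
    rcases Nat.eq_zero_or_pos c with hc | hc
    · have := h.he; subst hc; simp at this; omega
    · exact hc
  obtain ⟨hm1, hm2⟩ := h.mid_eq hc
  have := h.sum; have := h.le_j; have := h.j_le; have := h.i_le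
  have hbl : r * (2 * (c - 1)) + 2 * r = e := by
    rw [h.he]; conv_rhs => rw [show c = (c - 1) + 1 by omega]
    ring
  refine ⟨h.he, ho, hi, h.le_j, h.j_le, by omega, fun _ => ⟨hm1, by omega⟩, fun D => ?_, ?_, ?_, ?_⟩
  · rw [cnt_succ, Function.update_self, cnt_congr (B := W), cnt_succ]
    · have := h.count D; omega
    · intro x hx; rw [Function.update_of_ne (by omega)]
  · exact h.sorted.update h.he ho (by omega) fun x hx hx' => h.head_i x hx hx' hi
  · intro x hx hx' hi'
    have hs : A i ≤ A (i + 1) := hA (2 * (c - 1)) _ _ (by omega) (by omega)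
      (by rw [show r * (2 * (c - 1) + 1) = r * (2 * (c - 1)) + r by ring]; omega) (by omega)
    by_cases hxo : x = o
    · subst hxo; rwa [Function.update_self]
    · rw [Function.update_of_ne hxo]
      exact (h.head_i x (by omega) hx' hi).trans hs
  · intro x hx hx' hj'
    by_cases hxo : x = o
    · subst hxo; rw [Function.update_self]; exact hij hj'
    · rw [Function.update_of_ne hxo]
      exact h.head_j x (by omega) hx' hj'

theorem MergeInv.take_j {A W : ℕ → ℝ} {r o i j mid e c len : ℕ} (h : MergeInv A W r o i j mid e c)
    (hA : BlockSorted A r len) (ho : o < e) (hel : e ≤ len) (hj : j < e)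
    (hij : i < mid → A j ≤ A i) :
    MergeInv A (Function.update W o (A j)) r (o + 1) i (j + 1) mid e c := by
  have hc : 0 < c := by
    rcases Nat.eq_zero_or_pos c with hc | hc
    · have := h.he; subst hc; simp at this; omega
    · exact hc
  obtain ⟨hm1, hm2⟩ := h.mid_eq hc
  have := h.sum; have := h.le_j; have := h.j_le; have := h.i_le
  have hbl : r * (2 * (c - 1) + 1) + r = e := by
    rw [h.he]; conv_rhs => rw [show c = (c - 1) + 1 by omega]
    ring
  refine ⟨h.he, ho, h.i_le, by omega, hj, by omega, fun _ => ⟨hm1, by omega⟩, fun D => ?_, ?_, ?_, ?_⟩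
  · rw [cnt_succ, Function.update_self, cnt_congr (B := W), cnt_succ]
    · have := h.count D; omega
    · intro x hx; rw [Function.update_of_ne (by omega)]
  · exact h.sorted.update h.he ho (by omega) fun x hx hx' => h.head_j x hx hx' hj
  · intro x hx hx' hi'
    by_cases hxo : x = o
    · subst hxo; rw [Function.update_self]; exact hij hi'
    · rw [Function.update_of_ne hxo]
      exact h.head_i x (by omega) hx' hi'
  · intro x hx hx' hj'
    have hs : A j ≤ A (j + 1) := hA (2 * (c - 1) + 1) _ _ (by omega) (by omega)
      (by rw [show r * (2 * (c - 1) + 1 + 1) = r * (2 * (c - 1) + 1) + r by ring]; omega) (by omega)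
    by_cases hxo : x = o
    · subst hxo; rwa [Function.update_self]
    · rw [Function.update_of_ne hxo]
      exact (h.head_j x (by omega) hx' hj).trans hs

/-- Opening the next pair of blocks. -/
theorem MergeInv.next {A W : ℕ → ℝ} {r o i j mid c : ℕ} (h : MergeInv A W r o i j mid o c) :
    MergeInv A W r o o (o + r) (o + r) (o + r + r) (c + 1) := by
  have := h.sum; have := h.le_j; have := h.j_le; have := h.i_le
  obtain rfl : j = o := by omega
  obtain rfl : i = mid := by omega
  refine ⟨by rw [Nat.mul_add, ← h.he]; ring, by omega, by omega, by omega, by omega, by omega,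
    fun _ => ⟨rfl, by omega⟩, fun D => ?_, h.sorted, fun x hx hx' => ?_, fun x hx hx' => ?_⟩
  · have := h.count D; omega
  · omega
  · omega

/-- The loop runs over output positions and opens the next pair of blocks when the output has filled
the current one. Each position takes constant time, which gives a linear bound without a separate
potential for the two heads. -/
theorem ends_mergePass {s : State} {r g : ℕ} (hr : 0 < r) (hrr : s.nat nRR 0 = r)
    (hlen : s.nat nLen 0 = 2 * r * g) (hs : BlockSorted (s.real aV) r (2 * r * g)) :
    Ends I ε mergePass s (2 * r * g * 200 + 200) fun s' =>
      BlockSorted (s'.real aV) (2 * r) (2 * r * g) ∧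
      ∀ D, cnt D (s'.real aV) (2 * r * g) = cnt D (s.real aV) (2 * r * g) := by
  set len := 2 * r * g with hlen'
  refine Ends.step rfl (Ends.step rfl (Ends.step rfl (Ends.step rfl (Ends.seq
    (R := fun s' => BlockSorted (s'.real aW) (2 * r) len ∧
      ∀ D, cnt D (s'.real aW) len = cnt D (s.real aV) len)
    (n := len * 170 + 30) (n' := len * 25 + 30)
    (m := len * 195 + 60) ((Ends.forUp (k := 150) (a := 0) (b := len)
      (fun o s' => s'.real aV = s.real aV ∧ s'.nat nRR 0 = r ∧
        ∃ c ≤ g, MergeInv (s.real aV) (s'.real aW) r o (s'.nat nI 0) (s'.nat nJ 0) (s'.nat nMid 0)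
          (s'.nat nEnd 0) c)
      rfl (Nat.zero_le _) rfl ?_ ?_ ?_ (by simp; omega)).post ?_) ?_ ?_) le_rfl) le_rfl) le_rfl)
    (by simp; omega)
  · intro s' hf
    have h2 := hf.nat nLen rfl
    simp at h2 ⊢
    rw [h2, hlen]
  · refine ⟨by simp, by simpa using hrr, 0, Nat.zero_le _, ?_⟩
    refine ⟨by simp, by simp, by simp, by simp, by simp, by simp, by simp, by simp [cnt_zero],
      fun c x y _ _ _ h => absurd h (by omega), by simp, by simp⟩
  · rintro o s' - ho hf hoo ⟨hV, hR, c, hcg, hM⟩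
    refine Ends.straight rfl (by simp [mergeStep]) ?_
    have hel : ∀ c ≤ g, 2 * r * c ≤ len := fun c hc => Nat.mul_le_mul_left _ hc
    -- The second half of `mergeStep`, to be used both when the current pair of blocks continues and
    -- when a new pair has just been opened.
    have key : ∀ (s1 : State) (c : ℕ), c ≤ g → s1.real aV = s.real aV → s1.nat nRR 0 = r →
        s1.nat nO 0 = o → s1.real aW = s'.real aW →
        MergeInv (s.real aV) (s1.real aW) r o (s1.nat nI 0) (s1.nat nJ 0) (s1.nat nMid 0)
          (s1.nat nEnd 0) c → o < s1.nat nEnd 0 →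
        ∀ s2 : State, s2 = Program.run I ε (.cond (.conj (.natLt (.var nI) (.var nMid))
            (.neg (.conj (.natLt (.var nJ) (.var nEnd))
              (.realLt (.get aV (.var nJ)) (.get aV (.var nI))))))
          (.setReal aW (.var nO) (.get aV (.var nI)) ;; assign nI (.add (.var nI) (.lit 1)))
          (.setReal aW (.var nO) (.get aV (.var nJ)) ;; assign nJ (.add (.var nJ) (.lit 1)))) s1 →
        s2.real aV = s.real aV ∧ s2.nat nRR 0 = r ∧
        ∃ c ≤ g, MergeInv (s.real aV) (s2.real aW) r (o + 1) (s2.nat nI 0) (s2.nat nJ 0)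
          (s2.nat nMid 0) (s2.nat nEnd 0) c := by
      rintro s1 c hcg h1 h2 h3 - h5 h6 s2 rfl
      have hle : s1.nat nEnd 0 ≤ len := h5.he ▸ hel c hcg
      simp only [Program.run, NatExpr.eval, RealExpr.eval, Test.Holds, h1, h3]
      split_ifs with hc
      · refine ⟨by simpa using h1, by simpa using h2, c, hcg, ?_⟩
        have := h5.take_i hs h6 hle hc.1 fun hj => by
          by_contra hcon; exact hc.2 ⟨hj, not_le.1 hcon⟩
        simpa using this
      · refine ⟨by simpa using h1, by simpa using h2, c, hcg, ?_⟩
        have hj : s1.nat nJ 0 < s1.nat nEnd 0 := by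
          by_contra hj
          have := h5.sum; have := h5.le_j; have := h5.j_le; have := h5.i_le
          exact hc ⟨by omega, fun h => hj h.1⟩
        have := h5.take_j hs h6 hle hj fun hi => by
          by_contra hcon; exact hc ⟨hi, fun h => hcon h.2.le⟩
        simpa using this
    by_cases hoe : o < s'.nat nEnd 0
    · have := key s' c hcg hV hR hoo rfl hM hoe _ rfl
      rw [mergeStep, Program.run]
      simp only [Program.run, Test.Holds, NatExpr.eval, hoo, hoe, if_true]
      simpa [hoo] using this
    · have hoe' : s'.nat nEnd 0 = o := by have := hM.o_le; omega
      rw [hoe'] at hM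
      have hcg' : c + 1 ≤ g := by
        by_contra hcon
        obtain rfl : c = g := by omega
        have := hM.he; omega
      have := key ((((s'.setNat nI 0 o).setNat nMid 0 (o + r)).setNat nJ 0 (o + r)).setNat nEnd 0
        (o + r + r)) (c + 1) hcg' (by simpa using hV) (by simpa using hR) (by simpa using hoo) rfl
        (by simpa using hM.next) (by simp; omega) _ rfl
      rw [mergeStep, Program.run]
      simp only [Program.run, Test.Holds, NatExpr.eval, hoo, hoe, if_false]
      simpa [hoo, hR] using this
  · rintro s' - ⟨⟨hV, hR, c, hcg, hM⟩, -⟩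
    have h1 : s'.nat nEnd 0 ≤ len := hM.he ▸ Nat.mul_le_mul_left _ hcg
    have := hM.sum; have := hM.le_j; have := hM.j_le; have := hM.i_le; have := hM.o_le
    refine ⟨hM.sorted, fun D => ?_⟩
    have h2 := hM.count D
    rw [show s'.nat nI 0 = s'.nat nMid 0 by omega, show s'.nat nJ 0 = len by omega] at h2
    omega
  · rintro s' hf ⟨hR1, hR2⟩
    refine (Ends.forUp (k := 10) (a := 0) (b := len)
      (fun o s'' => s''.real aW = s'.real aW ∧ ∀ x < o, s''.real aV x = s'.real aW x)
      rfl (Nat.zero_le _) rfl ?_ ?_ ?_ (by simp; omega)).post ?_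
    · intro s'' hf'
      have h1 := hf.nat nLen rfl
      have h2 := hf'.nat nLen rfl
      simp at h1 h2 ⊢
      rw [h2, h1, hlen]
    · simp
    · rintro o s'' - ho hf' hoo ⟨h1, h2⟩
      refine Ends.straight rfl (by simp) ?_
      simp only [Program.run, NatExpr.eval, RealExpr.eval, hoo]
      refine ⟨by simpa using h1, fun x hx => ?_⟩
      by_cases hxo : x = o
      · subst hxo; simp [h1]
      · simp [Function.update_of_ne hxo, h2 x (by omega)]
    · rintro s'' - ⟨⟨h1, h2⟩, -⟩
      refine ⟨fun c x y hx hxy hy hyl => ?_, fun D => ?_⟩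
      · rw [h2 x (by omega), h2 y hyl]; exact hR1 c x y hx hxy hy hyl
      · rw [cnt_congr h2, hR2]
  · omega

/-- Every other element of `aV` is kept. -/
def halvePass : Program :=
  forUp nO (.lit 0) (.var nLen) (.cond (.natLt (.add (.var nO) (.var nO)) (.var nLen))
    (.setReal aV (.var nO) (.get aV (.add (.add (.var nO) (.var nO)) (.lit 1))) ;;
      assign nE (.add (.var nO) (.lit 1))) .skip) ;;
  assign nLen (.var nE)

/-- Working in place is safe because cell `2 * z + 1` is read before it could be overwritten. There
is no halving of natural numbers, so the loop runs over the full length and does nothing from `l`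
on. -/
theorem ends_halvePass {s : State} {l : ℕ} (hl : 0 < l) (hlen : s.nat nLen 0 = 2 * l) :
    Ends I ε halvePass s (2 * l * 80 + 50) fun s' => s'.nat nLen 0 = l ∧
      ∀ z < l, s'.real aV z = s.real aV (2 * z + 1) := by
  refine Ends.seq (R := fun s' => s'.nat nE 0 = l ∧
      ∀ z < l, s'.real aV z = s.real aV (2 * z + 1)) (n := 2 * l * 80 + 30) (n' := 20)
    ((Ends.forUp (k := 60) (a := 0) (b := 2 * l)
      -- `nE` is not initialised, so nothing is claimed about it before the first round.
      (fun o s' => s'.nat nE 0 = (if o = 0 then s'.nat nE 0 else min o l) ∧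
        (∀ z < o, z < l → s'.real aV z = s.real aV (2 * z + 1)) ∧
        ∀ z, o ≤ z → s'.real aV z = s.real aV z)
      rfl (Nat.zero_le _) rfl ?_ ?_ ?_ (by simp; omega)).post ?_) ?_ (by omega)
  · intro s' hf
    have h2 := hf.nat nLen rfl
    simp [h2, hlen]
  · simp
  · rintro o s' - ho hf hoo ⟨hE, h1, h2⟩
    have h3 := hf.nat nLen rfl
    refine Ends.straight rfl (by simp) ?_
    by_cases hol : o < l
    · have : o + o < 2 * l := by omega
      simp only [Program.run, Test.Holds, NatExpr.eval, RealExpr.eval, hoo, h3, hlen, this, if_true]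
      refine ⟨by simp [hoo]; omega, fun z hz hzl => ?_, fun z hz => ?_⟩
      · by_cases hzo : z = o
        · subst hzo
          simp [h2 (z + z + 1) (by omega), two_mul]
        · simp [Function.update_of_ne hzo, h1 z (by omega) hzl]
      · simp [Function.update_of_ne (show z ≠ o by omega), h2 z (by omega)]
    · have : ¬ o + o < 2 * l := by omega
      simp only [Program.run, Test.Holds, NatExpr.eval, hoo, h3, hlen, this, if_false]
      rw [if_neg (by omega)] at hE
      refine ⟨by simp [hE]; omega, fun z hz hzl => ?_, fun z hz => ?_⟩
      · simpa using h1 z (by omega) hzl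
      · simpa using h2 z (by omega)
  · rintro s' - ⟨⟨hE, h1, -⟩, -⟩
    rw [if_neg (by omega)] at hE
    exact ⟨by omega, fun z hz => h1 z (by omega) hz⟩
  · rintro s' - ⟨hE, h1⟩
    exact Ends.straight rfl (by simp) ⟨by simp [hE], by simpa using h1⟩

/-- The main loop of the selection of a pivot. -/
def pivotLoop : Program :=
  .loop (.natLt (.var nRun) (.var nLen))
    (assign nRR (.var nRun) ;; mergePass ;; assign nRR (.add (.var nRun) (.var nRun)) ;;
      mergePass ;; halvePass ;; assign nRun (.add (.var nRun) (.var nRun)))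

/-- An approximate median of the first `nX` elements of `aV` is written to `rT`. -/
def pivot : Program :=
  assign nLen (.lit 1) ;;
  .loop (.natLe (.add (.add (.var nLen) (.var nLen)) (.add (.var nLen) (.var nLen))) (.var nX))
    (assign nLen (.add (.add (.var nLen) (.var nLen)) (.add (.var nLen) (.var nLen)))) ;;
  assign nRun (.lit 1) ;;
  pivotLoop ;;
  assign nQ (.lit 0) ;;
  forUp nO (.lit 0) (.var nLen) (.cond
    (.natLe (.add (.add (.add (.var nO) (.var nO)) (.add (.var nO) (.var nO))) (.lit 4)) (.var nLen))
    (assign nQ (.add (.var nO) (.lit 1))) .skip) ;;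
  rassign rT (.get aV (.var nQ))

/-- The invariant of `pivotLoop`: `V` is a sketch of the first `4 ^ (e + d)` elements of `A`. -/
structure Sketch (A V : ℕ → ℝ) (e d : ℕ) : Prop where
  sorted : BlockSorted V (2 ^ e) (2 ^ e * 4 ^ d)
  mem : ∀ z < 2 ^ e * 4 ^ d, ∃ i < 4 ^ (e + d), V z = A i
  lower : ∀ D : ℝ → Prop, (∀ x y, x ≤ y → D y → D x) →
    2 ^ e * cnt D V (2 ^ e * 4 ^ d) ≤ cnt D A (4 ^ (e + d))
  upper : ∀ D : ℝ → Prop, (∀ x y, x ≤ y → D y → D x) →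
    2 * cnt D A (4 ^ (e + d)) + 2 ^ e * 4 ^ d ≤
      2 * 2 ^ e * cnt D V (2 ^ e * 4 ^ d) + 4 ^ (e + d)

theorem Sketch.zero (A : ℕ → ℝ) (h : ℕ) : Sketch A A 0 h := by
  refine ⟨fun c x y hx hxy hy _ => ?_, fun z hz => ⟨z, by simpa using hz, rfl⟩, by simp, by simp⟩
  obtain rfl : x = y := by simp at hx hy; omega
  exact le_rfl

/-- An element of the sketch stands for 2^e original ones. Halving errs by at most one element of
the sketch in each of 4^d blocks, that is by 2^e·4^d originals, which is half of the decrease of the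
sketch's length. The errors therefore telescope, which explains the form of `upper`: the total error
is half of the difference between the original and the current length. -/
theorem Sketch.next {A V V' B : ℕ → ℝ} {e d : ℕ} (h : Sketch A V e (d + 1))
    (hs : BlockSorted V' (2 * (2 * 2 ^ e)) (2 ^ e * 4 ^ (d + 1)))
    (hc : ∀ D, cnt D V' (2 ^ e * 4 ^ (d + 1)) = cnt D V (2 ^ e * 4 ^ (d + 1)))
    (hB : ∀ z < 2 ^ (e + 1) * 4 ^ d, B z = V' (2 * z + 1)) : Sketch A B (e + 1) d := by
  have e0 : 2 ^ e * 4 ^ (d + 1) = 2 * (2 ^ (e + 1) * 4 ^ d) := by ring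
  have e1 : 2 ^ e * 4 ^ (d + 1) = 2 * (2 * 2 ^ e) * 4 ^ d := by ring
  have e2 : 2 ^ (e + 1) * 4 ^ d = (2 * 2 ^ e) * 4 ^ d := by ring
  have e3 : e + 1 + d = e + (d + 1) := by ring
  have hh : ∀ D : ℝ → Prop, (∀ x y, x ≤ y → D y → D x) → _ := fun D hD =>
    cnt_halve hD (R := 2 * 2 ^ e) (g := 4 ^ d) (A := V') (B := B) (e1 ▸ hs) (e2 ▸ hB)
  refine ⟨fun c x y hx hxy hy hyl => ?_, fun z hz => ?_, fun D hD => ?_, fun D hD => ?_⟩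
  · rw [hB x (by omega), hB y hyl]
    have h1 : 2 * (2 * 2 ^ e) * c = 2 * (2 ^ (e + 1) * c) := by ring
    have h2 : 2 * (2 * 2 ^ e) * (c + 1) = 2 * (2 ^ (e + 1) * (c + 1)) := by ring
    exact hs c _ _ (by omega) (by omega) (by omega) (by omega)
  · rw [e3]
    have h1 := hc (fun v => v = B z)
    have h2 : 0 < cnt (fun v => v = B z) V' (2 ^ e * 4 ^ (d + 1)) :=
      cnt_pos (i := 2 * z + 1) (by omega) (hB z hz).symm
    rw [h1] at h2
    obtain ⟨i, hi, hi'⟩ := exists_of_cnt_pos h2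
    obtain ⟨j, hj, hj'⟩ := h.mem i hi
    exact ⟨j, hj, by rw [← hi', hj']⟩
  · have h1 := (hh D hD).1
    have h2 := h.lower D hD
    rw [← hc, e1] at h2
    rw [e3]
    refine le_trans ?_ h2
    rw [e2, pow_succ, mul_assoc]
    exact Nat.mul_le_mul_left _ h1
  · have h1 := (hh D hD).2
    have h2 := h.upper D hD
    rw [← hc, e1] at h2
    rw [e3, e2]
    have h3 := Nat.mul_le_mul_left (2 * 2 ^ e) h1
    rw [show 2 ^ (e + 1) = 2 * 2 ^ e by ring]
    nlinarith

/-- Two merges quadruple the blocks and the halving then leaves them doubled, while the length of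
the array is halved. The linear costs of the rounds thus form a geometric series, which the
potential `3000 * nLen` pays. -/
theorem ends_pivotLoop {s : State} {h : ℕ} (hrun : s.nat nRun 0 = 1) (hlen : s.nat nLen 0 = 4 ^ h) :
    Ends I ε pivotLoop s (3000 * 4 ^ h + 10) fun s' => s'.nat nLen 0 = 2 ^ h ∧
      Sketch (s.real aV) (s'.real aV) h 0 := by
  refine (Ends.loop (fun s' => ∃ e d, e + d = h ∧ s'.nat nRun 0 = 2 ^ e ∧
      s'.nat nLen 0 = 2 ^ e * 4 ^ d ∧ Sketch (s.real aV) (s'.real aV) e d)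
    (fun s' => 3000 * s'.nat nLen 0) ⟨0, h, by simp, by simpa using hrun, by simpa using hlen,
      Sketch.zero _ _⟩ ?_ (by simp [hlen])).post ?_
  · rintro s' - ⟨e, d, hed, hr, hl, hS⟩ hb
    have hd : d ≠ 0 := by
      rintro rfl
      simp [hr, hl] at hb
    obtain ⟨d, rfl⟩ := Nat.exists_eq_succ_of_ne_zero hd
    simp only [Nat.succ_eq_add_one] at *
    have hL : 0 < 2 ^ (e + 1) * 4 ^ d := by positivity
    have e0 : 2 ^ e * 4 ^ (d + 1) = 2 * (2 ^ (e + 1) * 4 ^ d) := by ring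
    have e1 : 2 ^ e * 4 ^ (d + 1) = 2 * 2 ^ e * (2 * 4 ^ d) := by ring
    have e2 : 2 ^ e * 4 ^ (d + 1) = 2 * (2 * 2 ^ e) * 4 ^ d := by ring
    set L := 2 ^ (e + 1) * 4 ^ d with hLdef
    refine ⟨L * 960 + 600, Ends.step (n' := L * 960 + 590) rfl
      (Ends.seq (n' := L * 560 + 380) (ends_mergePass (r := 2 ^ e) (g := 2 * 4 ^ d) (by positivity) (by simp [hr])
        (by simpa [← e1] using hl) (by rw [← e1]; simpa using hS.sorted))
      (fun s1 hf1 ⟨hs1, hc1⟩ => Ends.step (n' := L * 560 + 370) rfl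
      (Ends.seq (ends_mergePass (r := 2 * 2 ^ e) (g := 4 ^ d) (by positivity) ?_ ?_ ?_)
      (fun s2 hf2 ⟨hs2, hc2⟩ => Ends.seq (ends_halvePass hL ?_)
        (fun s3 hf3 ⟨hl3, hh3⟩ => Ends.straight (n := 20) rfl (by simp) ?_)
        (m := L * 160 + 120) (by omega)) ?_) (by simp; omega)) ?_) (by simp; omega)⟩
    · have := hf1.nat nRun rfl
      simp [this, hr, two_mul]
    · have := hf1.nat nLen rfl
      simp [this, hl, e2]
    · rw [← e2, e1]; simpa using hs1
    · have h1 := hf1.nat nLen rfl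
      have h2 := hf2.nat nLen rfl
      simp at h1 h2
      rw [h2, h1, hl, e0]
    · have hr3 := hf3.nat nRun rfl
      have hr2 := hf2.nat nRun rfl
      have hr1 := hf1.nat nRun rfl
      simp at hr1 hr2 hr3
      refine ⟨⟨e + 1, d, by omega, ?_, ?_, ?_⟩, ?_⟩
      · simp [hr3, hr2, hr1, hr]; ring
      · simpa using hl3
      · rw [← e2] at hs2 hc2
        rw [← e1] at hc1
        refine hS.next hs2 (fun D => ?_) (B := _) ?_
        · rw [hc2 D]; simpa using hc1 D
        · simpa using hh3
      · simp [hl3, hl, e0]; omega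
    · rw [← e2, e0]; omega
    · rw [← e1, e0]; omega
  · rintro s' - ⟨⟨e, d, hed, hr, hl, hS⟩, hb⟩
    have hd : d = 0 := by
      by_contra hd
      apply hb
      simp only [Test.Holds, NatExpr.eval, hr, hl]
      exact lt_mul_of_one_lt_right (by positivity) (Nat.one_lt_pow hd (by norm_num))
    subst hd
    obtain rfl : e = h := by omega
    exact ⟨by simpa using hl, hS⟩

/-- The sketch represents only the first 4^h elements, where 4^h ≤ X < 4·4^h. The element at the
quarter of the sorted sketch has at least 4^h/4 of these on either side, hence at least X/16 of all.
-/
theorem ends_pivot {s : State} {X : ℕ} (hX : 0 < X) (hx : s.nat nX 0 = X) :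
    Ends I ε pivot s (4000 * X) fun s' => (∃ i < X, s'.real rT 0 = s.real aV i) ∧
      X ≤ 16 * cnt (fun v => v ≤ s'.real rT 0) (s.real aV) X ∧
      X ≤ 16 * cnt (fun v => s'.real rT 0 ≤ v) (s.real aV) X := by
  refine Ends.step (n' := 4000 * X - 10) rfl (Ends.seq (n := 50 * X) (n' := 3900 * X)
    (R := fun s' => ∃ h, s'.nat nLen 0 = 4 ^ h ∧ 4 ^ h ≤ X ∧ X < 4 * 4 ^ h ∧
      s'.real aV = s.real aV)
    ((Ends.loop (fun s' => ∃ h, s'.nat nLen 0 = 4 ^ h ∧ 4 ^ h ≤ X)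
      (fun s' => 30 * (X - s'.nat nLen 0)) ?_ ?_ ?_).post ?_) ?_ (by omega)) (by simp; omega)
  · exact ⟨0, by simp, by simpa using Nat.succ_le_of_lt hX⟩
  · rintro s' hf ⟨h, hl, hlX⟩ hb
    have h1 := hf.nat nX rfl
    simp at h1
    simp [hl, h1, hx] at hb
    have hp : 0 < 4 ^ h := by positivity
    have h2 : 4 ^ (h + 1) = 4 ^ h + 4 ^ h + (4 ^ h + 4 ^ h) := by ring
    refine ⟨40, Ends.straight rfl (by simp) ⟨⟨h + 1, ?_, ?_⟩, ?_⟩⟩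
    · simp [hl, h2]
    · omega
    · simp [hl]; omega
  · simp; omega
  · rintro s' hf ⟨⟨h, hl, hlX⟩, hb⟩
    have h1 := hf.nat nX rfl
    simp at h1
    simp [hl, h1, hx] at hb
    refine ⟨h, hl, hlX, by omega, ?_⟩
    simpa using hf.real aV rfl
  · rintro s1 hf1 ⟨h, hl, hlX, hXl, hV⟩
    have hp : 0 < 4 ^ h := by positivity
    have h24 : (4 : ℕ) ^ h = 2 ^ h * 2 ^ h := by rw [← mul_pow]; norm_num
    have hp2 : 0 < 2 ^ h := by positivity
    have h2le : 2 ^ h ≤ 4 ^ h := Nat.pow_le_pow_left (by norm_num) h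
    refine Ends.step (n' := 3800 * X) rfl (Ends.seq (ends_pivotLoop (h := h) (by simp)
      (by simpa using hl)) (n' := 600 * X) (fun s2 hf2 ⟨hl2, hS2⟩ => ?_) (by omega)) (by simp; omega)
    refine Ends.step (n' := 500 * X) rfl (Ends.seq (n := 200 * X) (n' := 20)
      (R := fun s3 => s3.nat nQ 0 = 2 ^ h / 4 ∧ s3.real aV = s2.real aV)
      ((Ends.forUp (k := 60) (a := 0) (b := 2 ^ h) (fun o s3 => s3.nat nQ 0 = min o (2 ^ h / 4))
        rfl (Nat.zero_le _) rfl ?_ ?_ ?_ ?_).post ?_) (fun s3 hf3 ⟨hq3, hV3⟩ =>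
          Ends.straight rfl (by simp) ?_) (by omega)) (by simp; omega)
    · intro s' hf
      have := hf.nat nLen rfl
      simp at this ⊢
      rw [this, hl2]
    · simp
    · rintro o s' - ho hf hoo hI
      have := hf.nat nLen rfl
      simp at this
      refine Ends.straight rfl (by simp) ?_
      simp only [Program.run, NatExpr.eval, Test.Holds, hoo, this, hl2]
      split_ifs with hc
      · simp; omega
      · simp; omega
    · simp; omega
    · rintro s' hf ⟨h1, -⟩
      have := hf.real aV rfl
      exact ⟨by omega, by simpa using this⟩
    · have hsort : ∀ x y, x ≤ y → y < 2 ^ h → s2.real aV x ≤ s2.real aV y := fun x y hxy hy =>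
        hS2.sorted 0 x y (by simp) hxy (by simpa using hy) (by simpa using hy)
      have hq : 2 ^ h / 4 < 2 ^ h := Nat.div_lt_self hp2 (by norm_num)
      have ht : (rassign rT (.get aV (.var nQ))).run I ε s3 = s3.setReal rT 0 (s2.real aV (2 ^ h / 4)) := by
        simp [hq3, hV3]
      rw [ht]
      simp only [State.real_setReal_same, Function.update_self]
      have hV' : s1.real aV = s.real aV := hV
      set y := s2.real aV (2 ^ h / 4) with hy
      have l1 := hS2.lower (fun v => v ≤ y) fun a b hab hb => hab.trans hb
      have l2 := hS2.upper (fun v => v < y) fun a b hab hb => hab.trans_lt hb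
      simp only [pow_zero, mul_one, add_zero, State.real_setNat, Program.run, hV'] at l1 l2
      have g1 : 2 ^ h / 4 + 1 ≤ cnt (fun v => v ≤ y) (s2.real aV) (2 ^ h) := cnt_ge_of_sorted hsort hq
      have g2 : cnt (fun v => v < y) (s2.real aV) (2 ^ h) ≤ 2 ^ h / 4 := cnt_lt_le_of_sorted hsort hq
      -- Below the pivot the sketch never overestimates, so a quarter of the sketch yields a quarter
      -- of the 4^h elements.
      have m1 : 4 ^ h ≤ 4 * cnt (fun v => v ≤ y) (s.real aV) (4 ^ h) := by
        have : 2 ^ h ≤ 4 * cnt (fun v => v ≤ y) (s2.real aV) (2 ^ h) := by omega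
        calc 4 ^ h = 2 ^ h * 2 ^ h := h24
          _ ≤ 2 ^ h * (4 * cnt (fun v => v ≤ y) (s2.real aV) (2 ^ h)) := Nat.mul_le_mul_left _ this
          _ = 4 * (2 ^ h * cnt (fun v => v ≤ y) (s2.real aV) (2 ^ h)) := by ring
          _ ≤ _ := Nat.mul_le_mul_left _ l1
      -- Strictly below the pivot there is at most a quarter according to the sketch, plus an error
      -- of at most one half; this leaves a quarter above.
      have m2 : 4 * cnt (fun v => v < y) (s.real aV) (4 ^ h) ≤ 3 * 4 ^ h := by
        have h5 : 4 * cnt (fun v => v < y) (s2.real aV) (2 ^ h) ≤ 2 ^ h := by omega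
        have h6 := Nat.mul_le_mul_left (2 ^ h) h5
        rw [← h24] at h6
        have h7 : 2 * 2 ^ h * cnt (fun v => v < y) (s2.real aV) (2 ^ h) * 2 =
          2 ^ h * (4 * cnt (fun v => v < y) (s2.real aV) (2 ^ h)) := by ring
        omega
      have m3 := cnt_add_not (fun v => v < y) (s.real aV) (4 ^ h)
      simp only [not_lt] at m3
      have m4 := cnt_mono (fun v => v ≤ y) (s.real aV) hlX
      have m5 := cnt_mono (fun v => y ≤ v) (s.real aV) hlX
      obtain ⟨i, hi, hi'⟩ := hS2.mem (2 ^ h / 4) (by simpa using hq)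
      refine ⟨⟨i, ?_, ?_⟩, by omega, by omega⟩
      · simp at hi; omega
      · rw [← hV']; simpa using hi'

end RealRAM

/-! ### Dynamic programming with dominance -/


namespace RealRAM

variable {I : KSupplier} {ε : ℝ}

notation "nKK" => (20 : ℕ)
notation "nA" => (21 : ℕ)
notation "nB" => (22 : ℕ)
notation "aLC" => (23 : ℕ)
notation "aLF" => (24 : ℕ)
notation "aLast" => (25 : ℕ)
notation "aCov" => (26 : ℕ)
notation "aCnt" => (27 : ℕ)
notation "aPar" => (28 : ℕ)
notation "aBit" => (29 : ℕ)
notation "aLst" => (30 : ℕ)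
notation "nFree" => (31 : ℕ)
notation "nLo" => (32 : ℕ)
notation "nMd" => (33 : ℕ)
notation "nHi" => (34 : ℕ)
notation "dJ" => (35 : ℕ)
notation "dX" => (36 : ℕ)
notation "dE" => (37 : ℕ)
notation "dY" => (38 : ℕ)
notation "dQ" => (39 : ℕ)
notation "dNode" => (40 : ℕ)
notation "dOk" => (41 : ℕ)
notation "dDom" => (42 : ℕ)
notation "dNew" => (43 : ℕ)
notation "nFound" => (44 : ℕ)
notation "aBL" => (45 : ℕ)
notation "nBL" => (46 : ℕ)

/-! ### Dominance between partial solutions -/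

section Dominance

variable (rel : ℕ → ℕ → Prop) (a b : ℕ)

/-- Every client `q < b` is related to an element of `S`. -/
def Covers (S : Finset ℕ) : Prop := ∀ q < b, ∃ i ∈ S, rel i q

/-- `S` can be completed to a cover by items from position `j` on. -/
def Viable (j : ℕ) (S : Finset ℕ) : Prop := ∀ q < b, ∃ i, (i ∈ S ∨ j ≤ i ∧ i < a) ∧ rel i q

/-- `S` is not larger than `S'` and covers everything that `S'` covers. -/
def Dominates (S S' : Finset ℕ) : Prop :=
  S.card ≤ S'.card ∧ ∀ q < b, (∃ i ∈ S', rel i q) → ∃ i ∈ S, rel i q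

/-- `M` bounds the length of sequences of viable sets in which no set dominates a later one. -/
def FrontBound (kk M : ℕ) : Prop :=
  ∀ j, 0 < j → j ≤ a → ∀ (N : ℕ) (f : ℕ → Finset ℕ),
    (∀ x < N, f x ⊆ Finset.range j ∧ (f x).card ≤ kk ∧ Viable rel a b j (f x)) →
    (∀ x y, x < y → y < N → ¬ Dominates rel b (f x) (f y)) → N ≤ M

/-- The set `S` with or without the item `j`. -/
def ext (j e : ℕ) (S : Finset ℕ) : Finset ℕ := if e = 1 then insert j S else S

theorem ext_subset {j e : ℕ} {S : Finset ℕ} (h : S ⊆ Finset.range j) :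
    ext j e S ⊆ Finset.range (j + 1) := by
  unfold ext
  have h' : S ⊆ Finset.range (j + 1) := h.trans (Finset.range_subset_range.2 (by omega))
  split_ifs
  · exact Finset.insert_subset (by simp) h'
  · exact h'

theorem card_ext {j e : ℕ} {S : Finset ℕ} (h : S ⊆ Finset.range j) (he : e < 2) :
    (ext j e S).card = S.card + e := by
  unfold ext
  have hj : j ∉ S := fun hj => by simpa using h hj
  split_ifs with h1
  · rw [Finset.card_insert_of_notMem hj, h1]
  · obtain rfl : e = 0 := by omega
    rfl

/-- The sets at the list positions from `lo` to `hi` contain a good start for every solution. -/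
def Complete (kk j lo hi : ℕ) (G : ℕ → Finset ℕ) : Prop :=
  ∀ T ⊆ Finset.range a, T.card ≤ kk → Covers rel b T →
    ∃ x, lo ≤ x ∧ x < hi ∧ (G x).card ≤ (T ∩ Finset.range j).card ∧
      Covers rel b (G x ∪ (T \ Finset.range j))

variable {rel a b}

/-- Exchange argument: extend the entry belonging to `T` by the decision of `T` on `j`. The
extension is no larger than `T` up to `j`, and the later items of `T` complete it, so it is small
enough and viable. Hence some listed set dominates it, and replacing the extension by that set
destroys neither the size bound nor the cover. -/
theorem Complete.next {kk j lo md hi : ℕ} {G G' : ℕ → Finset ℕ} (hj : j < a)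
    (h : Complete rel a b kk j lo md G) (hG : ∀ x, lo ≤ x → x < md → G x ⊆ Finset.range j)
    (h' : ∀ x, lo ≤ x → x < md → ∀ e < 2, (ext j e (G x)).card ≤ kk →
      Viable rel a b (j + 1) (ext j e (G x)) →
      ∃ y, md ≤ y ∧ y < hi ∧ Dominates rel b (G' y) (ext j e (G x))) :
    Complete rel a b kk (j + 1) md hi G' := by
  classical
  intro T hT hTk hTc
  obtain ⟨x, hx1, hx2, hxc, hxT⟩ := h T hT hTk hTc
  set e := if j ∈ T then 1 else 0 with he
  have he2 : e < 2 := by rw [he]; split_ifs <;> omega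
  have hcard : (ext j e (G x)).card ≤ (T ∩ Finset.range (j + 1)).card := by
    rw [card_ext (hG x hx1 hx2) he2, Finset.range_add_one]
    by_cases hjT : j ∈ T
    · rw [Finset.inter_insert_of_mem hjT, Finset.card_insert_of_notMem (by simp)]
      simp only [he, hjT, if_true]; omega
    · rw [Finset.inter_insert_of_notMem hjT]
      simp only [he, hjT, if_false]; omega
  have hcov : Covers rel b (ext j e (G x) ∪ (T \ Finset.range (j + 1))) := by
    intro q hq
    obtain ⟨i, hi, hiq⟩ := hxT q hq
    refine ⟨i, ?_, hiq⟩
    simp only [Finset.mem_union, Finset.mem_sdiff, Finset.mem_range] at hi ⊢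
    rcases hi with hi | ⟨hiT, hij⟩
    · left; unfold ext; split_ifs
      · exact Finset.mem_insert_of_mem hi
      · exact hi
    · by_cases hij' : i = j
      · subst hij'; left; simp [ext, he, hiT]
      · right; exact ⟨hiT, by omega⟩
  obtain ⟨y, hy1, hy2, hy3, hy4⟩ := h' x hx1 hx2 e he2
    (hcard.trans ((Finset.card_le_card Finset.inter_subset_left).trans hTk)) (by
      intro q hq
      obtain ⟨i, hi, hiq⟩ := hcov q hq
      refine ⟨i, ?_, hiq⟩
      simp only [Finset.mem_union, Finset.mem_sdiff, Finset.mem_range] at hi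
      rcases hi with hi | ⟨hiT, hij⟩
      · exact .inl hi
      · exact .inr ⟨by omega, by simpa using hT hiT⟩)
  refine ⟨y, hy1, hy2, hy3.trans hcard, fun q hq => ?_⟩
  obtain ⟨i, hi, hiq⟩ := hcov q hq
  rcases Finset.mem_union.1 hi with hi | hi
  · obtain ⟨i', hi', hiq'⟩ := hy4 q hq ⟨i, hi, hiq⟩
    exact ⟨i', Finset.mem_union_left _ hi', hiq'⟩
  · exact ⟨i, Finset.mem_union_right _ hi, hiq⟩

end Dominance

/-! ### The dynamic program on arrays -/

/-- The item `i` of `aLF` is within distance `rT` from the client `q` of `aLC`. -/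
def relOf (I : KSupplier) (s : State) (i q : ℕ) : Prop :=
  dist (I.point (s.nat aLC q)) (I.point (s.nat aLF i)) ≤ s.real rT 0

/-- `d(LC[dQ], LF[dJ]) ≤ rT`. -/
abbrev testNear : Test :=
  .realLe (.dist (.get aLC (.var dQ)) (.get aLF (.var dJ))) (.var rT)

/-- The position of the last item that is related to a client, and the empty partial solution. -/
def dpInit : Program :=
  forUp dQ (.lit 0) (.var nB) (.setNat aCov (.var dQ) (.lit 0) ;; .setNat aLast (.var dQ) (.lit 0) ;;
    forUp dJ (.lit 0) (.var nA)
      (.cond testNear (.setNat aLast (.var dQ) (.add (.var dJ) (.lit 1))) .skip)) ;;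
  .setNat aCnt (.lit 0) (.lit 0) ;; assign nFree (.var nB) ;; .setNat aLst (.lit 0) (.lit 0) ;;
  assign nLo (.lit 0) ;; assign nHi (.lit 1)

/-- What `aLast` has to contain. -/
def LastOK (rel : ℕ → ℕ → Prop) (a b : ℕ) (last : ℕ → ℕ) : Prop :=
  ∀ q < b, ∀ j, last q ≤ j ↔ ∀ i, j ≤ i → i < a → ¬ rel i q

/-- The data of the node `c` describe the set `S`. -/
def NodeOK (rel : ℕ → ℕ → Prop) (b : ℕ) (cov cnt : ℕ → ℕ) (c : ℕ) (S : Finset ℕ) : Prop :=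
  cnt c = S.card ∧ ∀ q < b, (cov (c + q) ≤ 1 ∧ (cov (c + q) = 1 ↔ ∃ i ∈ S, rel i q))

theorem ends_dpInit {s : State} {a b : ℕ} (hA : s.nat nA 0 = a) (hB : s.nat nB 0 = b)
    (hb : 0 < b) :
    Ends I ε dpInit s (200 * ((a + 1) * (b + 1))) fun s' => LastOK (relOf I s) a b (s'.nat aLast) ∧
      NodeOK (relOf I s) b (s'.nat aCov) (s'.nat aCnt) 0 ∅ ∧ s'.nat nFree 0 = b ∧
      s'.nat aLst 0 = 0 ∧ s'.nat nLo 0 = 0 ∧ s'.nat nHi 0 = 1 := by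
  refine Ends.seq (R := fun s' => LastOK (relOf I s) a b (s'.nat aLast) ∧
      ∀ q < b, s'.nat aCov q = 0) (n := b * (a * 50 + 80) + 20) (n' := 40)
    ((Ends.forUp (k := a * 50 + 60) (a := 0) (b := b)
      (fun q s' => LastOK (relOf I s) a q (s'.nat aLast) ∧ ∀ z < q, s'.nat aCov z = 0)
      rfl (Nat.zero_le _) rfl ?_ ?_ ?_ ?_).post ?_) ?_ ?_
  · intro s' hf
    have := hf.nat nB rfl
    simp [this, hB]
  · exact ⟨fun q hq => absurd hq (by omega), fun q hq => absurd hq (by omega)⟩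
  · rintro q s' - hq hf hqq ⟨hL, hC⟩
    have f1 := hf.nat nA rfl
    have f2 := hf.nat aLC rfl
    have f3 := hf.nat aLF rfl
    have f4 := hf.real rT rfl
    refine Ends.step (n' := a * 50 + 50) rfl (Ends.step (n' := a * 50 + 40) rfl
      ((Ends.forUp (k := 30) (a := 0) (b := a)
        (fun j s'' => (∀ z, z ≠ q → s''.nat aLast z = s'.nat aLast z) ∧
          ∀ i, s''.nat aLast q ≤ i ↔ ∀ i', i ≤ i' → i' < j → ¬ relOf I s i' q)
        rfl (Nat.zero_le _) rfl ?_ ?_ ?_ ?_).post ?_) ?_) ?_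
    · intro s'' hf'
      have := hf'.nat nA rfl
      simp [this, f1, hA]
    · simp [hqq, Function.update_apply]; tauto
    · rintro j s'' - hj hf' hjj ⟨h1, h2⟩
      have g1 := hf'.nat dQ rfl
      have g2 := hf'.nat aLC rfl
      have g3 := hf'.nat aLF rfl
      have g4 := hf'.real rT rfl
      simp at g1 g2 g3 g4
      refine Ends.straight rfl (by simp) ?_
      have hrel : relOf I s j q ↔
          dist (I.point (s.nat aLC q)) (I.point (s.nat aLF j)) ≤ s.real rT 0 := Iff.rfl
      simp only [Program.run, Test.Holds, NatExpr.eval, RealExpr.eval, g1, g2, g3, g4, f2, f3, f4,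
        hqq, hjj, not_lt]
      split_ifs with hc
      · refine ⟨fun z hz => by simp [Function.update_of_ne hz, h1 z hz], fun i => ?_⟩
        simp only [State.nat_setNat_same, Function.update_self, State.nat_setNat_ne, ne_eq,
          Nat.reduceEqDiff, not_false_eq_true]
        constructor
        · intro hi i' hi' hi''; omega
        · intro hi; by_contra hcon
          exact hi j (by omega) (by omega) (hrel.2 hc)
      · refine ⟨fun z hz => by simp [h1 z hz], fun i => ?_⟩
        simp only [State.nat_setNat_ne, ne_eq, Nat.reduceEqDiff, not_false_eq_true, h2 i]
        constructor
        · intro hi i' hi' hi''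
          by_cases hij : i' = j
          · subst hij; exact fun h => hc (hrel.1 h)
          · exact hi i' hi' (by omega)
        · intro hi i' hi' hi''; exact hi i' hi' (by omega)
    · simp; omega
    · rintro s'' hf' ⟨⟨h1, h2⟩, -⟩
      have g5 := hf'.nat aCov rfl
      simp [hqq] at g5
      refine ⟨fun z hz j => ?_, fun z hz => ?_⟩
      · by_cases hzq : z = q
        · subst hzq; simpa using h2 j
        · have := hL z (by omega) j
          simpa [h1 z hzq] using this
      · by_cases hzq : z = q
        · subst hzq; simp [g5]
        · simpa [g5, Function.update_of_ne hzq] using hC z (by omega)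
    · simp; omega
    · simp; omega
  · simp; nlinarith
  · rintro s' - ⟨⟨h1, h2⟩, -⟩
    exact ⟨h1, h2⟩
  · rintro s' hf ⟨h1, h2⟩
    have f1 := hf.nat nB rfl
    refine Ends.straight rfl (by simp) ⟨by simpa using h1, ⟨by simp, fun q hq => ?_⟩, ?_, ?_, ?_, ?_⟩
    · simp [h2 q hq]
    all_goals simp [f1, hB]
  · nlinarith

/-- A new node is made from `dNode` by adding the item `dJ` if `dE = 1`. -/
def dpCreate : Program :=
  assign dNew (.var nFree) ;;
  forUp dQ (.lit 0) (.var nB)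
    (.setNat aCov (.add (.var dNew) (.var dQ)) (.get aCov (.add (.var dNode) (.var dQ))) ;;
      .cond (.conj (.natLt (.lit 0) (.var dE)) testNear)
        (.setNat aCov (.add (.var dNew) (.var dQ)) (.lit 1)) .skip) ;;
  .setNat aCnt (.var dNew) (.add (.get aCnt (.var dNode)) (.var dE)) ;;
  .setNat aPar (.var dNew) (.var dNode) ;; .setNat aBit (.var dNew) (.var dE) ;;
  assign nFree (.add (.var nFree) (.var nB))

/-- A node is addressed by the first of its `b` cover bits, and `nFree` advances by `b`. Addresses
thus need only additions, and since `c + b ≤ F` holds for existing nodes, a new node never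
overwrites an old one. -/
theorem ends_dpCreate {s : State} {b c e j F : ℕ} {S : Finset ℕ} (hB : s.nat nB 0 = b)
    (hc : s.nat dNode 0 = c) (he : s.nat dE 0 = e) (he2 : e < 2) (hj : s.nat dJ 0 = j)
    (hF : s.nat nFree 0 = F) (hcF : c + b ≤ F)
    (hS : NodeOK (relOf I s) b (s.nat aCov) (s.nat aCnt) c S) (hSj : S ⊆ Finset.range j) :
    Ends I ε dpCreate s (b * 60 + 60) fun s' =>
      NodeOK (relOf I s) b (s'.nat aCov) (s'.nat aCnt) F (ext j e S) ∧
      s'.nat dNew 0 = F ∧ s'.nat nFree 0 = F + b ∧ (∀ x < F, s'.nat aCov x = s.nat aCov x) ∧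
      (∃ v, s'.nat aCnt = Function.update (s.nat aCnt) F v) ∧
      s'.nat aPar = Function.update (s.nat aPar) F c ∧
      s'.nat aBit = Function.update (s.nat aBit) F e := by
  refine Ends.step (n' := b * 60 + 50) rfl (Ends.seq (R := fun s' =>
      (∀ x < F, s'.nat aCov x = s.nat aCov x) ∧ ∀ q < b, (s'.nat aCov (F + q) ≤ 1 ∧
        (s'.nat aCov (F + q) = 1 ↔ ∃ i ∈ ext j e S, relOf I s i q))) (n := b * 60 + 20) (n' := 30)
    ((Ends.forUp (k := 45) (a := 0) (b := b)
      (fun q s' => (∀ x < F, s'.nat aCov x = s.nat aCov x) ∧ ∀ z < q, (s'.nat aCov (F + z) ≤ 1 ∧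
        (s'.nat aCov (F + z) = 1 ↔ ∃ i ∈ ext j e S, relOf I s i z)))
      rfl (Nat.zero_le _) rfl ?_ ?_ ?_ ?_).post ?_) ?_ ?_) ?_
  · intro s' hf
    have := hf.nat nB rfl
    simp at this
    simp [this, hB]
  · simp
  · rintro q s' - hq hf hqq ⟨h1, h2⟩
    have f1 := hf.nat dNew rfl
    have f2 := hf.nat dNode rfl
    have f3 := hf.nat dE rfl
    have f4 := hf.nat dJ rfl
    have f5 := hf.nat aLC rfl
    have f6 := hf.nat aLF rfl
    have f7 := hf.real rT rfl
    simp at f1 f2 f3 f4 f5 f6 f7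
    refine Ends.straight rfl (by simp) ?_
    have hold := hS.2 q hq
    rw [← h1 (c + q) (by omega)] at hold
    have hrel : relOf I s j q ↔
          dist (I.point (s.nat aLC q)) (I.point (s.nat aLF j)) ≤ s.real rT 0 := Iff.rfl
    have hpres : ∀ v : ℕ, (v ≤ 1 ∧ (v = 1 ↔ ∃ i ∈ ext j e S, relOf I s i q)) →
        (∀ x < F, Function.update (s'.nat aCov) (F + q) v x = s.nat aCov x) ∧
        ∀ z < q + 1, (Function.update (s'.nat aCov) (F + q) v (F + z) ≤ 1 ∧
          (Function.update (s'.nat aCov) (F + q) v (F + z) = 1 ↔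
            ∃ i ∈ ext j e S, relOf I s i z)) := by
      intro v hv
      refine ⟨fun x hx => ?_, fun z hz => ?_⟩
      · rw [Function.update_of_ne (by omega), h1 x hx]
      · by_cases hzq : z = q
        · subst hzq; rw [Function.update_self]; exact hv
        · rw [Function.update_of_ne (by omega)]; exact h2 z (by omega)
    simp only [Program.run, Test.Holds, NatExpr.eval, RealExpr.eval, hqq, f1, f2, f3, f4, f5, f6, f7,
      Function.update_self, hF, hc, he, hj, State.nat_setNat_same, State.nat_setNat_ne, ne_eq,
      Nat.reduceEqDiff, not_false_eq_true, State.real_setNat, not_lt]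
    split_ifs with hcond
    · simp only [State.nat_setNat_same, State.nat_setNat_ne, ne_eq, Nat.reduceEqDiff,
        not_false_eq_true, Function.update_idem]
      have : e = 1 := by omega
      exact hpres 1 ⟨le_rfl, by simp only [true_iff]; exact ⟨j, by simp [ext, this], hrel.2 hcond.2⟩⟩
    · simp only [State.nat_setNat_same, State.nat_setNat_ne, ne_eq, Nat.reduceEqDiff,
        not_false_eq_true]
      refine hpres _ ⟨hold.1, hold.2.trans ?_⟩
      unfold ext
      split_ifs with he1
      · have hn : ¬ relOf I s j q := fun h => hcond ⟨by omega, hrel.1 h⟩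
        simp [hn]
      · rfl
  · simp; omega
  · rintro s' - ⟨h, -⟩; exact h
  · rintro s' hf ⟨h1, h2⟩
    have f1 := hf.nat dNew rfl
    have f2 := hf.nat dNode rfl
    have f3 := hf.nat dE rfl
    have f4 := hf.nat nFree rfl
    have f5 := hf.nat nB rfl
    have f6 := hf.nat aCnt rfl
    have f7 := hf.nat aPar rfl
    have f8 := hf.nat aBit rfl
    simp at f1 f2 f3 f4 f5 f6 f7 f8
    refine Ends.straight rfl (by simp) ⟨⟨?_, ?_⟩, ?_, ?_, ?_, ?_, ?_, ?_⟩
    · simp [f1, f2, f3, f6, hF, hc, he, hS.1, card_ext hSj he2]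
    · simpa using h2
    · simp [f1, hF]
    · simp [f4, f5, hF, hB]
    · simpa using h1
    · exact ⟨_, by simp [f1, f6, hF]; rfl⟩
    · simp [f1, f7, f2, hF, hc]
    · simp [f1, f8, f3, hF, he]
  · omega
  · simp; omega

/-- The new node is appended to the list unless it is useless. -/
def dpCheck : Program :=
  assign dOk (.lit 1) ;;
  .cond (.natLt (.var nKK) (.get aCnt (.var dNew))) (assign dOk (.lit 0)) .skip ;;
  forUp dQ (.lit 0) (.var nB)
    (.cond (.conj (.natLt (.get aCov (.add (.var dNew) (.var dQ))) (.lit 1))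
        (.natLe (.get aLast (.var dQ)) (.add (.var dJ) (.lit 1))))
      (assign dOk (.lit 0)) .skip) ;;
  forUp dY (.var nMd) (.var nHi)
    (assign dDom (.lit 1) ;;
      .cond (.natLt (.get aCnt (.var dNew)) (.get aCnt (.get aLst (.var dY))))
        (assign dDom (.lit 0)) .skip ;;
      forUp dQ (.lit 0) (.var nB)
        (.cond (.natLt (.get aCov (.add (.get aLst (.var dY)) (.var dQ)))
            (.get aCov (.add (.var dNew) (.var dQ)))) (assign dDom (.lit 0)) .skip) ;;
      .cond (.natLt (.lit 0) (.var dDom)) (assign dOk (.lit 0)) .skip) ;;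
  .cond (.natLt (.lit 0) (.var dOk))
    (.setNat aLst (.var nHi) (.var dNew) ;; assign nHi (.add (.var nHi) (.lit 1))) .skip

/-- A new set is compared with the listed ones, but listed sets that it dominates are not removed.
The list therefore has just the property that no set dominates a later one, which is the kind of
sequence that `FrontBound` measures. -/
theorem ends_dpCheck {s : State} {rel : ℕ → ℕ → Prop} {a b kk j F md hi : ℕ} {S : Finset ℕ}
    {G : ℕ → Finset ℕ} (hB : s.nat nB 0 = b) (hK : s.nat nKK 0 = kk) (hJ : s.nat dJ 0 = j)
    (hN : s.nat dNew 0 = F) (hMd : s.nat nMd 0 = md) (hHi : s.nat nHi 0 = hi) (hmd : md ≤ hi)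
    (hL : LastOK rel a b (s.nat aLast)) (hS : NodeOK rel b (s.nat aCov) (s.nat aCnt) F S)
    (hG : ∀ y, md ≤ y → y < hi → NodeOK rel b (s.nat aCov) (s.nat aCnt) (s.nat aLst y) (G y)) :
    Ends I ε dpCheck s ((hi - md + 1) * (b + 1) * 100) fun s' =>
      ((S.card ≤ kk ∧ Viable rel a b (j + 1) S ∧
          ∀ y, md ≤ y → y < hi → ¬ Dominates rel b (G y) S) →
        s'.nat aLst = Function.update (s.nat aLst) hi F ∧ s'.nat nHi 0 = hi + 1) ∧
      (¬ (S.card ≤ kk ∧ Viable rel a b (j + 1) S ∧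
          ∀ y, md ≤ y → y < hi → ¬ Dominates rel b (G y) S) →
        s'.nat aLst = s.nat aLst ∧ s'.nat nHi 0 = hi) := by
  refine Ends.step (n' := (hi - md + 1) * (b + 1) * 100 - 5) rfl
    (Ends.step (n' := (hi - md + 1) * (b + 1) * 100 - 25) rfl
    (Ends.seq (R := fun s' => 0 < s'.nat dOk 0 ↔ S.card ≤ kk ∧ Viable rel a b (j + 1) S)
      (n := b * 40 + 20) (n' := (hi - md) * (b * 35 + 75) + 50) ?_ ?_ ?_) ?_) ?_
  · refine (Ends.forUp (k := 26) (a := 0) (b := b) (fun q s' => 0 < s'.nat dOk 0 ↔ S.card ≤ kk ∧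
      ∀ z < q, ∃ i, (i ∈ S ∨ j + 1 ≤ i ∧ i < a) ∧ rel i z) rfl (Nat.zero_le _) rfl ?_ ?_ ?_
      ?_).post ?_
    · intro s' hf
      have e : s'.nat nB = s.nat nB := by rw [hf.nat nB rfl, run_nat, run_nat] <;> rfl
      simp [e, hB]
    · simp only [Program.run, Test.Holds, NatExpr.eval, State.nat_setNat_ne, ne_eq,
        Nat.reduceEqDiff, not_false_eq_true, hN, hK, hS.1]
      split_ifs with h <;> simp <;> omega
    · rintro q s' - hq hf hqq hI
      have e1 : s'.nat dNew = s.nat dNew := by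
        rw [hf.nat dNew rfl, run_nat, run_nat] <;> rfl
      have e2 : s'.nat dJ = s.nat dJ := by
        rw [hf.nat dJ rfl, run_nat, run_nat] <;> rfl
      have e3 : s'.nat aCov = s.nat aCov := by
        rw [hf.nat aCov rfl, run_nat, run_nat] <;> rfl
      have e4 : s'.nat aLast = s.nat aLast := by
        rw [hf.nat aLast rfl, run_nat, run_nat] <;> rfl
      refine Ends.straight rfl (by simp) ?_
      -- The client is lost: `S` does not cover it, and by `LastOK` no item from `j + 1` on is
      -- related to it.
      have hcond : (s.nat aCov (F + q) < 1 ∧ s.nat aLast q ≤ j + 1) ↔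
          ¬ ∃ i, (i ∈ S ∨ j + 1 ≤ i ∧ i < a) ∧ rel i q := by
        rw [hL q hq (j + 1)]
        have := hS.2 q hq
        have h0 : s.nat aCov (F + q) < 1 ↔ ¬ ∃ i ∈ S, rel i q := by rw [← this.2]; omega
        rw [h0]
        constructor
        · rintro ⟨h1, h2⟩ ⟨i, hi | hi, hr⟩
          · exact h1 ⟨i, hi, hr⟩
          · exact h2 i hi.1 hi.2 hr
        · intro h
          exact ⟨fun ⟨i, hi, hr⟩ => h ⟨i, .inl hi, hr⟩, fun i h1 h2 hr => h ⟨i, .inr ⟨h1, h2⟩, hr⟩⟩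
      have hext : (S.card ≤ kk ∧ ∀ z < q + 1, ∃ i, (i ∈ S ∨ j + 1 ≤ i ∧ i < a) ∧ rel i z) ↔
          (S.card ≤ kk ∧ ∀ z < q, ∃ i, (i ∈ S ∨ j + 1 ≤ i ∧ i < a) ∧ rel i z) ∧
            ∃ i, (i ∈ S ∨ j + 1 ≤ i ∧ i < a) ∧ rel i q := by
        rw [and_assoc]
        refine and_congr_right fun _ => ⟨fun h => ⟨fun z hz => h z (by omega), h q (by omega)⟩,
          fun ⟨h1, h2⟩ z hz => ?_⟩
        rcases Nat.lt_succ_iff_lt_or_eq.1 hz with hz | rfl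
        · exact h1 z hz
        · exact h2
      rw [hext]
      simp only [Program.run]
      split_ifs with hc <;> simp only [Test.Holds, NatExpr.eval, e1, e2, e3, e4, hqq, hN, hJ, not_lt, hcond, not_not] at hc
      · simp only [State.nat_setNat_ne, State.nat_setNat_same, Function.update_self, ne_eq,
          Nat.reduceEqDiff, not_false_eq_true, lt_irrefl, false_iff, NatExpr.eval]
        exact fun h => hc h.2
      · simp only [State.nat_setNat_ne, ne_eq, Nat.reduceEqDiff, not_false_eq_true, hI]
        exact ⟨fun h => ⟨h, hc⟩, fun h => h.1⟩
    · simp; omega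
    · rintro s' - ⟨h, -⟩; exact h
  · rintro s1 hf1 h1
    have g : ∀ A, A ≠ 41 → A ≠ 39 → s1.nat A = s.nat A := by
      intro A h41 h39
      rw [hf1.nat A (by simp [forUp, Program.writesNat, h41, h39, Ne.symm h41, Ne.symm h39]), run_nat, run_nat]
      all_goals first | rfl | simp [Program.writesNat, h41, Ne.symm h41]
    refine Ends.seq (R := fun s' => 0 < s'.nat dOk 0 ↔ S.card ≤ kk ∧ Viable rel a b (j + 1) S ∧
      ∀ y, md ≤ y → y < hi → ¬ Dominates rel b (G y) S) (n := (hi - md) * (b * 35 + 75) + 20)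
      (n' := 25) ((Ends.forUp (k := b * 35 + 60) (a := md) (b := hi) (fun z s' => 0 < s'.nat dOk 0 ↔
        (S.card ≤ kk ∧ Viable rel a b (j + 1) S) ∧
          ∀ y, md ≤ y → y < z → ¬ Dominates rel b (G y) S)
        ?_ hmd rfl ?_ ?_ ?_ ?_).post ?_) ?_ (by omega)
    · simp [g, hMd]
    · intro s' hf
      have := hf.nat nHi rfl
      simp [this, g, hHi]
    · simp [h1]
      intro _ _ y h2 h3; omega
    · rintro y s' hy1 hy2 hf hyy hI
      have e0 := hf.nat aLst rfl
      have e1 := hf.nat dNew rfl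
      have e2 := hf.nat aCnt rfl
      have e3 := hf.nat aCov rfl
      have e4 := hf.nat nB rfl
      rw [g _ (by simp) (by simp)] at e0 e1 e2 e3 e4
      have hGy := hG y hy1 hy2
      refine Ends.step (n' := b * 35 + 50) rfl (Ends.step (n' := b * 35 + 30) rfl
        (Ends.seq (n := b * 35 + 20) (n' := 10) (R := fun s'' => (0 < s''.nat dDom 0 ↔
          Dominates rel b (G y) S) ∧ s''.nat dOk = s'.nat dOk)
          ((Ends.forUp (k := 20) (a := 0) (b := b) (fun q s'' => 0 < s''.nat dDom 0 ↔
            (G y).card ≤ S.card ∧ ∀ z < q, (∃ i ∈ S, rel i z) → ∃ i ∈ G y, rel i z)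
            rfl (Nat.zero_le _) rfl ?_ ?_ ?_ ?_).post ?_) ?_ ?_) ?_) ?_
      · intro s'' hf'
        have e : s''.nat nB = s'.nat nB := by rw [hf'.nat nB rfl, run_nat, run_nat] <;> rfl
        simp [e, e4, hB]
      · simp only [Program.run, Test.Holds, NatExpr.eval, State.nat_setNat_ne, ne_eq,
          Nat.reduceEqDiff, not_false_eq_true, e0, e1, e2, hyy, hN, hS.1, hGy.1]
        split_ifs with h <;> simp <;> omega
      · rintro q s'' - hq hf' hqq hI'
        have d1 : s''.nat dNew = s.nat dNew := by
          rw [hf'.nat dNew rfl, run_nat, run_nat, e1] <;> rfl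
        have d2 : s''.nat aLst = s.nat aLst := by
          rw [hf'.nat aLst rfl, run_nat, run_nat, e0] <;> rfl
        have d3 : s''.nat aCov = s.nat aCov := by
          rw [hf'.nat aCov rfl, run_nat, run_nat, e3] <;> rfl
        have d4 : s''.nat dY = s'.nat dY := by
          rw [hf'.nat dY rfl, run_nat, run_nat] <;> rfl
        refine Ends.straight rfl (by simp) ?_
        have c1 := hS.2 q hq
        have c2 := hGy.2 q hq
        have hcond : s.nat aCov (s.nat aLst y + q) < s.nat aCov (F + q) ↔
            ¬ ((∃ i ∈ S, rel i q) → ∃ i ∈ G y, rel i q) := by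
          rw [← c1.2, ← c2.2]; omega
        have hext : ((G y).card ≤ S.card ∧
            ∀ z < q + 1, (∃ i ∈ S, rel i z) → ∃ i ∈ G y, rel i z) ↔
            ((G y).card ≤ S.card ∧ ∀ z < q, (∃ i ∈ S, rel i z) → ∃ i ∈ G y, rel i z) ∧
              ((∃ i ∈ S, rel i q) → ∃ i ∈ G y, rel i q) := by
          rw [and_assoc]
          refine and_congr_right fun _ => ⟨fun h => ⟨fun z hz => h z (by omega), h q (by omega)⟩,
            fun ⟨h1, h2⟩ z hz => ?_⟩
          rcases Nat.lt_succ_iff_lt_or_eq.1 hz with hz | rfl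
          · exact h1 z hz
          · exact h2
        rw [hext]
        simp only [Program.run]
        split_ifs with hc <;> simp only [Test.Holds, NatExpr.eval, d1, d2, d3, d4, hqq, hN, hyy, not_lt, hcond, not_not] at hc
        · simp only [State.nat_setNat_ne, State.nat_setNat_same, Function.update_self, ne_eq,
            Nat.reduceEqDiff, not_false_eq_true, lt_irrefl, false_iff, NatExpr.eval]
          exact fun h => hc h.2
        · simp only [State.nat_setNat_ne, ne_eq, Nat.reduceEqDiff, not_false_eq_true, hI']
          exact ⟨fun h => ⟨h, hc⟩, fun h => h.1⟩
      · simp; omega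
      · rintro s'' hf' ⟨h, -⟩
        refine ⟨h, ?_⟩
        rw [hf'.nat dOk rfl, run_nat, run_nat] <;> rfl
      · rintro s'' hf' ⟨h2, h3⟩
        refine Ends.straight rfl (by simp) ?_
        have hext : (∀ z, md ≤ z → z < y + 1 → ¬ Dominates rel b (G z) S) ↔
            (∀ z, md ≤ z → z < y → ¬ Dominates rel b (G z) S) ∧ ¬ Dominates rel b (G y) S := by
          refine ⟨fun h => ⟨fun z hz hz' => h z hz (by omega), h y hy1 (by omega)⟩,
            fun ⟨h1, h2⟩ z hz hz' => ?_⟩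
          rcases Nat.lt_succ_iff_lt_or_eq.1 hz' with hz' | rfl
          · exact h1 z hz hz'
          · exact h2
        rw [hext, ← and_assoc]
        simp only [Program.run]
        split_ifs with hc <;> simp only [Test.Holds, NatExpr.eval, h2] at hc
        · simp [hc]
        · simp only [State.nat_setNat_ne, ne_eq, Nat.reduceEqDiff, not_false_eq_true, h3, hI]
          exact ⟨fun h => ⟨h, hc⟩, fun h => h.1⟩
      · omega
      · simp; omega
      · simp; omega
    · simp
      have : b * 35 + 60 + 2 + 10 ≤ b * 35 + 75 := by omega
      have := Nat.mul_le_mul_left (hi - md) this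
      omega
    · rintro s' - ⟨h, -⟩
      rw [h, and_assoc]
    · rintro s2 hf2 h2
      refine Ends.straight rfl (by simp) ?_
      have d1 := hf2.nat dNew rfl
      have d2 := hf2.nat aLst rfl
      have d3 := hf2.nat nHi rfl
      rw [g _ (by simp) (by simp)] at d1 d2 d3
      simp only [Program.run]
      split_ifs with hc <;> simp only [Test.Holds, NatExpr.eval, h2] at hc
      · exact ⟨fun _ => by simp [d1, d2, d3, hHi, hN], fun h => absurd hc h⟩
      · exact ⟨fun h => absurd h hc, fun _ => by simp [d2, d3, hHi]⟩
  · have : (hi - md + 1) * (b + 1) * 100 = (hi - md) * (b * 100 + 100) + (b * 100 + 100) := by ring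
    have := Nat.mul_le_mul_left (hi - md) (show b * 35 + 75 ≤ b * 100 + 100 by omega)
    omega
  · have : (hi - md + 1) * (b + 1) * 100 = (hi - md) * (b * 100 + 100) + (b * 100 + 100) := by ring
    simp; omega
  · have : (hi - md + 1) * (b + 1) * 100 = (hi - md) * (b * 100 + 100) + (b * 100 + 100) := by ring
    simp; omega

/-- The node `c` was made by deciding on the items below `j` one after the other. -/
def Built (par bit : ℕ → ℕ) (F : ℕ) : ℕ → ℕ → Finset ℕ → Prop
  | 0, c, S => c < F ∧ S = ∅
  | j + 1, c, S => c < F ∧ bit c < 2 ∧ ∃ S', Built par bit F j (par c) S' ∧ S = ext j (bit c) S'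

theorem Built.mono {par bit par' bit' : ℕ → ℕ} {F F' : ℕ} (hF : F ≤ F')
    (hp : ∀ x < F, par' x = par x) (hb : ∀ x < F, bit' x = bit x) :
    ∀ {j c : ℕ} {S : Finset ℕ}, Built par bit F j c S → Built par' bit' F' j c S
  | 0, _, _, h => ⟨by have := h.1; omega, h.2⟩
  | j + 1, c, S, ⟨h1, h2, S', h3, h4⟩ =>
    ⟨by omega, by rwa [hb c h1], S', by rw [hp c h1]; exact h3.mono hF hp hb, by rwa [hb c h1]⟩

theorem Built.subset {par bit : ℕ → ℕ} {F : ℕ} :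
    ∀ {j c : ℕ} {S : Finset ℕ}, Built par bit F j c S → S ⊆ Finset.range j
  | 0, _, _, h => by simp [h.2]
  | j + 1, c, S, ⟨h1, h2, S', h3, h4⟩ => h4 ▸ ext_subset h3.subset

theorem NodeOK.mono {rel : ℕ → ℕ → Prop} {b F c : ℕ} {cov cnt cov' cnt' : ℕ → ℕ} {S : Finset ℕ}
    (h : NodeOK rel b cov cnt c S) (hb : 0 < b) (hc : c + b ≤ F) (h1 : ∀ x < F, cov' x = cov x)
    (h2 : ∀ x < F, cnt' x = cnt x) : NodeOK rel b cov' cnt' c S :=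
  ⟨by rw [h2 c (by omega), h.1], fun q hq => by rw [h1 _ (by omega)]; exact h.2 q hq⟩

theorem relOf_congr {s s' : State} (h1 : s'.nat aLC = s.nat aLC) (h2 : s'.nat aLF = s.nat aLF)
    (h3 : s'.real rT = s.real rT) : relOf I s' = relOf I s := by
  funext i q; simp [relOf, h1, h2, h3]

/-- The data that do not change during the dynamic program. -/
structure DPCtx (I : KSupplier) (rel : ℕ → ℕ → Prop) (a b kk : ℕ) (s : State) : Prop where
  hA : s.nat nA 0 = a
  hB : s.nat nB 0 = b
  hK : s.nat nKK 0 = kk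
  rel_eq : relOf I s = rel
  last : LastOK rel a b (s.nat aLast)

theorem DPCtx.frame {rel : ℕ → ℕ → Prop} {a b kk : ℕ} {s s' : State} {c : Program}
    (h : DPCtx I rel a b kk s) (hf : c.Frame s s')
    (hw : ([20, 21, 22, 23, 24, 25].all fun A => !c.writesNat A) = true)
    (hr : c.writesReal rT = false) : DPCtx I rel a b kk s' := by
  simp only [List.all_cons, List.all_nil, Bool.and_true, Bool.and_eq_true, Bool.not_eq_true'] at hw
  obtain ⟨h1, h2, h3, h4, h5, h6⟩ := hw
  refine ⟨by rw [hf.nat _ h2]; exact h.hA, by rw [hf.nat _ h3]; exact h.hB,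
    by rw [hf.nat _ h1]; exact h.hK, ?_, by rw [hf.nat _ h6]; exact h.last⟩
  rw [relOf_congr (hf.nat _ h4) (hf.nat _ h5) (hf.real _ hr)]
  exact h.rel_eq

/-- A list entry: the node `c` describes the admissible partial solution `S`. -/
structure Entry (rel : ℕ → ℕ → Prop) (a b kk : ℕ) (s : State) (j c : ℕ) (S : Finset ℕ) : Prop where
  lt : c + b ≤ s.nat nFree 0
  node : NodeOK rel b (s.nat aCov) (s.nat aCnt) c S
  built : Built (s.nat aPar) (s.nat aBit) (s.nat nFree 0) j c S
  card : S.card ≤ kk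
  viable : 0 < j → Viable rel a b j S

/-- The existing nodes are untouched. -/
structure Extends (s s' : State) : Prop where
  free : s.nat nFree 0 ≤ s'.nat nFree 0
  cov : ∀ x < s.nat nFree 0, s'.nat aCov x = s.nat aCov x
  cnt : ∀ x < s.nat nFree 0, s'.nat aCnt x = s.nat aCnt x
  par : ∀ x < s.nat nFree 0, s'.nat aPar x = s.nat aPar x
  bit : ∀ x < s.nat nFree 0, s'.nat aBit x = s.nat aBit x

theorem Entry.mono {rel : ℕ → ℕ → Prop} {a b kk j c : ℕ} {s s' : State} {S : Finset ℕ} (hb : 0 < b)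
    (h : Entry rel a b kk s j c S) (he : Extends s s') : Entry rel a b kk s' j c S :=
  ⟨h.lt.trans he.free, h.node.mono hb h.lt he.cov he.cnt, h.built.mono he.free he.par he.bit,
    h.card, h.viable⟩

/-- The list entries of one level are being extended to those of the next; all the extensions
of entries before `X`, and the first `E` extensions of the entry `X`, are done. -/
def Progress (rel : ℕ → ℕ → Prop) (a b kk : ℕ) (s : State) (j lo md : ℕ) (G₀ : ℕ → Finset ℕ)
    (X E : ℕ) : Prop :=
  (∀ x, lo ≤ x → x < md → Entry rel a b kk s j (s.nat aLst x) (G₀ x)) ∧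
  ∃ (G : ℕ → Finset ℕ) (hi : ℕ), s.nat nHi 0 = hi ∧ md ≤ hi ∧
    (∀ y, md ≤ y → y < hi → Entry rel a b kk s (j + 1) (s.nat aLst y) (G y)) ∧
    (∀ x y, md ≤ x → x < y → y < hi → ¬ Dominates rel b (G x) (G y)) ∧
    ∀ x, lo ≤ x → x < md → ∀ e < 2, (x < X ∨ x = X ∧ e < E) → (ext j e (G₀ x)).card ≤ kk →
      Viable rel a b (j + 1) (ext j e (G₀ x)) →
      ∃ y, md ≤ y ∧ y < hi ∧ Dominates rel b (G y) (ext j e (G₀ x))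

/-- This applies already to a level under construction, so it also bounds the number of comparisons
made for each new node. -/
theorem front_le {rel : ℕ → ℕ → Prop} {a b kk M j md hi : ℕ} {s : State} {G : ℕ → Finset ℕ}
    (hM : FrontBound rel a b kk M) (hj : j < a)
    (h1 : ∀ y, md ≤ y → y < hi → Entry rel a b kk s (j + 1) (s.nat aLst y) (G y))
    (h2 : ∀ x y, md ≤ x → x < y → y < hi → ¬ Dominates rel b (G x) (G y)) : hi - md ≤ M := by
  refine hM (j + 1) (by omega) hj (hi - md) (fun z => G (md + z)) (fun x hx => ?_)
    fun x y hxy hy => h2 _ _ (by omega) (by omega) (by omega)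
  have := h1 (md + x) (by omega) (by omega)
  exact ⟨this.built.subset, this.card, this.viable (by omega)⟩

theorem ends_dpStep {rel : ℕ → ℕ → Prop} {a b kk M j lo md x e : ℕ} {s : State}
    {G₀ : ℕ → Finset ℕ} (hb : 0 < b) (hc : DPCtx I rel a b kk s) (hM : FrontBound rel a b kk M)
    (hja : j < a) (hJ : s.nat dJ 0 = j) (hE : s.nat dE 0 = e) (he : e < 2)
    (hMd : s.nat nMd 0 = md) (hx1 : lo ≤ x) (hx2 : x < md) (hN : s.nat dNode 0 = s.nat aLst x)
    (hP : Progress rel a b kk s j lo md G₀ x e) :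
    Ends I ε (dpCreate ;; dpCheck) s (200 * ((M + 1) * (b + 1))) fun s' =>
      Progress rel a b kk s' j lo md G₀ x (e + 1) ∧ s'.nat aLst x = s.nat aLst x := by
  obtain ⟨hO, G, hi, hhi, hmd, hG, hnd, hdone⟩ := hP
  have hx := hO x hx1 hx2
  have hw := front_le hM hja hG hnd
  refine Ends.seq (ends_dpCreate hc.hB hN hE he hJ rfl hx.lt (by rw [hc.rel_eq]; exact hx.node)
    hx.built.subset) (n' := (hi - md + 1) * (b + 1) * 100) ?_ ?_
  · rintro s1 hf1 ⟨h1, h2, h3, h4, ⟨v, h5⟩, h6, h7⟩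
    rw [hc.rel_eq] at h1
    set F := s.nat nFree 0 with hF
    have hc1 := hc.frame hf1 rfl rfl
    have k1 : s1.nat dJ = s.nat dJ := hf1.nat _ rfl
    have k2 : s1.nat nMd = s.nat nMd := hf1.nat _ rfl
    have k3 : s1.nat nHi = s.nat nHi := hf1.nat _ rfl
    have k4 : s1.nat aLst = s.nat aLst := hf1.nat _ rfl
    have hext : Extends s s1 := by
      refine ⟨by omega, h4, fun z hz => ?_, fun z hz => ?_, fun z hz => ?_⟩
      · rw [h5, Function.update_of_ne (by omega)]
      · rw [h6, Function.update_of_ne (by omega)]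
      · rw [h7, Function.update_of_ne (by omega)]
    have hnew : Built (s1.nat aPar) (s1.nat aBit) (F + b) (j + 1) F (ext j e (G₀ x)) := by
      refine ⟨by omega, by rw [h7]; simpa using he, G₀ x, ?_, by rw [h7]; simp⟩
      rw [h6, Function.update_self, ← h6]
      exact hx.built.mono (by omega) hext.par hext.bit
    refine (ends_dpCheck hc1.hB hc1.hK (by rw [k1, hJ]) h2 (by rw [k2, hMd]) (by rw [k3, hhi]) hmd
      hc1.last h1 (G := G) fun y hy1 hy2 => ?_).post ?_
    · rw [k4]; exact ((hG y hy1 hy2).mono hb hext).node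
    · rintro s2 hf2 ⟨hyes, hno⟩
      have hext2 : Extends s s2 := by
        have e1 : s2.nat nFree = s1.nat nFree := hf2.nat _ rfl
        have e2 : s2.nat aCov = s1.nat aCov := hf2.nat _ rfl
        have e3 : s2.nat aCnt = s1.nat aCnt := hf2.nat _ rfl
        have e4 : s2.nat aPar = s1.nat aPar := hf2.nat _ rfl
        have e5 : s2.nat aBit = s1.nat aBit := hf2.nat _ rfl
        exact ⟨by rw [e1]; exact hext.free, by rw [e2]; exact hext.cov, by rw [e3]; exact hext.cnt,
          by rw [e4]; exact hext.par, by rw [e5]; exact hext.bit⟩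
      by_cases hP : (ext j e (G₀ x)).card ≤ kk ∧ Viable rel a b (j + 1) (ext j e (G₀ x)) ∧
          ∀ y, md ≤ y → y < hi → ¬ Dominates rel b (G y) (ext j e (G₀ x))
      · obtain ⟨l1, l2⟩ := hyes hP
        rw [k4] at l1
        have hold : ∀ z, z ≠ hi → s2.nat aLst z = s.nat aLst z := fun z hz => by
          rw [l1, Function.update_of_ne hz]
        refine ⟨⟨fun z hz1 hz2 => ?_, Function.update G hi (ext j e (G₀ x)), hi + 1, l2, by omega,
          fun y hy1 hy2 => ?_, fun z y hz hzy hy => ?_, fun z hz1 hz2 e' he' hze hk hv => ?_⟩, ?_⟩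
        · rw [hold z (by omega)]; exact (hO z hz1 hz2).mono hb hext2
        · by_cases hyh : y = hi
          · subst hyh
            rw [Function.update_self, l1, Function.update_self]
            have e1 : s2.nat nFree = s1.nat nFree := hf2.nat _ rfl
            have e2 : s2.nat aCov = s1.nat aCov := hf2.nat _ rfl
            have e3 : s2.nat aCnt = s1.nat aCnt := hf2.nat _ rfl
            have e4 : s2.nat aPar = s1.nat aPar := hf2.nat _ rfl
            have e5 : s2.nat aBit = s1.nat aBit := hf2.nat _ rfl
            exact ⟨by rw [e1, h3], by rw [e2, e3]; exact h1, by rw [e1, e4, e5, h3]; exact hnew,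
              hP.1, fun _ => hP.2.1⟩
          · rw [Function.update_of_ne hyh, hold y hyh]
            exact (hG y hy1 (by omega)).mono hb hext2
        · rw [Function.update_of_ne (show z ≠ hi by omega)]
          by_cases hyh : y = hi
          · subst hyh; rw [Function.update_self]; exact hP.2.2 z hz hzy
          · rw [Function.update_of_ne hyh]; exact hnd z y hz hzy (by omega)
        · by_cases hnow : z = x ∧ e' = e
          · obtain ⟨rfl, rfl⟩ := hnow
            exact ⟨hi, hmd, by omega, by rw [Function.update_self]; exact ⟨le_rfl, fun _ _ h => h⟩⟩
          · obtain ⟨y, hy1, hy2, hy3⟩ := hdone z hz1 hz2 e' he' (by omega) hk hv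
            exact ⟨y, hy1, by omega, by rw [Function.update_of_ne (by omega)]; exact hy3⟩
        · exact hold x (by omega)
      · obtain ⟨l1, l2⟩ := hno hP
        rw [k4] at l1
        refine ⟨⟨fun z hz1 hz2 => ?_, G, hi, l2, hmd, fun y hy1 hy2 => ?_, hnd,
          fun z hz1 hz2 e' he' hze hk hv => ?_⟩, by rw [l1]⟩
        · rw [l1]; exact (hO z hz1 hz2).mono hb hext2
        · rw [l1]; exact (hG y hy1 hy2).mono hb hext2
        · by_cases hnow : z = x ∧ e' = e
          · obtain ⟨rfl, rfl⟩ := hnow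
            -- The extension is small enough and viable, so it can have been rejected only because a
            -- listed set dominates it.
            by_contra hcon
            exact hP ⟨hk, hv, fun y hy1 hy2 hd => hcon ⟨y, hy1, hy2, hd⟩⟩
          · exact hdone z hz1 hz2 e' he' (by omega) hk hv
  · have h1 : (hi - md + 1) * (b + 1) ≤ (M + 1) * (b + 1) := Nat.mul_le_mul_right _ (by omega)
    have h2 : 1 * (b + 1) ≤ (M + 1) * (b + 1) := Nat.mul_le_mul_right _ (by omega)
    omega

/-- The decision on the item `dJ`. -/
def dpLevel : Program :=
  assign nMd (.var nHi) ;;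
  forUp dX (.var nLo) (.var nMd)
    (assign dNode (.get aLst (.var dX)) ;; forUp dE (.lit 0) (.lit 2) (dpCreate ;; dpCheck)) ;;
  assign nLo (.var nMd)

/-- The list of partial solutions after the decisions on the items below `j`. -/
def Level (rel : ℕ → ℕ → Prop) (a b kk M : ℕ) (s : State) (j : ℕ) : Prop :=
  ∃ (G : ℕ → Finset ℕ) (lo hi : ℕ), s.nat nLo 0 = lo ∧ s.nat nHi 0 = hi ∧ lo ≤ hi ∧ hi - lo ≤ M ∧
    (∀ x, lo ≤ x → x < hi → Entry rel a b kk s j (s.nat aLst x) (G x)) ∧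
    Complete rel a b kk j lo hi G

theorem Progress.congr {rel : ℕ → ℕ → Prop} {a b kk j lo md X E : ℕ} {s s' : State}
    {G₀ : ℕ → Finset ℕ} (h : Progress rel a b kk s j lo md G₀ X E)
    (he : ∀ A, A = 26 ∨ A = 27 ∨ A = 28 ∨ A = 29 ∨ A = 30 ∨ A = 31 ∨ A = 34 →
      s'.nat A = s.nat A) : Progress rel a b kk s' j lo md G₀ X E := by
  have hE : ∀ {j c S}, Entry rel a b kk s j c S → Entry rel a b kk s' j c S := by
    rintro j c S ⟨h1, h2, h3, h4, h5⟩
    exact ⟨by rw [he 31 (by simp)]; exact h1, by rw [he 26 (by simp), he 27 (by simp)]; exact h2,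
      by rw [he 28 (by simp), he 29 (by simp), he 31 (by simp)]; exact h3, h4, h5⟩
  obtain ⟨hO, G, hi, hhi, hmd, hG, hnd, hdone⟩ := h
  rw [Progress, he 30 (by simp), he 34 (by simp)]
  exact ⟨fun x h1 h2 => hE (hO x h1 h2), G, hi, hhi, hmd, fun x h1 h2 => hE (hG x h1 h2), hnd, hdone⟩

/-- At most `M` entries have two extensions each, and each extension is compared with at most `M`
new entries on `b` clients. This accounts for `(M + 1) ^ 2 * (b + 1)`. -/
theorem ends_dpLevel {rel : ℕ → ℕ → Prop} {a b kk M j : ℕ} {s : State} (hb : 0 < b)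
    (hc : DPCtx I rel a b kk s) (hM : FrontBound rel a b kk M) (hja : j < a)
    (hJ : s.nat dJ 0 = j) (hL : Level rel a b kk M s j) :
    Ends I ε dpLevel s (600 * ((M + 1) ^ 2 * (b + 1))) fun s' => Level rel a b kk M s' (j + 1) := by
  obtain ⟨G₀, lo, md, hlo, hmd, hle, hM', hE, hC⟩ := hL
  set K := (M + 1) * (b + 1) with hK
  have hK2 : (M + 1) ^ 2 * (b + 1) = (M + 1) * K := by rw [hK]; ring
  have hK1 : 1 ≤ K := Nat.mul_pos (by omega) (by omega)
  rw [hK2]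
  refine Ends.step (n' := 600 * ((M + 1) * K) - 4) rfl (Ends.seq
    (R := fun s' => Progress rel a b kk s' j lo md G₀ md 0 ∧ s'.nat nMd 0 = md)
    (n := M * (K * 520) + 30) (n' := 10)
    ((Ends.forUp (k := 400 * K + 90) (a := lo) (b := md)
      (fun x s' => Progress rel a b kk s' j lo md G₀ x 0) (by simp [hlo]) hle rfl
      ?_ ?_ ?_ ?_).post ?_) ?_ ?_) ?_
  · intro s' hf
    have e : s'.nat nMd = _ := hf.nat _ rfl
    simp [e, hmd]
  · refine Progress.congr (s := s) ⟨hE, fun _ => ∅, md, hmd, le_rfl, fun y h1 h2 => by omega,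
      fun x y h1 h2 h3 => by omega, fun x h1 h2 e he h3 => by omega⟩ ?_
    rintro A (rfl | rfl | rfl | rfl | rfl | rfl | rfl) <;> simp
  · rintro x s1 hx1 hx2 hf1 hxx hP
    have k1 : s1.nat dJ = _ := hf1.nat _ rfl
    have k2 : s1.nat nMd = _ := hf1.nat _ rfl
    simp only [Program.run, State.nat_setNat_ne, State.nat_setNat_same, NatExpr.eval, ne_eq,
      Nat.reduceEqDiff, not_false_eq_true] at k1 k2
    have hc1' : DPCtx I rel a b kk s1 := by
      have e := fun A (h : A ≠ 33) => State.nat_setNat_ne s 0 (s.nat nHi 0) h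
      refine ⟨?_, ?_, ?_, ?_, ?_⟩
      · rw [hf1.nat nA rfl]; simpa using hc.hA
      · rw [hf1.nat nB rfl]; simpa using hc.hB
      · rw [hf1.nat nKK rfl]; simpa using hc.hK
      · rw [← hc.rel_eq]
        refine relOf_congr ?_ ?_ ?_
        · rw [hf1.nat aLC rfl]; simp
        · rw [hf1.nat aLF rfl]; simp
        · rw [hf1.real rT rfl]; simp
      · rw [hf1.nat aLast rfl]; simpa using hc.last
    refine Ends.step (n' := 400 * K + 80) rfl ((Ends.forUp (k := 200 * K) (a := 0) (b := 2)
      (fun e s2 => Progress rel a b kk s2 j lo md G₀ x e ∧ s2.nat dNode 0 = s2.nat aLst x)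
      rfl (by omega) rfl (fun _ _ => rfl) ?_ ?_ ?_).post ?_) ?_
    · refine ⟨hP.congr ?_, ?_⟩
      · rintro A (rfl | rfl | rfl | rfl | rfl | rfl | rfl) <;> simp
      · simp [hxx]
    · rintro e s2 - he hf2 hee ⟨hP2, hN2⟩
      have j1 : s2.nat dJ = _ := hf2.nat _ rfl
      have j2 : s2.nat nMd = _ := hf2.nat _ rfl
      simp only [Program.run, State.nat_setNat_ne, NatExpr.eval, ne_eq,
        Nat.reduceEqDiff, not_false_eq_true] at j1 j2
      have hc2 : DPCtx I rel a b kk s2 := by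
        refine ⟨?_, ?_, ?_, ?_, ?_⟩
        · rw [hf2.nat nA rfl]; simpa using hc1'.hA
        · rw [hf2.nat nB rfl]; simpa using hc1'.hB
        · rw [hf2.nat nKK rfl]; simpa using hc1'.hK
        · rw [← hc1'.rel_eq]
          refine relOf_congr ?_ ?_ ?_
          · rw [hf2.nat aLC rfl]; simp
          · rw [hf2.nat aLF rfl]; simp
          · rw [hf2.real rT rfl]; simp
        · rw [hf2.nat aLast rfl]; simpa using hc1'.last
      refine (ends_dpStep hb hc2 hM hja (by rw [j1, k1, hJ]) hee he
        (by rw [j2, k2]; simp [hmd]) hx1 hx2 hN2 hP2).post ?_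
      rintro s3 hf3 ⟨hP3, hl3⟩
      have i1 : s3.nat dNode = _ := hf3.nat _ rfl
      refine ⟨hP3.congr ?_, ?_⟩
      · rintro A (rfl | rfl | rfl | rfl | rfl | rfl | rfl) <;> simp
      · simp [i1, hl3, hN2]
    · simp; omega
    · rintro s2 - ⟨⟨⟨hO, G, hi, h1, h2, h3, h4, h5⟩, -⟩, -⟩
      refine Progress.congr (s := s2) ⟨hO, G, hi, h1, h2, h3, h4,
        fun z hz1 hz2 e he hze => h5 z hz1 hz2 e he (by omega)⟩ ?_
      rintro A (rfl | rfl | rfl | rfl | rfl | rfl | rfl) <;> simp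
    · simp; omega
  · have h2 : (md - lo) * (400 * K + 102) ≤ M * (400 * K + 102) := Nat.mul_le_mul hM' le_rfl
    have h3 : M * (400 * K + 102) ≤ M * (K * 520) := Nat.mul_le_mul le_rfl (by omega)
    have h4 : 400 * K + 90 + 2 + 10 = 400 * K + 102 := by omega
    simp only [NatExpr.steps, h4]
    linarith
  · rintro s' hf ⟨h, -⟩
    refine ⟨h, ?_⟩
    have : s'.nat nMd = _ := hf.nat _ rfl
    simp [this, hmd]
  · rintro s1 hf1 ⟨⟨hO, G, hi, h1, h2, h3, h4, h5⟩, hmd1⟩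
    refine Ends.straight rfl (by simp) ?_
    refine ⟨G, md, hi, by simp [hmd1], by simp [h1], h2, front_le hM hja h3 h4, ?_,
      Complete.next hja hC (fun x hx1 hx2 => (hE x hx1 hx2).built.subset)
        fun x hx1 hx2 e he => h5 x hx1 hx2 e he (.inl hx2)⟩
    intro x hx1 hx2
    obtain ⟨g1, g2, g3, g4, g5⟩ := h3 x hx1 hx2
    exact ⟨by simpa using g1, by simpa using g2, by simpa using g3, g4, g5⟩
  · have : (M + 1) * K = M * K + K := by ring
    have h3 : M * (K * 520) = 520 * (M * K) := by ring
    omega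
  · simp
    have : 1 ≤ (M + 1) * K := Nat.mul_pos (by omega) hK1
    omega

/-- The items of the partial solution `dNode` are written to the output list. -/
def dpRecover : Program :=
  assign dNode (.get aLst (.var nLo)) ;; assign nBL (.lit 0) ;;
  forUp dX (.lit 0) (.var nA)
    (assign dJ (.sub (.sub (.var nA) (.var dX)) (.lit 1)) ;;
      .cond (.natLt (.lit 0) (.get aBit (.var dNode)))
        (.setNat aBL (.var nBL) (.get aLF (.var dJ)) ;; assign nBL (.add (.var nBL) (.lit 1)) ;;
          assign dNode (.get aPar (.var dNode)))
        (assign dNode (.get aPar (.var dNode))))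

/-- Every decision, also the one against an item, created a node. The path of parents therefore has
exactly `a` edges and is followed from item `a - 1` down to item `0`. -/
theorem ends_dpRecover {s : State} {a c F : ℕ} {S : Finset ℕ} (hA : s.nat nA 0 = a)
    (hc : s.nat aLst (s.nat nLo 0) = c) (hB : Built (s.nat aPar) (s.nat aBit) F a c S) :
    Ends I ε dpRecover s (a * 80 + 40) fun s' => s'.nat nBL 0 = S.card ∧
      (∀ z < s'.nat nBL 0, ∃ i < a, s'.nat aBL z = s.nat aLF i) ∧
      ∀ i ∈ S, ∃ z < s'.nat nBL 0, s'.nat aBL z = s.nat aLF i := by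
  refine Ends.step (n' := a * 80 + 30) rfl (Ends.step (n' := a * 80 + 20) rfl
    ((Ends.forUp (k := 60) (a := 0) (b := a) (fun x s' => ∃ S',
      Built (s.nat aPar) (s.nat aBit) F (a - x) (s'.nat dNode 0) S' ∧
      s'.nat nBL 0 + S'.card = S.card ∧
      (∀ z < s'.nat nBL 0, ∃ i < a, s'.nat aBL z = s.nat aLF i) ∧
      ∀ i ∈ S, i ∈ S' ∨ ∃ z < s'.nat nBL 0, s'.nat aBL z = s.nat aLF i)
      rfl (Nat.zero_le _) rfl ?_ ?_ ?_ ?_).post ?_) ?_) ?_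
  · intro s' hf
    have : s'.nat nA = _ := hf.nat _ rfl
    simp [this, hA]
  · refine ⟨S, ?_, by simp, by simp, fun i hi => .inl hi⟩
    simpa [hc] using hB
  · rintro x s1 - hx hf hxx ⟨S', h1, h2, h3, h4⟩
    have k1 : s1.nat nA = _ := hf.nat _ rfl
    have k2 : s1.nat aBit = _ := hf.nat _ rfl
    have k3 : s1.nat aPar = _ := hf.nat _ rfl
    have k4 : s1.nat aLF = _ := hf.nat _ rfl
    simp at k1 k2 k3 k4
    rw [show a - x = (a - (x + 1)) + 1 by omega] at h1
    obtain ⟨g1, g2, T, g3, g4⟩ := h1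
    have hcard := card_ext (e := s.nat aBit (s1.nat dNode 0)) g3.subset g2
    rw [← g4] at hcard
    refine Ends.step (n' := 40) rfl (Ends.cond (n := 30) (fun hb => Ends.straight rfl (by simp) ?_)
      (fun hb => Ends.straight rfl (by simp) ?_) (by simp)) (by simp) <;> simp [k2] at hb
    · have he : s.nat aBit (s1.nat dNode 0) = 1 := by omega
      rw [he] at g4 hcard
      refine ⟨T, by simpa [k3] using g3, by simp; omega, fun z hz => ?_, fun i hi => ?_⟩
      · simp at hz
        by_cases hzn : z = s1.nat nBL 0
        · refine ⟨a - x - 1, by omega, ?_⟩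
          simp [hzn, k4, k1, hA, hxx]
        · obtain ⟨i, hi, hi'⟩ := h3 z (by omega)
          exact ⟨i, hi, by simp [Function.update_of_ne hzn, hi']⟩
      · rcases h4 i hi with h | ⟨z, hz, hz'⟩
        · rw [g4] at h
          simp only [ext, if_true, Finset.mem_insert] at h
          rcases h with h | h
          · refine .inr ⟨s1.nat nBL 0, by simp, ?_⟩
            simp [k4, k1, hA, hxx, h, Nat.sub_sub]
          · exact .inl h
        · refine .inr ⟨z, by simp; omega, ?_⟩
          simp [Function.update_of_ne hz.ne, hz']
    · rw [hb] at g4 hcard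
      refine ⟨T, by simpa [k3] using g3, by simp; omega, fun z hz => ?_, fun i hi => ?_⟩
      · simp at hz
        simpa using h3 z hz
      · rcases h4 i hi with h | ⟨z, hz, hz'⟩
        · rw [g4] at h
          exact .inl (by simpa [ext] using h)
        · exact .inr ⟨z, by simpa using hz, by simpa using hz'⟩
  · simp; omega
  · rintro s1 - ⟨⟨S', h1, h2, h3, h4⟩, -⟩
    simp only [Nat.sub_self] at h1
    have hS' := h1.2
    subst hS'
    refine ⟨by simpa using h2, h3, fun i hi => ?_⟩
    rcases h4 i hi with h | h
    · simp at h
    · exact h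
  · simp; omega
  · simp; omega

/-- Decides whether `nKK` of the items in `aLF` suffice to cover the clients in `aLC` within
distance `rT`; if so, such items are written to `aBL`. -/
def dp : Program :=
  dpInit ;; forUp dJ (.lit 0) (.var nA) dpLevel ;;
  .cond (.natLt (.var nLo) (.var nHi)) (assign nFound (.lit 1) ;; dpRecover) (assign nFound (.lit 0))

/-- After the last item, viability of an entry means that it is a cover. Conversely, a cover with at
most `kk` items forces the last list to be nonempty, by `Complete`. Positivity of `a` is needed
because entries before the first decision are not tested for viability. -/
theorem ends_dp {a b kk M : ℕ} {s : State} (ha : 0 < a) (hb : 0 < b) (hM1 : 1 ≤ M) (hA : s.nat nA 0 = a)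
    (hB : s.nat nB 0 = b) (hK : s.nat nKK 0 = kk) (hM : FrontBound (relOf I s) a b kk M) :
    Ends I ε dp s (1000 * ((a + 1) * (b + 1) * (M + 1) ^ 2)) fun s' =>
      (s'.nat nFound 0 = 1 ∧ s'.nat nBL 0 ≤ kk ∧
        (∀ z < s'.nat nBL 0, ∃ i < a, s'.nat aBL z = s.nat aLF i) ∧
        ∀ q < b, ∃ z < s'.nat nBL 0,
          dist (I.point (s.nat aLC q)) (I.point (s'.nat aBL z)) ≤ s.real rT 0) ∨
      (s'.nat nFound 0 = 0 ∧ s'.nat nBL = s.nat nBL ∧ s'.nat aBL = s.nat aBL ∧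
        ¬ ∃ T ⊆ Finset.range a, T.card ≤ kk ∧ Covers (relOf I s) b T) := by
  set rel := relOf I s with hrel
  have hK2 : (b + 1) ≤ (M + 1) ^ 2 * (b + 1) := Nat.le_mul_of_pos_left _ (by positivity)
  set K := (M + 1) ^ 2 * (b + 1) with hKdef
  have ht : (a + 1) * (b + 1) * (M + 1) ^ 2 = a * K + K := by rw [hKdef]; ring
  have ht2 : (a + 1) * (b + 1) ≤ a * K + K := by
    rw [← ht]; exact Nat.le_mul_of_pos_right _ (by positivity)
  rw [ht]
  refine Ends.seq (ends_dpInit hA hB hb) (n' := 800 * (a * K + K)) ?_ (by omega)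
  rintro s1 hf1 ⟨h1, h2, h3, h4, h5, h6⟩
  have hc1 : DPCtx I rel a b kk s1 := by
    refine ⟨by rw [hf1.nat nA rfl, hA], by rw [hf1.nat nB rfl, hB], by rw [hf1.nat nKK rfl, hK],
      relOf_congr (hf1.nat _ rfl) (hf1.nat _ rfl) (hf1.real _ rfl), h1⟩
  refine Ends.seq (R := fun s' => Level rel a b kk M s' a) (n := a * (600 * K + 15) + 20)
    (n' := a * 80 + 80) ((Ends.forUp (k := 600 * K) (a := 0) (b := a)
      (fun j s' => Level rel a b kk M s' j) rfl (Nat.zero_le _) rfl ?_ ?_ ?_ ?_).post ?_) ?_ ?_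
  · intro s' hf
    have : s'.nat nA = _ := hf.nat _ rfl
    simp [this, hc1.hA]
  · refine ⟨fun _ => ∅, 0, 1, by simp [h5], by simp [h6], by omega, by omega, fun x hx1 hx2 => ?_, ?_⟩
    · obtain rfl : x = 0 := by omega
      simp only [State.nat_setNat_ne, ne_eq, Nat.reduceEqDiff, not_false_eq_true, h4]
      exact ⟨by simp [h3], by simpa using h2, ⟨by simpa [h3] using hb, rfl⟩, by simp,
        fun h => absurd h (by omega)⟩
    · intro T hT hTk hTc
      exact ⟨0, le_rfl, by omega, by simp, by simpa using hTc⟩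
  · rintro j s2 - hj hf2 hjj hL
    refine (ends_dpLevel hb (hc1.frame hf2 rfl rfl) hM hj hjj hL).post ?_
    rintro s3 - ⟨G, lo, hi, g1, g2, g3, g4, g5, g6⟩
    refine ⟨G, lo, hi, by simp [g1], by simp [g2], g3, g4, fun x hx1 hx2 => ?_, g6⟩
    obtain ⟨i1, i2, i3, i4, i5⟩ := g5 x hx1 hx2
    exact ⟨by simpa using i1, by simpa using i2, by simpa using i3, i4, i5⟩
  · simp
    have := Nat.mul_le_mul_left a (show 600 * K + 2 + 10 ≤ 600 * K + 15 by omega)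
    omega
  · rintro s2 - ⟨h, -⟩; exact h
  · rintro s2 hf2 ⟨G, lo, hi, g1, g2, g3, g4, g5, g6⟩
    have hc2 := hc1.frame hf2 rfl rfl
    have kLF : s2.nat aLF = s.nat aLF := by rw [hf2.nat aLF rfl, hf1.nat aLF rfl]
    have kLC : s2.nat aLC = s.nat aLC := by rw [hf2.nat aLC rfl, hf1.nat aLC rfl]
    refine Ends.cond (n := a * 80 + 60) (fun hb2 => ?_) (fun hb2 => ?_) (by simp; omega)
    · simp [g1, g2] at hb2
      have hE := g5 lo le_rfl hb2
      refine Ends.step (n' := a * 80 + 40) rfl ((ends_dpRecover (a := a) (c := s2.nat aLst lo)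
        (F := s2.nat nFree 0) (S := G lo) (by simpa using hc2.hA) (by simp [g1])
        (by simpa using hE.built)).post ?_) (by simp; omega)
      rintro s3 hf3 ⟨i1, i2, i3⟩
      refine .inl ⟨?_, by rw [i1]; exact hE.card, ?_, fun q hq => ?_⟩
      · have : s3.nat nFound = _ := hf3.nat _ rfl
        simp [this]
      · simpa [kLF] using i2
      · obtain ⟨i, hi1 | hi1, hi2⟩ := hE.viable ha q hq
        · obtain ⟨z, hz1, hz2⟩ := i3 i hi1
          refine ⟨z, hz1, ?_⟩
          rw [hz2]
          simp only [Program.run, State.nat_setNat_ne, ne_eq, Nat.reduceEqDiff, not_false_eq_true,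
            kLF]
          exact hi2
        · omega
    · simp [g1, g2] at hb2
      refine Ends.straight rfl (by simp) (.inr ⟨by simp, ?_, ?_, ?_⟩)
      · simp; rw [hf2.nat nBL rfl, hf1.nat nBL rfl]
      · simp; rw [hf2.nat aBL rfl, hf1.nat aBL rfl]
      · rintro ⟨T, hT, hTk, hTc⟩
        obtain ⟨x, hx1, hx2, -⟩ := g6 T hT hTk hTc
        omega
  · have : 1 ≤ K := by omega
    have h3 : a * (600 * K + 15) = 600 * (a * K) + 15 * a := by ring
    have h4 : a ≤ a * K := Nat.le_mul_of_pos_right _ this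
    omega

end RealRAM

/-! ### Patterns: a side with few points induces few types of points on the other side -/


namespace RealRAM

variable {I : KSupplier} {ε : ℝ}

notation "sOL" => (50 : ℕ)
notation "sOS" => (51 : ℕ)
notation "sNL" => (52 : ℕ)
notation "sNS" => (53 : ℕ)
notation "sOr" => (54 : ℕ)
notation "aPI" => (55 : ℕ)
notation "aPS" => (56 : ℕ)
notation "nPX" => (57 : ℕ)
notation "aBS" => (58 : ℕ)
notation "aCD" => (59 : ℕ)
notation "aPw" => (60 : ℕ)
notation "aPerm" => (61 : ℕ)
notation "aDyn" => (62 : ℕ)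
notation "aMk" => (63 : ℕ)
notation "nPat" => (64 : ℕ)
notation "sZ" => (65 : ℕ)
notation "aRep" => (66 : ℕ)
notation "nRep" => (67 : ℕ)
notation "aQI" => (68 : ℕ)
notation "aQS" => (69 : ℕ)
notation "nQX" => (70 : ℕ)
notation "sI" => (71 : ℕ)
notation "sJ" => (72 : ℕ)

/-! ### Patterns as binary numbers -/

open Classical in
/-- The set of the numbers `j < n` with `p j`, as a binary number. -/
noncomputable def code (p : ℕ → Prop) (n : ℕ) : ℕ := ∑ j ∈ (Finset.range n).filter p, 2 ^ j

theorem code_congr {p p' : ℕ → Prop} {n : ℕ} (h : ∀ j < n, (p j ↔ p' j)) : code p n = code p' n := by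
  classical
  unfold code
  rw [Finset.filter_congr fun j hj => h j (Finset.mem_range.1 hj)]

theorem code_lt (p : ℕ → Prop) (n : ℕ) : code p n < 2 ^ n := by
  classical
  unfold code
  have h := Nat.geomSum_lt (m := 2) (n := n) (s := (Finset.range n).filter p) le_rfl
    fun k hk => by simpa using (Finset.mem_filter.1 hk).1
  exact h

theorem code_inj {p p' : ℕ → Prop} {n : ℕ} (h : code p n = code p' n) {j : ℕ} (hj : j < n) :
    p j ↔ p' j := by
  classical
  have := Finset.geomSum_injective (n := 2) le_rfl h
  have h1 := Finset.ext_iff.1 this j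
  simpa [hj] using h1

theorem code_false {p : ℕ → Prop} {n : ℕ} (h : ∀ j < n, ¬ p j) : code p n = 0 := by
  classical
  unfold code
  rw [Finset.filter_false_of_mem fun j hj => h j (Finset.mem_range.1 hj), Finset.sum_empty]

/-- Setting a bit that was not set adds a power of two. Codes can thus be maintained with additions
and a table of powers. -/
theorem code_add {p p' : ℕ → Prop} {n j : ℕ} (hj : j < n) (hp : ¬ p j)
    (h : ∀ i < n, (p' i ↔ p i ∨ i = j)) : code p' n = code p n + 2 ^ j := by
  classical
  unfold code
  have : (Finset.range n).filter p' = insert j ((Finset.range n).filter p) := by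
    ext i
    simp only [Finset.mem_filter, Finset.mem_range, Finset.mem_insert]
    constructor
    · rintro ⟨h1, h2⟩
      rcases (h i h1).1 h2 with h2 | h2
      · exact .inr ⟨h1, h2⟩
      · exact .inl h2
    · rintro (rfl | ⟨h1, h2⟩)
      · exact ⟨hj, (h _ hj).2 (.inr rfl)⟩
      · exact ⟨h1, (h _ h1).2 (.inl h2)⟩
  rw [this, Finset.sum_insert (by simp [hp]), add_comm]

/-! ### Pairs with undecided distances -/

/-- The pairs `(x z, y z)`, `z < n`, are those that satisfy `R`, each listed once. -/
def Enumerates (R : ℕ → ℕ → Prop) (n : ℕ) (x y : ℕ → ℕ) : Prop :=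
  (∀ z < n, R (x z) (y z)) ∧ (∀ i j, R i j → ∃ z < n, x z = i ∧ y z = j) ∧
    ∀ z < n, ∀ z' < n, x z = x z' → y z = y z' → z = z'

/-- The point on the long side of the current pair. -/
abbrev eI : NatExpr := .get aPI (.var sZ)

/-- The point on the short side of the current pair. -/
abbrev eJ : NatExpr := .get aPS (.var sZ)

/-- The distance of the current pair. -/
abbrev eD : RealExpr := .dist (.add (.var sOL) eI) (.add (.var sOS) eJ)

/-- The distance of a point on the long side to a point on the short side. -/
noncomputable def sdist (I : KSupplier) (s : State) (i j : ℕ) : ℝ :=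
  dist (I.point (s.nat sOL 0 + i)) (I.point (s.nat sOS 0 + j))

theorem sdist_congr {s s' : State} (h1 : s'.nat sOL = s.nat sOL) (h2 : s'.nat sOS = s.nat sOS) :
    sdist I s' = sdist I s := by
  funext i j; simp [sdist, h1, h2]

/-- The distances of the pairs, and a copy of the codes of their points. -/
def sValues : Program :=
  forUp sZ (.lit 0) (.var nPX) (.setReal aV (.var sZ) eD ;; .setNat aCD eI (.get aBS eI)) ;;
  assign nX (.var nPX)

theorem ends_sValues {s : State} {X : ℕ} (hX : s.nat nPX 0 = X) :
    Ends I ε sValues s (X * 60 + 30) fun s' =>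
      (∀ z < X, s'.real aV z = sdist I s (s.nat aPI z) (s.nat aPS z)) ∧
      (∀ z < X, s'.nat aCD (s.nat aPI z) = s.nat aBS (s.nat aPI z)) ∧ s'.nat nX 0 = X := by
  refine Ends.seq (n := X * 60 + 25) (n' := 5) ((Ends.forUp (k := 40) (a := 0) (b := X)
    (fun z s' => (∀ y < z, s'.real aV y = sdist I s (s.nat aPI y) (s.nat aPS y)) ∧
      (∀ y < z, s'.nat aCD (s.nat aPI y) = s.nat aBS (s.nat aPI y)))
    rfl (Nat.zero_le _) rfl ?_ ?_ ?_ ?_)) ?_ le_rfl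
  · intro s' hf
    have e : s'.nat nPX = _ := hf.nat _ rfl
    simp [e, hX]
  · exact ⟨fun y hy => absurd hy (by omega), fun y hy => absurd hy (by omega)⟩
  · rintro z s' - hz hf hzz ⟨h1, h2⟩
    have f1 : s'.nat aPI = _ := hf.nat _ rfl
    have f2 : s'.nat aPS = _ := hf.nat _ rfl
    have f3 : s'.nat aBS = _ := hf.nat _ rfl
    have f4 : s'.nat sOL = _ := hf.nat _ rfl
    have f5 : s'.nat sOS = _ := hf.nat _ rfl
    refine Ends.straight rfl (by simp) ⟨fun y hy => ?_, fun y hy => ?_⟩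
    · by_cases hyz : y = z
      · subst hyz; simp [hzz, f1, f2, f4, f5, sdist]
      · simp [hzz, Function.update_of_ne hyz, h1 y (by omega)]
    · simp only [Program.run, State.nat_setNat_ne, State.nat_setNat_same, NatExpr.eval, ne_eq,
        Nat.reduceEqDiff, not_false_eq_true, State.nat_setReal, hzz, f1, f3]
      by_cases hyz : s.nat aPI y = s.nat aPI z
      · rw [hyz, Function.update_self]
      · rw [Function.update_of_ne hyz]
        exact h2 y (by
          rcases Nat.lt_succ_iff_lt_or_eq.1 hy with h | h
          · exact h
          · exact absurd (by rw [h]) hyz)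
  · simp; omega
  · rintro s1 hf ⟨⟨h1, h2⟩, -⟩
    have f1 : s1.nat nPX = _ := hf.nat _ rfl
    exact Ends.straight rfl (by simp) ⟨by simpa using h1, by simpa using h2, by simp [f1, hX]⟩

/-- The codes at the threshold `rT`. -/
def sCodes : Program :=
  forUp sZ (.lit 0) (.var nPX)
    (.cond (.realLe eD (.var rT)) (.setNat aCD eI (.add (.get aCD eI) (.get aPw eJ))) .skip)

/-- The codes start from the threshold `lo`, and each remaining pair within `rT` adds its bit. No
bit is added twice, since remaining pairs have distance greater than `lo` and each of them is listed
once. -/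
theorem ends_sCodes {s : State} {X m : ℕ} {lo : ℝ} {R : ℕ → ℕ → Prop} (hX : s.nat nPX 0 = X)
    (hE : Enumerates R X (s.nat aPI) (s.nat aPS)) (hP : ∀ j < m, s.nat aPw j = 2 ^ j)
    (hR : ∀ i j, R i j → j < m ∧ lo < sdist I s i j)
    (hC : ∀ z < X, s.nat aCD (s.nat aPI z) = code (fun j => sdist I s (s.nat aPI z) j ≤ lo) m) :
    Ends I ε sCodes s (X * 60 + 30) fun s' => ∀ z < X, s'.nat aCD (s.nat aPI z) =
      code (fun j => sdist I s (s.nat aPI z) j ≤ lo ∨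
        R (s.nat aPI z) j ∧ sdist I s (s.nat aPI z) j ≤ s.real rT 0) m := by
  obtain ⟨hE1, hE2, hE3⟩ := hE
  refine ((Ends.forUp (k := 40) (a := 0) (b := X)
    (fun z s' => ∀ y < X, s'.nat aCD (s.nat aPI y) =
      code (fun j => sdist I s (s.nat aPI y) j ≤ lo ∨ (∃ x < z, s.nat aPI x = s.nat aPI y ∧
        s.nat aPS x = j) ∧ sdist I s (s.nat aPI y) j ≤ s.real rT 0) m)
    rfl (Nat.zero_le _) rfl ?_ ?_ ?_ ?_)).post ?_
  · intro s' hf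
    have e : s'.nat nPX = _ := hf.nat _ rfl
    simp [e, hX]
  · intro y hy
    simpa using hC y hy
  · rintro z s' - hz hf hzz h
    have f1 : s'.nat aPI = _ := hf.nat _ rfl
    have f2 : s'.nat aPS = _ := hf.nat _ rfl
    have f3 : s'.nat aPw = _ := hf.nat _ rfl
    have f4 : s'.nat sOL = _ := hf.nat _ rfl
    have f5 : s'.nat sOS = _ := hf.nat _ rfl
    have f6 : s'.real rT = _ := hf.real _ rfl
    obtain ⟨hjm, hjl⟩ := hR _ _ (hE1 z hz)
    refine Ends.straight rfl (by simp) fun y hy => ?_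
    simp only [Program.run]
    split_ifs with hc <;> simp only [Test.Holds, NatExpr.eval, RealExpr.eval, hzz, f1, f2, f4, f5,
      f6, not_lt, not_le] at hc
    · simp only [State.nat_setNat_ne, State.nat_setNat_same, NatExpr.eval, ne_eq,
        Nat.reduceEqDiff, not_false_eq_true, hzz, f1, f2, f3]
      by_cases hyz : s.nat aPI y = s.nat aPI z
      · rw [hyz, Function.update_self, h z hz, hP _ hjm]
        refine (code_add hjm ?_ fun j hj => ?_).symm
        · rintro (h1 | ⟨⟨x, hx, hx1, hx2⟩, -⟩)
          · exact absurd h1 (not_le.2 hjl)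
          · exact absurd (hE3 x (by omega) z hz hx1 hx2) (by omega)
        · constructor
          · rintro (h1 | ⟨⟨x, hx, hx1, hx2⟩, h2⟩)
            · exact .inl (.inl h1)
            · rcases Nat.lt_succ_iff_lt_or_eq.1 hx with hx | rfl
              · exact .inl (.inr ⟨⟨x, hx, hx1, hx2⟩, h2⟩)
              · exact .inr hx2.symm
          · rintro ((h1 | ⟨⟨x, hx, hx1, hx2⟩, h2⟩) | rfl)
            · exact .inl h1
            · exact .inr ⟨⟨x, by omega, hx1, hx2⟩, h2⟩
            · exact .inr ⟨⟨z, by omega, rfl, rfl⟩, hc⟩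
      · rw [Function.update_of_ne hyz, h y hy]
        refine code_congr fun j hj => or_congr_right (and_congr_left fun _ => ?_)
        constructor
        · rintro ⟨x, hx, hx1, hx2⟩; exact ⟨x, by omega, hx1, hx2⟩
        · rintro ⟨x, hx, hx1, hx2⟩
          refine ⟨x, ?_, hx1, hx2⟩
          rcases Nat.lt_succ_iff_lt_or_eq.1 hx with hx | rfl
          · exact hx
          · exact absurd hx1.symm hyz
    · simp only [State.nat_setNat_ne, ne_eq, Nat.reduceEqDiff, not_false_eq_true, h y hy]
      refine code_congr fun j hj => or_congr_right ?_
      constructor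
      · rintro ⟨⟨x, hx, hx1, hx2⟩, h2⟩; exact ⟨⟨x, by omega, hx1, hx2⟩, h2⟩
      · rintro ⟨⟨x, hx, hx1, hx2⟩, h2⟩
        refine ⟨⟨x, ?_, hx1, hx2⟩, h2⟩
        rcases Nat.lt_succ_iff_lt_or_eq.1 hx with hx | rfl
        · exact hx
        · rw [← hx1, ← hx2] at h2
          exact absurd h2 (not_le.2 hc)
  · simp; omega
  · rintro s' - ⟨h, -⟩ z hz
    rw [h z hz]
    refine code_congr fun j hj => or_congr_right (and_congr_left fun _ => ?_)
    constructor
    · rintro ⟨x, hx, hx1, hx2⟩; rw [← hx1, ← hx2]; exact hE1 x hx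
    · exact fun hr => hE2 _ _ hr

/-- A table of the codes that occur in pairs. -/
def sTable : Program :=
  forUp sZ (.lit 0) (.var nPat) (.setNat aDyn (.var sZ) (.lit 0)) ;;
  forUp sZ (.lit 0) (.var nPX) (.setNat aDyn (.get aCD eI) (.add eI (.lit 1)))

/-- A point `i` is entered as `i + 1`, so that `0` means an empty cell. If several points have the
same code the last one stays, and any of them would do. -/
theorem ends_sTable {s : State} {X W : ℕ} (hX : s.nat nPX 0 = X) (hW : s.nat nPat 0 = W) :
    Ends I ε sTable s (X * 40 + W * 40 + 60) fun s' =>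
      (∀ z < X, s'.nat aDyn (s.nat aCD (s.nat aPI z)) ≠ 0) ∧
      ∀ c < W, s'.nat aDyn c ≠ 0 →
        ∃ z < X, s'.nat aDyn c = s.nat aPI z + 1 ∧ s.nat aCD (s.nat aPI z) = c := by
  refine Ends.seq (n := W * 40 + 30) (n' := X * 40 + 30) (Ends.forUp (k := 20) (a := 0) (b := W)
    (fun z s' => ∀ c < z, s'.nat aDyn c = 0) rfl (Nat.zero_le _) rfl ?_ ?_ ?_ ?_) ?_ (by omega)
  · intro s' hf
    have e : s'.nat nPat = _ := hf.nat _ rfl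
    simp [e, hW]
  · intro c hc; omega
  · rintro z s' - hz hf hzz h
    refine Ends.straight rfl (by simp) fun c hc => ?_
    by_cases hcz : c = z
    · simp [hcz, hzz]
    · simp [hzz, Function.update_of_ne hcz, h c (by omega)]
  · simp; omega
  · rintro s1 hf1 ⟨h1, -⟩
    have g1 : s1.nat nPX = _ := hf1.nat _ rfl
    have g2 : s1.nat aCD = _ := hf1.nat _ rfl
    have g3 : s1.nat aPI = _ := hf1.nat _ rfl
    refine (Ends.forUp (k := 26) (a := 0) (b := X)
      (fun z s' => (∀ y < z, s'.nat aDyn (s.nat aCD (s.nat aPI y)) ≠ 0) ∧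
        ∀ c < W, s'.nat aDyn c ≠ 0 →
        ∃ y < X, s'.nat aDyn c = s.nat aPI y + 1 ∧ s.nat aCD (s.nat aPI y) = c)
      rfl (Nat.zero_le _) rfl ?_ ?_ ?_ ?_).post ?_
    · intro s' hf
      have e : s'.nat nPX = _ := hf.nat _ rfl
      simp [e, g1, hX]
    · exact ⟨fun y hy => absurd hy (by omega), fun c hc h => absurd (h1 c hc) (by simpa using h)⟩
    · rintro z s' - hz hf hzz ⟨i1, i2⟩
      have f2 : s'.nat aCD = _ := hf.nat _ rfl
      have f3 : s'.nat aPI = _ := hf.nat _ rfl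
      refine Ends.straight rfl (by simp) ?_
      simp only [Program.run, State.nat_setNat_ne, State.nat_setNat_same, NatExpr.eval, ne_eq,
        Nat.reduceEqDiff, not_false_eq_true, hzz, f2, f3, g2, g3]
      refine ⟨fun y hy => ?_, fun c hc hne => ?_⟩
      · by_cases hyz : s.nat aCD (s.nat aPI y) = s.nat aCD (s.nat aPI z)
        · rw [hyz, Function.update_self]; omega
        · rw [Function.update_of_ne hyz]
          refine i1 y ?_
          rcases Nat.lt_succ_iff_lt_or_eq.1 hy with hy | rfl
          · exact hy
          · exact absurd rfl hyz
      · by_cases hcz : c = s.nat aCD (s.nat aPI z)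
        · subst hcz
          exact ⟨z, hz, by rw [Function.update_self], rfl⟩
        · rw [Function.update_of_ne hcz] at hne ⊢
          exact i2 c hc hne
    · simp; omega
    · rintro s' - ⟨h, -⟩; exact h

/-- One representative for each code. -/
def sReps : Program :=
  assign nRep (.lit 0) ;;
  forUp sZ (.lit 0) (.var nPat)
    (.cond (.natLt (.lit 0) (.get aPerm (.var sZ)))
      (.setNat aRep (.var nRep) (.get aPerm (.var sZ)) ;; assign nRep (.add (.var nRep) (.lit 1)))
      (.cond (.natLt (.lit 0) (.get aDyn (.var sZ)))
        (.setNat aRep (.var nRep) (.get aDyn (.var sZ)) ;; assign nRep (.add (.var nRep) (.lit 1)))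
        .skip))

theorem ends_sReps {s : State} {W : ℕ} (hW : s.nat nPat 0 = W) :
    Ends I ε sReps s (W * 60 + 40) fun s' => s'.nat nRep 0 ≤ W ∧
      (∀ r < s'.nat nRep 0, s'.nat aRep r ≠ 0 ∧ ∃ c < W, (s.nat aPerm c ≠ 0 ∧
        s'.nat aRep r = s.nat aPerm c) ∨ s'.nat aRep r = s.nat aDyn c) ∧
      ∀ c < W, (s.nat aPerm c ≠ 0 → ∃ r < s'.nat nRep 0, s'.nat aRep r = s.nat aPerm c) ∧
        (s.nat aPerm c = 0 → s.nat aDyn c ≠ 0 →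
          ∃ r < s'.nat nRep 0, s'.nat aRep r = s.nat aDyn c) := by
  refine Ends.step (n' := W * 60 + 30) rfl ((Ends.forUp (k := 45) (a := 0) (b := W)
    (fun z s' => s'.nat nRep 0 ≤ z ∧
      (∀ r < s'.nat nRep 0, s'.nat aRep r ≠ 0 ∧ ∃ c < W, (s.nat aPerm c ≠ 0 ∧
        s'.nat aRep r = s.nat aPerm c) ∨ s'.nat aRep r = s.nat aDyn c) ∧
      ∀ c < z, (s.nat aPerm c ≠ 0 → ∃ r < s'.nat nRep 0, s'.nat aRep r = s.nat aPerm c) ∧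
        (s.nat aPerm c = 0 → s.nat aDyn c ≠ 0 →
          ∃ r < s'.nat nRep 0, s'.nat aRep r = s.nat aDyn c))
    rfl (Nat.zero_le _) rfl ?_ ?_ ?_ ?_).post ?_) (by simp; omega)
  · intro s' hf
    have e : s'.nat nPat = _ := hf.nat _ rfl
    simp [e, hW]
  · simp
  · rintro z s' - hz hf hzz ⟨h0, h1, h2⟩
    have f1 : s'.nat aPerm = _ := hf.nat _ rfl
    have f2 : s'.nat aDyn = _ := hf.nat _ rfl
    simp at f1 f2
    have hadd : ∀ v, v ≠ 0 → ((s.nat aPerm z ≠ 0 ∧ v = s.nat aPerm z) ∨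
          (s.nat aPerm z = 0 ∧ v = s.nat aDyn z)) →
        s'.nat nRep 0 + 1 ≤ z + 1 ∧
        (∀ r < s'.nat nRep 0 + 1, Function.update (s'.nat aRep) (s'.nat nRep 0) v r ≠ 0 ∧
          ∃ c < W, (s.nat aPerm c ≠ 0 ∧ Function.update (s'.nat aRep) (s'.nat nRep 0) v r =
            s.nat aPerm c) ∨ Function.update (s'.nat aRep) (s'.nat nRep 0) v r = s.nat aDyn c) ∧
        ∀ c < z + 1, (s.nat aPerm c ≠ 0 → ∃ r < s'.nat nRep 0 + 1,
            Function.update (s'.nat aRep) (s'.nat nRep 0) v r = s.nat aPerm c) ∧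
          (s.nat aPerm c = 0 → s.nat aDyn c ≠ 0 → ∃ r < s'.nat nRep 0 + 1,
            Function.update (s'.nat aRep) (s'.nat nRep 0) v r = s.nat aDyn c) := by
      intro v hv hv'
      refine ⟨by omega, fun r hr => ?_, fun c hc => ?_⟩
      · by_cases hrn : r = s'.nat nRep 0
        · rw [hrn, Function.update_self]
          exact ⟨hv, z, hz, hv'.imp id And.right⟩
        · rw [Function.update_of_ne hrn]; exact h1 r (by omega)
      · by_cases hcz : c = z
        · subst hcz
          refine ⟨fun hp => ⟨s'.nat nRep 0, by omega, ?_⟩, fun hp hd => ⟨s'.nat nRep 0, by omega, ?_⟩⟩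
          · rw [Function.update_self]; rcases hv' with h | h
            · exact h.2
            · exact absurd h.1 hp
          · rw [Function.update_self]; rcases hv' with h | h
            · exact absurd hp h.1
            · exact h.2
        · obtain ⟨k1, k2⟩ := h2 c (by omega)
          refine ⟨fun hp => ?_, fun hp hd => ?_⟩
          · obtain ⟨r, hr, hr'⟩ := k1 hp
            exact ⟨r, by omega, by rw [Function.update_of_ne hr.ne, hr']⟩
          · obtain ⟨r, hr, hr'⟩ := k2 hp hd
            exact ⟨r, by omega, by rw [Function.update_of_ne hr.ne, hr']⟩
    refine Ends.straight rfl (by simp) ?_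
    simp only [Program.run]
    split_ifs with hc hd <;> simp only [Test.Holds, NatExpr.eval, hzz, f1, f2, not_lt,
      Nat.le_zero] at hc
    · simpa [hzz, f1] using hadd _ (by omega) (.inl ⟨by omega, rfl⟩)
    · simp only [Test.Holds, NatExpr.eval, hzz, f1, f2] at hd
      simpa [hzz, f2] using hadd _ (by omega) (.inr ⟨by omega, rfl⟩)
    · simp only [Test.Holds, NatExpr.eval, hzz, f1, f2, not_lt, Nat.le_zero] at hd
      simp only [State.nat_setNat_ne, ne_eq, Nat.reduceEqDiff, not_false_eq_true]
      refine ⟨by omega, h1, fun c hc' => ?_⟩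
      by_cases hcz : c = z
      · subst hcz
        exact ⟨fun h => absurd hc h, fun _ h => absurd hd h⟩
      · exact h2 c (by omega)
  · simp; omega
  · rintro s' - ⟨h, -⟩; exact h

/-- The pairs that satisfy a test are copied. -/
def sFilter (b : Test) : Program :=
  assign nQX (.lit 0) ;;
  forUp sZ (.lit 0) (.var nPX)
    (.cond b (.setNat aQI (.var nQX) eI ;; .setNat aQS (.var nQX) eJ ;;
      assign nQX (.add (.var nQX) (.lit 1))) .skip)

/-- `P` describes the distances to be discarded. It is a predicate on reals so that the number of
discarded pairs is the `cnt` for which `ends_pivot` gives a lower bound; both directions of the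
bisection are instances. -/
theorem ends_sFilter {s : State} {X : ℕ} {R : ℕ → ℕ → Prop} {P : ℝ → Prop} {b : Test}
    (hX : s.nat nPX 0 = X) (hE : Enumerates R X (s.nat aPI) (s.nat aPS)) (hbs : b.steps ≤ 16)
    (hb : ∀ s' : State, s'.nat aPI = s.nat aPI → s'.nat aPS = s.nat aPS →
      s'.nat sOL = s.nat sOL → s'.nat sOS = s.nat sOS → s'.real rT = s.real rT →
      (b.Holds I ε s' ↔ ¬ P (sdist I s (s.nat aPI (s'.nat sZ 0)) (s.nat aPS (s'.nat sZ 0))))) :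
    Ends I ε (sFilter b) s (X * 60 + 40) fun s' =>
      Enumerates (fun i j => R i j ∧ ¬ P (sdist I s i j)) (s'.nat nQX 0) (s'.nat aQI) (s'.nat aQS) ∧
      s'.nat nQX 0 + cnt P (fun z => sdist I s (s.nat aPI z) (s.nat aPS z)) X = X := by
  obtain ⟨hE1, hE2, hE3⟩ := hE
  refine Ends.step (n' := X * 60 + 30) rfl ((Ends.forUp (k := 45) (a := 0) (b := X)
    (fun z s' => (∀ y < s'.nat nQX 0, ∃ x < z, s.nat aPI x = s'.nat aQI y ∧
        s.nat aPS x = s'.nat aQS y ∧ ¬ P (sdist I s (s'.nat aQI y) (s'.nat aQS y))) ∧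
      (∀ x < z, ¬ P (sdist I s (s.nat aPI x) (s.nat aPS x)) →
        ∃ y < s'.nat nQX 0, s'.nat aQI y = s.nat aPI x ∧ s'.nat aQS y = s.nat aPS x) ∧
      (∀ y < s'.nat nQX 0, ∀ y' < s'.nat nQX 0, s'.nat aQI y = s'.nat aQI y' →
        s'.nat aQS y = s'.nat aQS y' → y = y') ∧
      s'.nat nQX 0 + cnt P (fun z => sdist I s (s.nat aPI z) (s.nat aPS z)) z = z)
    rfl (Nat.zero_le _) rfl ?_ ?_ ?_ ?_).post ?_) (by simp; omega)
  · intro s' hf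
    have e : s'.nat nPX = _ := hf.nat _ rfl
    simp [e, hX]
  · simp [cnt_zero]
  · rintro z s' - hz hf hzz ⟨h1, h2, h3, h4⟩
    have f1 : s'.nat aPI = _ := hf.nat _ rfl
    have f2 : s'.nat aPS = _ := hf.nat _ rfl
    have f3 : s'.nat sOL = _ := hf.nat _ rfl
    have f4 : s'.nat sOS = _ := hf.nat _ rfl
    have f5 : s'.real rT = _ := hf.real _ rfl
    simp at f1 f2 f3 f4 f5
    have hb' := hb s' f1 f2 f3 f4 f5
    rw [hzz] at hb'
    have hcs := cnt_succ P (fun z => sdist I s (s.nat aPI z) (s.nat aPS z)) z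
    refine Ends.straight rfl (by simp; omega) ?_
    simp only [Program.run]
    split_ifs with hc <;> rw [hb'] at hc
    · rw [if_neg hc] at hcs
      simp only [State.nat_setNat_ne, State.nat_setNat_same, Function.update_self, NatExpr.eval, ne_eq,
        Nat.reduceEqDiff, not_false_eq_true, hzz, f1, f2]
      set N := s'.nat nQX 0 with hN
      refine ⟨fun y hy => ?_, fun x hx hxP => ?_, fun y hy y' hy' e1 e2 => ?_, by omega⟩
      · by_cases hyN : y = N
        · subst hyN; simp only [Function.update_self]; exact ⟨z, by omega, rfl, rfl, hc⟩
        · rw [Function.update_of_ne hyN, Function.update_of_ne hyN]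
          obtain ⟨x, hx, hx'⟩ := h1 y (by omega)
          exact ⟨x, by omega, hx'⟩
      · by_cases hxz : x = z
        · subst hxz; exact ⟨N, by omega, by simp, by simp⟩
        · obtain ⟨y, hy, hy1, hy2⟩ := h2 x (by omega) hxP
          exact ⟨y, by omega, by rw [Function.update_of_ne hy.ne, hy1],
            by rw [Function.update_of_ne hy.ne, hy2]⟩
      · have hnew : ∀ y < N, ¬ (s'.nat aQI y = s.nat aPI z ∧ s'.nat aQS y = s.nat aPS z) := by
          rintro y hy ⟨k1, k2⟩
          obtain ⟨x, hx, x1, x2, -⟩ := h1 y hy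
          exact absurd (hE3 x (by omega) z hz (by rw [x1, k1]) (by rw [x2, k2])) (by omega)
        by_cases hyN : y = N <;> by_cases hyN' : y' = N
        · rw [hyN, hyN']
        · subst hyN
          rw [Function.update_self, Function.update_of_ne hyN'] at e1 e2
          exact absurd ⟨e1.symm, e2.symm⟩ (hnew y' (by omega))
        · subst hyN'
          rw [Function.update_self, Function.update_of_ne hyN] at e1 e2
          exact absurd ⟨e1, e2⟩ (hnew y (by omega))
        · rw [Function.update_of_ne hyN, Function.update_of_ne hyN'] at e1 e2
          exact h3 y (by omega) y' (by omega) e1 e2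
    · rw [not_not] at hc
      rw [if_pos hc] at hcs
      simp only [State.nat_setNat_ne, ne_eq, Nat.reduceEqDiff, not_false_eq_true]
      refine ⟨fun y hy => ?_, fun x hx hxP => ?_, h3, by omega⟩
      · obtain ⟨x, hx, hx'⟩ := h1 y hy
        exact ⟨x, by omega, hx'⟩
      · refine h2 x ?_ hxP
        rcases Nat.lt_succ_iff_lt_or_eq.1 hx with hx | rfl
        · exact hx
        · exact absurd hc hxP
  · simp; omega
  · rintro s' - ⟨⟨h1, h2, h3, h4⟩, -⟩
    refine ⟨⟨fun y hy => ?_, fun i j hij => ?_, h3⟩, h4⟩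
    · obtain ⟨x, hx, x1, x2, x3⟩ := h1 y hy
      exact ⟨by rw [← x1, ← x2]; exact hE1 x hx, x3⟩
    · obtain ⟨x, hx, rfl, rfl⟩ := hE2 i j hij.1
      exact h2 x hx hij.2

/-- The points without remaining pairs are entered into the table `aPerm`, and the remaining
pairs become the current ones. -/
def sFinish : Program :=
  forUp sZ (.lit 0) (.var nPX) (.setNat aMk eI (.lit 0)) ;;
  forUp sZ (.lit 0) (.var nQX) (.setNat aMk (.get aQI (.var sZ)) (.lit 1)) ;;
  forUp sZ (.lit 0) (.var nPX)
    (.cond (.natLt (.get aMk eI) (.lit 1)) (.setNat aPerm (.get aBS eI) (.add eI (.lit 1))) .skip) ;;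
  forUp sZ (.lit 0) (.var nQX)
    (.setNat aPI (.var sZ) (.get aQI (.var sZ)) ;; .setNat aPS (.var sZ) (.get aQS (.var sZ))) ;;
  assign nPX (.var nQX)

/-- A point all of whose remaining pairs have been filtered out is entered into `aPerm` under its
base code. The marks are set and reset along the lists of pairs only, so the time does not depend on
the number of points. -/
theorem ends_sFinish {s : State} {X Y : ℕ} (hX : s.nat nPX 0 = X) (hY : s.nat nQX 0 = Y)
    (hYX : Y ≤ X) :
    Ends I ε sFinish s (X * 200 + 200) fun s' =>
      s'.nat nPX 0 = Y ∧ (∀ z < Y, s'.nat aPI z = s.nat aQI z ∧ s'.nat aPS z = s.nat aQS z) ∧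
      (∀ c, s'.nat aPerm c = s.nat aPerm c ∨ ∃ z < X, (∀ y < Y, s.nat aQI y ≠ s.nat aPI z) ∧
        s.nat aBS (s.nat aPI z) = c ∧ s'.nat aPerm c = s.nat aPI z + 1) ∧
      ∀ z < X, (∀ y < Y, s.nat aQI y ≠ s.nat aPI z) →
        s'.nat aPerm (s.nat aBS (s.nat aPI z)) ≠ 0 := by
  refine Ends.seq (n := X * 40 + 30) (n' := X * 160 + 150) (Ends.forUp (k := 20) (a := 0) (b := X)
    (fun z s' => ∀ y < z, s'.nat aMk (s.nat aPI y) = 0) rfl (Nat.zero_le _) rfl ?_ ?_ ?_ ?_) ?_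
    (by omega)
  · intro s' hf
    have e : s'.nat nPX = _ := hf.nat _ rfl
    simp [e, hX]
  · intro c hc; omega
  · rintro z s' - hz hf hzz h
    have f1 : s'.nat aPI = _ := hf.nat _ rfl
    refine Ends.straight rfl (by simp) fun y hy => ?_
    simp only [Program.run, State.nat_setNat_ne, State.nat_setNat_same, NatExpr.eval, ne_eq,
        Nat.reduceEqDiff, not_false_eq_true, hzz, f1]
    by_cases hyz : s.nat aPI y = s.nat aPI z
    · rw [hyz, Function.update_self]
    · rw [Function.update_of_ne hyz]
      refine h y ?_
      rcases Nat.lt_succ_iff_lt_or_eq.1 hy with hy | rfl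
      · exact hy
      · exact absurd rfl hyz
  · simp; omega
  rintro s1 hf1 ⟨h1, -⟩
  have a1 : s1.nat nPX = _ := hf1.nat _ rfl
  have a2 : s1.nat nQX = _ := hf1.nat _ rfl
  have a3 : s1.nat aPI = _ := hf1.nat _ rfl
  have a4 : s1.nat aQI = _ := hf1.nat _ rfl
  refine Ends.seq (n := X * 40 + 30) (n' := X * 120 + 110) ((Ends.forUp (k := 20) (a := 0) (b := Y)
    (fun z s' => ∀ x < X, s'.nat aMk (s.nat aPI x) = 0 ↔ ∀ y < z, s.nat aQI y ≠ s.nat aPI x)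
    rfl (Nat.zero_le _) rfl ?_ ?_ ?_ ?_)) ?_ (by omega)
  · intro s' hf
    have e : s'.nat nQX = _ := hf.nat _ rfl
    simp [e, a2, hY]
  · intro x hx
    simpa using h1 x hx
  · rintro z s' - hz hf hzz h
    have f1 : s'.nat aQI = _ := hf.nat _ rfl
    refine Ends.straight rfl (by simp) fun x hx => ?_
    simp only [Program.run, State.nat_setNat_ne, State.nat_setNat_same, NatExpr.eval, ne_eq,
        Nat.reduceEqDiff, not_false_eq_true, hzz, f1, a4]
    by_cases hxz : s.nat aPI x = s.nat aQI z
    · rw [hxz, Function.update_self]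
      simp only [one_ne_zero, false_iff]
      exact fun hh => hh z (by omega) rfl
    · rw [Function.update_of_ne hxz, h x hx]
      constructor
      · intro hh y hy
        rcases Nat.lt_succ_iff_lt_or_eq.1 hy with hy | rfl
        · exact hh y hy
        · exact Ne.symm hxz
      · intro hh y hy; exact hh y (by omega)
  · simp; omega
  rintro s2 hf2 ⟨h2, -⟩
  have b1 : s2.nat nPX = _ := hf2.nat _ rfl
  have b2 : s2.nat nQX = _ := hf2.nat _ rfl
  have b3 : s2.nat aPI = _ := hf2.nat _ rfl
  have b4 : s2.nat aBS = s.nat aBS := (hf2.nat _ rfl).trans (hf1.nat _ rfl)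
  have b5 : s2.nat aPerm = s.nat aPerm := (hf2.nat _ rfl).trans (hf1.nat _ rfl)
  refine Ends.seq (n := X * 60 + 30) (n' := X * 60 + 60) ((Ends.forUp (k := 40) (a := 0) (b := X)
    (fun z s' => (∀ c, s'.nat aPerm c = s.nat aPerm c ∨ ∃ x < X, (∀ y < Y, s.nat aQI y ≠ s.nat aPI x) ∧
        s.nat aBS (s.nat aPI x) = c ∧ s'.nat aPerm c = s.nat aPI x + 1) ∧
      ∀ x < z, (∀ y < Y, s.nat aQI y ≠ s.nat aPI x) →
        s'.nat aPerm (s.nat aBS (s.nat aPI x)) ≠ 0)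
    rfl (Nat.zero_le _) rfl ?_ ?_ ?_ ?_)) ?_ (by omega)
  · intro s' hf
    have e : s'.nat nPX = _ := hf.nat _ rfl
    simp [e, b1, a1, hX]
  · exact ⟨fun c => .inl (by simp [b5]), fun x hx => absurd hx (by omega)⟩
  · rintro z s' - hz hf hzz ⟨i1, i2⟩
    have f1 : s'.nat aPI = _ := hf.nat _ rfl
    have f2 : s'.nat aBS = _ := hf.nat _ rfl
    have f3 : s'.nat aMk = _ := hf.nat _ rfl
    refine Ends.straight rfl (by simp) ?_
    simp only [Program.run]
    split_ifs with hc <;> simp only [Test.Holds, NatExpr.eval, hzz, f1, f2, f3, b3, a3,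
      Nat.lt_one_iff, h2 z hz] at hc
    · simp only [State.nat_setNat_ne, State.nat_setNat_same, NatExpr.eval, ne_eq,
        Nat.reduceEqDiff, not_false_eq_true, hzz, f1, f2, b3, a3, b4]
      refine ⟨fun c => ?_, fun x hx hxY => ?_⟩
      · by_cases hcz : c = s.nat aBS (s.nat aPI z)
        · subst hcz; exact .inr ⟨z, hz, hc, rfl, by rw [Function.update_self]⟩
        · rw [Function.update_of_ne hcz]; exact i1 c
      · by_cases hcz : s.nat aBS (s.nat aPI x) = s.nat aBS (s.nat aPI z)
        · rw [hcz, Function.update_self]; omega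
        · rw [Function.update_of_ne hcz]
          refine i2 x ?_ hxY
          rcases Nat.lt_succ_iff_lt_or_eq.1 hx with hx | rfl
          · exact hx
          · exact absurd rfl hcz
    · simp only [State.nat_setNat_ne, ne_eq, Nat.reduceEqDiff, not_false_eq_true]
      refine ⟨i1, fun x hx hxY => i2 x ?_ hxY⟩
      rcases Nat.lt_succ_iff_lt_or_eq.1 hx with hx | rfl
      · exact hx
      · exact absurd hxY hc
  · simp; omega
  rintro s3 hf3 ⟨h3, -⟩
  have c1 : s3.nat nQX = s.nat nQX := by rw [hf3.nat _ rfl, b2, a2]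
  have c2 : s3.nat aQI = s.nat aQI := by rw [hf3.nat _ rfl, hf2.nat _ rfl, a4]
  have c3 : s3.nat aQS = s.nat aQS := by rw [hf3.nat _ rfl, hf2.nat _ rfl, hf1.nat _ rfl]
  refine Ends.seq (n := X * 60 + 30) (n' := 30) ((Ends.forUp (k := 40) (a := 0) (b := Y)
    (fun z s' => ∀ y < z, s'.nat aPI y = s.nat aQI y ∧ s'.nat aPS y = s.nat aQS y)
    rfl (Nat.zero_le _) rfl ?_ ?_ ?_ ?_)) ?_ (by omega)
  · intro s' hf
    have e : s'.nat nQX = _ := hf.nat _ rfl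
    simp [e, c1, hY]
  · intro y hy; omega
  · rintro z s' - hz hf hzz h
    have f1 : s'.nat aQI = _ := hf.nat _ rfl
    have f2 : s'.nat aQS = _ := hf.nat _ rfl
    refine Ends.straight rfl (by simp) fun y hy => ?_
    by_cases hyz : y = z
    · subst hyz; simp [hzz, f1, f2, c2, c3]
    · simpa [hzz, Function.update_of_ne hyz] using h y (by omega)
  · simp; omega
  rintro s4 hf4 ⟨h4, -⟩
  have d1 : s4.nat nQX = _ := hf4.nat _ rfl
  have d2 : s4.nat aPerm = _ := hf4.nat _ rfl
  refine Ends.straight rfl (by simp) ⟨by simp [d1, c1, hY], by simpa using h4, ?_⟩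
  simpa [d2] using h3

/-! ### Exact solution when one side is small -/

/-- `kk` facilities suffice to cover all clients within distance `t`. -/
def Feas (I : KSupplier) (kk : ℕ) (t : ℝ) : Prop :=
  ∃ T ⊆ Finset.range I.numFacilities, T.card ≤ kk ∧
    ∀ q < I.numClients, ∃ j ∈ T, dist (I.point q) (I.point (I.numClients + j)) ≤ t

/-- The output list consists of at most `kk` facilities and covers all clients within
distance `t`. -/
def Good (I : KSupplier) (kk : ℕ) (s : State) (t : ℝ) : Prop :=
  s.nat nBL 0 ≤ kk ∧
  (∀ z < s.nat nBL 0, I.numClients ≤ s.nat aBL z ∧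
    s.nat aBL z < I.numClients + I.numFacilities) ∧
  ∀ q < I.numClients, ∃ z < s.nat nBL 0, dist (I.point q) (I.point (s.nat aBL z)) ≤ t

theorem Good.congr {kk : ℕ} {s s' : State} {t : ℝ} (h : Good I kk s t)
    (h1 : s'.nat nBL = s.nat nBL) (h2 : s'.nat aBL = s.nat aBL) : Good I kk s' t := by
  unfold Good; rw [h1, h2]; exact h

theorem Good.mono {kk : ℕ} {s : State} {t t' : ℝ} (h : Good I kk s t) (ht : t ≤ t') :
    Good I kk s t' :=
  ⟨h.1, h.2.1, fun q hq => (h.2.2 q hq).imp fun _ hz => ⟨hz.1, hz.2.trans ht⟩⟩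

/-- One side consists of `L` points, starting with the point `oL`, the other one of `w` points,
starting with the point `oS`; the clients are the former if `o = 0`, else the latter. -/
def Sides (I : KSupplier) (o oL L oS w : ℕ) : Prop :=
  o = 0 ∧ oL = 0 ∧ L = I.numClients ∧ oS = I.numClients ∧ w = I.numFacilities ∨
  o = 1 ∧ oL = I.numClients ∧ L = I.numFacilities ∧ oS = 0 ∧ w = I.numClients

/-- The data that do not change in the search. -/
structure SCtx (I : KSupplier) (kk L w : ℕ) (s : State) : Prop where
  sides : Sides I (s.nat sOr 0) (s.nat sOL 0) L (s.nat sOS 0) w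
  hL : s.nat sNL 0 = L
  hw : s.nat sNS 0 = w
  pw : ∀ j < w, s.nat aPw j = 2 ^ j
  pat : s.nat nPat 0 = 2 ^ w
  hkk : s.nat nKK 0 = kk
  kk_le : kk ≤ w
  L_pos : 0 < L
  w_pos : 0 < w

theorem SCtx.frame {kk L w : ℕ} {s s' : State} {c : Program} (h : SCtx I kk L w s)
    (hf : c.Frame s s')
    (hc : ([20, 50, 51, 52, 53, 54, 60, 64].all fun A => !c.writesNat A) = true) :
    SCtx I kk L w s' := by
  simp only [List.all_cons, List.all_nil, Bool.and_true, Bool.and_eq_true, Bool.not_eq_true'] at hc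
  obtain ⟨h1, h2, h3, h4, h5, h6, h7, h8⟩ := hc
  obtain ⟨i1, i2, i3, i4, i5, i6, i7, i8, i9⟩ := h
  exact ⟨by rw [hf.nat _ h6, hf.nat _ h2, hf.nat _ h3]; exact i1, by rw [hf.nat _ h4]; exact i2,
    by rw [hf.nat _ h5]; exact i3, by rw [hf.nat _ h7]; exact i4, by rw [hf.nat _ h8]; exact i5,
    by rw [hf.nat _ h1]; exact i6, i7, i8, i9⟩

/-- `rep` lists points of the long side with all the patterns that occur there at the
threshold `t`. -/
def RepsOK (I : KSupplier) (s : State) (L w : ℕ) (t : ℝ) : Prop :=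
  s.nat nRep 0 ≤ 2 ^ w ∧ (∀ r < s.nat nRep 0, ∃ i < L, s.nat aRep r = i + 1) ∧
  ∀ i < L, ∃ r < s.nat nRep 0, ∀ j < w, sdist I s (s.nat aRep r - 1) j ≤ t ↔ sdist I s i j ≤ t

/-- The cells `A[i]`, `i < N`, are set to the values of `e`. -/
def fill (i A : ℕ) (N e : NatExpr) : Program := forUp i (.lit 0) N (.setNat A (.var i) e)

theorem ends_fill {s : State} {i A X : ℕ} {N e : NatExpr} {g : ℕ → ℕ} (hiA : i ≠ A)
    (hN : ∀ s', (fill i A N e).Frame s s' → N.eval I s' = X)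
    (he : ∀ s' z, (fill i A N e).Frame s s' → s'.nat i 0 = z → z < X → e.eval I s' = g z) :
    Ends I ε (fill i A N e) s (X * (e.steps + N.steps + 15) + N.steps + 15)
      fun s' => ∀ z < X, s'.nat A z = g z := by
  refine (Ends.forUp (k := e.steps + 3) (a := 0) (b := X) (fun z s' => ∀ y < z, s'.nat A y = g y)
    rfl (Nat.zero_le _) (by simpa [Program.writesNat] using hiA) hN (fun y hy => absurd hy (by omega))
    (fun z s' _ hz hf hzz h => ?_) ?_).post fun s' _ h => h.1
  · refine Ends.straight rfl (by simp; omega) fun y hy => ?_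
    have hev := he s' z hf hzz hz
    simp only [Program.run, NatExpr.eval, hzz, hev, State.nat_setNat_same,
      State.nat_setNat_ne _ _ _ hiA.symm]
    by_cases hyz : y = z
    · subst hyz; simp
    · simpa [Function.update_of_ne hyz] using h y (by omega)
  · have := Nat.mul_le_mul_left X (show e.steps + 3 + N.steps + 10 ≤ e.steps + N.steps + 15 by omega)
    simp; omega

/-- The lists of clients and of facilities for the dynamic program. -/
def sLists : Program :=
  .cond (.natLt (.var sOr) (.lit 1))
    (fill sZ aLC (.var nRep) (.add (.var sOL) (.sub (.get aRep (.var sZ)) (.lit 1))) ;;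
      fill sZ aLF (.var sNS) (.add (.var sOS) (.var sZ)) ;;
      assign nA (.var sNS) ;; assign nB (.var nRep))
    (fill sZ aLF (.var nRep) (.add (.var sOL) (.sub (.get aRep (.var sZ)) (.lit 1))) ;;
      fill sZ aLC (.var sNS) (.add (.var sOS) (.var sZ)) ;;
      assign nB (.var sNS) ;; assign nA (.var nRep))

theorem ends_sLists {kk L w : ℕ} {s : State} (hc : SCtx I kk L w s) (hR : s.nat nRep 0 ≤ 2 ^ w) :
    Ends I ε sLists s (2 ^ w * 100 + 200) fun s' =>
      (s.nat sOr 0 = 0 → s'.nat nB 0 = s.nat nRep 0 ∧ s'.nat nA 0 = w ∧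
        (∀ z < s.nat nRep 0, s'.nat aLC z = s.nat sOL 0 + (s.nat aRep z - 1)) ∧
        ∀ z < w, s'.nat aLF z = s.nat sOS 0 + z) ∧
      (s.nat sOr 0 = 1 → s'.nat nA 0 = s.nat nRep 0 ∧ s'.nat nB 0 = w ∧
        (∀ z < s.nat nRep 0, s'.nat aLF z = s.nat sOL 0 + (s.nat aRep z - 1)) ∧
        ∀ z < w, s'.nat aLC z = s.nat sOS 0 + z) := by
  have hw : w ≤ 2 ^ w := Nat.lt_two_pow_self.le
  have hS := hc.hw
  set V := 2 ^ w
  refine Ends.cond (n := V * 100 + 190) (fun ho => ?_) (fun ho => ?_) (by simp; omega)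
  all_goals
    simp only [Test.Holds, NatExpr.eval] at ho
    refine Ends.seq (n := V * 40 + 30) (n' := V * 40 + 100) ((ends_fill (X := s.nat nRep 0)
      (g := fun z => s.nat sOL 0 + (s.nat aRep z - 1)) (by simp) (fun s' hf => by
        have e : s'.nat nRep = _ := hf.nat _ rfl
        simp [e]) (fun s' z hf hzz hz => by
        have f1 : s'.nat aRep = _ := hf.nat _ rfl
        have f2 : s'.nat sOL = _ := hf.nat _ rfl
        simp [f1, f2, hzz])).le (by simp; omega)) ?_ (by omega)
    intro s1 hf1 h1
    have a1 : s1.nat sNS = _ := hf1.nat _ rfl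
    have a2 : s1.nat sOS = _ := hf1.nat _ rfl
    have a3 : s1.nat nRep = _ := hf1.nat _ rfl
    refine Ends.seq (n := V * 40 + 30) (n' := 30) ((ends_fill (X := w)
      (g := fun z => s.nat sOS 0 + z) (by simp) (fun s' hf => by
        have e : s'.nat sNS = _ := hf.nat _ rfl
        simp [e, a1, hS]) (fun s' z hf hzz hz => by
        have f2 : s'.nat sOS = _ := hf.nat _ rfl
        simp [f2, a2, hzz])).le (by simp; omega)) ?_ (by omega)
    intro s2 hf2 h2
  · have b1 : s2.nat sNS = _ := hf2.nat _ rfl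
    have b2 : s2.nat nRep = _ := hf2.nat _ rfl
    have b3 : s2.nat aLC = _ := hf2.nat _ rfl
    refine Ends.straight rfl (by simp) ⟨fun _ => ⟨?_, ?_, ?_, ?_⟩, fun h => by omega⟩
    · simp [b2, a3]
    · simp [b1, a1, hS]
    · simpa [b3] using h1
    · simpa using h2
  · have b1 : s2.nat sNS = _ := hf2.nat _ rfl
    have b2 : s2.nat nRep = _ := hf2.nat _ rfl
    have b3 : s2.nat aLF = _ := hf2.nat _ rfl
    refine Ends.straight rfl (by simp) ⟨fun h => by omega, fun _ => ⟨?_, ?_, ?_, ?_⟩⟩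
    · simp [b2, a3]
    · simp [b1, a1, hS]
    · simpa [b3] using h1
    · simpa using h2

/-- Equal sets dominate each other, so the sets of such a sequence are distinct subsets of the
items. -/
theorem frontBound_subsets {rel : ℕ → ℕ → Prop} {a b kk M : ℕ} (h : 2 ^ a ≤ M) :
    FrontBound rel a b kk M := by
  intro j _ hja N f hf hd
  have h1 : (Finset.range N).card ≤ ((Finset.range a).powerset).card := by
    refine Finset.card_le_card_of_injOn f (fun x hx => ?_) fun x hx y hy hxy => ?_
    · simp only [Finset.coe_range, Set.mem_Iio] at hx
      simp only [Finset.coe_powerset, Set.mem_preimage, Set.mem_powerset_iff, Finset.coe_subset]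
      exact (hf x hx).1.trans (Finset.range_subset_range.2 hja)
    · simp only [Finset.coe_range, Set.mem_Iio] at hx hy
      rcases lt_trichotomy x y with h | h | h
      · exact absurd ⟨by rw [hxy], fun q _ hq => by rwa [hxy]⟩ (hd x y h hy)
      · exact h
      · exact absurd ⟨by rw [hxy], fun q _ hq => by rwa [← hxy]⟩ (hd y x h hx)
  simp only [Finset.card_range, Finset.card_powerset] at h1
  exact h1.trans h

/-- Domination depends only on the size and on the set of covered clients, so no such pair of data
occurs twice. -/
theorem frontBound_cover {rel : ℕ → ℕ → Prop} {a b kk M : ℕ} (h : (kk + 1) * 2 ^ b ≤ M) :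
    FrontBound rel a b kk M := by
  classical
  intro j _ hja N f hf hd
  let g : ℕ → ℕ × Finset ℕ := fun x =>
    ((f x).card, (Finset.range b).filter fun q => ∃ i ∈ f x, rel i q)
  have key : ∀ x y, g x = g y → Dominates rel b (f x) (f y) := by
    intro x y hxy
    refine ⟨(Prod.ext_iff.1 hxy).1.le, fun q hq hq' => ?_⟩
    have h2 := Finset.ext_iff.1 (Prod.ext_iff.1 hxy).2 q
    simp only [g, Finset.mem_filter, Finset.mem_range, hq, true_and] at h2
    exact h2.2 hq'
  have h1 : (Finset.range N).card ≤ (Finset.range (kk + 1) ×ˢ (Finset.range b).powerset).card := by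
    refine Finset.card_le_card_of_injOn g (fun x hx => ?_) fun x hx y hy hxy => ?_
    · simp only [Finset.coe_range, Set.mem_Iio] at hx
      simp only [g, Finset.coe_product, Set.mem_prod, Finset.mem_coe, Finset.mem_range,
        Finset.mem_powerset]
      exact ⟨Nat.lt_succ_of_le (hf x hx).2.1, Finset.filter_subset _ _⟩
    · simp only [Finset.coe_range, Set.mem_Iio] at hx hy
      rcases lt_trichotomy x y with h | h | h
      · exact absurd (key x y hxy) (hd x y h hy)
      · exact h
      · exact absurd (key y x hxy.symm) (hd y x h hx)
  simp only [Finset.card_range, Finset.card_product, Finset.card_powerset] at h1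
  exact h1.trans h

/-- With V = 2^w ≥ w + 1, the two sides together contribute at most 2V² and the square of the front
size at most 4V⁴. Together this is 8·V^6 = 8·64^w. -/
theorem pattern_time {w a b : ℕ} (hw : 0 < w) (h : a ≤ 2 ^ w ∧ b ≤ w ∨ a ≤ w ∧ b ≤ 2 ^ w) :
    1000 * ((a + 1) * (b + 1) * ((w + 1) * 2 ^ w + 1) ^ 2) + (2 ^ w * 100 + 200) ≤
      8300 * 64 ^ w := by
  have h1 : w + 1 ≤ 2 ^ w := Nat.lt_two_pow_self
  have h2 : (64 : ℕ) ^ w = (2 ^ w) ^ 6 := by rw [← pow_mul, mul_comm, pow_mul]; norm_num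
  rw [h2]
  set V := 2 ^ w
  have hV : 1 ≤ V := by omega
  have hV2 : 2 ≤ V := by omega
  have h3 : (a + 1) * (b + 1) ≤ (2 * V) * V := by
    rcases h with ⟨ha, hb⟩ | ⟨ha, hb⟩
    · exact Nat.mul_le_mul (by omega) (by omega)
    · rw [mul_comm (2 * V)]; exact Nat.mul_le_mul (by omega) (by omega)
  have h4 : (w + 1) * V + 1 ≤ 2 * V ^ 2 := by
    have : (w + 1) * V ≤ V * V := Nat.mul_le_mul h1 le_rfl
    nlinarith
  have h5 : ((w + 1) * V + 1) ^ 2 ≤ (2 * V ^ 2) ^ 2 := Nat.pow_le_pow_left h4 2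
  have h6 := Nat.mul_le_mul h3 h5
  have h7 : 2 * V * V * (2 * V ^ 2) ^ 2 = 8 * V ^ 6 := by ring
  have h8 : V ≤ V ^ 6 := Nat.le_self_pow (by omega) V
  rw [h7] at h6
  omega

/-- Clients with the same pattern impose the same requirement, and facilities with the same pattern
are interchangeable; representatives therefore decide feasibility. The front is bounded by subsets
of the facilities if these are the short side, and by sizes and covered sets if the clients are. In
both cases `(w + 1) * 2 ^ w` is enough. -/
theorem ends_sDecide {kk L w : ℕ} {s : State} (hc : SCtx I kk L w s)
    (hR : RepsOK I s L w (s.real rT 0)) :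
    Ends I ε (sLists ;; dp) s (8300 * 64 ^ w) fun s' =>
      s'.nat nFound 0 = 1 ∧ Good I kk s' (s.real rT 0) ∨
      s'.nat nFound 0 = 0 ∧ s'.nat nBL = s.nat nBL ∧ s'.nat aBL = s.nat aBL ∧
        ¬ Feas I kk (s.real rT 0) := by
  classical
  obtain ⟨hR1, hR2, hR3⟩ := hR
  obtain ⟨r0, hr0, -⟩ := hR3 0 hc.L_pos
  have hkk := hc.kk_le
  have hwp := hc.w_pos
  have hw1 : w + 1 ≤ 2 ^ w := Nat.lt_two_pow_self
  refine Ends.seq (n' := 1000 * (((s.nat nRep 0) + 1) * (w + 1) * ((w + 1) * 2 ^ w + 1) ^ 2))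
    (ends_sLists hc hR1) ?_ ?_
  · rintro s1 hf ⟨h0, h1⟩
    have a1 : s1.nat nKK = _ := hf.nat _ rfl
    have a2 : s1.real rT = _ := hf.real _ rfl
    have a3 : s1.nat nBL = _ := hf.nat _ rfl
    have a4 : s1.nat aBL = _ := hf.nat _ rfl
    have hM1 : 1 ≤ (w + 1) * 2 ^ w := Nat.mul_pos (by omega) (by positivity)
    rcases hc.sides with ⟨e0, e1, e2, e3, e4⟩ | ⟨e0, e1, e2, e3, e4⟩
    · obtain ⟨g1, g2, g3, g4⟩ := h0 e0
      rw [e1] at g3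
      rw [e3] at g4
      have hd : ∀ i j, sdist I s i j = dist (I.point i) (I.point (I.numClients + j)) := by
        intro i j; simp [sdist, e1, e3]
      simp only [hd, zero_add] at hR3 g3
      refine ((ends_dp (a := w) (b := s.nat nRep 0) (kk := kk) hwp (by omega) hM1 g2 g1
        (by rw [a1, hc.hkk]) (frontBound_subsets (Nat.le_mul_of_pos_left _ (by omega)))).le
        (by rw [mul_comm (w + 1)])).post ?_
      rintro s2 - (⟨i1, i2, i3, i4⟩ | ⟨i1, i2, i3, i4⟩)
      · refine .inl ⟨i1, i2, fun z hz => ?_, fun p hp => ?_⟩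
        · obtain ⟨i, hi, hi'⟩ := i3 z hz
          rw [hi', g4 i hi]; omega
        · obtain ⟨r, hr, hrp⟩ := hR3 p (by omega)
          obtain ⟨z, hz, hz'⟩ := i4 r hr
          obtain ⟨i, hi, hi'⟩ := i3 z hz
          refine ⟨z, hz, ?_⟩
          rw [g3 r hr, hi', g4 i hi, a2] at hz'
          rw [hi', g4 i hi]
          exact (hrp i hi).1 hz'
      · refine .inr ⟨i1, by rw [i2, a3], by rw [i3, a4], fun ⟨T, hT, hTk, hTc⟩ => i4 ?_⟩
        refine ⟨T, by rwa [e4], hTk, fun q hq => ?_⟩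
        obtain ⟨i, hi, hi'⟩ := hR2 q hq
        obtain ⟨j, hj, hj'⟩ := hTc i (by omega)
        refine ⟨j, hj, ?_⟩
        have hjm := Finset.mem_range.1 (hT hj)
        simp only [relOf, a2]
        rw [g3 q hq, g4 j (by omega), hi']
        simpa using hj'
    · obtain ⟨g1, g2, g3, g4⟩ := h1 e0
      rw [e1] at g3
      simp only [e3, zero_add] at g4
      have hd : ∀ i j, sdist I s i j = dist (I.point j) (I.point (I.numClients + i)) := by
        intro i j; simp [sdist, e1, e3, dist_comm]
      simp only [hd] at hR3
      have hM2 : (kk + 1) * 2 ^ w ≤ (w + 1) * 2 ^ w := Nat.mul_le_mul (by omega) le_rfl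
      refine (ends_dp (a := s.nat nRep 0) (b := w) (kk := kk) (by omega) hwp hM1 g1 g2
        (by rw [a1, hc.hkk]) (frontBound_cover hM2)).post ?_
      rintro s2 - (⟨i1, i2, i3, i4⟩ | ⟨i1, i2, i3, i4⟩)
      · refine .inl ⟨i1, i2, fun z hz => ?_, fun p hp => ?_⟩
        · obtain ⟨i, hi, hi'⟩ := i3 z hz
          obtain ⟨x, hx, hx'⟩ := hR2 i hi
          rw [hi', g3 i hi]; omega
        · obtain ⟨z, hz, hz'⟩ := i4 p (by omega)
          rw [g4 p (by omega), a2] at hz'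
          exact ⟨z, hz, hz'⟩
      · refine .inr ⟨i1, by rw [i2, a3], by rw [i3, a4], fun ⟨T, hT, hTk, hTc⟩ => i4 ?_⟩
        -- Each facility of a solution is replaced by the representative of its pattern.
        have hφ : ∀ i, ∃ r, i < L → r < s.nat nRep 0 ∧ ∀ j < w,
            dist (I.point j) (I.point (I.numClients + (s.nat aRep r - 1))) ≤ s.real rT 0 ↔
            dist (I.point j) (I.point (I.numClients + i)) ≤ s.real rT 0 := by
          intro i
          by_cases hi : i < L
          · obtain ⟨r, hr, hr'⟩ := hR3 i hi
            exact ⟨r, fun _ => ⟨hr, hr'⟩⟩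
          · exact ⟨0, fun h => absurd h hi⟩
        choose φ hφ using hφ
        refine ⟨T.image φ, fun r hr => ?_, Finset.card_image_le.trans hTk, fun q hq => ?_⟩
        · obtain ⟨i, hi, rfl⟩ := Finset.mem_image.1 hr
          have := Finset.mem_range.1 (hT hi)
          exact Finset.mem_range.2 (hφ i (by omega)).1
        · obtain ⟨j, hj, hj'⟩ := hTc q (by omega)
          have := Finset.mem_range.1 (hT hj)
          obtain ⟨k1, k2⟩ := hφ j (by omega)
          refine ⟨φ j, Finset.mem_image_of_mem _ hj, ?_⟩
          simp only [relOf, a2]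
          rw [g3 _ k1, g4 q hq]
          exact (k2 q hq).2 hj'
  · have := pattern_time hwp (a := s.nat nRep 0) (b := w) (.inl ⟨hR1, le_rfl⟩)
    omega

/-- `perm` lists the points all of whose distances are compared with the optimum, one for
each code. -/
def PermOK (L W : ℕ) (R : ℕ → ℕ → Prop) (bs perm : ℕ → ℕ) : Prop :=
  (∀ c < W, perm c ≠ 0 → ∃ i < L, perm c = i + 1 ∧ bs i = c ∧ ∀ j, ¬ R i j) ∧
  ∀ i < L, (∀ j, ¬ R i j) → perm (bs i) ≠ 0

/-- The pairs with distance strictly between `lo` and `hi`. -/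
def Between (I : KSupplier) (s : State) (L w : ℕ) (lo hi : ℝ) (i j : ℕ) : Prop :=
  i < L ∧ j < w ∧ lo < sdist I s i j ∧ sdist I s i j < hi

/-- The state of the search: the optimum is in `(lo, hi]`. -/
structure SOK (I : KSupplier) (kk L w : ℕ) (lo hi : ℝ) (X : ℕ) (s : State) : Prop where
  ctx : SCtx I kk L w s
  lt : lo < hi
  hX : s.nat nPX 0 = X
  enum : Enumerates (Between I s L w lo hi) X (s.nat aPI) (s.nat aPS)
  bs : ∀ i < L, s.nat aBS i = code (fun j => sdist I s i j ≤ lo) w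
  perm : PermOK L (2 ^ w) (Between I s L w lo hi) (s.nat aBS) (s.nat aPerm)

theorem SOK.congr {kk L w X : ℕ} {lo hi : ℝ} {s s' : State} (h : SOK I kk L w lo hi X s)
    (hc : SCtx I kk L w s') (h1 : s'.nat sOL = s.nat sOL) (h2 : s'.nat sOS = s.nat sOS)
    (h3 : s'.nat nPX = s.nat nPX) (h4 : s'.nat aPI = s.nat aPI) (h5 : s'.nat aPS = s.nat aPS)
    (h6 : s'.nat aBS = s.nat aBS) (h7 : s'.nat aPerm = s.nat aPerm) : SOK I kk L w lo hi X s' := by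
  have hd := sdist_congr (I := I) h1 h2
  have hB : Between I s' L w lo hi = Between I s L w lo hi := by
    funext i j; simp only [Between, hd]
  exact ⟨hc, h.lt, by rw [h3]; exact h.hX, by rw [hB, h4, h5]; exact h.enum,
    by rw [h6, hd]; exact h.bs, by rw [hB, h6, h7]; exact h.perm⟩

/-- A threshold, and representatives of the patterns at this threshold. -/
def sPattern : Program := sValues ;; pivot ;; sCodes ;; sTable ;; sReps

/-- Every pattern at the new threshold is found in one of two tables: points with remaining pairs
have freshly computed codes, and points without are represented in `aPerm`. This costs time
proportional to `X` and `2 ^ w`, independently of the number `L` of points. -/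
theorem ends_sPattern {kk L w X : ℕ} {lo hi : ℝ} {s : State} (h : SOK I kk L w lo hi X s)
    (hX : 0 < X) :
    Ends I ε sPattern s (X * 4200 + 2 ^ w * 300) fun s' =>
      (lo < s'.real rT 0 ∧ s'.real rT 0 < hi) ∧
      X ≤ 16 * cnt (· ≤ s'.real rT 0) (fun z => sdist I s (s.nat aPI z) (s.nat aPS z)) X ∧
      X ≤ 16 * cnt (s'.real rT 0 ≤ ·) (fun z => sdist I s (s.nat aPI z) (s.nat aPS z)) X ∧
      RepsOK I s' L w (s'.real rT 0) ∧
      ∀ z < X, s'.nat aCD (s.nat aPI z) =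
        code (fun j => sdist I s (s.nat aPI z) j ≤ s'.real rT 0) w := by
  obtain ⟨hE1, hE2, hE3⟩ := h.enum
  have hV : 1 ≤ 2 ^ w := Nat.one_le_two_pow
  refine Ends.seq (ends_sValues h.hX) (n' := X * 4140 + 2 ^ w * 300 - 30) ?_ (by omega)
  rintro s1 hf1 ⟨v1, v2, v3⟩
  refine Ends.seq (ends_pivot hX v3) (n' := X * 140 + 2 ^ w * 300 - 30) ?_ (by omega)
  rintro s2 hf2 ⟨⟨z, hz, hzt⟩, c1, c2⟩
  have hcnt : ∀ D, cnt D (s1.real aV) X =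
    cnt D (fun z => sdist I s (s.nat aPI z) (s.nat aPS z)) X := fun D => cnt_congr v1
  rw [hcnt] at c1 c2
  rw [v1 z hz] at hzt
  set t := s2.real rT 0 with ht
  have hlt : lo < t := by rw [hzt]; exact (hE1 z hz).2.2.1
  have hth : t < hi := by rw [hzt]; exact (hE1 z hz).2.2.2
  have a1 : s2.nat nPX = s.nat nPX := (hf2.nat _ rfl).trans (hf1.nat _ rfl)
  have a2 : s2.nat aPI = s.nat aPI := (hf2.nat _ rfl).trans (hf1.nat _ rfl)
  have a3 : s2.nat aPS = s.nat aPS := (hf2.nat _ rfl).trans (hf1.nat _ rfl)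
  have a4 : s2.nat aPw = s.nat aPw := (hf2.nat _ rfl).trans (hf1.nat _ rfl)
  have a5 : sdist I s2 = sdist I s :=
    sdist_congr ((hf2.nat _ rfl).trans (hf1.nat _ rfl)) ((hf2.nat _ rfl).trans (hf1.nat _ rfl))
  have a6 : s2.nat aCD = s1.nat aCD := hf2.nat _ rfl
  refine Ends.seq (ends_sCodes (m := w) (lo := lo) (R := Between I s L w lo hi)
    (by rw [a1, h.hX]) (by rw [a2, a3]; exact h.enum) (by rw [a4]; exact h.ctx.pw)
    (fun i j hij => by rw [a5]; exact ⟨hij.2.1, hij.2.2.1⟩) ?_)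
    (n' := X * 80 + 2 ^ w * 300 - 60) ?_ (by omega)
  · intro z hz
    rw [a2, a6, v2 z hz, a5]
    exact h.bs _ (hE1 z hz).1
  rintro s3 hf3 h3
  rw [a2, a5] at h3
  have hcode : ∀ z < X, s3.nat aCD (s.nat aPI z) = code (fun j => sdist I s (s.nat aPI z) j ≤ t) w := by
    intro z hz
    rw [h3 z hz]
    refine code_congr fun j hj => ?_
    constructor
    · rintro (h1 | ⟨-, h1⟩)
      · exact h1.trans hlt.le
      · exact h1
    · intro h1
      by_cases h2 : sdist I s (s.nat aPI z) j ≤ lo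
      · exact .inl h2
      · exact .inr ⟨⟨(hE1 z hz).1, hj, not_le.1 h2, h1.trans_lt hth⟩, h1⟩
  have b1 : s3.nat nPX = s.nat nPX := (hf3.nat _ rfl).trans a1
  have b2 : s3.nat aPI = s.nat aPI := (hf3.nat _ rfl).trans a2
  have b3 : s3.nat nPat = s.nat nPat :=
    (hf3.nat _ rfl).trans ((hf2.nat _ rfl).trans (hf1.nat _ rfl))
  refine Ends.seq (ends_sTable (by rw [b1, h.hX]) (by rw [b3, h.ctx.pat]))
    (n' := X * 40 + 2 ^ w * 260 - 120) ?_ (by omega)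
  rintro s4 hf4 ⟨d1, d2⟩
  rw [b2] at d1 d2
  have e1 : s4.nat aPerm = s.nat aPerm := (hf4.nat _ rfl).trans ((hf3.nat _ rfl).trans
    ((hf2.nat _ rfl).trans (hf1.nat _ rfl)))
  have e2 : s4.nat nPat = s.nat nPat := (hf4.nat _ rfl).trans b3
  refine (ends_sReps (by rw [e2, h.ctx.pat])).mono (by omega) ?_
  rintro s5 hf5 ⟨r1, r2, r3⟩
  rw [e1] at r2 r3
  have k1 : s5.nat aCD = s3.nat aCD := (hf5.nat _ rfl).trans (hf4.nat _ rfl)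
  have k2 : s5.real rT 0 = t := by rw [hf5.real _ rfl, hf4.real _ rfl, hf3.real _ rfl]
  have k3 : sdist I s5 = sdist I s := by
    rw [← a5]
    exact sdist_congr ((hf5.nat _ rfl).trans ((hf4.nat _ rfl).trans (hf3.nat _ rfl)))
      ((hf5.nat _ rfl).trans ((hf4.nat _ rfl).trans (hf3.nat _ rfl)))
  rw [k2]
  refine ⟨⟨hlt, hth⟩, c1, c2, ⟨r1, ?_, ?_⟩, by rw [k1]; exact hcode⟩
  · intro r hr
    obtain ⟨hne, c, hc, ⟨hp, hp'⟩ | hd⟩ := r2 r hr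
    · obtain ⟨i, hi, hi', -⟩ := h.perm.1 c hc hp
      exact ⟨i, hi, by rw [hp', hi']⟩
    · obtain ⟨z, hz, hz', -⟩ := d2 c hc (by rw [← hd]; exact hne)
      exact ⟨_, (hE1 z hz).1, by rw [hd, hz']⟩
  · intro i hiL
    rw [k3]
    -- A point without remaining pairs has no distance in (lo, hi), so its pattern is the same at
    -- `t` as at `lo`.
    have hnp : ∀ i < L, (∀ j, ¬ Between I s L w lo hi i j) →
        s.nat aBS i = code (fun j => sdist I s i j ≤ t) w := by
      intro i hiL hno
      rw [h.bs i hiL]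
      refine code_congr fun j hj => ⟨fun h1 => h1.trans hlt.le, fun h1 => ?_⟩
      by_contra h2
      exact hno j ⟨hiL, hj, not_le.1 h2, h1.trans_lt hth⟩
    set c := code (fun j => sdist I s i j ≤ t) w with hc
    have hcW : c < 2 ^ w := code_lt _ _
    have hfin : ∀ i' < L, code (fun j => sdist I s i' j ≤ t) w = c → ∀ r, s5.nat aRep r = i' + 1 →
        ∀ j < w, sdist I s (s5.nat aRep r - 1) j ≤ t ↔ sdist I s i j ≤ t := by
      intro i' hi' hcc r hr j hj
      rw [hr, Nat.add_sub_cancel]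
      exact code_inj hcc hj
    by_cases hp : s.nat aPerm c = 0
    · have hex : ∃ j, Between I s L w lo hi i j := by
        by_contra! hno
        exact h.perm.2 i hiL hno (by rw [hnp i hiL hno]; exact hp)
      obtain ⟨j, hj⟩ := hex
      obtain ⟨z, hz, hzi, -⟩ := hE2 i j hj
      have hd := d1 z hz
      rw [hcode z hz, hzi, ← hc] at hd
      obtain ⟨z', hz', hz1, hz2⟩ := d2 c hcW hd
      obtain ⟨r, hr, hr'⟩ := (r3 c hcW).2 hp hd
      refine ⟨r, hr, hfin _ (hE1 z' hz').1 ?_ r (by rw [hr', hz1])⟩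
      rw [← hcode z' hz', hz2]
    · obtain ⟨i', hi', hp1, hp2, hp3⟩ := h.perm.1 c hcW hp
      obtain ⟨r, hr, hr'⟩ := (r3 c hcW).1 hp
      exact ⟨r, hr, hfin i' hi' (by rw [← hnp i' hi' hp3, hp2]) r (by rw [hr', hp1])⟩

theorem Enumerates.congr {R : ℕ → ℕ → Prop} {n : ℕ} {x y x' y' : ℕ → ℕ} (h : Enumerates R n x y)
    (hx : ∀ z < n, x' z = x z ∧ y' z = y z) : Enumerates R n x' y' := by
  obtain ⟨h1, h2, h3⟩ := h
  refine ⟨fun z hz => by rw [(hx z hz).1, (hx z hz).2]; exact h1 z hz, fun i j hij => ?_,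
    fun z hz z' hz' => ?_⟩
  · obtain ⟨z, hz, hz'⟩ := h2 i j hij
    exact ⟨z, hz, by rw [(hx z hz).1, (hx z hz).2]; exact hz'⟩
  · rw [(hx z hz).1, (hx z hz).2, (hx z' hz').1, (hx z' hz').2]
    exact h3 z hz z' hz'

/-- `R` is the relation before the interval shrank. A point belongs to the new table if it had no
`R`-pairs before or has just lost the last one. In the second case all its distances lie outside the
new interval. -/
theorem ends_sFinish_ok {kk L w X Y : ℕ} {lo hi : ℝ} {s : State} {R : ℕ → ℕ → Prop}
    (hc : SCtx I kk L w s) (hlt : lo < hi) (hX : s.nat nPX 0 = X) (hY : s.nat nQX 0 = Y)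
    (hYX : Y ≤ X) (hE : Enumerates R X (s.nat aPI) (s.nat aPS)) (hRL : ∀ i j, R i j → i < L)
    (hE' : Enumerates (Between I s L w lo hi) Y (s.nat aQI) (s.nat aQS))
    (hRR : ∀ i j, Between I s L w lo hi i j → R i j)
    (hbs : ∀ i < L, s.nat aBS i = code (fun j => sdist I s i j ≤ lo) w)
    (hp : PermOK L (2 ^ w) R (s.nat aBS) (s.nat aPerm)) :
    Ends I ε sFinish s (X * 200 + 200) fun s' => SOK I kk L w lo hi Y s' := by
  refine (ends_sFinish hX hY hYX).post ?_
  rintro s1 hf ⟨h1, h2, h3, h4⟩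
  have hd : sdist I s1 = sdist I s := sdist_congr (hf.nat _ rfl) (hf.nat _ rfl)
  have hB : Between I s1 L w lo hi = Between I s L w lo hi := by
    funext i j; simp only [Between, hd]
  have a1 : s1.nat aBS = _ := hf.nat _ rfl
  refine ⟨hc.frame hf rfl, hlt, h1, by rw [hB]; exact hE'.congr h2, by rw [a1, hd]; exact hbs, ?_⟩
  rw [hB, a1]
  constructor
  · intro c hcW hne
    rcases h3 c with h | ⟨z, hz, hz1, hz2, hz3⟩
    · rw [h] at hne ⊢
      obtain ⟨i, hi, hi1, hi2, hi3⟩ := hp.1 c hcW hne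
      exact ⟨i, hi, hi1, hi2, fun j hj => hi3 j (hRR i j hj)⟩
    · refine ⟨_, hRL _ _ (hE.1 z hz), hz3, hz2, fun j hj => ?_⟩
      obtain ⟨y, hy, hy1, -⟩ := hE'.2.1 _ _ hj
      exact hz1 y hy hy1
  · intro i hi hno
    by_cases hex : ∃ j, R i j
    · obtain ⟨j, hj⟩ := hex
      obtain ⟨z, hz, rfl, -⟩ := hE.2.1 _ _ hj
      exact h4 z hz fun y hy hyz => hno (s.nat aQS y) (by rw [← hyz]; exact hE'.1 y hy)
    · push Not at hex
      rcases h3 (s.nat aBS i) with h | ⟨z, hz, hz1, hz2, hz3⟩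
      · rw [h]; exact hp.2 i hi hex
      · omega

/-- Sequencing itself costs no step, so regrouping leaves the count unchanged. It allows a prefix of
a right-nested sequence to be treated as one program. -/
theorem Ends.assoc {c c' c'' : Program} {s : State} {n : ℕ} {Q : State → Prop}
    (h : Ends I ε ((c ;; c') ;; c'') s n Q) : Ends I ε (c ;; c' ;; c'') s n Q := by
  obtain ⟨s', t, he, ht, hq⟩ := h
  cases he with
  | seq h1 h3 => cases h1 with
    | seq h1 h2 => exact ⟨s', _, .seq h1 (.seq h2 h3), by omega, hq⟩

/-- One round of the search. -/
def sRound : Program :=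
  sPattern ;; sLists ;; dp ;;
  .cond (.natLt (.lit 0) (.var nFound))
    (sFilter (.realLt eD (.var rT)) ;; sFinish)
    (forUp sZ (.lit 0) (.var nPX) (.setNat aBS eI (.get aCD eI)) ;;
      sFilter (.realLt (.var rT) eD) ;; sFinish)

/-- If the pivot `t` is feasible it becomes the upper end and the distances at least `t` are
dropped; otherwise it becomes the lower end and the distances at most `t` are dropped. Either way at
least a sixteenth of the pairs goes. Only in the second case do the base codes change. -/
theorem ends_sRound {kk L w X : ℕ} {lo hi : ℝ} {s : State} (h : SOK I kk L w lo hi X s)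
    (hX : 0 < X) (hlo : ¬ Feas I kk lo) (hhi : Good I kk s hi) :
    Ends I ε sRound s (X * 4700 + 9000 * 64 ^ w) fun s' => ∃ lo' hi' X', SOK I kk L w lo' hi' X' s' ∧
      ¬ Feas I kk lo' ∧ Good I kk s' hi' ∧ 16 * X' ≤ 15 * X := by
  have hVW : 2 ^ w ≤ 64 ^ w := Nat.pow_le_pow_left (by omega) w
  have hV1 : 1 ≤ 2 ^ w := Nat.one_le_two_pow
  set V := 2 ^ w with hVdef
  set W := 64 ^ w with hW
  refine Ends.seq (ends_sPattern h hX) (n' := X * 500 + 8600 * W) ?_ (by omega)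
  rintro s1 hf1 ⟨⟨t1, t2⟩, c1, c2, hR, hcd⟩
  have hd1 : sdist I s1 = sdist I s := sdist_congr (hf1.nat _ rfl) (hf1.nat _ rfl)
  have hc1 := h.ctx.frame hf1 rfl
  refine Ends.assoc (Ends.seq (ends_sDecide hc1 hR) (n' := X * 500 + 300) ?_ (by omega))
  intro s2 hf2 h2
  set t := s1.real rT 0 with ht
  have hf12 : ∀ A, sPattern.writesNat A = false → (sLists ;; dp).writesNat A = false →
      s2.nat A = s.nat A := fun A h1 h2 => (hf2.nat A h2).trans (hf1.nat A h1)
  have k1 : s2.nat sOL = s.nat sOL := hf12 _ rfl rfl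
  have k2 : s2.nat sOS = s.nat sOS := hf12 _ rfl rfl
  have k3 : s2.nat nPX = s.nat nPX := hf12 _ rfl rfl
  have k4 : s2.nat aPI = s.nat aPI := hf12 _ rfl rfl
  have k5 : s2.nat aPS = s.nat aPS := hf12 _ rfl rfl
  have k6 : s2.nat aBS = s.nat aBS := hf12 _ rfl rfl
  have k7 : s2.nat aPerm = s.nat aPerm := hf12 _ rfl rfl
  have k8 : s2.nat aCD = s1.nat aCD := hf2.nat _ rfl
  have k9 : s2.real rT 0 = t := by rw [hf2.real _ rfl]
  have k10 : s1.nat nBL = s.nat nBL := hf1.nat _ rfl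
  have k11 : s1.nat aBL = s.nat aBL := hf1.nat _ rfl
  have hd2 : sdist I s2 = sdist I s := sdist_congr k1 k2
  have hS2 := h.congr (hc1.frame hf2 rfl) k1 k2 k3 k4 k5 k6 k7
  have hB : ∀ lo hi, Between I s2 L w lo hi = Between I s L w lo hi := by
    intro lo hi; funext i j; simp only [Between, hd2]
  have hE := h.enum
  refine Ends.cond (n := X * 500 + 290) (fun hfd => ?_) (fun hfd => ?_) (by simp; omega)
  · simp only [Test.Holds, NatExpr.eval] at hfd
    rcases h2 with ⟨-, hG⟩ | ⟨h2, -⟩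
    swap
    · omega
    refine Ends.seq (ends_sFilter (R := Between I s L w lo hi) (P := (t ≤ ·)) hS2.hX
      (by rw [k4, k5]; exact hE) (by simp) ?_) (n' := X * 200 + 200) ?_ (by omega)
    · intro s' e1 e2 e3 e4 e5
      simp only [Test.Holds, RealExpr.eval, NatExpr.eval, e1, e2, e3, e4, e5, k9, not_le, sdist]
    · rintro s3 hf3 ⟨g1, g2⟩
      have l1 : sdist I s3 = sdist I s := by
        rw [← hd2]; exact sdist_congr (hf3.nat _ rfl) (hf3.nat _ rfl)
      have hB3 : ∀ lo hi, Between I s3 L w lo hi = Between I s L w lo hi := by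
        intro lo hi; funext i j; simp only [Between, l1]
      have l2 : s3.nat nPX = s.nat nPX := (hf3.nat _ rfl).trans k3
      have l3 : s3.nat aPI = s.nat aPI := (hf3.nat _ rfl).trans k4
      have l4 : s3.nat aPS = s.nat aPS := (hf3.nat _ rfl).trans k5
      have l5 : s3.nat aBS = s.nat aBS := (hf3.nat _ rfl).trans k6
      have l6 : s3.nat aPerm = s.nat aPerm := (hf3.nat _ rfl).trans k7
      rw [k4, k5, hd2] at g2
      refine (ends_sFinish_ok (X := X) (Y := s3.nat nQX 0) (lo := lo) (hi := t)
        (R := Between I s L w lo hi) (hS2.ctx.frame hf3 rfl) t1 (by rw [l2, h.hX]) rfl (by omega)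
        (by rw [l3, l4]; exact hE) (fun i j hij => hij.1) ?_ ?_ ?_ ?_).post ?_
      · rw [hB3]
        rw [hd2] at g1
        convert g1 using 1
        funext i j
        simp only [Between, not_le, eq_iff_iff]
        constructor
        · rintro ⟨m1, m2, m3, m4⟩; exact ⟨⟨m1, m2, m3, m4.trans t2⟩, m4⟩
        · rintro ⟨⟨m1, m2, m3, m4⟩, m5⟩; exact ⟨m1, m2, m3, m5⟩
      · rw [hB3]
        rintro i j ⟨m1, m2, m3, m4⟩; exact ⟨m1, m2, m3, m4.trans t2⟩
      · rw [l5, l1]; exact h.bs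
      · rw [l5, l6]; exact h.perm
      · intro s4 hf4 h4
        refine ⟨lo, t, _, h4, hlo, hG.congr ?_ ?_, by omega⟩
        · rw [hf4.nat _ rfl, hf3.nat _ rfl]
        · rw [hf4.nat _ rfl, hf3.nat _ rfl]
  · simp only [Test.Holds, NatExpr.eval] at hfd
    rcases h2 with ⟨h2, -⟩ | ⟨-, i1, i2, hnf⟩
    · omega
    refine Ends.seq (n := X * 40 + 30) (n' := X * 260 + 240)
      (R := fun s' => (∀ z < X, s'.nat aBS (s.nat aPI z) = s1.nat aCD (s.nat aPI z)) ∧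
        ∀ i, (∀ z < X, s.nat aPI z ≠ i) → s'.nat aBS i = s.nat aBS i)
      ((Ends.forUp (k := 20) (a := 0) (b := X)
      (fun z s' => (∀ y < z, s'.nat aBS (s.nat aPI y) = s1.nat aCD (s.nat aPI y)) ∧
        ∀ i, (∀ z < X, s.nat aPI z ≠ i) → s'.nat aBS i = s.nat aBS i)
      rfl (Nat.zero_le _) rfl ?_ ?_ ?_ ?_).post fun s' _ h => h.1) ?_ (by omega)
    · intro s' hf
      have e : s'.nat nPX = _ := hf.nat _ rfl
      simp [e, hS2.hX]
    · exact ⟨fun y hy => absurd hy (by omega), fun i _ => by simp [k6]⟩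
    · rintro z s' - hz hf hzz ⟨m1, m2⟩
      have f1 : s'.nat aPI = _ := hf.nat _ rfl
      have f2 : s'.nat aCD = _ := hf.nat _ rfl
      refine Ends.straight rfl (by simp) ?_
      simp only [Program.run, State.nat_setNat_ne, State.nat_setNat_same, NatExpr.eval, ne_eq,
        Nat.reduceEqDiff, not_false_eq_true, hzz, f1, f2, k4, k8]
      refine ⟨fun y hy => ?_, fun i hi => ?_⟩
      · by_cases hyz : s.nat aPI y = s.nat aPI z
        · rw [hyz, Function.update_self]
        · rw [Function.update_of_ne hyz]
          refine m1 y ?_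
          rcases Nat.lt_succ_iff_lt_or_eq.1 hy with hy | rfl
          · exact hy
          · exact absurd rfl hyz
      · rw [Function.update_of_ne (Ne.symm (hi z hz))]; exact m2 i hi
    · simp; omega
    rintro s3 hf3 ⟨p1, p2⟩
    have l1 : sdist I s3 = sdist I s := by
      rw [← hd2]; exact sdist_congr (hf3.nat _ rfl) (hf3.nat _ rfl)
    have l2 : s3.nat nPX = s.nat nPX := (hf3.nat _ rfl).trans k3
    have l3 : s3.nat aPI = s.nat aPI := (hf3.nat _ rfl).trans k4
    have l4 : s3.nat aPS = s.nat aPS := (hf3.nat _ rfl).trans k5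
    have l7 : s3.real rT 0 = t := by rw [hf3.real _ rfl, k9]
    refine Ends.seq (ends_sFilter (R := Between I s L w lo hi) (P := (· ≤ t)) (l2 ▸ h.hX)
      (by rw [l3, l4]; exact hE) (by simp) ?_) (n' := X * 200 + 200) ?_ (by omega)
    · intro s' e1 e2 e3 e4 e5
      simp only [Test.Holds, RealExpr.eval, NatExpr.eval, e1, e2, e3, e4, e5, l7, not_le, sdist]
    · rintro s4 hf4 ⟨g1, g2⟩
      have j1 : sdist I s4 = sdist I s := by
        rw [← l1]; exact sdist_congr (hf4.nat _ rfl) (hf4.nat _ rfl)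
      have hB3 : ∀ lo hi, Between I s4 L w lo hi = Between I s L w lo hi := by
        intro lo hi; funext i j; simp only [Between, j1]
      have j2 : s4.nat nPX = s.nat nPX := (hf4.nat _ rfl).trans l2
      have j3 : s4.nat aPI = s.nat aPI := (hf4.nat _ rfl).trans l3
      have j4 : s4.nat aPS = s.nat aPS := (hf4.nat _ rfl).trans l4
      have j5 : s4.nat aBS = s3.nat aBS := hf4.nat _ rfl
      have j6 : s4.nat aPerm = s.nat aPerm := (hf4.nat _ rfl).trans ((hf3.nat _ rfl).trans k7)
      rw [l3, l4, l1] at g2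
      -- The base codes are rewritten only for points with remaining pairs, so the points already in
      -- `aPerm` stay under their correct codes.
      have hno : ∀ i < L, (∀ j, ¬ Between I s L w lo hi i j) → s3.nat aBS i = s.nat aBS i := by
        refine fun i hi hij => p2 i fun z hz hzi => hij (s.nat aPS z) ?_
        rw [← hzi]; exact hE.1 z hz
      refine (ends_sFinish_ok (X := X) (Y := s4.nat nQX 0) (lo := t) (hi := hi)
        (R := Between I s L w lo hi) ((hS2.ctx.frame hf3 rfl).frame hf4 rfl) t2
        (by rw [j2, h.hX]) rfl (by omega)
        (by rw [j3, j4]; exact hE) (fun i j hij => hij.1) ?_ ?_ ?_ ?_).post ?_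
      · rw [hB3]
        rw [l1] at g1
        convert g1 using 1
        funext i j
        simp only [Between, not_le, eq_iff_iff]
        constructor
        · rintro ⟨m1, m2, m3, m4⟩; exact ⟨⟨m1, m2, t1.trans m3, m4⟩, m3⟩
        · rintro ⟨⟨m1, m2, m3, m4⟩, m5⟩; exact ⟨m1, m2, m5, m4⟩
      · rw [hB3]
        rintro i j ⟨m1, m2, m3, m4⟩; exact ⟨m1, m2, t1.trans m3, m4⟩
      · rw [j5, j1]
        intro i hi
        by_cases hex : ∃ z < X, s.nat aPI z = i
        · obtain ⟨z, hz, rfl⟩ := hex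
          rw [p1 z hz, hcd z hz]
        · push Not at hex
          rw [p2 i hex, h.bs i hi]
          refine code_congr fun j hj => ⟨fun h1 => h1.trans t1.le, fun h1 => ?_⟩
          by_contra h2
          obtain ⟨z, hz, hz', -⟩ := hE.2.1 i j ⟨hi, hj, not_le.1 h2, h1.trans_lt t2⟩
          exact hex z hz hz'
      · rw [j5, j6]
        refine ⟨fun c hc hne => ?_, fun i hi hij => ?_⟩
        · obtain ⟨i, hi, m1, m2, m3⟩ := h.perm.1 c hc hne
          exact ⟨i, hi, m1, by rw [hno i hi m3, m2], m3⟩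
        · rw [hno i hi hij]; exact h.perm.2 i hi hij
      · intro s5 hf5 h5
        refine ⟨t, hi, _, h5, hnf, hhi.congr ?_ ?_, by omega⟩
        · rw [hf5.nat _ rfl, hf4.nat _ rfl, hf3.nat _ rfl, i1, k10]
        · rw [hf5.nat _ rfl, hf4.nat _ rfl, hf3.nat _ rfl, i2, k11]

/-- The search for the optimum among the distances. -/
def sSearch : Program := .loop (.natLt (.lit 0) (.var nPX)) sRound

/-- The output list is an optimal solution. -/
def Optimal (I : KSupplier) (kk : ℕ) (s : State) : Prop :=
  ∃ r, Good I kk s r ∧ ∀ t, Feas I kk t → r ≤ t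

/-- If no distance lies strictly between `lo` and `hi`, distances at most `t < hi` are at most `lo`.
-/
theorem Sides.feas {o L w kk : ℕ} {s : State} (h : Sides I o (s.nat sOL 0) L (s.nat sOS 0) w)
    {lo hi t : ℝ} (hno : ∀ i j, ¬ Between I s L w lo hi i j) (ht : t < hi) (hF : Feas I kk t) :
    Feas I kk lo := by
  obtain ⟨T, hT, hTk, hTc⟩ := hF
  refine ⟨T, hT, hTk, fun q hq => ?_⟩
  obtain ⟨j, hj, hj'⟩ := hTc q hq
  have hjm := Finset.mem_range.1 (hT hj)
  refine ⟨j, hj, ?_⟩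
  by_contra hlt
  rw [not_le] at hlt
  rcases h with ⟨-, e1, e2, e3, e4⟩ | ⟨-, e1, e2, e3, e4⟩
  · refine hno q j ⟨by omega, by omega, ?_⟩
    simp only [sdist, e1, e3, zero_add]
    exact ⟨hlt, hj'.trans_lt ht⟩
  · refine hno j q ⟨by omega, by omega, ?_⟩
    simp only [sdist, e1, e3, zero_add]
    rw [dist_comm] at hlt hj'
    exact ⟨hlt, hj'.trans_lt ht⟩

/-- The number of rounds is not bounded in terms of `w` alone. As long as `X ≥ W`, the cost `W` of
the decision is charged to `X`, which shrinks geometrically. Once `X < W` there are fewer than `W`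
rounds left, which cost at most about `W * W`. The potential adds the two accounts. -/
theorem ends_sSearch {kk L w X : ℕ} {lo hi : ℝ} {s : State} (h : SOK I kk L w lo hi X s)
    (hlo : ¬ Feas I kk lo) (hhi : Good I kk s hi) :
    Ends I ε sSearch s (300000 * (X + 64 ^ w * 64 ^ w)) fun s' => Optimal I kk s' := by
  set W := 64 ^ w with hW
  have hW1 : 1 ≤ W := Nat.one_le_pow _ _ (by omega)
  refine (Ends.loop (m := 230000 * X + 9100 * (W * min X W) + 10)
    (fun s' => ∃ lo hi X, SOK I kk L w lo hi X s' ∧ ¬ Feas I kk lo ∧ Good I kk s' hi)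
    (fun s' => 230000 * s'.nat nPX 0 + 9100 * (W * min (s'.nat nPX 0) W)) ?_ ?_ ?_).mono ?_ ?_
  · exact ⟨lo, hi, X, h, hlo, hhi⟩
  · rintro s' - ⟨lo, hi, X, h, hlo, hhi⟩ hb
    simp only [Test.Holds, NatExpr.eval, h.hX] at hb
    refine ⟨_, (ends_sRound h hb hlo hhi).post ?_⟩
    rintro s'' - ⟨lo', hi', X', h', hlo', hhi', hX'⟩
    refine ⟨⟨lo', hi', X', h', hlo', hhi'⟩, ?_⟩
    rw [h.hX, h'.hX]
    simp only [Test.steps, NatExpr.steps]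
    -- If `X < W`, the second account falls by at least `W` as `X' < X`. Otherwise the fall of the
    -- first one by 230000·X/16 suffices for the whole round.
    have hm : W * min X' W + (if X < W then W else 0) ≤ W * min X W := by
      split_ifs with hXW
      · rw [min_eq_left hXW.le]
        have : min X' W + 1 ≤ X := by omega
        have := Nat.mul_le_mul_left W this
        rw [Nat.mul_add] at this
        omega
      · exact Nat.mul_le_mul_left _ (by omega)
    split_ifs at hm with hXW <;> omega
  · rw [h.hX]; simp
  · have : W * min X W ≤ W * W := Nat.mul_le_mul_left _ (min_le_right _ _)
    have : 1 ≤ W * W := Nat.mul_pos hW1 hW1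
    omega
  · rintro s' - ⟨⟨lo, hi, X, h, hlo, hhi⟩, hb⟩
    simp only [Test.Holds, NatExpr.eval, h.hX] at hb
    obtain rfl : X = 0 := by omega
    refine ⟨hi, hhi, fun t ht => ?_⟩
    by_contra hlt
    refine hlo (h.ctx.sides.feas (fun i j hij => ?_) (not_le.1 hlt) ht)
    obtain ⟨z, hz, -⟩ := h.enum.2.1 i j hij
    omega

theorem Enumerates.push {R R' : ℕ → ℕ → Prop} {n i j : ℕ} {x y : ℕ → ℕ} (h : Enumerates R n x y)
    (hij : ¬ R i j) (hR : ∀ u v, R' u v ↔ R u v ∨ u = i ∧ v = j) :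
    Enumerates R' (n + 1) (Function.update x n i) (Function.update y n j) := by
  obtain ⟨h1, h2, h3⟩ := h
  have hnew : ∀ z < n, ¬ (x z = i ∧ y z = j) := by
    rintro z hz ⟨e1, e2⟩
    have := h1 z hz
    rw [e1, e2] at this
    exact hij this
  refine ⟨fun z hz => ?_, fun u v huv => ?_, fun z hz z' hz' e1 e2 => ?_⟩
  · rw [hR]
    by_cases hzn : z = n
    · subst hzn; simp
    · rw [Function.update_of_ne hzn, Function.update_of_ne hzn]
      exact .inl (h1 z (by omega))
  · rcases (hR u v).1 huv with huv | ⟨rfl, rfl⟩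
    · obtain ⟨z, hz, hz'⟩ := h2 u v huv
      exact ⟨z, by omega, by rwa [Function.update_of_ne hz.ne, Function.update_of_ne hz.ne]⟩
    · exact ⟨n, by omega, by simp⟩
  · by_cases hzn : z = n <;> by_cases hzn' : z' = n
    · rw [hzn, hzn']
    · subst hzn
      rw [Function.update_self, Function.update_of_ne hzn'] at e1 e2
      exact absurd ⟨e1.symm, e2.symm⟩ (hnew z' (by omega))
    · subst hzn'
      rw [Function.update_self, Function.update_of_ne hzn] at e1 e2
      exact absurd ⟨e1, e2⟩ (hnew z (by omega))
    · rw [Function.update_of_ne hzn, Function.update_of_ne hzn'] at e1 e2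
      exact h3 z (by omega) z' (by omega) e1 e2

/-- All pairs of a point of the long side and a point of the short side. -/
def sPairs : Program :=
  assign nPX (.lit 0) ;;
  forUp sI (.lit 0) (.var sNL) (forUp sJ (.lit 0) (.var sNS)
    (.setNat aPI (.var nPX) (.var sI) ;; .setNat aPS (.var nPX) (.var sJ) ;;
      assign nPX (.add (.var nPX) (.lit 1))))

theorem ends_sPairs {s : State} {L w : ℕ} (hL : s.nat sNL 0 = L) (hw : s.nat sNS 0 = w) :
    Ends I ε sPairs s (L * w * 40 + L * 40 + 40) fun s' => s'.nat nPX 0 = L * w ∧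
      Enumerates (fun i j => i < L ∧ j < w) (L * w) (s'.nat aPI) (s'.nat aPS) := by
  have hb : L * (w * 32 + 36) = L * w * 32 + L * 36 := by ring
  refine Ends.step (n' := L * (w * 32 + 36) + 20) rfl ((Ends.forUp (k := w * 32 + 20) (a := 0) (b := L)
    (fun i s' => s'.nat nPX 0 = i * w ∧
      Enumerates (fun u v => u < i ∧ v < w) (i * w) (s'.nat aPI) (s'.nat aPS))
    rfl (Nat.zero_le _) rfl ?_ ?_ ?_ ?_).post ?_) (by simp; omega)
  · intro s' hf
    have e : s'.nat sNL = _ := hf.nat _ rfl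
    simp [e, hL]
  · refine ⟨by simp, fun z hz => absurd hz (by omega), fun u v h => absurd h.1 (by omega),
      fun z hz => absurd hz (by omega)⟩
  · rintro i s1 - hi hf1 hii ⟨h1, h2⟩
    have a1 : s1.nat sNS = _ := hf1.nat _ rfl
    simp at a1
    refine (Ends.forUp (k := 20) (a := 0) (b := w)
      (fun j s' => s'.nat nPX 0 = i * w + j ∧ Enumerates (fun u v => u < i ∧ v < w ∨ u = i ∧ v < j)
        (i * w + j) (s'.nat aPI) (s'.nat aPS))
      rfl (Nat.zero_le _) rfl ?_ ?_ ?_ ?_).post ?_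
    · intro s' hf
      have e : s'.nat sNS = _ := hf.nat _ rfl
      simp [e, a1, hw]
    · simpa [h1] using h2
    · rintro j s2 - hj hf2 hjj ⟨h3, h4⟩
      have b1 : s2.nat sI = _ := hf2.nat _ rfl
      refine Ends.straight rfl (by simp) ⟨by simp [h3]; ring, ?_⟩
      simp only [Program.run, State.nat_setNat_ne, State.nat_setNat_same, NatExpr.eval, ne_eq,
        Nat.reduceEqDiff, not_false_eq_true, hjj, b1, hii, h3]
      refine h4.push (by omega) fun u v => ?_
      omega
    · simp
    · rintro s2 - ⟨⟨h3, h4⟩, -⟩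
      have e : (i + 1) * w = i * w + w := by ring
      refine ⟨by simp [h3, e], ?_⟩
      simp only [State.nat_setNat_ne, ne_eq, Nat.reduceEqDiff, not_false_eq_true, e]
      convert h4 using 1
      funext u v
      rw [eq_iff_iff]
      omega
  · have e : L * (w * 32 + 20 + 2 + 10) + L * 4 = L * (w * 32 + 36) := by ring
    simp; omega
  · rintro s' - ⟨h, -⟩; exact h

/-- Preparation of the search. -/
def sInit : Program :=
  .setNat aPw (.lit 0) (.lit 1) ;;
  forUp sZ (.lit 0) (.var sNS) (.setNat aPw (.add (.var sZ) (.lit 1))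
    (.add (.get aPw (.var sZ)) (.get aPw (.var sZ)))) ;;
  assign nPat (.get aPw (.var sNS)) ;;
  fill sZ aPerm (.var nPat) (.lit 0) ;; fill sZ aBS (.var sNL) (.lit 0) ;; sPairs ;;
  .setNat aBL (.lit 0) .numClients ;; assign nBL (.lit 1)

theorem ends_sInit {s : State} {kk L w : ℕ}
    (hS : Sides I (s.nat sOr 0) (s.nat sOL 0) L (s.nat sOS 0) w) (hL : s.nat sNL 0 = L)
    (hw : s.nat sNS 0 = w) (hk : s.nat nKK 0 = kk) (hkk : kk ≤ w) (hk1 : 1 ≤ kk) (hL0 : 0 < L) :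
    Ends I ε sInit s (500 * (L * w + 64 ^ w)) fun s' => ∃ lo hi,
      SOK I kk L w lo hi (L * w) s' ∧ ¬ Feas I kk lo ∧ Good I kk s' hi := by
  have hw0 : 0 < w := by omega
  have hVW : 2 ^ w ≤ 64 ^ w := Nat.pow_le_pow_left (by omega) w
  have hw1 : w + 1 ≤ 2 ^ w := Nat.lt_two_pow_self
  have hLw : L ≤ L * w := Nat.le_mul_of_pos_right _ hw0
  set V := 2 ^ w with hV
  set W := 64 ^ w with hW
  refine Ends.step (n' := 400 * (L * w) + 400 * W + 20) rfl (Ends.seq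
    (R := fun s' => ∀ j ≤ w, s'.nat aPw j = 2 ^ j) (n := w * 40 + 20)
    (n' := 400 * (L * w) + 350 * W) ((Ends.forUp (k := 22) (a := 0) (b := w)
      (fun z s' => ∀ j ≤ z, s'.nat aPw j = 2 ^ j) rfl (Nat.zero_le _) rfl ?_ ?_ ?_ ?_).post
      fun s' _ h => h.1) ?_ (by omega)) (by simp; omega)
  · intro s' hf
    have e : s'.nat sNS = _ := hf.nat _ rfl
    simp [e, hw]
  · intro j hj
    obtain rfl : j = 0 := by omega
    simp
  · rintro z s' - hz hf hzz h
    refine Ends.straight rfl (by simp) fun j hj => ?_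
    by_cases hjz : j = z + 1
    · subst hjz
      simp [hzz, h z le_rfl]; ring
    · simpa [hzz, Function.update_of_ne hjz] using h j (by omega)
  · simp; omega
  rintro s1 hf1 h1
  have a1 : s1.nat sNS = _ := hf1.nat _ rfl
  have a2 : s1.nat sNL = _ := hf1.nat _ rfl
  simp at a1 a2
  refine Ends.step (n' := 400 * (L * w) + 300 * W) rfl ?_ (by simp; omega)
  set s1' := (assign nPat (.get aPw (.var sNS))).run I ε s1 with hs1'
  have b1 : s1'.nat nPat 0 = V := by simp [hs1', a1, hw, h1 w le_rfl, hV]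
  have b2 : s1'.nat sNL 0 = L := by simp [hs1', a2, hL]
  have b3 : s1'.nat sNS 0 = w := by simp [hs1', a1, hw]
  have b4 : ∀ j ≤ w, s1'.nat aPw j = 2 ^ j := by simpa [hs1'] using h1
  have b5 : ∀ A, A ≠ 60 → A ≠ 65 → A ≠ 64 → s1'.nat A = s.nat A := by
    intro A h1 h2 h3
    rw [hs1', run_nat (by simp [Program.writesNat, h3]) rfl,
      hf1.nat _ (by simp [forUp, Program.writesNat, h1, h2]),
      run_nat (by simp [Program.writesNat, h1]) rfl]
  refine Ends.seq ((ends_fill (X := V) (g := fun _ => 0) (by simp) (fun s' hf => by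
    have e : s'.nat nPat = _ := hf.nat _ rfl
    simp [e, b1]) (fun s' z hf hzz hz => by simp)).le le_rfl)
    (n' := 400 * (L * w) + 270 * W) ?_ (by simp; omega)
  intro s2 hf2 h2
  have c1 : s2.nat sNL = _ := hf2.nat _ rfl
  refine Ends.seq ((ends_fill (X := L) (g := fun _ => 0) (by simp) (fun s' hf => by
    have e : s'.nat sNL = _ := hf.nat _ rfl
    simp [e, c1, b2]) (fun s' z hf hzz hz => by simp)).le le_rfl)
    (n' := 370 * (L * w) + 200 * W) ?_ (by simp; omega)
  intro s3 hf3 h3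
  have d1 : s3.nat sNL = _ := hf3.nat _ rfl
  have d2 : s3.nat sNS = s1'.nat sNS := (hf3.nat _ rfl).trans (hf2.nat _ rfl)
  refine Ends.seq (ends_sPairs (L := L) (w := w) (by rw [d1, c1, b2]) (by rw [d2, b3]))
    (n' := 20) ?_ (by omega)
  rintro s4 hf4 ⟨h4, h5⟩
  have e0 : ∀ A, A ≠ 60 → A ≠ 65 → A ≠ 64 → A ≠ 61 → A ≠ 58 → A ≠ 55 → A ≠ 56 → A ≠ 57 → A ≠ 71 →
      A ≠ 72 → s4.nat A = s.nat A := by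
    intro A i1 i2 i3 i4 i5 i6 i7 i8 i9 i10
    rw [hf4.nat _ (by simp [sPairs, forUp, Program.writesNat, *]),
      hf3.nat _ (by simp [fill, forUp, Program.writesNat, *]),
      hf2.nat _ (by simp [fill, forUp, Program.writesNat, *]), b5 A i1 i2 i3]
  refine Ends.straight rfl (by simp) ?_
  set s5 := (Program.setNat aBL (.lit 0) .numClients ;; assign nBL (.lit 1)).run I ε s4 with hs5
  have f0 : ∀ A, A ≠ 45 → A ≠ 46 → s5.nat A = s4.nat A := by
    intro A i1 i2
    rw [hs5, run_nat (by simp [Program.writesNat, i1, i2]) rfl]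
  have f1 : s5.nat aPw = s1'.nat aPw := by
    rw [f0 _ (by simp) (by simp), hf4.nat _ rfl, hf3.nat _ rfl, hf2.nat _ rfl]
  have f2 : s5.nat nPat = s1'.nat nPat := by
    rw [f0 _ (by simp) (by simp), hf4.nat _ rfl, hf3.nat _ rfl, hf2.nat _ rfl]
  have f3 : s5.nat aBS = s3.nat aBS := by rw [f0 _ (by simp) (by simp), hf4.nat _ rfl]
  have f4 : s5.nat aPerm = s2.nat aPerm := by
    rw [f0 _ (by simp) (by simp), hf4.nat _ rfl, hf3.nat _ rfl]
  have g : ∀ A, A = 54 ∨ A = 50 ∨ A = 51 ∨ A = 52 ∨ A = 53 ∨ A = 20 → s5.nat A = s.nat A := by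
    rintro A hA
    rw [f0 A (by omega) (by omega), e0 A]
    all_goals omega
  have hd : sdist I s5 = sdist I s := sdist_congr (g _ (by simp)) (g _ (by simp))
  -- Neither end of the interval is ever computed; the program keeps only the pairs in between. With
  -- −1 and a number above all distances, every pair is in between, and the first facility alone is
  -- a solution at the upper end.
  set hi : ℝ := 1 + ∑ q ∈ Finset.range I.numClients, ∑ j ∈ Finset.range I.numFacilities,
    dist (I.point q) (I.point (I.numClients + j)) with hhi
  have hub : ∀ q < I.numClients, ∀ j < I.numFacilities,
      dist (I.point q) (I.point (I.numClients + j)) < hi := by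
    intro q hq j hj
    have h1 := Finset.single_le_sum (f := fun j => dist (I.point q) (I.point (I.numClients + j)))
      (fun _ _ => dist_nonneg) (Finset.mem_range.2 hj)
    have h2 := Finset.single_le_sum (f := fun q => ∑ j ∈ Finset.range I.numFacilities,
      dist (I.point q) (I.point (I.numClients + j)))
      (fun _ _ => Finset.sum_nonneg fun _ _ => dist_nonneg) (Finset.mem_range.2 hq)
    linarith
  have hhi0 : 0 < hi := by
    have : 0 ≤ ∑ q ∈ Finset.range I.numClients, ∑ j ∈ Finset.range I.numFacilities,
      dist (I.point q) (I.point (I.numClients + j)) :=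
      Finset.sum_nonneg fun _ _ => Finset.sum_nonneg fun _ _ => dist_nonneg
    linarith
  have hn : 0 < I.numClients ∧ 0 < I.numFacilities := by
    rcases hS with ⟨-, -, e2, -, e4⟩ | ⟨-, -, e2, -, e4⟩ <;> omega
  have hBw : Between I s5 L w (-1) hi = fun i j => i < L ∧ j < w := by
    funext i j
    rw [eq_iff_iff, Between, hd]
    refine ⟨fun h => ⟨h.1, h.2.1⟩, fun ⟨hi1, hj1⟩ => ⟨hi1, hj1, ?_, ?_⟩⟩
    · have : 0 ≤ sdist I s i j := dist_nonneg
      linarith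
    · rcases hS with ⟨-, e1, e2, e3, e4⟩ | ⟨-, e1, e2, e3, e4⟩
      · simpa [sdist, e1, e3] using hub i (by omega) j (by omega)
      · simpa [sdist, e1, e3, dist_comm] using hub j (by omega) i (by omega)
  refine ⟨-1, hi, ⟨⟨?_, by rw [g _ (by simp), hL], by rw [g _ (by simp), hw], ?_,
    by rw [f2, b1], by rw [g _ (by simp), hk], hkk, hL0, hw0⟩, by linarith,
    by rw [f0 _ (by simp) (by simp), h4], ?_, ?_, ?_⟩, ?_, ?_⟩
  · rw [g 54 (by simp), g 50 (by simp), g 51 (by simp)]; exact hS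
  · intro j hj; rw [f1]; exact b4 j hj.le
  · rw [hBw, f0 _ (by simp) (by simp), f0 _ (by simp) (by simp)]; exact h5
  · intro i hi1
    rw [f3, h3 i hi1, hd]
    refine (code_false fun j _ => ?_).symm
    have : 0 ≤ sdist I s i j := dist_nonneg
    linarith
  · rw [hBw, f4]
    exact ⟨fun c hc hne => absurd (h2 c hc) hne, fun i hi1 hno => absurd ⟨hi1, hw0⟩ (hno 0)⟩
  · rintro ⟨T, -, -, hT⟩
    obtain ⟨j, -, hj⟩ := hT 0 hn.1
    have : 0 ≤ dist (I.point 0) (I.point (I.numClients + j)) := dist_nonneg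
    linarith
  · have k1 : s5.nat nBL 0 = 1 := by simp [hs5]
    have k2 : s5.nat aBL 0 = I.numClients := by simp [hs5]
    refine ⟨by omega, fun z hz => ?_, fun q hq => ⟨0, by omega, ?_⟩⟩
    · obtain rfl : z = 0 := by omega
      rw [k2]; omega
    · rw [k2]; exact (hub q hq 0 hn.2).le

theorem ends_sSolve {s : State} {kk L w : ℕ}
    (hS : Sides I (s.nat sOr 0) (s.nat sOL 0) L (s.nat sOS 0) w) (hL : s.nat sNL 0 = L)
    (hw : s.nat sNS 0 = w) (hk : s.nat nKK 0 = kk) (hkk : kk ≤ w) (hk1 : 1 ≤ kk) (hL0 : 0 < L) :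
    Ends I ε (sInit ;; sSearch) s (300500 * (L * w + 64 ^ w * 64 ^ w)) fun s' =>
      Optimal I kk s' := by
  refine Ends.seq (ends_sInit hS hL hw hk hkk hk1 hL0) (n' := 300000 * (L * w + 64 ^ w * 64 ^ w)) ?_ ?_
  · rintro s1 - ⟨lo, hi, h1, h2, h3⟩
    exact ends_sSearch h1 h2 h3
  · have : 64 ^ w ≤ 64 ^ w * 64 ^ w := Nat.le_mul_of_pos_left _ (by positivity)
    omega

end RealRAM

/-! ### A constant factor approximation -/


namespace RealRAM

variable {I : KSupplier} {ε : ℝ}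

notation "rCD" => (4 : ℕ)
notation "rS" => (5 : ℕ)
notation "rR" => (6 : ℕ)
notation "gB" => (80 : ℕ)
notation "aCen" => (81 : ℕ)
notation "gI" => (82 : ℕ)
notation "gP" => (83 : ℕ)
notation "gQ" => (84 : ℕ)
notation "gF" => (85 : ℕ)
notation "gX" => (86 : ℕ)

/-- The distance of two input points. -/
noncomputable abbrev pd (I : KSupplier) (p q : ℕ) : ℝ := dist (I.point p) (I.point q)

/-- The point `gB` becomes a center, and the next point farthest from the centers is found. -/
def gStep : Program :=
  .setNat aCen (.var gI) (.var gB) ;;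
  forUp gQ (.lit 0) .numClients
    (.cond (.neg (.conj (.natLe (.lit 1) (.var gI))
        (.realLe (.get rCD (.var gQ)) (.dist (.var gQ) (.var gB)))))
      (.setReal rCD (.var gQ) (.dist (.var gQ) (.var gB))) .skip) ;;
  assign gP (.lit 0) ;;
  forUp gQ (.lit 0) .numClients
    (.cond (.realLt (.get rCD (.var gP)) (.get rCD (.var gQ))) (assign gP (.var gQ)) .skip) ;;
  assign gB (.var gP)

/-- Farthest point traversal. -/
def gonzalez : Program := assign gB (.lit 0) ;; forUp gI (.lit 0) (.var nKK) gStep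

/-- The result of farthest point traversal with `i` centers `c`; `g` is the client that is
farthest from them. -/
structure Traversal (I : KSupplier) (i : ℕ) (c : ℕ → ℕ) (g : ℕ) (D : ℕ → ℝ) : Prop where
  cen_lt : ∀ x < i, c x < I.numClients
  far_lt : g < I.numClients
  attained : 0 < i → ∀ q < I.numClients, ∃ x < i, D q = pd I q (c x)
  le : ∀ q < I.numClients, ∀ x < i, D q ≤ pd I q (c x)
  max : 0 < i → ∀ q < I.numClients, D q ≤ D g
  sep : ∀ x y, x < y → y < i → ∀ q < I.numClients, D q ≤ pd I (c x) (c y)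

/-- The separation survives because the new center is the farthest client: its distance to each old
center is at least the old covering radius, and covering radii only decrease. -/
theorem ends_gStep {s : State} {i : ℕ} (hi : s.nat gI 0 = i)
    (h : Traversal I i (s.nat aCen) (s.nat gB 0) (s.real rCD)) :
    Ends I ε gStep s (I.numClients * 80 + 100) fun s' =>
      Traversal I (i + 1) (s'.nat aCen) (s'.nat gB 0) (s'.real rCD) := by
  have hn := h.far_lt
  set n := I.numClients with hnn
  set g := s.nat gB 0 with hg
  refine Ends.step (n' := n * 80 + 90) rfl (Ends.seq (n := n * 40 + 20) (n' := n * 40 + 50)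
    -- In the first round `rCD` has no meaning yet and is overwritten unconditionally; this replaces
    -- an initial value of infinity.
    ((Ends.forUp (k := 28) (a := 0) (b := n) (fun z s' =>
      (∀ q < z, s'.real rCD q = if 0 < i ∧ s.real rCD q ≤ pd I q g then s.real rCD q else pd I q g) ∧
      ∀ q, z ≤ q → s'.real rCD q = s.real rCD q)
      rfl (Nat.zero_le _) rfl (fun _ _ => rfl) ?_ ?_ ?_).post fun s' _ h => h.1.1) ?_ (by omega))
    (by simp; omega)
  · exact ⟨fun q hq => absurd hq (by omega), fun q _ => by simp⟩
  · rintro z s' - hz hf hzz ⟨h1, h2⟩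
    have f1 : s'.nat gI = _ := hf.nat _ rfl
    have f2 : s'.nat gB = _ := hf.nat _ rfl
    simp at f1 f2
    refine Ends.straight rfl (by simp) ?_
    simp only [Program.run]
    split_ifs with hc <;> simp only [Test.Holds, NatExpr.eval, RealExpr.eval, hzz, f1, f2, not_lt,
      h2 z le_rfl, hi, ← hg, not_and, not_le, not_not, not_forall] at hc
    · refine ⟨fun q hq => ?_, fun q hq => ?_⟩
      · by_cases hqz : q = z
        · subst hqz
          have : ¬ (0 < i ∧ s.real rCD q ≤ pd I q g) := by
            rintro ⟨h3, h4⟩; exact absurd (hc (by omega)) (not_lt.2 h4)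
          simp [this, hzz, f2, ← hg, pd]
        · simp [hzz, Function.update_of_ne hqz, h1 q (by omega)]
      · simp [hzz, Function.update_of_ne (show q ≠ z by omega), h2 q (by omega)]
    · obtain ⟨h3, h4⟩ := hc
      refine ⟨fun q hq => ?_, fun q hq => by simpa using h2 q (by omega)⟩
      by_cases hqz : q = z
      · subst hqz
        simp only [State.real_setNat, h2 q le_rfl]
        rw [if_pos ⟨by omega, h4⟩]
      · simpa using h1 q (by omega)
  · simp; omega
  intro s1 hf1 h1
  have k1 : s1.nat aCen = _ := hf1.nat _ rfl
  simp [hi, ← hg] at k1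
  refine Ends.step (n' := n * 40 + 40) rfl (Ends.seq (n := n * 40 + 20) (n' := 10)
    (Ends.forUp (k := 20) (a := 0) (b := n) (fun z s' => s'.nat gP 0 < n ∧
      ∀ q < z, s1.real rCD q ≤ s1.real rCD (s'.nat gP 0))
      rfl (Nat.zero_le _) rfl (fun _ _ => rfl) ?_ ?_ ?_) ?_ (by omega))
    (by simp; omega)
  · exact ⟨by simpa using (show 0 < n by omega), fun q hq => absurd hq (by omega)⟩
  · rintro z s' - hz hf hzz ⟨h3, h4⟩
    have f1 : s'.real rCD = _ := hf.real _ rfl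
    simp at f1
    refine Ends.straight rfl (by simp) ?_
    simp only [Program.run]
    split_ifs with hc <;> simp only [Test.Holds, NatExpr.eval, RealExpr.eval, hzz, f1, not_lt] at hc
    · refine ⟨by simpa [hzz] using hz, fun q hq => ?_⟩
      simp only [State.nat_setNat_ne, State.nat_setNat_same, NatExpr.eval, ne_eq, Nat.reduceEqDiff,
        not_false_eq_true, hzz, Function.update_self]
      rcases Nat.lt_succ_iff_lt_or_eq.1 hq with hq | rfl
      · exact (h4 q hq).trans hc.le
      · exact le_rfl
    · refine ⟨by simpa using h3, fun q hq => ?_⟩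
      simp only [State.nat_setNat_ne, ne_eq, Nat.reduceEqDiff, not_false_eq_true]
      rcases Nat.lt_succ_iff_lt_or_eq.1 hq with hq | rfl
      · exact h4 q hq
      · exact hc
  · simp; omega
  rintro s2 hf2 ⟨⟨h3, h4⟩, -⟩
  have k2 : s2.nat aCen = _ := hf2.nat _ rfl
  have k3 : s2.real rCD = _ := hf2.real _ rfl
  simp at k2 k3
  refine Ends.straight rfl (by simp) ?_
  have e1 : ((assign gB (.var gP)).run I ε s2).nat aCen = Function.update (s.nat aCen) i g := by
    simp [k2, k1]
  have e2 : ((assign gB (.var gP)).run I ε s2).nat gB 0 = s2.nat gP 0 := by simp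
  have e3 : ((assign gB (.var gP)).run I ε s2).real rCD = s1.real rCD := by simp [k3]
  rw [e1, e2, e3]
  have hle : ∀ q < n, ∀ x < i, s1.real rCD q ≤ pd I q (s.nat aCen x) := by
    intro q hq x hx
    rw [h1 q hq]
    split_ifs with hc
    · exact h.le q hq x hx
    · rw [not_and, not_le] at hc
      exact (hc (by omega)).le.trans (h.le q hq x hx)
  have hlg : ∀ q < n, s1.real rCD q ≤ pd I q g := by
    intro q hq
    rw [h1 q hq]
    split_ifs with hc
    · exact hc.2
    · exact le_rfl
  have hold : ∀ q < n, 0 < i → s1.real rCD q ≤ s.real rCD q := by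
    intro q hq hi0
    rw [h1 q hq]
    split_ifs with hc
    · exact le_rfl
    · rw [not_and, not_le] at hc; exact (hc hi0).le
  refine ⟨fun x hx => ?_, h3, fun _ q hq => ?_, fun q hq x hx => ?_, fun _ q hq => h4 q hq,
    fun x y hxy hy q hq => ?_⟩
  · by_cases hxi : x = i
    · subst hxi; rw [Function.update_self]; exact h.far_lt
    · rw [Function.update_of_ne hxi]; exact h.cen_lt x (by omega)
  · rw [h1 q hq]
    split_ifs with hc
    · obtain ⟨x, hx, hx'⟩ := h.attained hc.1 q hq
      exact ⟨x, by omega, by rw [Function.update_of_ne hx.ne, hx']⟩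
    · exact ⟨i, by omega, by rw [Function.update_self]⟩
  · by_cases hxi : x = i
    · subst hxi; rw [Function.update_self]; exact hlg q hq
    · rw [Function.update_of_ne hxi]; exact hle q hq x (by omega)
  · rw [Function.update_of_ne (show x ≠ i by omega)]
    by_cases hyi : y = i
    · subst hyi
      rw [Function.update_self]
      refine (hold q hq (by omega)).trans ((h.max (by omega) q hq).trans ?_)
      rw [pd, dist_comm]
      exact h.le g h.far_lt x hxy
    · rw [Function.update_of_ne hyi]
      exact (hold q hq (by omega)).trans (h.sep x y hxy (by omega) q hq)

theorem ends_gonzalez {s : State} {kk : ℕ} (hk : s.nat nKK 0 = kk) (hn : 0 < I.numClients) :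
    Ends I ε gonzalez s (kk * (I.numClients * 80 + 120) + 40) fun s' =>
      Traversal I kk (s'.nat aCen) (s'.nat gB 0) (s'.real rCD) := by
  refine Ends.step (n' := kk * (I.numClients * 80 + 120) + 20) rfl
    ((Ends.forUp (k := I.numClients * 80 + 100) (a := 0) (b := kk)
    (fun i s' => Traversal I i (s'.nat aCen) (s'.nat gB 0) (s'.real rCD))
    rfl (Nat.zero_le _) rfl ?_ ?_ ?_ ?_).post fun s' _ h => h.1) (by simp; omega)
  · intro s' hf
    have e : s'.nat nKK = _ := hf.nat _ rfl
    simp [e, hk]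
  · exact ⟨fun x hx => absurd hx (by omega), by simpa using hn, fun h => absurd h (by omega),
      fun q _ x hx => absurd hx (by omega), fun h => absurd h (by omega),
      fun x y hxy hy => absurd hy (by omega)⟩
  · rintro i s1 - hi hf hii h
    refine (ends_gStep hii h).post ?_
    rintro s2 - h2
    simpa using h2
  · have : kk * (I.numClients * 80 + 100 + 2 + 10) ≤ kk * (I.numClients * 80 + 120) :=
      Nat.mul_le_mul_left _ (by omega)
    simp; omega

/-- Pigeonhole: the `kk` centers together with the farthest client are `kk + 1` points at mutual
distances at least `D g`, and two of them are served by the same facility. -/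
theorem Traversal.le_two_mul {kk g : ℕ} {c : ℕ → ℕ} {D : ℕ → ℝ} (h : Traversal I kk c g D)
    {t : ℝ} (ht : Feas I kk t) : D g ≤ 2 * t := by
  classical
  obtain ⟨T, hT, hTk, hTc⟩ := ht
  let y : ℕ → ℕ := fun x => if x < kk then c x else g
  have hy : ∀ x ∈ Finset.range (kk + 1), y x < I.numClients := by
    intro x hx
    simp only [y]
    split_ifs with hxk
    · exact h.cen_lt x hxk
    · exact h.far_lt
  have hφ : ∀ x, ∃ j, x ∈ Finset.range (kk + 1) →
      j ∈ T ∧ pd I (y x) (I.numClients + j) ≤ t := by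
    intro x
    by_cases hx : x ∈ Finset.range (kk + 1)
    · obtain ⟨j, hj, hj'⟩ := hTc _ (hy x hx)
      exact ⟨j, fun _ => ⟨hj, hj'⟩⟩
    · exact ⟨0, fun h => absurd h hx⟩
  choose φ hφ using hφ
  obtain ⟨x, hx, x', hx', hne, heq⟩ := Finset.exists_ne_map_eq_of_card_lt_of_maps_to
    (s := Finset.range (kk + 1)) (t := T) (f := φ) (by simp; omega) fun x hx => (hφ x hx).1
  have hd : ∀ x x', x < x' → x' < kk + 1 → D g ≤ pd I (y x) (y x') := by
    intro x x' hxx hx'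
    have e : y x = c x := if_pos (by omega)
    rw [e]
    by_cases hx'k : x' < kk
    · rw [show y x' = c x' from if_pos hx'k]
      exact h.sep x x' hxx hx'k g h.far_lt
    · rw [show y x' = g from if_neg hx'k, pd, dist_comm]
      exact h.le g h.far_lt x (by omega)
  have htri : pd I (y x) (y x') ≤ t + t := by
    refine (dist_triangle_right _ _ (I.point (I.numClients + φ x))).trans ?_
    refine add_le_add (hφ x hx).2 ?_
    rw [heq]; exact (hφ x' hx').2
  rcases lt_or_gt_of_ne hne with h1 | h1
  · have := hd x x' h1 (Finset.mem_range.1 hx'); linarith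
  · have := hd x' x h1 (Finset.mem_range.1 hx)
    rw [pd, dist_comm] at this
    simp only [pd] at htri
    linarith

/-- The largest distance of a client to its nearest facility. -/
def farthest : Program :=
  rassign rS (.cast (.lit 0)) ;;
  forUp gQ (.lit 0) .numClients
    (assign gP (.lit 0) ;;
      forUp gI (.lit 0) .numFacilities
        (.cond (.realLt (.dist (.var gQ) (.add .numClients (.var gI)))
            (.dist (.var gQ) (.add .numClients (.var gP)))) (assign gP (.var gI)) .skip) ;;
      .cond (.realLt (.var rS) (.dist (.var gQ) (.add .numClients (.var gP))))
        (rassign rS (.dist (.var gQ) (.add .numClients (.var gP)))) .skip)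

theorem ends_farthest {s : State} (hm : 0 < I.numFacilities) :
    Ends I ε farthest s (I.numClients * (I.numFacilities * 50 + 120) + 30) fun s' =>
      0 ≤ s'.real rS 0 ∧
      (∀ q < I.numClients, ∃ j < I.numFacilities, pd I q (I.numClients + j) ≤ s'.real rS 0) ∧
      ∀ kk t, Feas I kk t → 0 ≤ t → s'.real rS 0 ≤ t := by
  set n := I.numClients with hn
  set m := I.numFacilities with hmm
  refine Ends.step (n' := n * (m * 50 + 120) + 20) rfl ((Ends.forUp (k := m * 50 + 100) (a := 0)
    (b := n) (fun z s' => 0 ≤ s'.real rS 0 ∧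
      (∀ q < z, ∃ j < m, pd I q (n + j) ≤ s'.real rS 0) ∧
      ∀ kk t, Feas I kk t → 0 ≤ t → s'.real rS 0 ≤ t)
    rfl (Nat.zero_le _) rfl (fun _ _ => rfl) ?_ ?_ ?_).post fun s' _ h => h.1) (by simp; omega)
  · exact ⟨by simp, fun q hq => absurd hq (by omega), fun kk t _ ht => by simpa using ht⟩
  · rintro q s1 - hq hf hqq ⟨h0, h1, h2⟩
    refine Ends.step (n' := m * 50 + 90) rfl (Ends.seq (n := m * 50 + 20) (n' := 50)
      ((Ends.forUp (k := 35) (a := 0) (b := m) (fun z s' => s'.nat gP 0 < m ∧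
        ∀ j < z, pd I q (n + s'.nat gP 0) ≤ pd I q (n + j))
        rfl (Nat.zero_le _) rfl (fun _ _ => rfl) ?_ ?_ ?_)) ?_ (by omega)) (by simp; omega)
    · exact ⟨by simpa using hm, fun q hq => absurd hq (by omega)⟩
    · rintro z s' - hz hf' hzz ⟨h3, h4⟩
      have f1 : s'.nat gQ = _ := hf'.nat _ rfl
      simp at f1
      refine Ends.straight rfl (by simp) ?_
      simp only [Program.run]
      split_ifs with hc <;> simp only [Test.Holds, NatExpr.eval, RealExpr.eval, hzz, f1, hqq,
        not_lt, ← hn] at hc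
      · refine ⟨by simpa [hzz] using hz, fun j hj => ?_⟩
        simp only [State.nat_setNat_ne, State.nat_setNat_same, NatExpr.eval, ne_eq, Nat.reduceEqDiff,
          not_false_eq_true, hzz, Function.update_self]
        rcases Nat.lt_succ_iff_lt_or_eq.1 hj with hj | rfl
        · exact hc.le.trans (h4 j hj)
        · exact le_rfl
      · refine ⟨by simpa using h3, fun j hj => ?_⟩
        simp only [State.nat_setNat_ne, ne_eq, Nat.reduceEqDiff, not_false_eq_true]
        rcases Nat.lt_succ_iff_lt_or_eq.1 hj with hj | rfl
        · exact h4 j hj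
        · exact hc
    · simp; omega
    rintro s2 hf2 ⟨⟨h3, h4⟩, -⟩
    have f1 : s2.nat gQ = _ := hf2.nat _ rfl
    have f2 : s2.real rS = _ := hf2.real _ rfl
    simp at f1 f2
    refine Ends.straight rfl (by simp) ?_
    simp only [Program.run]
    split_ifs with hc <;> simp only [Test.Holds, NatExpr.eval, RealExpr.eval, f1, f2, hqq,
        not_lt, ← hn] at hc
    · simp only [State.real_setNat, State.real_setReal_same, NatExpr.eval, RealExpr.eval,
        Function.update_self, f1, hqq, ← hn]
      refine ⟨dist_nonneg, fun q' hq' => ?_, fun kk t ht h0 => ?_⟩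
      · rcases Nat.lt_succ_iff_lt_or_eq.1 hq' with hq' | rfl
        · obtain ⟨j, hj, hj'⟩ := h1 q' hq'
          exact ⟨j, hj, hj'.trans hc.le⟩
        · exact ⟨_, h3, le_rfl⟩
      · obtain ⟨T, hT, -, hTc⟩ := ht
        obtain ⟨j, hj, hj'⟩ := hTc q hq
        exact (h4 j (Finset.mem_range.1 (hT hj))).trans hj'
    · simp only [State.real_setNat, f2]
      refine ⟨h0, fun q' hq' => ?_, h2⟩
      rcases Nat.lt_succ_iff_lt_or_eq.1 hq' with hq' | rfl
      · exact h1 q' hq'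
      · exact ⟨_, h3, hc⟩
  · have : n * (m * 50 + 100 + 1 + 10) ≤ n * (m * 50 + 120) := Nat.mul_le_mul_left _ (by omega)
    simp; omega

/-- A radius `rR` with `rR ≤ opt ≤ 3 rR`. -/
def radius : Program :=
  gonzalez ;; farthest ;;
  rassign rR (.div (.get rCD (.var gB)) (.cast (.lit 2))) ;;
  .cond (.realLt (.var rR) (.var rS)) (rassign rR (.var rS)) .skip

/-- The clients `c i`, `i < kk`, are centers of balls with radius `2 R` that contain all clients,
and `R` is up to a factor `3` the optimum. -/
structure Scale (I : KSupplier) (kk : ℕ) (c : ℕ → ℕ) (R : ℝ) : Prop where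
  nonneg : 0 ≤ R
  cen_lt : ∀ x < kk, c x < I.numClients
  near : ∀ q < I.numClients, ∃ x < kk, pd I q (c x) ≤ 2 * R
  le : ∀ t, Feas I kk t → R ≤ t
  feas : Feas I kk (3 * R)

/-- R is the larger of half the covering radius D of the traversal and the largest distance S of a
client to its nearest facility. Both are lower bounds for the optimum. Conversely, the facilities
nearest to the centers serve everything within D + S ≤ 3R. -/
theorem ends_radius {s : State} {kk : ℕ} (hk : s.nat nKK 0 = kk) (hk0 : 0 < kk)
    (hn : 0 < I.numClients) (hm : 0 < I.numFacilities) (hkm : kk ≤ I.numFacilities) :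
    Ends I ε radius s (500 * (I.numClients * I.numFacilities)) fun s' =>
      Scale I kk (s'.nat aCen) (s'.real rR 0) := by
  classical
  have hnm : I.numClients ≤ I.numClients * I.numFacilities := Nat.le_mul_of_pos_right _ hm
  have h1nm : 1 ≤ I.numClients * I.numFacilities := Nat.mul_pos hn hm
  have hm' : I.numFacilities ≤ I.numClients * I.numFacilities := Nat.le_mul_of_pos_left _ hn
  have e1 : kk * (I.numClients * 80 + 120) + 40 ≤ 240 * (I.numClients * I.numFacilities) := by
    have : kk * (I.numClients * 80 + 120) ≤ I.numFacilities * (I.numClients * 80 + 120) :=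
      Nat.mul_le_mul_right _ hkm
    have e : I.numFacilities * (I.numClients * 80 + 120) =
      80 * (I.numClients * I.numFacilities) + 120 * I.numFacilities := by ring
    omega
  have e2 : I.numClients * (I.numFacilities * 50 + 120) + 30 ≤
      200 * (I.numClients * I.numFacilities) := by
    have e : I.numClients * (I.numFacilities * 50 + 120) =
      50 * (I.numClients * I.numFacilities) + 120 * I.numClients := by ring
    omega
  refine Ends.seq (ends_gonzalez hk hn) (n' := 260 * (I.numClients * I.numFacilities)) ?_ (by omega)
  intro s1 hf1 h1
  refine Ends.seq (ends_farthest hm) (n' := 40) ?_ (by omega)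
  rintro s2 hf2 ⟨h0, h2, h3⟩
  have k1 : s2.nat gB = _ := hf2.nat _ rfl
  have k2 : s2.real rCD = _ := hf2.real _ rfl
  have k3 : s2.nat aCen = _ := hf2.nat _ rfl
  refine Ends.straight rfl (by simp) ?_
  set D := s1.real rCD (s1.nat gB 0) with hD
  set S := s2.real rS 0 with hS
  set s' := (rassign rR (.div (.get rCD (.var gB)) (.cast (.lit 2))) ;;
    .cond (.realLt (.var rR) (.var rS)) (rassign rR (.var rS)) .skip : Program).run I ε s2 with hs'
  have hc' : s'.nat aCen = s1.nat aCen := by rw [hs', run_nat rfl rfl, k3]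
  have hR : s'.real rR 0 = max (D / 2) S := by
    by_cases hc : D / 2 < S
    · simp [hs', k1, k2, ← hD, ← hS, hc, max_eq_right hc.le]
    · simp [hs', k1, k2, ← hD, ← hS, hc, max_eq_left (not_lt.1 hc)]
  have hD0 : 0 ≤ D := by
    obtain ⟨x, -, hx⟩ := h1.attained hk0 _ h1.far_lt
    rw [hD, hx]; exact dist_nonneg
  have hnear : ∀ q < I.numClients, ∃ x < kk, pd I q (s1.nat aCen x) ≤ D := by
    intro q hq
    obtain ⟨x, hx, hx'⟩ := h1.attained hk0 q hq
    exact ⟨x, hx, by rw [← hx']; exact h1.max hk0 q hq⟩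
  rw [hc', hR]
  set R := max (D / 2) S with hRdef
  have hDR : D ≤ 2 * R := by have := le_max_left (D / 2) S; linarith
  have hSR : S ≤ R := le_max_right _ _
  refine ⟨h0.trans hSR, h1.cen_lt, fun q hq => ?_, fun t ht => max_le ?_ ?_, ?_⟩
  · obtain ⟨x, hx, hx'⟩ := hnear q hq
    exact ⟨x, hx, hx'.trans hDR⟩
  · have := h1.le_two_mul ht; linarith
  · have := h1.le_two_mul ht; exact h3 kk t ht (by linarith)
  · choose! φ hφ hφ' using h2
    refine ⟨(Finset.range kk).image fun x => φ (s1.nat aCen x), fun j hj => ?_,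
      Finset.card_image_le.trans (by simp), fun q hq => ?_⟩
    · obtain ⟨x, hx, rfl⟩ := Finset.mem_image.1 hj
      exact Finset.mem_range.2 (hφ _ (h1.cen_lt x (Finset.mem_range.1 hx)))
    · obtain ⟨x, hx, hx'⟩ := hnear q hq
      refine ⟨_, Finset.mem_image_of_mem _ (Finset.mem_range.2 hx), ?_⟩
      have h4 := hφ' _ (h1.cen_lt x hx)
      have h5 := dist_triangle (I.point q) (I.point (s1.nat aCen x))
        (I.point (I.numClients + φ (s1.nat aCen x)))
      simp only [pd] at hx' h4
      linarith

end RealRAM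

/-! ### Nets -/


namespace RealRAM

variable {I : KSupplier} {ε : ℝ}

notation "rDl" => (7 : ℕ)
notation "rFar" => (8 : ℕ)
notation "aLen" => (87 : ℕ)
notation "aCell" => (88 : ℕ)
notation "aN" => (89 : ℕ)
notation "nN" => (90 : ℕ)
notation "nOff" => (91 : ℕ)
notation "nCnt" => (92 : ℕ)
notation "aG" => (93 : ℕ)
notation "nG" => (94 : ℕ)

/-- At most `M` points with pairwise distances greater than `δ` fit into a ball of radius `ρ`. -/
def PackBound (I : KSupplier) (ρ δ : ℝ) (M : ℕ) : Prop :=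
  ∀ (x : EuclideanSpace ℝ (Fin I.dim)) (L : ℕ) (f : ℕ → ℕ), (∀ p < L, dist (I.point (f p)) x ≤ ρ) →
    (∀ p p', p < p' → p' < L → δ < pd I (f p) (f p')) → L ≤ M

/-- A net for the points `off + p`, `p < P`, near the centers, and the cells of the net points by
their nearest centers. -/
structure NetOK (I : KSupplier) (kk : ℕ) (c : ℕ → ℕ) (ρ δ : ℝ) (off P : ℕ) (len cell : ℕ → ℕ)
    (n : ℕ) (N : ℕ → ℕ) : Prop where
  range : ∀ z < n, off ≤ N z ∧ N z < off + P
  near : ∀ z < n, ∃ i < kk, pd I (N z) (c i) ≤ ρ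
  cover : ∀ p < P, (∃ i < kk, pd I (off + p) (c i) ≤ ρ) → ∃ z < n, pd I (off + p) (N z) ≤ δ
  cells : ∀ i < kk, ∀ p < len i, pd I (cell (i + p * kk)) (c i) ≤ ρ ∧
    ∃ z < n, cell (i + p * kk) = N z
  sep : ∀ i < kk, ∀ p p', p < p' → p' < len i →
    δ < pd I (cell (i + p * kk)) (cell (i + p' * kk))
  sum : n = ∑ i ∈ Finset.range kk, len i

/-- A cell consists of separated points in the ball of radius `ρ` around its center. -/
theorem NetOK.len_le {kk : ℕ} {c : ℕ → ℕ} {ρ δ : ℝ} {off P : ℕ} {len cell : ℕ → ℕ}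
    {n M : ℕ} {N : ℕ → ℕ} (h : NetOK I kk c ρ δ off P len cell n N) (hM : PackBound I ρ δ M)
    {i : ℕ} (hi : i < kk) : len i ≤ M :=
  hM (I.point (c i)) (len i) (fun p => cell (i + p * kk)) (fun p hp => (h.cells i hi p hp).1)
    (h.sep i hi)

theorem NetOK.card_le {kk : ℕ} {c : ℕ → ℕ} {ρ δ : ℝ} {off P : ℕ} {len cell : ℕ → ℕ}
    {n M : ℕ} {N : ℕ → ℕ} (h : NetOK I kk c ρ δ off P len cell n N) (hM : PackBound I ρ δ M) :
    n ≤ kk * M := by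
  rw [h.sum]
  refine (Finset.sum_le_card_nsmul _ _ M fun i hi => h.len_le hM (Finset.mem_range.1 hi)).trans ?_
  simp

/-- The cells are interleaved with stride `kk`, so that the next entry of a cell is reached by an
addition and no bound on their lengths has to be fixed in advance. -/
theorem cell_inj {kk i b p q : ℕ} (hi : i < kk) (hb : b < kk) (h : i + p * kk = b + q * kk) :
    i = b ∧ p = q := by
  have h1 : (i + p * kk) % kk = (b + q * kk) % kk := by rw [h]
  rw [Nat.add_mul_mod_self_right, Nat.add_mul_mod_self_right, Nat.mod_eq_of_lt hi,
    Nat.mod_eq_of_lt hb] at h1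
  subst h1
  refine ⟨rfl, ?_⟩
  have : p * kk = q * kk := by omega
  exact Nat.eq_of_mul_eq_mul_right (by omega) this

theorem NetOK.skip {kk : ℕ} {c : ℕ → ℕ} {ρ δ : ℝ} {off P : ℕ} {len cell : ℕ → ℕ}
    {n : ℕ} {N : ℕ → ℕ} (h : NetOK I kk c ρ δ off P len cell n N)
    (hP : (∃ i < kk, pd I (off + P) (c i) ≤ ρ) → ∃ z < n, pd I (off + P) (N z) ≤ δ) :
    NetOK I kk c ρ δ off (P + 1) len cell n N := by
  refine ⟨fun z hz => ⟨(h.range z hz).1, by have := (h.range z hz).2; omega⟩, h.near,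
    fun p hp hi => ?_, h.cells, h.sep, h.sum⟩
  rcases Nat.lt_succ_iff_lt_or_eq.1 hp with hp | rfl
  · exact h.cover p hp hi
  · exact hP hi

theorem NetOK.push {kk : ℕ} {c : ℕ → ℕ} {ρ δ : ℝ} {off P : ℕ} {len cell : ℕ → ℕ}
    {n : ℕ} {N : ℕ → ℕ} (h : NetOK I kk c ρ δ off P len cell n N) {b : ℕ} (hb : b < kk)
    (hδ : 0 ≤ δ) (hbc : pd I (off + P) (c b) ≤ ρ)
    (hnew : ∀ p < len b, δ < pd I (off + P) (cell (b + p * kk))) :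
    NetOK I kk c ρ δ off (P + 1) (Function.update len b (len b + 1))
      (Function.update cell (b + len b * kk) (off + P)) (n + 1) (Function.update N n (off + P)) := by
  have hcell : ∀ i < kk, ∀ p, ¬ (i = b ∧ p = len b) →
      Function.update cell (b + len b * kk) (off + P) (i + p * kk) = cell (i + p * kk) := by
    intro i hi p hne
    rw [Function.update_of_ne]
    exact fun he => hne (cell_inj hi hb he)
  refine ⟨fun z hz => ?_, fun z hz => ?_, fun p hp hi => ?_, fun i hi p hp => ?_,
    fun i hi p p' hpp hp' => ?_, ?_⟩
  · by_cases hzn : z = n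
    · subst hzn; rw [Function.update_self]; omega
    · rw [Function.update_of_ne hzn]
      have := h.range z (by omega); omega
  · by_cases hzn : z = n
    · subst hzn; rw [Function.update_self]; exact ⟨b, hb, hbc⟩
    · rw [Function.update_of_ne hzn]; exact h.near z (by omega)
  · rcases Nat.lt_succ_iff_lt_or_eq.1 hp with hp | rfl
    · obtain ⟨z, hz, hz'⟩ := h.cover p hp hi
      exact ⟨z, by omega, by rwa [Function.update_of_ne hz.ne]⟩
    · exact ⟨n, by omega, by rw [Function.update_self, pd, dist_self]; exact hδ⟩
  · by_cases hib : i = b ∧ p = len b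
    · obtain ⟨rfl, rfl⟩ := hib
      rw [Function.update_self]
      exact ⟨hbc, n, by omega, by rw [Function.update_self]⟩
    · rw [hcell i hi p hib]
      have hp' : p < len i := by
        by_cases hib' : i = b
        · subst hib'; rw [Function.update_self] at hp; omega
        · rwa [Function.update_of_ne hib'] at hp
      obtain ⟨h1, z, hz, hz'⟩ := h.cells i hi p hp'
      exact ⟨h1, z, by omega, by rw [Function.update_of_ne hz.ne, hz']⟩
  · by_cases hib : i = b
    · subst hib
      rw [Function.update_self] at hp'
      rw [hcell i hi p (by omega)]
      by_cases hpl : p' = len i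
      · rw [hpl, Function.update_self, pd, dist_comm]
        exact hnew p (by omega)
      · rw [hcell i hi p' (by omega)]
        exact h.sep i hi p p' hpp (by omega)
    · rw [Function.update_of_ne hib] at hp'
      rw [hcell i hi p (by omega), hcell i hi p' (by omega)]
      exact h.sep i hi p p' hpp hp'
  · rw [Finset.sum_update_of_mem (Finset.mem_range.2 hb), h.sum,
      ← Finset.add_sum_erase _ _ (Finset.mem_range.2 hb), Finset.sdiff_singleton_eq_erase]
    omega

/-- The point `gQ` is added to the net if it is near the centers but not near the net. -/
def netStep : Program :=
  assign gQ (.add (.var nOff) (.var gP)) ;; assign gB (.lit 0) ;;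
  forUp gI (.lit 0) (.var nKK)
    (.cond (.realLt (.dist (.var gQ) (.get aCen (.var gI))) (.dist (.var gQ) (.get aCen (.var gB))))
      (assign gB (.var gI)) .skip) ;;
  .cond (.realLe (.dist (.var gQ) (.get aCen (.var gB))) (.var rFar))
    (assign gF (.lit 0) ;; assign gX (.var gB) ;;
      forUp gI (.lit 0) (.get aLen (.var gB))
        (.cond (.realLe (.dist (.var gQ) (.get aCell (.var gX))) (.var rDl))
            (assign gF (.lit 1) ;; assign gX (.add (.var gX) (.var nKK)))
            (assign gX (.add (.var gX) (.var nKK)))) ;;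
      .cond (.natLt (.var gF) (.lit 1))
        (.setNat aCell (.var gX) (.var gQ) ;;
          .setNat aLen (.var gB) (.add (.get aLen (.var gB)) (.lit 1)) ;;
          .setNat aN (.var nN) (.var gQ) ;; assign nN (.add (.var nN) (.lit 1))) .skip) .skip

/-- A net for a range of points. -/
def net : Program :=
  assign nN (.lit 0) ;; fill gI aLen (.var nKK) (.lit 0) ;; forUp gP (.lit 0) (.var nCnt) netStep

/-- A point is compared only with the net points of its own cell, of which there are at most `M`.
This gives `kk + M` steps per point instead of the size `kk * M` of the net, which matters for the
term |C|·|F|. -/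
theorem ends_netStep {s : State} {kk off P M : ℕ} {c : ℕ → ℕ} {ρ δ : ℝ} (hk : s.nat nKK 0 = kk)
    (hk0 : 0 < kk) (hoff : s.nat nOff 0 = off) (hc : s.nat aCen = c) (hρ : s.real rFar 0 = ρ)
    (hδ : s.real rDl 0 = δ) (hδ0 : 0 ≤ δ) (hM : PackBound I ρ δ M) (hP : s.nat gP 0 = P)
    (h : NetOK I kk c ρ δ off P (s.nat aLen) (s.nat aCell) (s.nat nN 0) (s.nat aN)) :
    Ends I ε netStep s ((kk + M) * 60 + 150) fun s' =>
      NetOK I kk c ρ δ off (P + 1) (s'.nat aLen) (s'.nat aCell) (s'.nat nN 0) (s'.nat aN) := by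
  refine Ends.step (n' := (kk + M) * 60 + 143) rfl (Ends.step (n' := (kk + M) * 60 + 140) rfl
    (Ends.seq (n := kk * 40 + 20) (n' := M * 60 + 120) (Ends.forUp (k := 24) (a := 0) (b := kk)
      (fun z s' => s'.nat gB 0 < kk ∧
        ∀ j < z, pd I (off + P) (c (s'.nat gB 0)) ≤ pd I (off + P) (c j))
      rfl (Nat.zero_le _) rfl ?_ ?_ ?_ ?_) ?_ (by omega)) (by simp; omega)) (by simp; omega)
  · intro s' hf
    have e : s'.nat nKK = _ := hf.nat _ rfl
    simp [e, hk]
  · exact ⟨by simpa using hk0, fun j hj => absurd hj (by omega)⟩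
  · rintro z s' - hz hf hzz ⟨h1, h2⟩
    have f1 : s'.nat gQ = _ := hf.nat _ rfl
    have f2 : s'.nat aCen = _ := hf.nat _ rfl
    simp [hoff, hP, hc] at f1 f2
    refine Ends.straight rfl (by simp) ?_
    simp only [Program.run]
    split_ifs with hd <;> simp only [Test.Holds, NatExpr.eval, RealExpr.eval, hzz, f1, f2,
      Function.update_self, not_lt] at hd
    · refine ⟨by simpa [hzz] using hz, fun j hj => ?_⟩
      simp only [State.nat_setNat_ne, State.nat_setNat_same, NatExpr.eval, ne_eq, Nat.reduceEqDiff,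
        not_false_eq_true, hzz, Function.update_self]
      rcases Nat.lt_succ_iff_lt_or_eq.1 hj with hj | rfl
      · exact hd.le.trans (h2 j hj)
      · exact le_rfl
    · refine ⟨by simpa using h1, fun j hj => ?_⟩
      simp only [State.nat_setNat_ne, ne_eq, Nat.reduceEqDiff, not_false_eq_true]
      rcases Nat.lt_succ_iff_lt_or_eq.1 hj with hj | rfl
      · exact h2 j hj
      · exact hd
  · simp; omega
  rintro s1 hf1 ⟨⟨h1, h2⟩, -⟩
  have a0 : ∀ A, A ≠ 84 → A ≠ 80 → A ≠ 82 → s1.nat A = s.nat A := by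
    intro A i1 i2 i3
    rw [hf1.nat A (by simp [forUp, Program.writesNat, *]), run_nat (by simp [Program.writesNat, *]) rfl,
      run_nat (by simp [Program.writesNat, *]) rfl]
  have a1 : s1.nat gQ 0 = off + P := by
    rw [hf1.nat _ rfl]; simp [hoff, hP]
  have a2 : s1.real rFar 0 = ρ := by rw [hf1.real _ rfl]; simpa using hρ
  have a3 : s1.real rDl 0 = δ := by rw [hf1.real _ rfl]; simpa using hδ
  have b1 := a0 aCen (by simp) (by simp) (by simp)
  have b2 := a0 aLen (by simp) (by simp) (by simp)
  have b3 := a0 aCell (by simp) (by simp) (by simp)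
  have b4 := a0 nN (by simp) (by simp) (by simp)
  have b5 := a0 aN (by simp) (by simp) (by simp)
  have b6 := a0 nKK (by simp) (by simp) (by simp)
  set b := s1.nat gB 0 with hb
  have hlen := h.len_le hM h1
  set l := s.nat aLen b with hl
  refine Ends.cond (n := M * 60 + 100) (fun hn => ?_) (fun hn => ?_) (by simp; omega)
  · simp only [Test.Holds, NatExpr.eval, RealExpr.eval, a1, a2, b1, hc, ← hb, not_lt] at hn
    refine Ends.step (n' := M * 60 + 96) rfl (Ends.step (n' := M * 60 + 90) rfl
      (Ends.seq (n := l * 50 + 20) (n' := 50) (Ends.forUp (k := 32) (a := 0) (b := l)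
        (fun z s' => s'.nat gX 0 = b + z * kk ∧
          (s'.nat gF 0 = 0 → ∀ p < z, δ < pd I (off + P) (s.nat aCell (b + p * kk))) ∧
          (s'.nat gF 0 ≠ 0 → ∃ p < l, pd I (off + P) (s.nat aCell (b + p * kk)) ≤ δ))
        rfl (Nat.zero_le _) rfl ?_ ?_ ?_ ?_) ?_ (by omega)) (by simp; omega)) (by simp; omega)
    · intro s' hf
      have e1 : s'.nat gB = _ := hf.nat _ rfl
      have e2 : s'.nat aLen = _ := hf.nat _ rfl
      simp at e1 e2
      simp [e1, e2, b2, ← hb, ← hl]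
    · simp [← hb]
    · rintro z s' - hz hf hzz ⟨h3, h4, h5⟩
      have f1 : s'.nat gQ = _ := hf.nat _ rfl
      have f2 : s'.nat aCell = _ := hf.nat _ rfl
      have f3 : s'.real rDl = _ := hf.real _ rfl
      have f4 : s'.nat nKK = _ := hf.nat _ rfl
      simp at f1 f2 f3 f4
      have hz1 : b + z * kk + kk = b + (z + 1) * kk := by ring
      refine Ends.straight rfl (by simp) ?_
      simp only [Program.run]
      split_ifs with hd <;> simp only [Test.Holds, NatExpr.eval, RealExpr.eval, f1, f2, f3, a1, a3,
        b3, h3, not_lt, not_le] at hd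
      · refine ⟨by simp [h3, f4, b6, hk, hz1], fun h0 => by simp at h0, fun _ => ⟨z, hz, hd⟩⟩
      · refine ⟨by simp [h3, f4, b6, hk, hz1], fun h0 p hp => ?_, fun h0 => h5 (by simpa using h0)⟩
        rcases Nat.lt_succ_iff_lt_or_eq.1 hp with hp | rfl
        · exact h4 (by simpa using h0) p hp
        · exact hd
    · simp; omega
    rintro s2 hf2 ⟨⟨h3, h4, h5⟩, -⟩
    have f1 : s2.nat gQ = _ := hf2.nat _ rfl
    have f2 : s2.nat aCell = _ := hf2.nat _ rfl
    have f3 : s2.nat aLen = _ := hf2.nat _ rfl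
    have f4 : s2.nat nN = _ := hf2.nat _ rfl
    have f5 : s2.nat aN = _ := hf2.nat _ rfl
    have f6 : s2.nat gB = _ := hf2.nat _ rfl
    simp at f1 f2 f3 f4 f5 f6
    refine Ends.straight rfl (by simp) ?_
    simp only [Program.run]
    split_ifs with hd <;> simp only [Test.Holds, NatExpr.eval, not_lt, Nat.lt_one_iff] at hd
    · have := h.push h1 hδ0 hn (h4 hd)
      simpa [f1, f2, f3, f4, f5, f6, a1, b2, b3, b4, b5, ← hb, ← hl, h3] using this
    · obtain ⟨p, hp, hp'⟩ := h5 (by omega)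
      rw [f2, f3, f4, f5, b2, b3, b4, b5]
      refine h.skip fun _ => ?_
      obtain ⟨-, z, hz, hz'⟩ := h.cells b h1 p hp
      exact ⟨z, hz, by rwa [← hz']⟩
  · simp only [Test.Holds, NatExpr.eval, RealExpr.eval, a1, a2, b1, hc, ← hb, not_lt, not_le] at hn
    refine Ends.straight rfl (by simp) ?_
    simp only [Program.run, b2, b3, b4, b5]
    -- The nearest center is too far away, hence all are.
    exact h.skip fun ⟨i, hi, hi'⟩ => absurd ((h2 i hi).trans hi') (not_le.2 hn)

theorem ends_net {s : State} {kk off P M : ℕ} {c : ℕ → ℕ} {ρ δ : ℝ} (hk : s.nat nKK 0 = kk)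
    (hk0 : 0 < kk) (hoff : s.nat nOff 0 = off) (hP : s.nat nCnt 0 = P) (hc : s.nat aCen = c)
    (hρ : s.real rFar 0 = ρ) (hδ : s.real rDl 0 = δ) (hδ0 : 0 ≤ δ) (hM : PackBound I ρ δ M) :
    Ends I ε net s (P * ((kk + M) * 60 + 170) + kk * 20 + 60) fun s' =>
      s'.nat nN 0 ≤ kk * M ∧
      (∀ z < s'.nat nN 0, off ≤ s'.nat aN z ∧ s'.nat aN z < off + P) ∧
      (∀ z < s'.nat nN 0, ∃ i < kk, pd I (s'.nat aN z) (c i) ≤ ρ) ∧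
      ∀ p < P, (∃ i < kk, pd I (off + p) (c i) ≤ ρ) →
        ∃ z < s'.nat nN 0, pd I (off + p) (s'.nat aN z) ≤ δ := by
  refine Ends.step (n' := P * ((kk + M) * 60 + 170) + kk * 20 + 50) rfl
    (Ends.seq (n := kk * 20 + 20) (n' := P * ((kk + M) * 60 + 170) + 20)
      ((ends_fill (X := kk) (g := fun _ => 0) (by simp) ?_ (fun _ _ _ _ _ => rfl)).le
        (by simp; omega)) ?_ (by omega)) (by simp; omega)
  · intro s' hf
    have e : s'.nat nKK = _ := hf.nat _ rfl
    simp [e, hk]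
  intro s1 hf1 h1
  have a0 : ∀ A, A ≠ 90 → A ≠ 87 → A ≠ 82 → s1.nat A = s.nat A := by
    intro A i1 i2 i3
    rw [hf1.nat A (by simp [fill, forUp, Program.writesNat, *]),
      run_nat (by simp [Program.writesNat, *]) rfl]
  have a1 : s1.nat nN 0 = 0 := by rw [hf1.nat _ rfl]; simp
  have a2 : s1.real = s.real := by
    funext A; rw [hf1.real A rfl]; rfl
  refine (Ends.forUp (k := (kk + M) * 60 + 150) (a := 0) (b := P) (fun p s' =>
    NetOK I kk c ρ δ off p (s'.nat aLen) (s'.nat aCell) (s'.nat nN 0) (s'.nat aN))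
    rfl (Nat.zero_le _) rfl ?_ ?_ ?_ ?_).post ?_
  · intro s' hf
    have e : s'.nat nCnt = _ := hf.nat _ rfl
    simp [e, a0, hP]
  · refine ⟨?_, ?_, fun p hp => absurd hp (by omega), ?_, ?_, ?_⟩
    · simp [a1]
    · simp [a1]
    · intro i hi p hp
      simp [h1 i hi] at hp
    · intro i hi p p' hpp hp
      simp [h1 i hi] at hp
    · simp only [State.nat_setNat_ne, ne_eq, Nat.reduceEqDiff, not_false_eq_true, a1]
      exact (Finset.sum_eq_zero fun i hi => h1 i (Finset.mem_range.1 hi)).symm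
  · rintro p s' - hp hf hpp h
    have e1 : s'.nat nKK = _ := hf.nat _ rfl
    have e2 : s'.nat nOff = _ := hf.nat _ rfl
    have e3 : s'.nat aCen = _ := hf.nat _ rfl
    have e4 : s'.real = s.real := by funext A; rw [hf.real A rfl, a2]
    refine (ends_netStep (by rw [e1, a0 _ (by simp) (by simp) (by simp), hk]) hk0
      (by rw [e2, a0 _ (by simp) (by simp) (by simp), hoff])
      (by rw [e3, a0 _ (by simp) (by simp) (by simp), hc]) (by rw [e4, hρ]) (by rw [e4, hδ]) hδ0 hM
      hpp h).post ?_
    rintro s'' - h'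
    simpa using h'
  · have : P * ((kk + M) * 60 + 150 + 2 + 10) ≤ P * ((kk + M) * 60 + 170) :=
      Nat.mul_le_mul_left _ (by omega)
    simp; omega
  · rintro s' - ⟨h, -⟩
    exact ⟨h.card_le hM, h.range, h.near, h.cover⟩

/-- A net for the points in the list `aN`. -/
def thin : Program :=
  assign nG (.lit 0) ;;
  forUp gP (.lit 0) (.var nN)
    (assign gF (.lit 0) ;;
      forUp gI (.lit 0) (.var nG)
        (.cond (.realLe (.dist (.get aN (.var gP)) (.get aG (.var gI))) (.var rDl))
          (assign gF (.lit 1)) .skip) ;;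
      .cond (.natLt (.var gF) (.lit 1))
        (.setNat aG (.var nG) (.get aN (.var gP)) ;; assign nG (.add (.var nG) (.lit 1))) .skip)

/-- Net points of different cells may be close to each other. A second greedy pass separates all of
them, at the price of doubling the resolution and of quadratic time in the size of the net only. -/
theorem ends_thin {s : State} {n : ℕ} {δ : ℝ} (hn : s.nat nN 0 = n) (hδ : s.real rDl 0 = δ)
    (hδ0 : 0 ≤ δ) :
    Ends I ε thin s (n * (n * 50 + 100) + 40) fun s' => s'.nat nG 0 ≤ n ∧
      (∀ z < s'.nat nG 0, ∃ y < n, s'.nat aG z = s.nat aN y) ∧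
      (∀ z z', z < z' → z' < s'.nat nG 0 → δ < pd I (s'.nat aG z) (s'.nat aG z')) ∧
      ∀ y < n, ∃ z < s'.nat nG 0, pd I (s.nat aN y) (s'.nat aG z) ≤ δ := by
  refine Ends.step (n' := n * (n * 50 + 100) + 20) rfl ((Ends.forUp (k := n * 50 + 80) (a := 0)
    (b := n) (fun y s' => s'.nat nG 0 ≤ y ∧
      (∀ z < s'.nat nG 0, ∃ y < n, s'.nat aG z = s.nat aN y) ∧
      (∀ z z', z < z' → z' < s'.nat nG 0 → δ < pd I (s'.nat aG z) (s'.nat aG z')) ∧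
      ∀ x < y, ∃ z < s'.nat nG 0, pd I (s.nat aN x) (s'.nat aG z) ≤ δ)
    rfl (Nat.zero_le _) rfl ?_ ?_ ?_ ?_).post fun s' _ h => h.1) (by simp; omega)
  · intro s' hf
    have e : s'.nat nN = _ := hf.nat _ rfl
    simp [e, hn]
  · simp
  · rintro y s1 - hy hf1 hyy ⟨h1, h2, h3, h4⟩
    have a1 : s1.nat aN = _ := hf1.nat _ rfl
    have a2 : s1.real rDl = _ := hf1.real _ rfl
    simp at a1 a2
    set g := s1.nat nG 0 with hg
    refine Ends.step (n' := n * 50 + 70) rfl (Ends.seq (n := g * 50 + 20) (n' := 40)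
      (Ends.forUp (k := 26) (a := 0) (b := g) (fun z s' =>
          (s'.nat gF 0 = 0 → ∀ x < z, δ < pd I (s.nat aN y) (s1.nat aG x)) ∧
          (s'.nat gF 0 ≠ 0 → ∃ x < g, pd I (s.nat aN y) (s1.nat aG x) ≤ δ))
        rfl (Nat.zero_le _) rfl ?_ ?_ ?_ ?_) ?_ (by omega)) (by simp; omega)
    · intro s' hf
      have e : s'.nat nG = _ := hf.nat _ rfl
      simp [e, hg]
    · simp
    · rintro z s' - hz hf hzz ⟨i1, i2⟩
      have f1 : s'.nat aN = _ := hf.nat _ rfl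
      have f2 : s'.nat aG = _ := hf.nat _ rfl
      have f3 : s'.nat gP = _ := hf.nat _ rfl
      have f4 : s'.real rDl = _ := hf.real _ rfl
      simp at f1 f2 f3 f4
      refine Ends.straight rfl (by simp) ?_
      simp only [Program.run]
      split_ifs with hd <;> simp only [Test.Holds, NatExpr.eval, RealExpr.eval, f1, f2, f3, f4, a1,
        a2, hyy, hzz, hδ, not_lt, not_le] at hd
      · exact ⟨fun h0 => by simp at h0, fun _ => ⟨z, hz, hd⟩⟩
      · refine ⟨fun h0 x hx => ?_, fun h0 => i2 (by simpa using h0)⟩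
        rcases Nat.lt_succ_iff_lt_or_eq.1 hx with hx | rfl
        · exact i1 (by simpa using h0) x hx
        · exact hd
    · simp; omega
    rintro s2 hf2 ⟨⟨i1, i2⟩, -⟩
    have f1 : s2.nat aN = _ := hf2.nat _ rfl
    have f2 : s2.nat aG = _ := hf2.nat _ rfl
    have f3 : s2.nat gP = _ := hf2.nat _ rfl
    have f4 : s2.nat nG = _ := hf2.nat _ rfl
    simp at f1 f2 f3 f4
    refine Ends.straight rfl (by simp) ?_
    simp only [Program.run]
    split_ifs with hd <;> simp only [Test.Holds, NatExpr.eval, not_lt, Nat.lt_one_iff] at hd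
    · simp only [State.nat_setNat_ne, State.nat_setNat_same, NatExpr.eval, ne_eq, Nat.reduceEqDiff,
        not_false_eq_true, f1, f2, f3, f4, a1, hyy, ← hg, Function.update_self]
      refine ⟨by omega, fun z hz => ?_, fun z z' hzz hz' => ?_, fun x hx => ?_⟩
      · by_cases hzg : z = g
        · subst hzg; exact ⟨y, hy, by rw [Function.update_self]⟩
        · rw [Function.update_of_ne hzg]; exact h2 z (by omega)
      · rw [Function.update_of_ne (show z ≠ g by omega)]
        by_cases hzg : z' = g
        · subst hzg
          rw [Function.update_self, pd, dist_comm]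
          exact i1 hd z hzz
        · rw [Function.update_of_ne hzg]; exact h3 z z' hzz (by omega)
      · rcases Nat.lt_succ_iff_lt_or_eq.1 hx with hx | rfl
        · obtain ⟨z, hz, hz'⟩ := h4 x hx
          exact ⟨z, by omega, by rwa [Function.update_of_ne hz.ne]⟩
        · exact ⟨g, by omega, by rw [Function.update_self, pd, dist_self]; exact hδ0⟩
    · obtain ⟨z, hz, hz'⟩ := i2 (by omega)
      simp only [State.nat_setNat_ne, ne_eq, Nat.reduceEqDiff, not_false_eq_true, f2, f4]
      refine ⟨by omega, h2, h3, fun x hx => ?_⟩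
      rcases Nat.lt_succ_iff_lt_or_eq.1 hx with hx | rfl
      · exact h4 x hx
      · exact ⟨z, hz, hz'⟩
  · have : n * (n * 50 + 80 + 2 + 10) ≤ n * (n * 50 + 100) := Nat.mul_le_mul_left _ (by omega)
    simp; omega

-- The nets of the instance and the parameters of the clustering

notation "rH" => (9 : ℕ)
notation "rPow" => (12 : ℕ)
notation "gLg" => (95 : ℕ)
notation "gPw" => (96 : ℕ)
notation "gEl" => (97 : ℕ)

/-- The resolution of the nets, the distance up to which facilities are of interest, and the
width of the shells that separate clusters. -/
def scales : Program :=
  rassign rDl (.div (.mul .eps (.var rR)) (.cast (.lit 8))) ;;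
  rassign rFar (.mul (.cast (.lit 6)) (.var rR)) ;; rassign rH (.mul (.cast (.lit 8)) (.var rR))

/-- Nets of the clients and of the facilities. -/
def nets : Program :=
  scales ;; assign nOff (.lit 0) ;; assign nCnt .numClients ;; net ;;
  assign nB (.var nN) ;; fill gI aLC (.var nN) (.get aN (.var gI)) ;;
  assign nOff .numClients ;; assign nCnt .numFacilities ;; net ;; thin

/-- The lists `C` of `b` clients and `G` of `a` facilities are nets with resolution `δ`. -/
structure Nets (I : KSupplier) (kk M : ℕ) (R δ : ℝ) (c : ℕ → ℕ) (b : ℕ) (C : ℕ → ℕ) (a : ℕ)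
    (G : ℕ → ℕ) : Prop where
  b_le : b ≤ kk * M
  a_le : a ≤ kk * M
  client_lt : ∀ q < b, C q < I.numClients
  client_near : ∀ p < I.numClients, (∃ i < kk, pd I p (c i) ≤ 6 * R) → ∃ q < b, pd I p (C q) ≤ δ
  fac_mem : ∀ z < a, I.numClients ≤ G z ∧ G z < I.numClients + I.numFacilities
  fac_near : ∀ j < I.numFacilities, (∃ i < kk, pd I (I.numClients + j) (c i) ≤ 6 * R) →
    ∃ z < a, pd I (I.numClients + j) (G z) ≤ 2 * δ
  sep : ∀ z z', z < z' → z' < a → δ < pd I (G z) (G z')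

/-- Radius 6R is enough: a solution of cost at most 3R serves clients within 2R of the centers by
facilities within 5R of them. Only the facilities are thinned, since only they have to be packed
into annuli later. -/
theorem ends_nets {s : State} {kk M : ℕ} {c : ℕ → ℕ} {R : ℝ} (hk : s.nat nKK 0 = kk)
    (hk0 : 0 < kk) (hc : s.nat aCen = c) (hR : s.real rR 0 = R) (hR0 : 0 ≤ R) (hε : 0 ≤ ε)
    (hM : PackBound I (6 * R) (ε * R / 8) M) :
    Ends I ε nets s ((I.numClients + I.numFacilities) * ((kk + M) * 60 + 170) +
      200 * (kk * M + kk + 1) ^ 2) fun s' =>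
        Nets I kk M R (ε * R / 8) c (s'.nat nB 0) (s'.nat aLC) (s'.nat nG 0) (s'.nat aG) ∧
        s'.real rDl 0 = ε * R / 8 ∧ s'.real rH 0 = 8 * R := by
  set δ := ε * R / 8 with hδ
  have hδ0 : 0 ≤ δ := by positivity
  set A := kk * M with hA
  obtain ⟨Y, hY⟩ : ∃ Y, Y = (kk + M) * 60 + 170 := ⟨_, rfl⟩
  rw [← hY]
  have ht : 200 * (A + kk + 1) ^ 2 = 200 * (A * A) + 400 * (A * kk) + 400 * A + 200 * (kk * kk) +
    400 * kk + 200 := by ring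
  have hAA : A * (A * 50 + 100) = 50 * (A * A) + 100 * A := by ring
  have ht2 : (I.numClients + I.numFacilities) * Y = I.numClients * Y + I.numFacilities * Y := by ring
  rw [ht, ht2]
  refine Ends.seq (n := 40) (n' := I.numClients * Y + I.numFacilities * Y + 200 * (A * A) +
    400 * A + 400 * kk + 160) (R := fun s' => s'.real rDl 0 = δ ∧ s'.real rFar 0 = 6 * R ∧
    s'.real rH 0 = 8 * R) (Ends.straight rfl (by simp [scales]) (by simp [scales, hR, hδ])) ?_ (by omega)
  rintro s0 hf0 ⟨r1, r2, r3⟩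
  refine Ends.step (n' := I.numClients * Y + I.numFacilities * Y + 200 * (A * A) +
    400 * A + 400 * kk + 156) rfl (Ends.step (n' := I.numClients * Y + I.numFacilities * Y +
    200 * (A * A) + 400 * A + 400 * kk + 152) rfl (Ends.seq (ends_net (kk := kk) (off := 0)
    (P := I.numClients) (M := M) (c := c) (ρ := 6 * R) (δ := δ) ?_ hk0 ?_ ?_ ?_ ?_ ?_ hδ0 hM)
    (n' := I.numFacilities * Y + 200 * (A * A) + 400 * A + 300 * kk + 92) ?_
    (by rw [← hY]; omega)) (by simp; omega)) (by simp; omega)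
  · simp [hf0.nat nKK rfl, hk]
  · simp
  · simp
  · simp [hf0.nat aCen rfl, hc]
  · simp [r2]
  · simp [r1]
  rintro s1 hf1 ⟨h1, h2, h3, h4⟩
  simp only [zero_add, Nat.zero_le, true_and] at h2 h4
  have a0 : ∀ A, scales.writesNat A = false → A ≠ 91 → A ≠ 92 → net.writesNat A = false →
      s1.nat A = s.nat A := by
    intro A i1 i2 i3 i4
    rw [hf1.nat A i4, run_nat (by simp [Program.writesNat, *]) rfl,
      run_nat (by simp [Program.writesNat, *]) rfl, hf0.nat A i1]
  have a1 : ∀ A, net.writesReal A = false → s1.real A = s0.real A := by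
    intro A i; rw [hf1.real A i]; simp
  refine Ends.step (n' := I.numFacilities * Y + 200 * (A * A) + 400 * A + 300 * kk + 88) rfl
    (Ends.seq (n := A * 40 + 20) ((ends_fill (X := s1.nat nN 0) (g := s1.nat aN)
      (by simp) ?_ ?_).le ?_)
    (n' := I.numFacilities * Y + 200 * (A * A) + 360 * A + 300 * kk + 68) ?_ (by omega)) (by simp; omega)
  · intro s' hf
    have e : s'.nat nN = _ := hf.nat _ rfl
    simp [e]
  · intro s' z hf hzz hz
    have e : s'.nat aN = _ := hf.nat _ rfl
    simp [e, hzz]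
  · simp
    omega
  intro s2 hf2 h5
  have b0 : ∀ A, A ≠ 22 → A ≠ 82 → A ≠ 23 → s2.nat A = s1.nat A := by
    intro A i1 i2 i3
    rw [hf2.nat A (by simp [fill, forUp, Program.writesNat, *]), run_nat (by simp [Program.writesNat, *]) rfl]
  have b1 : s2.nat nB 0 = s1.nat nN 0 := by rw [hf2.nat _ rfl]; simp
  have b2 : s2.real = s1.real := by funext A; rw [hf2.real A rfl]; simp
  refine Ends.step (n' := I.numFacilities * Y + 200 * (A * A) + 360 * A + 300 * kk + 65) rfl
    (Ends.step (n' := I.numFacilities * Y + 200 * (A * A) + 360 * A + 300 * kk + 62) rfl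
    (Ends.seq (ends_net (kk := kk) (off := I.numClients)
    (P := I.numFacilities) (M := M) (c := c) (ρ := 6 * R) (δ := δ) ?_ hk0 ?_ ?_ ?_ ?_ ?_ hδ0 hM)
    (n' := A * (A * 50 + 100) + 40) ?_
    (by rw [← hY, hAA]; omega)) (by simp; omega)) (by simp; omega)
  · simp only [Program.run, State.nat_setNat_ne, ne_eq, Nat.reduceEqDiff, not_false_eq_true]
    rw [b0 _ (by simp) (by simp) (by simp), a0 _ rfl (by simp) (by simp) rfl, hk]
  · simp
  · simp
  · simp only [Program.run, State.nat_setNat_ne, ne_eq, Nat.reduceEqDiff, not_false_eq_true]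
    rw [b0 _ (by simp) (by simp) (by simp), a0 _ rfl (by simp) (by simp) rfl, hc]
  · simp only [Program.run, State.real_setNat]; rw [b2, a1 _ rfl, r2]
  · simp only [Program.run, State.real_setNat]; rw [b2, a1 _ rfl, r1]
  rintro s3 hf3 ⟨g1, g2, g3, g4⟩
  have c0 : ∀ A, A ≠ 91 → A ≠ 92 → net.writesNat A = false → s3.nat A = s2.nat A := by
    intro A i1 i2 i3
    rw [hf3.nat A i3, run_nat (by simp [Program.writesNat, *]) rfl,
      run_nat (by simp [Program.writesNat, *]) rfl]
  have c1 : s3.real = s2.real := by funext A; rw [hf3.real A rfl]; simp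
  refine (ends_thin (n := s3.nat nN 0) (δ := δ) rfl (by rw [c1, b2, a1 _ rfl, r1]) hδ0).mono ?_ ?_
  · have : s3.nat nN 0 * (s3.nat nN 0 * 50 + 100) ≤ A * (A * 50 + 100) :=
      Nat.mul_le_mul g1 (by omega)
    omega
  rintro s4 hf4 ⟨l1, l2, l3, l4⟩
  have d1 : s4.nat nB 0 = s1.nat nN 0 := by rw [hf4.nat _ rfl, c0 _ (by simp) (by simp) rfl, b1]
  have d2 : s4.nat aLC = s2.nat aLC := by rw [hf4.nat _ rfl, c0 _ (by simp) (by simp) rfl]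
  have d3 : s4.real = s0.real := by
    funext A; rw [hf4.real A rfl, c1, b2, a1 A rfl]
  refine ⟨⟨by rw [d1]; exact h1, l1.trans g1, fun q hq => ?_, fun p hp hi => ?_, fun z hz => ?_,
    fun j hj hi => ?_, l3⟩, by rw [d3, r1], by rw [d3, r3]⟩
  · rw [d1] at hq
    rw [d2, h5 q hq]; exact h2 q hq
  · obtain ⟨z, hz, hz'⟩ := h4 p hp hi
    exact ⟨z, by omega, by rwa [d2, h5 z hz]⟩
  · obtain ⟨y, hy, hy'⟩ := l2 z hz
    rw [hy']; exact g2 y hy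
  · obtain ⟨y, hy, hy'⟩ := g4 j hj hi
    obtain ⟨z, hz, hz'⟩ := l4 y hy
    refine ⟨z, hz, ?_⟩
    have := dist_triangle (I.point (I.numClients + j)) (I.point (s3.nat aN y)) (I.point (s4.nat aG z))
    simp only [pd] at hy' hz' ⊢
    linarith

/-- The binary logarithm of the number of facilities in the net, rounded up. -/
def binLog : Program :=
  assign gLg (.lit 0) ;; assign gPw (.lit 1) ;;
  .loop (.natLt (.var gPw) (.var nG))
    (assign gPw (.add (.var gPw) (.var gPw)) ;; assign gLg (.add (.var gLg) (.lit 1)))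

theorem ends_binLog {s : State} {a : ℕ} (ha : s.nat nG 0 = a) (ha0 : 0 < a) :
    Ends I ε binLog s (a * 30 + 30) fun s' =>
      a ≤ 2 ^ s'.nat gLg 0 ∧ 2 ^ s'.nat gLg 0 ≤ 2 * a := by
  refine Ends.step (n' := a * 30 + 26) rfl (Ends.step (n' := a * 30 + 22) rfl
    ((Ends.loop (fun s' => s'.nat gPw 0 = 2 ^ s'.nat gLg 0 ∧ 2 ^ s'.nat gLg 0 ≤ 2 * a)
      (fun s' => (a - s'.nat gLg 0) * 30) ?_ ?_ ?_).post ?_) (by simp; omega)) (by simp; omega)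
  · simp; omega
  · rintro s' hf ⟨h1, h2⟩ hb
    have e : s'.nat nG = _ := hf.nat _ rfl
    simp [e, ha] at hb
    have hlt : s'.nat gLg 0 < 2 ^ s'.nat gLg 0 := Nat.lt_two_pow_self
    refine ⟨14, Ends.straight rfl (by simp) ⟨⟨?_, ?_⟩, ?_⟩⟩
    · simp [h1]; ring
    · simp [pow_succ]; omega
    · simp; omega
  · simp
  · rintro s' hf ⟨⟨h1, h2⟩, hb⟩
    have e : s'.nat nG = _ := hf.nat _ rfl
    simp [e, ha] at hb
    exact ⟨by omega, h2⟩

/-- The `d`-th root of `nKK`, rounded up. -/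
def root : Program :=
  assign gEl (.lit 0) ;; rassign rPow (.cast (.lit 0)) ;;
  .loop (.realLt (.var rPow) (.cast (.var nKK)))
    (assign gEl (.add (.var gEl) (.lit 1)) ;; rassign rPow (.cast (.lit 1)) ;;
      forUp gI (.lit 0) .dim (rassign rPow (.mul (.var rPow) (.cast (.var gEl)))))

/-- The powers are formed in a real cell, as natural numbers cannot be multiplied. The candidates
are tried in turn, and the root is at most `kk`. -/
theorem ends_root {s : State} {kk : ℕ} (hk : s.nat nKK 0 = kk) (hk0 : 0 < kk) (hd : 0 < I.dim) :
    Ends I ε root s (kk * (I.dim * 30 + 60) + 30) fun s' =>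
      0 < s'.nat gEl 0 ∧ kk ≤ s'.nat gEl 0 ^ I.dim ∧ (s'.nat gEl 0 - 1) ^ I.dim < kk := by
  set d := I.dim with hdd
  refine Ends.step (n' := kk * (d * 30 + 60) + 26) rfl (Ends.step (n' := kk * (d * 30 + 60) + 22) rfl
    ((Ends.loop (fun s' => s'.real rPow 0 = ((s'.nat gEl 0 ^ d : ℕ) : ℝ) ∧
      (s'.nat gEl 0 - 1) ^ d < kk)
      (fun s' => (kk - s'.nat gEl 0) * (d * 30 + 60)) ?_ ?_ ?_).post ?_) (by simp; omega)) (by simp; omega)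
  -- The start `l = 0` fits the invariant because `0 - 1 = 0` for natural numbers and `0 ^ d = 0`
  -- for positive `d`.
  · simp [hd.ne', hk0]
  · rintro s' hf ⟨h1, h2⟩ hb
    have e : s'.nat nKK = _ := hf.nat _ rfl
    simp only [Test.Holds, RealExpr.eval, NatExpr.eval, e, h1] at hb
    simp [hk] at hb
    norm_cast at hb
    have hle : s'.nat gEl 0 ≤ s'.nat gEl 0 ^ d := Nat.le_self_pow hd.ne' _
    set l := s'.nat gEl 0 with hl
    refine ⟨d * 25 + 40, Ends.step (n' := d * 25 + 34) rfl (Ends.step (n' := d * 25 + 28) rfl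
      ((Ends.forUp (k := 10) (a := 0) (b := d) (fun j s'' => s''.nat gEl 0 = l + 1 ∧
        s''.real rPow 0 = (((l + 1) ^ j : ℕ) : ℝ))
        rfl (Nat.zero_le _) rfl (fun _ _ => rfl) ?_ ?_ ?_).post ?_) (by simp; omega)) (by simp; omega)⟩
    · simp [hl]
    · rintro j s'' - hj hf' hjj ⟨h3, h4⟩
      refine Ends.straight rfl (by simp) ⟨by simp [h3], ?_⟩
      simp [h3, h4, pow_succ]
    · simp; omega
    · rintro s'' hf' ⟨⟨h3, h4⟩, -⟩
      refine ⟨⟨by rw [h4, h3], by rw [h3]; simpa using hb⟩, ?_⟩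
      rw [h3]
      have e : kk - l = (kk - (l + 1)) + 1 := by omega
      rw [e, Nat.add_mul]
      simp
      omega
  · simp
  · rintro s' hf ⟨⟨h1, h2⟩, hb⟩
    have e : s'.nat nKK = _ := hf.nat _ rfl
    simp only [Test.Holds, RealExpr.eval, NatExpr.eval, e, h1] at hb
    simp [hk] at hb
    norm_cast at hb
    refine ⟨?_, hb, h2⟩
    by_contra h0
    have : s'.nat gEl 0 = 0 := by omega
    rw [this, zero_pow hd.ne'] at hb
    omega

end RealRAM

/-! ### Clusters of facilities separated by shells -/


namespace RealRAM

variable {I : KSupplier} {ε : ℝ}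

notation "rKey" => (10 : ℕ)
notation "rRad" => (11 : ℕ)
notation "aLab" => (98 : ℕ)
notation "gV" => (99 : ℕ)
notation "gC0" => (100 : ℕ)
notation "gC1" => (101 : ℕ)
notation "gDn" => (102 : ℕ)
notation "gJ" => (103 : ℕ)

/-- If each of `l` steps multiplies the count by more than 1 + x with x = lg/l ≤ 1, the final count
exceeds (1 + x)^l ≥ 2^lg ≥ a, which is impossible. So sustained growth leaves only the case x > 1.
-/
theorem lt_of_growth {C : ℕ → ℕ} {a l lg : ℕ} (hl : 0 < l) (h0 : 1 ≤ C 0) (ha : ∀ g, C g ≤ a)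
    (hlg : a ≤ 2 ^ lg) (h : ∀ g < l, lg * C g < l * (C (g + 1) - C g)) : l < lg := by
  by_contra hle
  rw [not_lt] at hle
  have hl' : (0 : ℝ) < l := by exact_mod_cast hl
  set x : ℝ := lg / l with hx
  have hx0 : 0 ≤ x := by positivity
  have hx1 : x ≤ 1 := by rw [hx, div_le_one hl']; exact_mod_cast hle
  have hstep : ∀ g < l, (1 + x) * C g < C (g + 1) := by
    intro g hg
    have h1 := h g hg
    have h2 : C g ≤ C (g + 1) := by
      by_contra hc
      rw [Nat.sub_eq_zero_of_le (by omega)] at h1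
      omega
    have h3 : (lg : ℝ) * C g < l * (C (g + 1) - C g) := by
      have := (Nat.cast_lt (α := ℝ)).2 h1
      push_cast [Nat.cast_sub h2] at this
      exact this
    have h4 : (lg : ℝ) = l * x := by rw [hx]; field_simp
    rw [h4] at h3
    have : (l : ℝ) * (x * C g) < l * (C (g + 1) - C g) := by rw [← mul_assoc]; exact h3
    have := lt_of_mul_lt_mul_left this hl'.le
    linarith
  have hpow : ∀ g ≤ l, (1 + x) ^ g ≤ C g := by
    intro g
    induction g with
    | zero => intro _; simpa using h0
    | succ g ih =>
      intro hg
      rw [pow_succ']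
      exact (mul_le_mul_of_nonneg_left (ih (by omega)) (by linarith)).trans (hstep g (by omega)).le
  -- Bernoulli's inequality for exponents in [0, 1].
  have h2x : (2 : ℝ) ^ x ≤ 1 + x := by
    have := rpow_one_add_le_one_add_mul_self (s := 1) (by norm_num) hx0 hx1
    rw [mul_one] at this
    convert this using 2
    norm_num
  have h2 : (2 : ℝ) ^ lg ≤ (1 + x) ^ l := by
    have e : (2 : ℝ) ^ lg = (2 ^ x) ^ l := by
      rw [← Real.rpow_natCast (2 ^ x), ← Real.rpow_mul (by norm_num), hx,
        div_mul_cancel₀ _ hl'.ne', Real.rpow_natCast]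
    rw [e]
    exact pow_le_pow_left₀ (by positivity) h2x _
  have h3 : (1 + x) ^ l < C l := by
    obtain ⟨g, rfl⟩ : ∃ g, l = g + 1 := ⟨l - 1, by omega⟩
    rw [pow_succ']
    exact (mul_le_mul_of_nonneg_left (hpow g (by omega)) (by linarith)).trans_lt
      (hstep g (by omega))
  have h4 : (C l : ℝ) ≤ 2 ^ lg := by exact_mod_cast (ha l).trans hlg
  linarith

/-- The items processed so far have labels: `1` for shells, and `2 ≤ lab i` for the cluster around
the item `lab i - 2`. -/
structure Clusters (I : KSupplier) (a : ℕ) (G : ℕ → ℕ) (H : ℝ) (l lg v : ℕ) (lab : ℕ → ℕ)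
    (key : ℕ → ℝ) : Prop where
  labelled : ∀ i < v, lab i ≠ 0
  lab_lt : ∀ i < a, lab i < v + 2
  key_eq : ∀ i < a, 2 ≤ lab i → key i = pd I (G i) (G (lab i - 2)) ∧ key i ≤ H * l
  sep : ∀ i < a, ∀ i' < a, 2 ≤ lab i → lab i' ≠ 1 → lab i' ≠ lab i → H < pd I (G i) (G i')
  few : Nat.count (fun i => lab i = 1) a * l ≤ lg * Nat.count (fun i => lab i ≠ 0) a

open Classical in
/-- The label of the item `i` after the cluster of `v` and its shell have been marked. -/
noncomputable def newLab (I : KSupplier) (G : ℕ → ℕ) (H r : ℝ) (v : ℕ) (lab : ℕ → ℕ) (i : ℕ) : ℕ :=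
  if lab i = 0 then if pd I (G i) (G v) ≤ r then v + 2 else if pd I (G i) (G v) ≤ r + H then 1 else 0
  else lab i

open Classical in
/-- The keys after the cluster of `v` has been marked. -/
noncomputable def newKey (I : KSupplier) (G : ℕ → ℕ) (r : ℝ) (v : ℕ) (lab : ℕ → ℕ) (key : ℕ → ℝ)
    (i : ℕ) : ℝ :=
  if lab i = 0 ∧ pd I (G i) (G v) ≤ r then pd I (G i) (G v) else key i

open Classical in
/-- The number of items without label at distance at most `r` from `v`. -/
noncomputable def ballCount (I : KSupplier) (a : ℕ) (G : ℕ → ℕ) (v : ℕ) (lab : ℕ → ℕ) (r : ℝ) : ℕ :=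
  Nat.count (fun i => lab i = 0 ∧ pd I (G i) (G v) ≤ r) a

theorem ballCount_le (a : ℕ) (G : ℕ → ℕ) (v : ℕ) (lab : ℕ → ℕ) (r : ℝ) :
    ballCount I a G v lab r ≤ a := by
  classical
  exact Nat.count_le _

theorem ballCount_mono {a : ℕ} {G : ℕ → ℕ} {v : ℕ} {lab : ℕ → ℕ} {r r' : ℝ} (h : r ≤ r') :
    ballCount I a G v lab r ≤ ballCount I a G v lab r' :=
  Nat.count_mono_left fun _ _ hi => ⟨hi.1, hi.2.trans h⟩

theorem ballCount_pos {a : ℕ} {G : ℕ → ℕ} {v : ℕ} {lab : ℕ → ℕ} (hv : v < a) (h : lab v = 0) :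
    1 ≤ ballCount I a G v lab 0 := by
  classical
  unfold ballCount
  rw [Nat.count_eq_card_filter_range]
  exact Finset.card_pos.2 ⟨v, by simp [hv, h]⟩

/-- The cluster takes the unlabelled items within r of `v`, its shell those within r + H. What stays
unlabelled is more than H away from the cluster by the triangle inequality. Earlier clusters need no
new argument, because `sep` already keeps them away from unlabelled items. The shell is charged to
the items labelled in this step, so `few` adds up. -/
theorem Clusters.next {a : ℕ} {G : ℕ → ℕ} {H r : ℝ} {l lg v : ℕ} {lab : ℕ → ℕ} {key : ℕ → ℝ}
    (h : Clusters I a G H l lg v lab key) (hH : 0 ≤ H) (hr0 : 0 ≤ r) (hr : r ≤ H * l)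
    (hc : l * (ballCount I a G v lab (r + H) - ballCount I a G v lab r) ≤
      lg * ballCount I a G v lab (r + H)) :
    Clusters I a G H l lg (v + 1) (newLab I G H r v lab) (newKey I G r v lab key) := by
  classical
  have hnew : ∀ i, 2 ≤ newLab I G H r v lab i →
      (lab i = 0 ∧ pd I (G i) (G v) ≤ r ∧ newLab I G H r v lab i = v + 2 ∧
        newKey I G r v lab key i = pd I (G i) (G v)) ∨
      (2 ≤ lab i ∧ newLab I G H r v lab i = lab i ∧ newKey I G r v lab key i = key i) := by
    intro i hi
    unfold newLab newKey at *
    split_ifs at * <;> simp_all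
  have hold : ∀ i, newLab I G H r v lab i ≠ 1 →
      (lab i = 0 ∧ pd I (G i) (G v) ≤ r ∧ newLab I G H r v lab i = v + 2) ∨
      (lab i = 0 ∧ r + H < pd I (G i) (G v)) ∨
      (lab i ≠ 1 ∧ lab i ≠ 0 ∧ newLab I G H r v lab i = lab i) := by
    intro i hi
    unfold newLab at *
    split_ifs at * <;> simp_all
  refine ⟨fun i hi => ?_, fun i hi => ?_, fun i hi h2 => ?_, fun i hi i' hi' h2 h1 hne => ?_, ?_⟩
  · rcases Nat.lt_succ_iff_lt_or_eq.1 hi with hi | rfl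
    · simp [newLab, h.labelled i hi]
    · unfold newLab
      split_ifs with h1 h2 h3
      · omega
      · omega
      · exact absurd (by simpa using hr0) h2
      · exact h1
  · have := h.lab_lt i hi
    unfold newLab
    split_ifs <;> omega
  · rcases hnew i h2 with ⟨_, h3, h4, h5⟩ | ⟨h3, h4, h5⟩
    · rw [h4, h5]; exact ⟨rfl, h3.trans hr⟩
    · rw [h4, h5]; exact h.key_eq i hi h3
  · rcases hnew i h2 with ⟨h3, h4, h5, -⟩ | ⟨h3, h4, -⟩
    · rcases hold i' h1 with ⟨_, _, h6⟩ | ⟨h6, h7⟩ | ⟨h6, h7, h8⟩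
      · exact absurd (h6.trans h5.symm) hne
      · have := dist_triangle (I.point (G i')) (I.point (G i)) (I.point (G v))
        simp only [pd] at *
        rw [dist_comm]
        linarith
      · rw [pd, dist_comm]
        exact h.sep i' hi' i hi (by omega) (by omega) (by omega)
    · refine h.sep i hi i' hi' h3 ?_ ?_ <;>
        rcases hold i' h1 with ⟨h6, -⟩ | ⟨h6, -⟩ | ⟨h6, h7, h8⟩ <;> omega
  · have hmono := ballCount_mono (I := I) (a := a) (G := G) (v := v) (lab := lab)
      (show r ≤ r + H by linarith)
    have hpt : ∀ i, pd I (G i) (G v) ≤ r → pd I (G i) (G v) ≤ r + H := fun i hi => by linarith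
    -- The new shell is the difference of the two balls; the identity is stated with sums to avoid
    -- truncated subtraction during the induction.
    have e1 : ∀ n, Nat.count (fun i => newLab I G H r v lab i = 1) n + ballCount I n G v lab r =
        Nat.count (fun i => lab i = 1) n + ballCount I n G v lab (r + H) := by
      intro n
      unfold ballCount
      induction n with
      | zero => simp
      | succ n ih =>
        have : (if newLab I G H r v lab n = 1 then 1 else 0) +
            (if lab n = 0 ∧ pd I (G n) (G v) ≤ r then 1 else 0) = (if lab n = 1 then 1 else 0) +
            (if lab n = 0 ∧ pd I (G n) (G v) ≤ r + H then 1 else 0) := by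
          unfold newLab
          by_cases h1 : lab n = 0
          · by_cases h2 : pd I (G n) (G v) ≤ r
            · simp [h1, h2, hpt n h2]
            · by_cases h3 : pd I (G n) (G v) ≤ r + H <;> simp [h1, h2, h3]
          · simp [h1]
        simp only [Nat.count_succ]
        omega
    have e2 : ∀ n, Nat.count (fun i => newLab I G H r v lab i ≠ 0) n =
        Nat.count (fun i => lab i ≠ 0) n + ballCount I n G v lab (r + H) := by
      intro n
      unfold ballCount
      induction n with
      | zero => simp
      | succ n ih =>
        have : (if newLab I G H r v lab n ≠ 0 then 1 else 0) = (if lab n ≠ 0 then 1 else 0) +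
            (if lab n = 0 ∧ pd I (G n) (G v) ≤ r + H then 1 else 0) := by
          unfold newLab
          by_cases h1 : lab n = 0
          · by_cases h2 : pd I (G n) (G v) ≤ r
            · simp [h1, h2, hpt n h2]
            · by_cases h3 : pd I (G n) (G v) ≤ r + H <;> simp [h1, h2, h3]
          · simp [h1]
        simp only [Nat.count_succ]
        omega
    have e3 := e1 a
    rw [e2 a]
    have e4 : Nat.count (fun i => newLab I G H r v lab i = 1) a =
      Nat.count (fun i => lab i = 1) a + (ballCount I a G v lab (r + H) - ballCount I a G v lab r) := by
      omega
    rw [e4, Nat.add_mul, Nat.mul_add, mul_comm _ l, mul_comm _ l]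
    have := h.few
    rw [mul_comm _ l] at this
    omega

/-- The distance of the item `gI` to the item `gV`. -/
abbrev toCenter : RealExpr := .dist (.get aG (.var gI)) (.get aG (.var gV))

/-- The numbers of items without label in two balls around the item `gV`. -/
def growCount : Program :=
  assign gC0 (.lit 0) ;; assign gC1 (.lit 0) ;;
  forUp gI (.lit 0) (.var nG)
    (.cond (.natLt (.get aLab (.var gI)) (.lit 1))
      (.cond (.realLe toCenter (.var rRad))
        (assign gC0 (.add (.var gC0) (.lit 1)) ;; assign gC1 (.add (.var gC1) (.lit 1)))
        (.cond (.realLe toCenter (.add (.var rRad) (.var rH)))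
          (assign gC1 (.add (.var gC1) (.lit 1))) .skip)) .skip)

theorem ends_growCount {s : State} {a v : ℕ} {H : ℝ} (ha : s.nat nG 0 = a) (hv : s.nat gV 0 = v)
    (hH : s.real rH 0 = H) (hH0 : 0 ≤ H) :
    Ends I ε growCount s (a * 100 + 50) fun s' =>
      s'.nat gC0 0 = ballCount I a (s.nat aG) v (s.nat aLab) (s.real rRad 0) ∧
      s'.nat gC1 0 = ballCount I a (s.nat aG) v (s.nat aLab) (s.real rRad 0 + H) := by
  classical
  refine Ends.step (n' := a * 100 + 40) rfl (Ends.step (n' := a * 100 + 30) rfl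
    ((Ends.forUp (k := 60) (a := 0) (b := a) (fun z s' =>
      s'.nat gC0 0 = ballCount I z (s.nat aG) v (s.nat aLab) (s.real rRad 0) ∧
      s'.nat gC1 0 = ballCount I z (s.nat aG) v (s.nat aLab) (s.real rRad 0 + H))
      rfl (Nat.zero_le _) rfl ?_ ?_ ?_ ?_).post fun s' _ h => h.1) (by simp; omega)) (by simp; omega)
  · intro s' hf
    have e : s'.nat nG = _ := hf.nat _ rfl
    simp [e, ha]
  · simp [ballCount]
  · rintro z s' - hz hf hzz ⟨h1, h2⟩
    have f1 : s'.nat aG = _ := hf.nat _ rfl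
    have f2 : s'.nat aLab = _ := hf.nat _ rfl
    have f3 : s'.nat gV = _ := hf.nat _ rfl
    have f4 : ∀ A, s'.real A = s.real A := fun A => hf.real A rfl
    simp at f1 f2 f3
    have hpt : pd I (s.nat aG z) (s.nat aG v) ≤ s.real rRad 0 →
      pd I (s.nat aG z) (s.nat aG v) ≤ s.real rRad 0 + H := fun h => by linarith
    refine Ends.straight rfl (by simp) ?_
    unfold ballCount at *
    simp only [Program.run]
    split_ifs with c1 c2 c3 <;> simp only [Test.Holds, NatExpr.eval, RealExpr.eval, f1, f2, f3, f4,
      hv, hH, hzz, not_lt, not_le, Nat.lt_one_iff] at c1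
    · simp only [Test.Holds, NatExpr.eval, RealExpr.eval, f1, f2, f3, f4, hv, hH, hzz, not_lt] at c2
      simp [Nat.count_succ, c1, c2, hpt c2, h1, h2, pd]
    · simp only [Test.Holds, NatExpr.eval, RealExpr.eval, f1, f2, f3, f4, hv, hH, hzz, not_lt] at c2 c3
      simp [Nat.count_succ, c1, c2, c3, h1, h2, pd]
    · simp only [Test.Holds, NatExpr.eval, RealExpr.eval, f1, f2, f3, f4, hv, hH, hzz, not_lt] at c2 c3
      simp [Nat.count_succ, c1, c2, c3, h1, h2, pd]
    · have : s.nat aLab z ≠ 0 := by omega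
      simp [Nat.count_succ, this, h1, h2]
  · simp; omega

/-- The radius of the next cluster. -/
def growRadius : Program :=
  rassign rRad (.cast (.lit 0)) ;; assign gDn (.lit 0) ;;
  forUp gJ (.lit 0) (.var gEl)
    (.cond (.natLt (.var gDn) (.lit 1))
      (growCount ;;
        .cond (.realLe (.mul (.cast (.var gEl)) (.cast (.sub (.var gC1) (.var gC0))))
            (.mul (.cast (.var gLg)) (.cast (.var gC0))))
          (assign gDn (.lit 1)) (rassign rRad (.add (.var rRad) (.var rH)))) .skip)

/-- The first of the radii 0, H, …, (l − 1)H whose shell is small compared with its ball is taken,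
and H·l if there is none. -/
theorem ends_growRadius {s : State} {a v l lg : ℕ} {H : ℝ} (ha : s.nat nG 0 = a)
    (hv : s.nat gV 0 = v) (hH : s.real rH 0 = H) (hH0 : 0 ≤ H) (hl : s.nat gEl 0 = l) (hl0 : 0 < l)
    (hlg : s.nat gLg 0 = lg) (ha2 : a ≤ 2 ^ lg) (hva : v < a) (hlab : s.nat aLab v = 0) :
    Ends I ε growRadius s (l * (a * 100 + 120) + 40) fun s' =>
      0 ≤ s'.real rRad 0 ∧ s'.real rRad 0 ≤ H * l ∧
      l * (ballCount I a (s.nat aG) v (s.nat aLab) (s'.real rRad 0 + H) -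
          ballCount I a (s.nat aG) v (s.nat aLab) (s'.real rRad 0)) ≤
        lg * ballCount I a (s.nat aG) v (s.nat aLab) (s'.real rRad 0 + H) := by
  set C : ℝ → ℕ := ballCount I a (s.nat aG) v (s.nat aLab) with hC
  refine Ends.step (n' := l * (a * 100 + 120) + 30) rfl (Ends.step (n' := l * (a * 100 + 120) + 20)
    rfl ((Ends.forUp (k := a * 100 + 90) (a := 0) (b := l) (fun g s' =>
      (s'.nat gDn 0 = 0 ∧ s'.real rRad 0 = H * g ∧
        ∀ g' < g, lg * C (H * g') < l * (C (H * g' + H) - C (H * g'))) ∨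
      (s'.nat gDn 0 = 1 ∧ ∃ g' < l, s'.real rRad 0 = H * g' ∧
        l * (C (H * g' + H) - C (H * g')) ≤ lg * C (H * g')))
      rfl (Nat.zero_le _) rfl ?_ ?_ ?_ ?_).post ?_) (by simp; omega)) (by simp; omega)
  · intro s' hf
    have e : s'.nat gEl = _ := hf.nat _ rfl
    simp [e, hl]
  · simp
  · rintro g s' - hg hf hgg hI
    have f1 : s'.nat nG = s.nat nG := hf.nat _ rfl
    have f2 : s'.nat gV = s.nat gV := hf.nat _ rfl
    have f3 : s'.nat gEl = s.nat gEl := hf.nat _ rfl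
    have f4 : s'.nat gLg = s.nat gLg := hf.nat _ rfl
    have f5 : s'.nat aG = s.nat aG := hf.nat _ rfl
    have f6 : s'.nat aLab = s.nat aLab := hf.nat _ rfl
    have f7 : s'.real rH = s.real rH := hf.real _ rfl
    refine Ends.cond (n := a * 100 + 80) (fun hb => ?_) (fun hb => ?_) (by simp; omega)
    · simp only [Test.Holds, NatExpr.eval, Nat.lt_one_iff] at hb
      obtain ⟨h1, h2, h3⟩ | ⟨h1, -⟩ := hI
      swap
      · omega
      refine Ends.seq (ends_growCount (by rw [f1, ha]) (by rw [f2, hv]) (by rw [f7, hH]) hH0)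
        (n' := 30) ?_ (by omega)
      rintro s2 hf2 ⟨k1, k2⟩
      rw [f5, f6, h2] at k1 k2
      have g1 : s2.nat gEl 0 = l := by rw [hf2.nat _ rfl, f3, hl]
      have g2 : s2.nat gLg 0 = lg := by rw [hf2.nat _ rfl, f4, hlg]
      have g3 : s2.nat gDn 0 = 0 := by rw [hf2.nat _ rfl, hb]
      have g4 : s2.real rRad 0 = H * g := by rw [hf2.real _ rfl, h2]
      have g5 : s2.real rH 0 = H := by rw [hf2.real _ rfl, f7, hH]
      refine Ends.straight rfl (by simp) ?_
      simp only [Program.run]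
      split_ifs with hc <;> simp only [Test.Holds, NatExpr.eval, RealExpr.eval, g1, g2, k1, k2,
        not_lt, not_le] at hc
      · norm_cast at hc
        exact .inr ⟨by simp, g, hg, by simpa using g4, hc⟩
      · norm_cast at hc
        refine .inl ⟨by simpa using g3, by simp [g4, g5]; ring, fun g' hg' => ?_⟩
        rcases Nat.lt_succ_iff_lt_or_eq.1 hg' with hg' | rfl
        · exact h3 g' hg'
        · exact hc
    · simp only [Test.Holds, NatExpr.eval, Nat.lt_one_iff] at hb
      refine Ends.straight rfl (by simp) ?_
      obtain ⟨h1, h2, h3⟩ | ⟨h1, h2⟩ := hI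
      · exact absurd h1 hb
      · exact .inr ⟨by simpa using h1, by simpa using h2⟩
  · have : l * (a * 100 + 90 + 2 + 10) ≤ l * (a * 100 + 120) := Nat.mul_le_mul_left _ (by omega)
    simp; omega
  · rintro s' - ⟨⟨-, h2, h3⟩ | ⟨-, g, hg, h2, h3⟩, -⟩
    -- No radius was accepted, so all steps showed growth and `l < lg`. Then the required inequality
    -- is trivial, as the shell is part of the larger ball.
    · have hlt : l < lg := lt_of_growth (C := fun g => C (H * g)) hl0
        (by simpa using ballCount_pos hva hlab) (fun g => ballCount_le _ _ _ _ _) ha2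
        (fun g hg => by
          have e : H * ((g + 1 : ℕ) : ℝ) = H * g + H := by push_cast; ring
          show _ < l * (C (H * ((g + 1 : ℕ) : ℝ)) - _)
          rw [e]; exact h3 g hg)
      rw [h2]
      exact ⟨by positivity, le_rfl, Nat.mul_le_mul hlt.le (Nat.sub_le _ _)⟩
    · rw [h2]
      refine ⟨by positivity, mul_le_mul_of_nonneg_left (by exact_mod_cast hg.le) hH0, h3.trans ?_⟩
      exact Nat.mul_le_mul_left _ (ballCount_mono (by linarith))

/-- The next cluster and its shell get labels. -/
def growLabel : Program :=
  forUp gI (.lit 0) (.var nG)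
    (.cond (.natLt (.get aLab (.var gI)) (.lit 1))
      (.cond (.realLe toCenter (.var rRad))
        (.setNat aLab (.var gI) (.add (.var gV) (.lit 2)) ;; .setReal rKey (.var gI) toCenter)
        (.cond (.realLe toCenter (.add (.var rRad) (.var rH)))
          (.setNat aLab (.var gI) (.lit 1)) .skip)) .skip)

theorem ends_growLabel {s : State} {a v : ℕ} {H : ℝ} (ha : s.nat nG 0 = a) (hv : s.nat gV 0 = v)
    (hH : s.real rH 0 = H) :
    Ends I ε growLabel s (a * 100 + 50) fun s' => ∀ i < a,
      s'.nat aLab i = newLab I (s.nat aG) H (s.real rRad 0) v (s.nat aLab) i ∧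
      s'.real rKey i = newKey I (s.nat aG) (s.real rRad 0) v (s.nat aLab) (s.real rKey) i := by
  refine (Ends.forUp (k := 60) (a := 0) (b := a) (fun z s' => (∀ i < z,
      s'.nat aLab i = newLab I (s.nat aG) H (s.real rRad 0) v (s.nat aLab) i ∧
      s'.real rKey i = newKey I (s.nat aG) (s.real rRad 0) v (s.nat aLab) (s.real rKey) i) ∧
      ∀ i, z ≤ i → s'.nat aLab i = s.nat aLab i ∧ s'.real rKey i = s.real rKey i)
      rfl (Nat.zero_le _) rfl ?_ ?_ ?_ ?_).post fun s' _ h => h.1.1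
  · intro s' hf
    have e : s'.nat nG = _ := hf.nat _ rfl
    simp [e, ha]
  · simp
  · rintro z s' - hz hf hzz ⟨h1, h2⟩
    have f1 : s'.nat aG = s.nat aG := hf.nat _ rfl
    have f3 : s'.nat gV = s.nat gV := hf.nat _ rfl
    have f4 : s'.real rRad = s.real rRad := hf.real _ rfl
    have f5 : s'.real rH = s.real rH := hf.real _ rfl
    obtain ⟨h3, h4⟩ := h2 z le_rfl
    have key : ∀ s'' : State,
        (∀ i, i ≠ z → s''.nat aLab i = s'.nat aLab i ∧ s''.real rKey i = s'.real rKey i) →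
        s''.nat aLab z = newLab I (s.nat aG) H (s.real rRad 0) v (s.nat aLab) z →
        s''.real rKey z = newKey I (s.nat aG) (s.real rRad 0) v (s.nat aLab) (s.real rKey) z →
        (∀ i < z + 1, s''.nat aLab i = newLab I (s.nat aG) H (s.real rRad 0) v (s.nat aLab) i ∧
          s''.real rKey i = newKey I (s.nat aG) (s.real rRad 0) v (s.nat aLab) (s.real rKey) i) ∧
        ∀ i, z + 1 ≤ i → s''.nat aLab i = s.nat aLab i ∧ s''.real rKey i = s.real rKey i := by
      intro s'' k1 k2 k3
      refine ⟨fun i hi => ?_, fun i hi => ?_⟩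
      · rcases Nat.lt_succ_iff_lt_or_eq.1 hi with hi | rfl
        · rw [(k1 i hi.ne).1, (k1 i hi.ne).2]; exact h1 i hi
        · exact ⟨k2, k3⟩
      · rw [(k1 i (by omega)).1, (k1 i (by omega)).2]; exact h2 i (by omega)
    refine Ends.straight rfl (by simp) ?_
    refine key _ ?_ ?_ ?_
    · intro i hi
      simp only [Program.run]
      split_ifs <;> simp [hzz, hi]
    all_goals
      simp only [Program.run]
      split_ifs with c1 c2 c3 <;> simp only [Test.Holds, NatExpr.eval, Nat.lt_one_iff, hzz, h3] at c1
      · simp only [Test.Holds, NatExpr.eval, RealExpr.eval, f1, f3, f4, f5, hv, hH, hzz, not_lt] at c2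
        simp [newLab, newKey, c1, c2, f1, f3, hv, hzz, pd]
      · simp only [Test.Holds, NatExpr.eval, RealExpr.eval, f1, f3, f4, f5, hv, hH, hzz, not_lt] at c2 c3
        simp [newLab, newKey, c1, c2, c3, f1, f3, hv, hzz, pd, h4]
      · simp only [Test.Holds, NatExpr.eval, RealExpr.eval, f1, f3, f4, f5, hv, hH, hzz, not_lt] at c2 c3
        simp [newLab, newKey, c1, c2, c3, f1, f3, hv, hzz, pd, h3, h4]
      · simp [newLab, newKey, c1, h3, h4]
  · simp; omega

/-- All items get labels. -/
def cluster : Program :=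
  fill gI aLab (.var nG) (.lit 0) ;;
  forUp gV (.lit 0) (.var nG)
    (.cond (.natLt (.get aLab (.var gV)) (.lit 1)) (growRadius ;; growLabel) .skip)

theorem Clusters.congr {a : ℕ} {G : ℕ → ℕ} {H : ℝ} {l lg v : ℕ} {lab lab' : ℕ → ℕ}
    {key key' : ℕ → ℝ} (h : Clusters I a G H l lg v lab key) (hva : v ≤ a)
    (h' : ∀ i < a, lab' i = lab i ∧ key' i = key i) : Clusters I a G H l lg v lab' key' := by
  have hcount : ∀ (p : ℕ → Prop) [DecidablePred p], Nat.count (fun i => p (lab' i)) a =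
      Nat.count (fun i => p (lab i)) a := by
    intro p _
    rw [Nat.count_eq_card_filter_range, Nat.count_eq_card_filter_range]
    congr 1
    refine Finset.filter_congr fun i hi => ?_
    rw [(h' i (Finset.mem_range.1 hi)).1]
  refine ⟨fun i hi => ?_, fun i hi => ?_, fun i hi => ?_, fun i hi i' hi' => ?_, ?_⟩
  · rw [(h' i (by omega)).1]; exact h.labelled i hi
  · rw [(h' i hi).1]; exact h.lab_lt i hi
  · rw [(h' i hi).1, (h' i hi).2]; exact h.key_eq i hi
  · rw [(h' i hi).1, (h' i' hi').1]; exact h.sep i hi i' hi'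
  · rw [hcount (· = 1), hcount (· ≠ 0)]; exact h.few

theorem ends_cluster {s : State} {a l lg : ℕ} {H : ℝ} (ha : s.nat nG 0 = a)
    (hH : s.real rH 0 = H) (hH0 : 0 ≤ H) (hl : s.nat gEl 0 = l) (hl0 : 0 < l)
    (hlg : s.nat gLg 0 = lg) (ha2 : a ≤ 2 ^ lg) :
    Ends I ε cluster s (a * ((l + 1) * (a * 100 + 150)) + a * 200 + 60) fun s' =>
      Clusters I a (s.nat aG) H l lg a (s'.nat aLab) (s'.real rKey) := by
  have e1 : (l + 1) * (a * 100 + 150) = l * (a * 100 + 120) + l * 30 + a * 100 + 150 := by ring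
  refine Ends.seq (n := a * 20 + 20) (n' := a * ((l + 1) * (a * 100 + 150)) + a * 100 + 30)
    ((ends_fill (X := a) (g := fun _ => 0) (by simp) ?_ (fun _ _ _ _ _ => rfl)).le
        (by simp; omega)) ?_ (by omega)
  · intro s' hf
    have e : s'.nat nG = s.nat nG := hf.nat _ rfl
    simp [e, ha]
  intro s1 hf1 h1
  refine (Ends.forUp (k := (l + 1) * (a * 100 + 150) + 60) (a := 0) (b := a) (fun v s' =>
    Clusters I a (s.nat aG) H l lg v (s'.nat aLab) (s'.real rKey))
    rfl (Nat.zero_le _) rfl ?_ ?_ ?_ ?_).post fun s' _ h => h.1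
  · intro s' hf
    have e : s'.nat nG = _ := hf.nat _ rfl
    simp [e, hf1.nat nG rfl, ha]
  · have e0 : ∀ i < a, (s1.setNat gV 0 0).nat aLab i = 0 := fun i hi => by simpa using h1 i hi
    refine ⟨fun i hi => absurd hi (by omega), fun i hi => by rw [e0 i hi]; omega,
      fun i hi h2 => by rw [e0 i hi] at h2; omega, fun i hi _ _ h2 => by rw [e0 i hi] at h2; omega, ?_⟩
    have : Nat.count (fun i => (s1.setNat gV 0 0).nat aLab i = 1) a = 0 := by
      rw [Nat.count_eq_card_filter_range, Finset.card_eq_zero, Finset.filter_eq_empty_iff]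
      intro i hi
      rw [e0 i (Finset.mem_range.1 hi)]; omega
    rw [this]; omega
  · rintro v s' - hv hf hvv h
    have f1 : s'.nat nG = s1.nat nG := hf.nat _ rfl
    have f2 : s'.nat aG = s1.nat aG := hf.nat _ rfl
    have f3 : s'.nat gEl = s1.nat gEl := hf.nat _ rfl
    have f4 : s'.nat gLg = s1.nat gLg := hf.nat _ rfl
    have f5 : s'.real rH = s1.real rH := hf.real _ rfl
    have k1 : s1.nat nG = s.nat nG := hf1.nat _ rfl
    have k2 : s1.nat aG = s.nat aG := hf1.nat _ rfl
    have k3 : s1.nat gEl = s.nat gEl := hf1.nat _ rfl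
    have k4 : s1.nat gLg = s.nat gLg := hf1.nat _ rfl
    have k5 : s1.real rH = s.real rH := hf1.real _ rfl
    refine Ends.cond (n := l * (a * 100 + 120) + a * 100 + 110) (fun hb => ?_) (fun hb => ?_)
      (by simp; omega)
    · simp only [Test.Holds, NatExpr.eval, Nat.lt_one_iff, hvv] at hb
      refine Ends.seq (ends_growRadius (by rw [f1, k1, ha]) hvv (by rw [f5, k5, hH]) hH0
        (by rw [f3, k3, hl]) hl0 (by rw [f4, k4, hlg]) ha2 hv hb) (n' := a * 100 + 50) ?_ (by omega)
      rintro s2 hf2 ⟨r1, r2, r3⟩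
      have g1 : s2.nat nG = s'.nat nG := hf2.nat _ rfl
      have g2 : s2.nat gV = s'.nat gV := hf2.nat _ rfl
      have g3 : s2.real rH = s'.real rH := hf2.real _ rfl
      have g4 : s2.nat aG = s'.nat aG := hf2.nat _ rfl
      have g5 : s2.nat aLab = s'.nat aLab := hf2.nat _ rfl
      have g6 : s2.real rKey = s'.real rKey := hf2.real _ rfl
      rw [f2, k2] at r3
      have hn := h.next hH0 r1 r2 r3
      refine (ends_growLabel (a := a) (v := v) (H := H) (by rw [g1, f1, k1, ha]) (by rw [g2, hvv])
        (by rw [g3, f5, k5, hH])).post ?_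
      intro s3 hf3 h3
      rw [g4, g5, g6, f2, k2] at h3
      simpa using hn.congr (by omega) h3
    · simp only [Test.Holds, NatExpr.eval, Nat.lt_one_iff, hvv] at hb
      refine Ends.straight rfl (by simp) ?_
      refine ⟨fun i hi => ?_, fun i hi => ?_, ?_, ?_, ?_⟩
      · simp only [Program.run, State.nat_setNat_ne, ne_eq, Nat.reduceEqDiff, not_false_eq_true]
        rcases Nat.lt_succ_iff_lt_or_eq.1 hi with hi | rfl
        · exact h.labelled i hi
        · exact hb
      · simp only [Program.run, State.nat_setNat_ne, ne_eq, Nat.reduceEqDiff, not_false_eq_true]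
        have := h.lab_lt i hi
        omega
      · simpa using h.key_eq
      · simpa using h.sep
      · simpa using h.few
  · have : a * ((l + 1) * (a * 100 + 150) + 60 + 2 + 10) = a * ((l + 1) * (a * 100 + 150)) + a * 72 := by
      ring
    simp; omega

end RealRAM

/-! ### The order of the facilities -/


namespace RealRAM

variable {I : KSupplier} {ε : ℝ}

/-- The order by labels, keys and indices. -/
def Prec (lab : ℕ → ℕ) (key : ℕ → ℝ) (i p : ℕ) : Prop :=
  lab i < lab p ∨ lab i ≤ lab p ∧ (key i < key p ∨ key i ≤ key p ∧ i < p)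

theorem Prec.irrefl (lab : ℕ → ℕ) (key : ℕ → ℝ) (i : ℕ) : ¬ Prec lab key i i := by
  simp [Prec]

theorem Prec.trans {lab : ℕ → ℕ} {key : ℕ → ℝ} {i p q : ℕ} (h : Prec lab key i p)
    (h' : Prec lab key p q) : Prec lab key i q := by
  unfold Prec at *
  rcases h with h | ⟨h1, h | ⟨h2, h3⟩⟩ <;> rcases h' with h' | ⟨h1', h' | ⟨h2', h3'⟩⟩
  · exact .inl (by omega)
  · exact .inl (by omega)
  · exact .inl (by omega)
  · exact .inl (by omega)
  · exact .inr ⟨by omega, .inl (h.trans h')⟩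
  · exact .inr ⟨by omega, .inl (h.trans_le h2')⟩
  · exact .inl (by omega)
  · exact .inr ⟨by omega, .inl (h2.trans_lt h')⟩
  · exact .inr ⟨by omega, .inr ⟨h2.trans h2', by omega⟩⟩

theorem Prec.total {lab : ℕ → ℕ} {key : ℕ → ℝ} {i p : ℕ} (h : i ≠ p) :
    Prec lab key i p ∨ Prec lab key p i := by
  unfold Prec
  rcases lt_trichotomy (lab i) (lab p) with h1 | h1 | h1
  · exact .inl (.inl h1)
  · rcases lt_trichotomy (key i) (key p) with h2 | h2 | h2
    · exact .inl (.inr ⟨h1.le, .inl h2⟩)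
    · rcases lt_or_gt_of_ne h with h3 | h3
      · exact .inl (.inr ⟨h1.le, .inr ⟨h2.le, h3⟩⟩)
      · exact .inr (.inr ⟨h1.ge, .inr ⟨h2.ge, h3⟩⟩)
    · exact .inr (.inr ⟨h1.ge, .inl h2⟩)
  · exact .inr (.inl h1)

open Classical in
/-- The position of the item `p` in the order. -/
noncomputable def rank (lab : ℕ → ℕ) (key : ℕ → ℝ) (a p : ℕ) : ℕ :=
  Nat.count (fun i => Prec lab key i p) a

theorem rank_lt_rank {lab : ℕ → ℕ} {key : ℕ → ℝ} {a i p : ℕ} (hi : i < a)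
    (h : Prec lab key i p) : rank lab key a i < rank lab key a p := by
  classical
  unfold rank
  rw [Nat.count_eq_card_filter_range, Nat.count_eq_card_filter_range]
  refine Finset.card_lt_card (Finset.ssubset_iff_subset_ne.2 ⟨fun x hx => ?_, fun he => ?_⟩)
  · rw [Finset.mem_filter] at hx ⊢
    exact ⟨hx.1, hx.2.trans h⟩
  · have : i ∈ (Finset.range a).filter fun x => Prec lab key x p := by simp [hi, h]
    rw [← he] at this
    exact Prec.irrefl lab key i (Finset.mem_filter.1 this).2

theorem rank_inj {lab : ℕ → ℕ} {key : ℕ → ℝ} {a i p : ℕ} (hi : i < a) (hp : p < a)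
    (h : rank lab key a i = rank lab key a p) : i = p := by
  by_contra hne
  rcases Prec.total (lab := lab) (key := key) hne with h1 | h1
  · have := rank_lt_rank hi h1; omega
  · have := rank_lt_rank hp h1; omega

theorem rank_lt {lab : ℕ → ℕ} {key : ℕ → ℝ} {a p : ℕ} (hp : p < a) : rank lab key a p < a := by
  classical
  unfold rank
  rw [Nat.count_eq_card_filter_range]
  have := Finset.card_lt_card (s := (Finset.range a).filter fun x => Prec lab key x p)
    (t := Finset.range a) (Finset.filter_ssubset.2 ⟨p, by simpa using hp, Prec.irrefl lab key p⟩)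
  simpa using this

theorem exists_rank_eq {lab : ℕ → ℕ} {key : ℕ → ℝ} {a z : ℕ} (hz : z < a) :
    ∃ p < a, rank lab key a p = z := by
  have := Finset.surj_on_of_inj_on_of_card_le (s := Finset.range a) (t := Finset.range a)
    (fun p _ => rank lab key a p) (fun p hp => Finset.mem_range.2 (rank_lt (Finset.mem_range.1 hp)))
    (fun i p hi hp h => rank_inj (Finset.mem_range.1 hi) (Finset.mem_range.1 hp) h) le_rfl z
    (Finset.mem_range.2 hz)
  obtain ⟨p, hp, h⟩ := this
  exact ⟨p, Finset.mem_range.1 hp, h.symm⟩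

/-- One of two tests succeeds. -/
abbrev Test.or (b c : Test) : Test := .neg (.conj (.neg b) (.neg c))

/-- The item `gI` precedes the item `gP`. -/
abbrev precTest : Test :=
  .or (.natLt (.get aLab (.var gI)) (.get aLab (.var gP)))
    (.conj (.natLe (.get aLab (.var gI)) (.get aLab (.var gP)))
      (.or (.realLt (.get rKey (.var gI)) (.get rKey (.var gP)))
        (.conj (.realLe (.get rKey (.var gI)) (.get rKey (.var gP))) (.natLt (.var gI) (.var gP)))))

/-- The list of facilities in the order of labels and keys. -/
def arrange : Program :=
  assign nA (.var nG) ;;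
  forUp gP (.lit 0) (.var nG)
    (assign gX (.lit 0) ;;
      forUp gI (.lit 0) (.var nG)
        (.cond precTest (assign gX (.add (.var gX) (.lit 1))) .skip) ;;
      .setNat aLF (.var gX) (.get aG (.var gP)))

/-- An item is written to the position given by the number of its predecessors. Since `Prec` is a
strict total order, these positions form a permutation. -/
theorem ends_arrange {s : State} {a : ℕ} (ha : s.nat nG 0 = a) :
    Ends I ε arrange s (a * (a * 90 + 100) + 30) fun s' => s'.nat nA 0 = a ∧
      ∀ p < a, s'.nat aLF (rank (s.nat aLab) (s.real rKey) a p) = s.nat aG p := by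
  classical
  refine Ends.step (n' := a * (a * 90 + 100) + 20) rfl ((Ends.forUp (k := a * 90 + 70) (a := 0)
    (b := a) (fun p s' => ∀ p' < p, s'.nat aLF (rank (s.nat aLab) (s.real rKey) a p') = s.nat aG p')
    rfl (Nat.zero_le _) rfl ?_ ?_ ?_ ?_).post ?_) (by simp; omega)
  · intro s' hf
    have e : s'.nat nG = _ := hf.nat _ rfl
    simp [e, ha]
  · simp
  · rintro p s1 - hp hf1 hpp h
    have a1 : s1.nat nG = s.nat nG := hf1.nat _ rfl
    have a2 : s1.nat aLab = s.nat aLab := hf1.nat _ rfl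
    have a3 : s1.real rKey = s.real rKey := hf1.real _ rfl
    have a4 : s1.nat aG = s.nat aG := hf1.nat _ rfl
    refine Ends.step (n' := a * 90 + 60) rfl (Ends.seq (n := a * 90 + 20) (n' := 20)
      (Ends.forUp (k := 70) (a := 0) (b := a)
        (fun z s' => s'.nat gX 0 = rank (s.nat aLab) (s.real rKey) z p)
        rfl (Nat.zero_le _) rfl ?_ ?_ ?_ ?_) ?_ (by omega)) (by simp; omega)
    · intro s' hf
      have e : s'.nat nG = _ := hf.nat _ rfl
      simp [e, a1, ha]
    · simp [rank]
    · rintro z s' - hz hf hzz h1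
      have f1 : s'.nat aLab = s1.nat aLab := hf.nat _ rfl
      have f2 : s'.real rKey = s1.real rKey := hf.real _ rfl
      have f3 : s'.nat gP = s1.nat gP := hf.nat _ rfl
      have hT : precTest.Holds I ε s' ↔ Prec (s.nat aLab) (s.real rKey) z p := by
        simp only [Test.Holds, NatExpr.eval, RealExpr.eval, f1, f2, f3, a2, a3, hpp, hzz, Prec]
        rw [← or_iff_not_and_not, ← or_iff_not_and_not, not_lt, not_lt]
      refine Ends.straight rfl (by simp) ?_
      simp only [Program.run, hT]
      unfold rank at *
      split_ifs with hc
      · simp [Nat.count_succ, hc, h1]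
      · simp [Nat.count_succ, hc, h1]
    · simp; omega
    rintro s2 hf2 ⟨h1, -⟩
    have f1 : s2.nat aLF = s1.nat aLF := hf2.nat _ rfl
    have f2 : s2.nat aG = s1.nat aG := hf2.nat _ rfl
    have f3 : s2.nat gP = s1.nat gP := hf2.nat _ rfl
    refine Ends.straight rfl (by simp) fun p' hp' => ?_
    simp only [Program.run, State.nat_setNat_ne, State.nat_setNat_same, NatExpr.eval, ne_eq,
      Nat.reduceEqDiff, not_false_eq_true, h1, f1, f2, f3, a4, hpp]
    by_cases hpe : p' = p
    · rw [hpe, Function.update_self]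
    · rw [Function.update_of_ne fun he => hpe (rank_inj (by omega) hp he)]
      exact h p' (by omega)
  · have : a * (a * 90 + 70 + 2 + 10) ≤ a * (a * 90 + 100) := Nat.mul_le_mul_left _ (by omega)
    simp; omega
  · rintro s' hf ⟨h, -⟩
    have e : s'.nat nA = _ := hf.nat _ rfl
    exact ⟨by simp [e, ha], h⟩

/-- The facilities `F z`, `z < a`, are ordered by labels and keys. -/
structure Layout (I : KSupplier) (a : ℕ) (F : ℕ → ℕ) (H δ : ℝ) (l lg : ℕ) (lab : ℕ → ℕ)
    (key : ℕ → ℝ) (cen : ℕ → ℕ) : Prop where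
  labelled : ∀ z < a, lab z ≠ 0
  lab_mono : ∀ z z', z ≤ z' → z' < a → lab z ≤ lab z'
  key_mono : ∀ z z', z ≤ z' → z' < a → lab z = lab z' → key z ≤ key z'
  key_eq : ∀ z < a, 2 ≤ lab z → key z = pd I (F z) (cen (lab z)) ∧ key z ≤ H * l
  sep : ∀ z < a, ∀ z' < a, 2 ≤ lab z → 2 ≤ lab z' → lab z ≠ lab z' → H < pd I (F z) (F z')
  few : ((Finset.range a).filter fun z => lab z = 1).card * l ≤ lg * a
  packed : ∀ z z', z < z' → z' < a → δ < pd I (F z) (F z')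

/-- Everything is transported along the inverse `σ` of `rank`. At the end no item has label 0, so
the shell items, with label 1, come first and the clusters follow as intervals sorted by distance
from their centers. -/
theorem Clusters.layout {a : ℕ} {G F : ℕ → ℕ} {H δ : ℝ} {l lg : ℕ} {lab : ℕ → ℕ} {key : ℕ → ℝ}
    (h : Clusters I a G H l lg a lab key)
    (hpack : ∀ z z', z < z' → z' < a → δ < pd I (G z) (G z'))
    (hF : ∀ p < a, F (rank lab key a p) = G p) :
    (∃ lab' key' cen, Layout I a F H δ l lg lab' key' cen) ∧
      (∀ z < a, ∃ p < a, F z = G p) ∧ ∀ p < a, ∃ z < a, F z = G p := by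
  classical
  have hσ : ∀ z, ∃ p, z < a → p < a ∧ rank lab key a p = z := by
    intro z
    by_cases hz : z < a
    · obtain ⟨p, hp⟩ := exists_rank_eq (lab := lab) (key := key) hz
      exact ⟨p, fun _ => hp⟩
    · exact ⟨0, fun h => absurd h hz⟩
  choose σ hσ using hσ
  have hFσ : ∀ z < a, F z = G (σ z) := fun z hz => by
    rw [← hF _ (hσ z hz).1, (hσ z hz).2]
  have hprec : ∀ z z', z < z' → z' < a → Prec lab key (σ z) (σ z') := by
    intro z z' hzz hz'
    have h1 := hσ z (by omega)
    have h2 := hσ z' hz'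
    rcases Prec.total (lab := lab) (key := key) (i := σ z) (p := σ z')
      (fun he => by rw [he] at h1; omega) with h3 | h3
    · exact h3
    · have := rank_lt_rank h2.1 h3
      omega
  have hne : ∀ z z', z < z' → z' < a → σ z ≠ σ z' := by
    intro z z' hzz hz' he
    have h1 := hprec z z' hzz hz'
    rw [he] at h1
    exact Prec.irrefl _ _ _ h1
  refine ⟨⟨fun z => lab (σ z), fun z => key (σ z), fun c => G (c - 2), ?_, ?_, ?_, ?_, ?_, ?_, ?_⟩,
    fun z hz => ⟨σ z, (hσ z hz).1, hFσ z hz⟩, fun p hp => ⟨_, rank_lt hp, hF p hp⟩⟩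
  · exact fun z hz => h.labelled _ (hσ z hz).1
  · intro z z' hzz hz'
    rcases Nat.lt_or_eq_of_le hzz with h1 | rfl
    · rcases hprec z z' h1 hz' with h2 | h2
      · exact h2.le
      · exact h2.1
    · exact le_rfl
  · intro z z' hzz hz' he
    rcases Nat.lt_or_eq_of_le hzz with h1 | rfl
    · rcases hprec z z' h1 hz' with h2 | ⟨-, h2 | h2⟩
      · exact absurd he h2.ne
      · exact h2.le
      · exact h2.1
    · exact le_rfl
  · intro z hz h2
    rw [hFσ z hz]
    exact h.key_eq _ (hσ z hz).1 h2
  · intro z hz z' hz' h1 h2 h3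
    rw [hFσ z hz, hFσ z' hz']
    exact h.sep _ (hσ z hz).1 _ (hσ z' hz').1 h1 (by omega) h3.symm
  · have h1 : ((Finset.range a).filter fun z => lab (σ z) = 1).card ≤
        ((Finset.range a).filter fun z => lab z = 1).card := by
      refine Finset.card_le_card_of_injOn σ (fun z hz => ?_) fun z hz z' hz' he => ?_
      · simp only [Finset.coe_filter, Finset.mem_range, Set.mem_ofPred_eq] at hz ⊢
        exact ⟨(hσ z hz.1).1, hz.2⟩
      · simp only [Finset.coe_filter, Finset.mem_range, Set.mem_ofPred_eq] at hz hz'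
        rcases lt_trichotomy z z' with h1 | h1 | h1
        · exact absurd he (hne z z' h1 hz'.1)
        · exact h1
        · exact absurd he.symm (hne z' z h1 hz.1)
    have h2 := h.few
    rw [Nat.count_eq_card_filter_range] at h2
    exact (Nat.mul_le_mul_right l h1).trans (h2.trans (Nat.mul_le_mul_left _ (Nat.count_le _)))
  · intro z z' hzz hz'
    rw [hFσ z (by omega), hFσ z' hz']
    rcases lt_or_gt_of_ne (hne z z' hzz hz') with h1 | h1
    · exact hpack _ _ h1 (hσ z' hz').1
    · rw [pd, dist_comm]
      exact hpack _ _ h1 (hσ z (by omega)).1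

/-! ### The window that determines a partial solution -/

/-- At most `N` points with pairwise distances greater than `δ` fit into an annulus of width `H`
and radius at most `ρ`. -/
def ShellBound (I : KSupplier) (H ρ δ : ℝ) (N : ℕ) : Prop :=
  ∀ (x : EuclideanSpace ℝ (Fin I.dim)) (r : ℝ) (S : Finset ℕ) (F : ℕ → ℕ), r ≤ ρ →
    (∀ z ∈ S, r - H ≤ dist (I.point (F z)) x ∧ dist (I.point (F z)) x ≤ r) →
    (∀ z ∈ S, ∀ z' ∈ S, z < z' → δ < pd I (F z) (F z')) → S.card ≤ N

/-- The size of a viable partial solution and its trace on the window of shell items and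
current-annulus items determine it up to domination. Suppose `f y'` covers a client by `i`, while `f
y` covers it only by a future item `i'`. Then `i` and `i'` are at distance at most 2t ≤ H, which
forces `i` into the window. Hence `i` belongs to `f y` as well. -/
theorem Layout.frontBound {a b kk l lg N B M : ℕ} {F C : ℕ → ℕ} {H δ t : ℝ} {lab : ℕ → ℕ}
    {key : ℕ → ℝ} {cen : ℕ → ℕ} (h : Layout I a F H δ l lg lab key cen)
    (hN : ShellBound I H (H * l) δ N)
    (hB : ((Finset.range a).filter fun z => lab z = 1).card ≤ B) (ht : 2 * t ≤ H)
    (hM : (kk + 1) * 2 ^ (B + N) ≤ M) :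
    FrontBound (fun i q => dist (I.point (C q)) (I.point (F i)) ≤ t) a b kk M := by
  classical
  intro j hj hja n f hf hd
  -- The last decided item: everything still to come has at least its label and, within its cluster,
  -- at least its key.
  set x := j - 1 with hx
  have hxa : x < a := by omega
  set W₁ := (Finset.range a).filter fun z => lab z = 1 with hW₁
  set W₂ := (Finset.range j).filter fun z => 2 ≤ lab z ∧ lab z = lab x ∧ key x - H ≤ key z with hW₂
  have hW₂c : W₂.card ≤ N := by
    by_cases hx2 : 2 ≤ lab x
    · refine hN (I.point (cen (lab x))) (key x) W₂ F (h.key_eq x hxa hx2).2 (fun z hz => ?_)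
        fun z hz z' hz' hzz => ?_
      · obtain ⟨hz1, hz2, hz3, hz4⟩ := Finset.mem_filter.1 hz
        have hz1 := Finset.mem_range.1 hz1
        have e := (h.key_eq z (by omega) hz2).1
        rw [hz3] at e
        rw [pd] at e
        rw [← e]
        exact ⟨hz4, h.key_mono z x (by omega) hxa hz3⟩
      · have := Finset.mem_range.1 (Finset.mem_filter.1 hz').1
        exact h.packed z z' hzz (by omega)
    · have : W₂ = ∅ := by
        rw [Finset.eq_empty_iff_forall_notMem]
        intro z hz
        obtain ⟨-, hz2, hz3, -⟩ := Finset.mem_filter.1 hz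
        omega
      simp [this]
  have hW : (W₁ ∪ W₂).card ≤ B + N := (Finset.card_union_le _ _).trans (by omega)
  let g : ℕ → ℕ × Finset ℕ := fun y => ((f y).card, f y ∩ (W₁ ∪ W₂))
  have key : ∀ y < n, ∀ y' < n, g y = g y' → Dominates
      (fun i q => dist (I.point (C q)) (I.point (F i)) ≤ t) b (f y) (f y') := by
    intro y hy y' hy' hyy
    refine ⟨(Prod.ext_iff.1 hyy).1.le, ?_⟩
    rintro q hq ⟨i, hi, hiq⟩
    have hij := Finset.mem_range.1 ((hf y' hy').1 hi)
    obtain ⟨i', hi' | ⟨hji', hi'a⟩, hiq'⟩ := (hf y hy).2.2 q hq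
    · exact ⟨i', hi', hiq'⟩
    have hdist : pd I (F i) (F i') ≤ H := by
      have := dist_triangle_left (I.point (F i)) (I.point (F i')) (I.point (C q))
      simp only [pd]
      linarith
    have hlab : lab i ≤ lab x := h.lab_mono i x (by omega) hxa
    have hlab' : lab x ≤ lab i' := h.lab_mono x i' (by omega) hi'a
    have hiW : i ∈ W₁ ∪ W₂ := by
      by_cases h1 : lab i = 1
      · exact Finset.mem_union_left _ (Finset.mem_filter.2 ⟨Finset.mem_range.2 (by omega), h1⟩)
      have h0 := h.labelled i (by omega)
      have heq : lab i = lab i' := by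
        by_contra hne
        exact absurd hdist (not_le.2 (h.sep i (by omega) i' hi'a (by omega) (by omega) hne))
      refine Finset.mem_union_right _ (Finset.mem_filter.2 ⟨Finset.mem_range.2 hij, by omega,
        by omega, ?_⟩)
      -- The keys of `i` and `i'` are distances from the same center, so they differ by at most H.
      -- Since `i'` comes after `x`, the key of `i` is at least `key x - H`.
      have k1 := h.key_mono x i' (by omega) hi'a (by omega)
      have k2 := (h.key_eq i (by omega) (by omega)).1
      have k3 := (h.key_eq i' hi'a (by omega)).1
      have k4 := dist_triangle_left (I.point (F i')) (I.point (cen (lab i'))) (I.point (F i))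
      rw [heq] at k2
      simp only [pd] at *
      linarith
    have : i ∈ f y ∩ (W₁ ∪ W₂) := by
      have e : f y ∩ (W₁ ∪ W₂) = f y' ∩ (W₁ ∪ W₂) := (Prod.ext_iff.1 hyy).2
      rw [e]; exact Finset.mem_inter.2 ⟨hi, hiW⟩
    exact ⟨i, (Finset.mem_inter.1 this).1, hiq⟩
  have h1 : (Finset.range n).card ≤ (Finset.range (kk + 1) ×ˢ (W₁ ∪ W₂).powerset).card := by
    refine Finset.card_le_card_of_injOn g (fun y hy => ?_) fun y hy y' hy' hyy => ?_
    · simp only [Finset.coe_range, Set.mem_Iio] at hy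
      simp only [g, Finset.coe_product, Set.mem_prod, Finset.mem_coe, Finset.mem_range,
        Finset.mem_powerset]
      exact ⟨Nat.lt_succ_of_le (hf y hy).2.1, Finset.inter_subset_right⟩
    · simp only [Finset.coe_range, Set.mem_Iio] at hy hy'
      rcases lt_trichotomy y y' with h | h | h
      · exact absurd (key y hy y' hy' hyy) (hd y y' h hy')
      · exact h
      · exact absurd (key y' hy' y hy hyy.symm) (hd y' y h hy)
  simp only [Finset.card_range, Finset.card_product, Finset.card_powerset] at h1
  exact h1.trans ((Nat.mul_le_mul_left _ (Nat.pow_le_pow_right (by omega) hW)).trans hM)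

end RealRAM

/-! ### Packing -/


namespace RealRAM

variable {I : KSupplier} {ε : ℝ}

open MeasureTheory in
/-- Disjoint balls in an annulus. -/
theorem card_mul_pow_add_le {d : ℕ} (hd : 0 < d) (x : EuclideanSpace ℝ (Fin d)) {h r₁ r₂ : ℝ}
    (hh : 0 ≤ h) (hr₁ : 0 ≤ r₁) (hr : r₁ ≤ r₂) (S : Finset ℕ) (f : ℕ → EuclideanSpace ℝ (Fin d))
    (hout : ∀ z ∈ S, dist (f z) x + h ≤ r₂) (hin : ∀ z ∈ S, r₁ = 0 ∨ r₁ + h ≤ dist (f z) x)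
    (hsep : ∀ z ∈ S, ∀ z' ∈ S, z < z' → 2 * h ≤ dist (f z) (f z')) :
    S.card * h ^ d + r₁ ^ d ≤ r₂ ^ d := by
  have : Nonempty (Fin d) := ⟨⟨0, hd⟩⟩
  have hvol : ∀ (y : EuclideanSpace ℝ (Fin d)) (r : ℝ), 0 ≤ r →
      volume.real (Metric.ball y r) =
        r ^ d * volume.real (Metric.ball (0 : EuclideanSpace ℝ (Fin d)) 1) := by
    intro y r hr
    rw [Measure.real, Measure.addHaar_ball _ _ hr, ENNReal.toReal_mul, ENNReal.toReal_ofReal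
      (by positivity), finrank_euclideanSpace_fin]
    rfl
  have hV : 0 < volume.real (Metric.ball (0 : EuclideanSpace ℝ (Fin d)) 1) :=
    ENNReal.toReal_pos (Metric.measure_ball_pos _ _ one_pos).ne' measure_ball_lt_top.ne
  have hdis : (S : Set ℕ).PairwiseDisjoint fun z => Metric.ball (f z) h := by
    intro z hz z' hz' hne
    refine Metric.ball_disjoint_ball ?_
    rcases lt_or_gt_of_ne hne with h1 | h1
    · have := hsep z hz z' hz' h1; linarith
    · have := hsep z' hz' z hz h1
      rw [dist_comm] at this
      linarith
  -- If `r₁ = 0` the inner ball is empty, so that the case of a full ball is included.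
  have hdis' : Disjoint (⋃ z ∈ S, Metric.ball (f z) h) (Metric.ball x r₁) := by
    rw [Set.disjoint_iUnion₂_left]
    intro z hz
    rcases hin z hz with h1 | h1
    · simp [h1]
    · exact Metric.ball_disjoint_ball (by linarith)
  have hsub : (⋃ z ∈ S, Metric.ball (f z) h) ∪ Metric.ball x r₁ ⊆ Metric.ball x r₂ := by
    refine Set.union_subset (Set.iUnion₂_subset fun z hz => ?_) (Metric.ball_subset_ball hr)
    exact Metric.ball_subset_ball' (by linarith [hout z hz])
  have h1 := measureReal_mono (μ := volume) hsub measure_ball_lt_top.ne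
  rw [measureReal_union hdis' measurableSet_ball
      (by exact (measure_mono (Set.subset_union_left.trans hsub)).trans_lt measure_ball_lt_top |>.ne)
      measure_ball_lt_top.ne,
    measureReal_biUnion_finset hdis (fun _ _ => measurableSet_ball)
      (fun _ _ => measure_ball_lt_top.ne), Finset.sum_congr rfl fun z _ => hvol (f z) h hh,
    Finset.sum_const, nsmul_eq_mul, hvol x r₁ hr₁, hvol x r₂ (hr₁.trans hr)] at h1
  refine le_of_mul_le_mul_right ?_ hV
  linarith

/-- Half of the separation is h = εR/16. Balls of this radius around points within 6R lie in a ball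
of radius 8R = (128/ε)·h, and volumes are compared. -/
theorem packBound {R : ℝ} {M : ℕ} (hd : 0 < I.dim) (hε : 0 < ε) (hε1 : ε ≤ 1) (hR : 0 ≤ R)
    (hM : (128 / ε) ^ I.dim < M + 1) : PackBound I (6 * R) (ε * R / 8) M := by
  intro x L f hf hsep
  have hM1 : 1 ≤ M := by
    have h1 : (1 : ℝ) ≤ (128 / ε) ^ I.dim := one_le_pow₀ (by rw [le_div_iff₀ hε]; linarith)
    have : (0 : ℝ) < M := by linarith
    exact_mod_cast this
  rcases hR.lt_or_eq with hR | rfl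
  · set h := ε * R / 16 with hh
    have hh0 : 0 < h := by positivity
    have h1 := card_mul_pow_add_le hd x hh0.le le_rfl (r₂ := 128 / ε * h) (by positivity)
      (Finset.range L) (fun z => I.point (f z)) (fun z hz => ?_) (fun _ _ => .inl rfl)
      (fun z _ z' hz' hzz => ?_)
    · rw [zero_pow hd.ne', add_zero, mul_pow, Finset.card_range] at h1
      have h2 : (L : ℝ) ≤ (128 / ε) ^ I.dim := le_of_mul_le_mul_right h1 (by positivity)
      have h3 : (L : ℝ) < (M + 1 : ℕ) := by push_cast; linarith
      exact Nat.lt_succ_iff.1 (by exact_mod_cast h3)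
    · have h1 := hf z (Finset.mem_range.1 hz)
      have h2 : 128 / ε * h = 8 * R := by rw [hh]; field_simp; ring
      have h3 : h ≤ R := by rw [hh]; nlinarith
      rw [h2]; linarith
    · have h1 := hsep z z' hzz (Finset.mem_range.1 hz')
      simp only [pd] at h1
      rw [hh]; linarith
  -- For R = 0 all points coincide with `x`, while two of them would have positive distance.
  · by_contra hL
    rw [not_le] at hL
    have h1 := hsep 0 1 (by omega) (by omega)
    have h2 := hf 0 (by omega)
    have h3 := hf 1 (by omega)
    have h4 := dist_triangle_right (I.point (f 0)) (I.point (f 1)) x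
    simp only [pd] at h1
    linarith

theorem pow_sub_pow_le {b m : ℝ} (hm : 0 ≤ m) (hmb : m ≤ b) (d : ℕ) :
    b ^ d - m ^ d ≤ d * (b - m) * b ^ (d - 1) := by
  have h : ∀ d : ℕ, b ^ (d + 1) - m ^ (d + 1) ≤ (d + 1) * (b - m) * b ^ d := by
    intro d
    induction d with
    | zero => simp
    | succ d ih =>
      have h1 : m ^ (d + 1) ≤ b ^ (d + 1) := pow_le_pow_left₀ hm hmb _
      have h2 : (b - m) * m ^ (d + 1) ≤ (b - m) * b ^ (d + 1) :=
        mul_le_mul_of_nonneg_left h1 (by linarith)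
      have h3 := mul_le_mul_of_nonneg_left ih (hm.trans hmb)
      have e1 : b ^ (d + 1 + 1) - m ^ (d + 1 + 1) =
        b * (b ^ (d + 1) - m ^ (d + 1)) + (b - m) * m ^ (d + 1) := by ring
      have e2 : ((d + 1 : ℕ) + 1 : ℝ) * (b - m) * b ^ (d + 1) =
        b * ((d + 1) * (b - m) * b ^ d) + (b - m) * b ^ (d + 1) := by push_cast; ring
      rw [e1, e2]
      linarith
  cases d with
  | zero => simp
  | succ d => simpa using h d

/-- Enlarged by h = εR/16 on both sides, the annulus has width at most 8R + R/8 = (130/ε)·h and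
outer radius at most l times this. Its volume relative to a ball of radius h is bounded by b^d − m^d
≤ d(b − m)b^{d−1}. This saves one factor l compared with the full ball. -/
theorem shellBound {R : ℝ} {l N : ℕ} (hd : 0 < I.dim) (hε : 0 < ε) (hε1 : ε ≤ 1) (hR : 0 ≤ R)
    (hl : 0 < l) (hN : I.dim * (130 / ε) ^ I.dim * (l : ℝ) ^ (I.dim - 1) ≤ N) :
    ShellBound I (8 * R) (8 * R * l) (ε * R / 8) N := by
  intro x r S F hr hS hsep
  have hl1 : (1 : ℝ) ≤ l := by exact_mod_cast hl
  have hd1 : (1 : ℝ) ≤ I.dim := by exact_mod_cast hd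
  have hN1 : 1 ≤ N := by
    have h1 : (1 : ℝ) ≤ (130 / ε) ^ I.dim := one_le_pow₀ (by rw [le_div_iff₀ hε]; linarith)
    have h2 : (1 : ℝ) ≤ (l : ℝ) ^ (I.dim - 1) := one_le_pow₀ hl1
    have : (1 : ℝ) ≤ N := (one_le_mul_of_one_le_of_one_le
      (one_le_mul_of_one_le_of_one_le hd1 h1) h2).trans hN
    exact_mod_cast this
  rcases S.eq_empty_or_nonempty with rfl | ⟨z₀, hz₀⟩
  · simp
  have hr0 : 0 ≤ r := dist_nonneg.trans (hS z₀ hz₀).2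
  rcases hR.lt_or_eq with hR | rfl
  · set h := ε * R / 16 with hh
    have hh0 : 0 < h := by positivity
    -- If the annulus reaches its center there is no inner ball to be left out.
    set m := max (r - 8 * R - h) 0 with hm
    have hm0 : 0 ≤ m := le_max_right _ _
    have hmb : m ≤ r + h := max_le (by linarith) (by linarith)
    have h1 := card_mul_pow_add_le hd x hh0.le hm0 (r₂ := r + h) hmb S (fun z => I.point (F z))
      (fun z hz => by linarith [(hS z hz).2]) (fun z hz => ?_) (fun z hz z' hz' hzz => ?_)
    · have h2 := pow_sub_pow_le hm0 hmb I.dim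
      have hA : r + h - m ≤ 130 / ε * h := by
        have e : 130 / ε * h = 8 * R + R / 8 := by rw [hh]; field_simp; ring
        have h3 : r - 8 * R - h ≤ m := le_max_left _ _
        have h4 : h ≤ R / 16 := by rw [hh]; nlinarith
        rw [e]; linarith
      have hB : r + h ≤ 130 / ε * l * h := by
        have e : 130 / ε * l * h = 8 * R * l + R / 8 * l := by rw [hh]; field_simp; ring
        have h4 : h ≤ R / 16 := by rw [hh]; nlinarith
        have h5 : R ≤ R * l := le_mul_of_one_le_right hR.le hl1
        rw [e]; linarith
      have hC : (r + h) ^ (I.dim - 1) ≤ (130 / ε * l * h) ^ (I.dim - 1) :=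
        pow_le_pow_left₀ (by linarith) hB _
      have h3 : I.dim * (r + h - m) * (r + h) ^ (I.dim - 1) ≤
          I.dim * (130 / ε * h) * (130 / ε * l * h) ^ (I.dim - 1) :=
        mul_le_mul (mul_le_mul_of_nonneg_left hA (by positivity)) hC (by positivity) (by positivity)
      have e : I.dim * (130 / ε * h) * (130 / ε * l * h) ^ (I.dim - 1) =
          I.dim * (130 / ε) ^ I.dim * (l : ℝ) ^ (I.dim - 1) * h ^ I.dim := by
        obtain ⟨d, hd'⟩ : ∃ d, I.dim = d + 1 := ⟨I.dim - 1, by omega⟩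
        rw [hd', Nat.add_sub_cancel]
        ring_nf
      have h4 : (S.card : ℝ) * h ^ I.dim ≤ N * h ^ I.dim := by
        have := mul_le_mul_of_nonneg_right hN (show (0 : ℝ) ≤ h ^ I.dim by positivity)
        linarith
      exact_mod_cast le_of_mul_le_mul_right h4 (by positivity)
    · rcases le_total (r - 8 * R - h) 0 with h3 | h3
      · exact .inl (max_eq_right h3)
      · refine .inr ?_
        rw [hm, max_eq_left h3]
        linarith [(hS z hz).1]
    · have h1 := hsep z hz z' hz' hzz
      simp only [pd] at h1
      rw [hh]; linarith
  · refine (Finset.card_le_one.2 fun z hz z' hz' => ?_).trans hN1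
    have key : ∀ z ∈ S, ∀ z' ∈ S, ¬ z < z' := by
      intro z hz z' hz' hzz
      have h1 := hsep z hz z' hz' hzz
      have h2 := (hS z hz).2
      have h3 := (hS z' hz').2
      have h4 := dist_triangle_right (I.point (F z)) (I.point (F z')) x
      simp only [pd] at h1
      linarith
    have := key z hz z' hz'
    have := key z' hz' z hz
    omega

end RealRAM

/-! ### The search for the smallest threshold -/


namespace RealRAM

variable {I : KSupplier} {ε : ℝ}

notation "rBt" => (13 : ℕ)

/-- The distance of the client `gQ` to the facility `gP` of the lists. -/
abbrev listDist : RealExpr := .dist (.get aLC (.var gQ)) (.get aLF (.var gP))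

/-- All distances of clients and facilities in the lists are tried as thresholds. -/
def search : Program :=
  rassign rBt (.mul (.cast (.lit 4)) (.var rR)) ;;
  forUp gQ (.lit 0) (.var nB)
    (forUp gP (.lit 0) (.var nA)
      (rassign rT listDist ;;
        .cond (.realLe (.var rT) (.var rBt))
          (dp ;; .cond (.natLt (.lit 0) (.var nFound)) (rassign rBt (.var rT)) .skip) .skip))

/-- The facility `F i` is at distance at most `t` from the client `C q`. -/
def nearRel (I : KSupplier) (C F : ℕ → ℕ) (t : ℝ) (i q : ℕ) : Prop :=
  dist (I.point (C q)) (I.point (F i)) ≤ t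

/-- The clients in the list can be covered by `kk` facilities of the list within distance `t`. -/
def ListFeas (I : KSupplier) (C F : ℕ → ℕ) (a b kk : ℕ) (t : ℝ) : Prop :=
  ∃ T ⊆ Finset.range a, T.card ≤ kk ∧ Covers (nearRel I C F t) b T

/-- The facilities in the list of results are from the list, and cover the clients in the list
within distance `t`. -/
def ListGood (I : KSupplier) (C F : ℕ → ℕ) (a b kk : ℕ) (s : State) (t : ℝ) : Prop :=
  s.nat nBL 0 ≤ kk ∧ (∀ z < s.nat nBL 0, ∃ i < a, s.nat aBL z = F i) ∧
    ∀ q < b, ∃ z < s.nat nBL 0, dist (I.point (C q)) (I.point (s.nat aBL z)) ≤ t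

theorem ListGood.congr {C F : ℕ → ℕ} {a b kk : ℕ} {s s' : State} {t : ℝ}
    (h : ListGood I C F a b kk s t) (h1 : s'.nat nBL = s.nat nBL) (h2 : s'.nat aBL = s.nat aBL) :
    ListGood I C F a b kk s' t := by
  unfold ListGood; rw [h1, h2]; exact h

/-- The state after the thresholds given by `P` have been tried. -/
def Searched (I : KSupplier) (C F : ℕ → ℕ) (a b kk : ℕ) (R : ℝ) (P : ℝ → Prop) (s : State) : Prop :=
  (s.real rBt 0 = 4 * R ∨ s.real rBt 0 ≤ 4 * R ∧ ListGood I C F a b kk s (s.real rBt 0)) ∧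
  ∀ t, P t → t ≤ 4 * R → ListFeas I C F a b kk t →
    s.real rBt 0 ≤ t ∧ ListGood I C F a b kk s (s.real rBt 0)

theorem Searched.congr {C F : ℕ → ℕ} {a b kk : ℕ} {R : ℝ} {P P' : ℝ → Prop} {s s' : State}
    (h : Searched I C F a b kk R P s) (hP : ∀ t, P' t → P t) (h1 : s'.nat nBL = s.nat nBL)
    (h2 : s'.nat aBL = s.nat aBL) (h3 : s'.real rBt 0 = s.real rBt 0) :
    Searched I C F a b kk R P' s' := by
  unfold Searched
  rw [h3]
  exact ⟨h.1.imp_right fun h => ⟨h.1, h.2.congr h1 h2⟩,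
    fun t ht h4 hF => ⟨(h.2 t (hP t ht) h4 hF).1, (h.2 t (hP t ht) h4 hF).2.congr h1 h2⟩⟩

/-- `rBt` is the best threshold found so far, and larger ones are skipped. It starts at 4R, so the
dynamic program runs only at thresholds for which the front is known to be small. -/
theorem ends_search {s : State} {a b kk M : ℕ} {C F : ℕ → ℕ} {R : ℝ} (ha : 0 < a) (hb : 0 < b)
    (hM1 : 1 ≤ M) (hA : s.nat nA 0 = a) (hB : s.nat nB 0 = b) (hk : s.nat nKK 0 = kk)
    (hC : s.nat aLC = C) (hF : s.nat aLF = F) (hR : s.real rR 0 = R)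
    (hM : ∀ t ≤ 4 * R, FrontBound (nearRel I C F t) a b kk M) :
    Ends I ε search s (b * (a * (1000 * ((a + 1) * (b + 1) * (M + 1) ^ 2) + 60) + 60) + 40) fun s' =>
      ∀ t ≤ 4 * R, ListFeas I C F a b kk t → ∃ ρ ≤ t, ListGood I C F a b kk s' ρ := by
  classical
  obtain ⟨K, hK⟩ : ∃ K, K = 1000 * ((a + 1) * (b + 1) * (M + 1) ^ 2) := ⟨_, rfl⟩
  rw [← hK]
  let d : ℕ → ℕ → ℝ := fun q i => dist (I.point (C q)) (I.point (F i))
  refine Ends.step (n' := b * (a * (K + 60) + 60) + 30) rfl ((Ends.forUp (k := a * (K + 60) + 30)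
    (a := 0) (b := b) (fun q s' => Searched I C F a b kk R (fun t => ∃ q' < q, ∃ i < a, t = d q' i) s')
    rfl (Nat.zero_le _) rfl ?_ ?_ ?_ ?_).post ?_) (by simp; omega)
  · intro s' hf
    have e : s'.nat nB = _ := hf.nat _ rfl
    simp [e, hB]
  · exact ⟨.inl (by simp [hR]), fun t ⟨q, hq, _⟩ => absurd hq (by omega)⟩
  · rintro q s1 - hq hf1 hqq h1
    refine (Ends.forUp (k := K + 48) (a := 0) (b := a) (fun i s' => Searched I C F a b kk R
      (fun t => (∃ q' < q, ∃ i < a, t = d q' i) ∨ ∃ i' < i, t = d q i') s')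
      rfl (Nat.zero_le _) rfl ?_ ?_ ?_ ?_).post ?_
    · intro s' hf
      have e : s'.nat nA = _ := hf.nat _ rfl
      have e1 : s1.nat nA = _ := hf1.nat _ rfl
      simp [e, e1, hA]
    · refine h1.congr ?_ rfl rfl rfl
      rintro t (h | ⟨i, hi, -⟩)
      · exact h
      · omega
    · rintro i s2 - hi hf2 hii h2
      have f1 : s2.nat nA 0 = a := by rw [hf2.nat _ rfl, hf1.nat _ rfl]; simpa using hA
      have f2 : s2.nat nB 0 = b := by rw [hf2.nat _ rfl, hf1.nat _ rfl]; simpa using hB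
      have f3 : s2.nat nKK 0 = kk := by rw [hf2.nat _ rfl, hf1.nat _ rfl]; simpa using hk
      have f4 : s2.nat aLC = C := by rw [hf2.nat _ rfl, hf1.nat _ rfl]; simpa using hC
      have f5 : s2.nat aLF = F := by rw [hf2.nat _ rfl, hf1.nat _ rfl]; simpa using hF
      have f6 : s2.nat gQ 0 = q := by rw [hf2.nat _ rfl, hqq]
      have hstep : ∀ s' : State, s'.real rBt 0 ≤ d q i ∧ ListGood I C F a b kk s' (s'.real rBt 0) ∨
          (s'.nat nBL = s2.nat nBL ∧ s'.nat aBL = s2.nat aBL ∧ s'.real rBt 0 = s2.real rBt 0 ∧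
            (d q i ≤ 4 * R → ListFeas I C F a b kk (d q i) → s2.real rBt 0 ≤ d q i ∧
              ListGood I C F a b kk s2 (s2.real rBt 0))) →
          s'.real rBt 0 ≤ s2.real rBt 0 →
          Searched I C F a b kk R
            (fun t => (∃ q' < q, ∃ i < a, t = d q' i) ∨ ∃ i' < i + 1, t = d q i')
            (s'.setNat gP 0 (i + 1)) := by
        rintro s' (⟨k1, k2⟩ | ⟨k1, k2, k3, k4⟩) hle
        · have k2' : ListGood I C F a b kk (s'.setNat gP 0 (i + 1)) (s'.real rBt 0) :=
            k2.congr (by simp) (by simp)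
          refine ⟨.inr ⟨?_, k2'⟩, ?_⟩
          · rcases h2.1 with h | h
            · exact hle.trans h.le
            · exact hle.trans h.1
          · rintro t ht ht4 htF
            refine ⟨?_, k2'⟩
            rcases ht with ht | ⟨i', hi', rfl⟩
            · exact hle.trans (h2.2 t (.inl ht) ht4 htF).1
            · rcases Nat.lt_succ_iff_lt_or_eq.1 hi' with hi' | rfl
              · exact hle.trans (h2.2 _ (.inr ⟨i', hi', rfl⟩) ht4 htF).1
              · exact k1
        · refine Searched.congr (s := s2) ⟨h2.1, fun t ht ht4 htF => ?_⟩ (fun t ht => ht)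
            (by simpa using k1) (by simpa using k2) (by simpa using k3)
          rcases ht with ht | ⟨i', hi', rfl⟩
          · exact h2.2 t (.inl ht) ht4 htF
          · rcases Nat.lt_succ_iff_lt_or_eq.1 hi' with hi' | rfl
            · exact h2.2 _ (.inr ⟨i', hi', rfl⟩) ht4 htF
            · exact k4 ht4 htF
      set s3 := (rassign rT listDist).run I ε s2 with hs3
      have g0 : s3.nat = s2.nat := by simp [hs3]
      have g1 : s3.real rT 0 = d q i := by simp [hs3, f4, f5, f6, hii, d]
      have g2 : s3.real rBt = s2.real rBt := by simp [hs3]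
      have hrel : relOf I s3 = nearRel I C F (d q i) := by
        funext x y
        simp only [relOf, nearRel, g0, g1, f4, f5]
      refine Ends.step (n' := K + 37) rfl (Ends.cond (n := K + 30) (fun hc => ?_) (fun hc => ?_)
        (by simp; omega)) (by simp; omega)
      · rw [← hs3] at hc ⊢
        simp only [Test.Holds, RealExpr.eval, NatExpr.eval, g1, g2, not_lt] at hc
        have hd4 : d q i ≤ 4 * R := by
          rcases h2.1 with h | h
          · exact hc.trans h.le
          · exact hc.trans h.1
        refine Ends.seq (ends_dp (a := a) (b := b) (kk := kk) (M := M) ha hb hM1 (by rw [g0, f1])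
          (by rw [g0, f2]) (by rw [g0, f3]) (by rw [hrel]; exact hM _ hd4)) (n' := 20) ?_ (by rw [← hK]; omega)
        intro s4 hf4 h4
        have e1 : s4.real rT 0 = d q i := by rw [hf4.real _ rfl, g1]
        have e2 : s4.real rBt 0 = s2.real rBt 0 := by rw [hf4.real _ rfl, g2]
        refine Ends.straight rfl (by simp) ?_
        rw [g0, f4, f5, g1] at h4
        rcases h4 with ⟨i1, i2, i3, i4⟩ | ⟨i1, i2, i3, i4⟩
        · refine hstep _ (.inl ?_) ?_
          · simp only [Program.run, Test.Holds, NatExpr.eval, i1, Nat.lt_one_iff, if_true]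
            have e3 : ((rassign rBt (.var rT)).run I ε s4).real rBt 0 = d q i := by simp [e1]
            simp only [Program.run, NatExpr.eval] at e3 ⊢
            rw [e3]
            exact ⟨le_rfl, ListGood.congr (s := s4) ⟨i2, i3, i4⟩ (by simp) (by simp)⟩
          · simp only [Program.run, Test.Holds, NatExpr.eval, i1, Nat.lt_one_iff, if_true]
            simpa [e1] using hc
        · have e3 : ∀ c : Program, ((Program.cond (.natLt (.lit 0) (.var nFound)) c .skip).run I ε s4) =
              s4 := by
            intro c; simp [i1]
          rw [e3]
          refine hstep _ (.inr ⟨i2, i3, e2, fun _ hF => ?_⟩) e2.le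
          rw [hrel] at i4
          exact absurd hF i4
      · rw [← hs3] at hc ⊢
        simp only [Test.Holds, RealExpr.eval, NatExpr.eval, g1, g2, not_lt, not_le] at hc
        refine Ends.straight rfl (by simp) ?_
        simp only [Program.run]
        refine hstep _ (.inr ⟨by rw [g0], by rw [g0], by rw [g2], fun h4 hF => ?_⟩) (by rw [g2])
        rcases h2.1 with h | h
        · rw [h] at hc; exact absurd h4 (not_le.2 hc)
        · exact ⟨hc.le, h.2⟩
    · simp
    · rintro s' - ⟨h3, -⟩
      refine h3.congr ?_ (by simp) (by simp) (by simp)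
      rintro t ⟨q', hq', i, hi, rfl⟩
      rcases Nat.lt_succ_iff_lt_or_eq.1 hq' with hq' | rfl
      · exact .inl ⟨q', hq', i, hi, rfl⟩
      · exact .inr ⟨i, hi, rfl⟩
  · have : b * (a * (K + 60) + 30 + 2 + 10) ≤ b * (a * (K + 60) + 60) :=
      Nat.mul_le_mul_left _ (by omega)
    simp; omega
  · rintro s' - ⟨⟨-, h⟩, -⟩ t ht ⟨T, hT, hTk, hTc⟩
    have hφ : ∀ q, ∃ i, q < b → i ∈ T ∧ d q i ≤ t := by
      intro q
      by_cases hq : q < b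
      · obtain ⟨i, hi, hi'⟩ := hTc q hq
        exact ⟨i, fun _ => ⟨hi, hi'⟩⟩
      · exact ⟨0, fun h => absurd h hq⟩
    choose φ hφ using hφ
    -- A solution within `t` is also one within its largest assigned distance, and this is among the
    -- distances that were tried.
    obtain ⟨q, hq, hmax⟩ := Finset.exists_max_image (Finset.range b) (fun q => d q (φ q)) ⟨0, by simpa using hb⟩
    have hq' := Finset.mem_range.1 hq
    have hdt := (hφ q hq').2
    obtain ⟨k1, k2⟩ := h (d q (φ q)) ⟨q, hq', φ q, Finset.mem_range.1 (hT (hφ q hq').1), rfl⟩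
      (hdt.trans ht) ⟨T, hT, hTk, fun q₂ hq₂ => ⟨φ q₂, (hφ q₂ hq₂).1,
        hmax q₂ (Finset.mem_range.2 hq₂)⟩⟩
    exact ⟨_, k1.trans hdt, k2⟩

/-! ### From solutions on the nets to approximate solutions -/

/-- At most `kk` facilities have been found, and their cost is at most `1 + ε` times the optimum. -/
def Approx (I : KSupplier) (ε : ℝ) (kk : ℕ) (s : State) : Prop :=
  ∀ t, Feas I kk t → Good I kk s ((1 + ε) * t)

/-- Clients of the net are clients, so only the facilities have to be moved to net points. This
costs 2δ after thinning. The centers see all facilities involved within 2R + 3R ≤ 6R. -/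
theorem Nets.listFeas {kk M a b : ℕ} {R δ t : ℝ} {c C G F : ℕ → ℕ}
    (h : Nets I kk M R δ c b C a G) (hs : Scale I kk c R) (hF : ∀ p < a, ∃ z < a, F z = G p)
    (ha : 0 < a) (ht : Feas I kk t) (ht3 : t ≤ 3 * R) : ListFeas I C F a b kk (t + 2 * δ) := by
  classical
  obtain ⟨T, hT, hTk, hTc⟩ := ht
  have hφ : ∀ j, ∃ z < a, (j < I.numFacilities → (∃ i < kk, pd I (I.numClients + j) (c i) ≤ 6 * R) →
      pd I (I.numClients + j) (F z) ≤ 2 * δ) := by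
    intro j
    by_cases hj : j < I.numFacilities ∧ ∃ i < kk, pd I (I.numClients + j) (c i) ≤ 6 * R
    · obtain ⟨p, hp, hp'⟩ := h.fac_near j hj.1 hj.2
      obtain ⟨z, hz, hz'⟩ := hF p hp
      exact ⟨z, hz, fun _ _ => by rw [hz']; exact hp'⟩
    · exact ⟨0, ha, fun h1 h2 => absurd ⟨h1, h2⟩ hj⟩
  choose φ hφa hφ using hφ
  refine ⟨T.image φ, fun z hz => ?_, Finset.card_image_le.trans hTk, fun q hq => ?_⟩
  · obtain ⟨j, -, rfl⟩ := Finset.mem_image.1 hz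
    exact Finset.mem_range.2 (hφa j)
  · obtain ⟨j, hj, hj'⟩ := hTc _ (h.client_lt q hq)
    obtain ⟨x, hx, hx'⟩ := hs.near _ (h.client_lt q hq)
    refine ⟨φ j, Finset.mem_image_of_mem _ hj, ?_⟩
    have h1 := hφ j (Finset.mem_range.1 (hT hj)) ⟨x, hx, by
      have := dist_triangle_left (I.point (I.numClients + j)) (I.point (c x)) (I.point (C q))
      have := hs.nonneg
      simp only [pd] at hx' ⊢
      linarith⟩
    have := dist_triangle (I.point (C q)) (I.point (I.numClients + j)) (I.point (F (φ j)))
    simp only [pd, nearRel] at *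
    linarith

theorem Nets.pos {kk M a b : ℕ} {R δ : ℝ} {c C G : ℕ → ℕ} (h : Nets I kk M R δ c b C a G)
    (hs : Scale I kk c R) (hn : 0 < I.numClients) : 0 < b ∧ 0 < a := by
  have hR := hs.nonneg
  obtain ⟨x, hx, hx'⟩ := hs.near 0 hn
  obtain ⟨q, hq, -⟩ := h.client_near 0 hn ⟨x, hx, by linarith⟩
  obtain ⟨T, hT, -, hTc⟩ := hs.feas
  obtain ⟨j, hj, hj'⟩ := hTc 0 hn
  obtain ⟨z, hz, -⟩ := h.fac_near j (Finset.mem_range.1 (hT hj)) ⟨x, hx, by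
    have := dist_triangle_left (I.point (I.numClients + j)) (I.point (c x)) (I.point 0)
    simp only [pd] at hx' ⊢
    linarith⟩
  exact ⟨by omega, by omega⟩

/-- Error budget: 2δ for moving the facilities to the net and δ for passing from a client to its net
point. In total 3δ = 3εR/8 ≤ ε·t, as R is at most every feasible t. -/
theorem Nets.approx {kk M a b : ℕ} {R : ℝ} {c C G F : ℕ → ℕ} {s : State}
    (h : Nets I kk M R (ε * R / 8) c b C a G) (hε : 0 < ε) (hε1 : ε ≤ 1) (hs : Scale I kk c R)
    (hn : 0 < I.numClients) (hF : ∀ p < a, ∃ z < a, F z = G p) (hF' : ∀ z < a, ∃ p < a, F z = G p)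
    (hl : ∀ t ≤ 4 * R, ListFeas I C F a b kk t → ∃ ρ ≤ t, ListGood I C F a b kk s ρ) :
    Approx I ε kk s := by
  classical
  set δ := ε * R / 8 with hδ
  have hR := hs.nonneg
  have hδR : δ ≤ R / 8 := by rw [hδ]; nlinarith
  have hδ0 : 0 ≤ δ := by rw [hδ]; positivity
  obtain ⟨hb, ha⟩ := h.pos hs hn
  have key : ∀ t, Feas I kk t → t ≤ 3 * R → Good I kk s ((1 + ε) * t) := by
    intro t ht ht3
    obtain ⟨ρ, hρ, h1, h2, h3⟩ := hl (t + 2 * δ) (by linarith) (h.listFeas hs hF ha ht ht3)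
    refine Good.mono (t := ρ + δ) ⟨h1, fun z hz => ?_, fun p hp => ?_⟩ ?_
    · obtain ⟨i, hi, hi'⟩ := h2 z hz
      obtain ⟨p, hp, hp'⟩ := hF' i hi
      rw [hi', hp']
      exact h.fac_mem p hp
    · obtain ⟨x, hx, hx'⟩ := hs.near p hp
      obtain ⟨q, hq, hq'⟩ := h.client_near p hp ⟨x, hx, by linarith⟩
      obtain ⟨z, hz, hz'⟩ := h3 q hq
      refine ⟨z, hz, ?_⟩
      have := dist_triangle (I.point p) (I.point (C q)) (I.point (s.nat aBL z))
      simp only [pd] at hq'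
      linarith
    · have h4 : ε * R ≤ ε * t := mul_le_mul_of_nonneg_left (hs.le t ht) hε.le
      have h5 : 0 ≤ ε * R := by positivity
      linarith
  intro t ht
  -- The nets serve only costs up to 3R, but 3R is itself feasible, so larger t follow from it.
  rcases le_total t (3 * R) with h3 | h3
  · exact key t ht h3
  · exact (key _ hs.feas le_rfl).mono (mul_le_mul_of_nonneg_left h3 (by linarith))

end RealRAM

/-! ### The algorithm for many points -/


namespace RealRAM

variable {I : KSupplier} {ε : ℝ}

/-- An approximate solution if there are many clients and facilities. -/
def lSolve : Program := radius ;; nets ;; binLog ;; root ;; cluster ;; arrange ;; search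

/-- The terms (n + m)(kk + P) for the nets are O(n·m) because kk and P are at most n and at most m.
All the rest is polynomial in Q = kk·P + kk + 1, d and the front size. -/
theorem lSolve_time {n m kk P a b l d M : ℕ} (hn : 0 < n) (hm : 0 < m) (hkn : kk ≤ n) (hkm : kk ≤ m)
    (hPn : P ≤ n) (hPm : P ≤ m) (hk : 0 < kk) (ha : a ≤ kk * P) (hb : b ≤ kk * P) (hl : l ≤ kk) :
    500 * (n * m) + ((n + m) * ((kk + P) * 60 + 170) + 200 * (kk * P + kk + 1) ^ 2) +
      (a * 30 + 30) + (kk * (d * 30 + 60) + 30) +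
      (a * ((l + 1) * (a * 100 + 150)) + a * 200 + 60) + (a * (a * 90 + 100) + 30) +
      (b * (a * (1000 * ((a + 1) * (b + 1) * (M + 1) ^ 2) + 60) + 60) + 40) ≤
    1100 * (n * m) + 3000 * ((d + 1) * (kk * P + kk + 1) ^ 4 * (M + 1) ^ 2) := by
  obtain ⟨Q, hQ⟩ : ∃ Q, Q = kk * P + kk + 1 := ⟨_, rfl⟩
  obtain ⟨V, hV⟩ : ∃ V, V = (M + 1) ^ 2 := ⟨_, rfl⟩
  rw [← hQ, ← hV]
  have hV1 : 1 ≤ V := by rw [hV]; exact Nat.one_le_pow _ _ (by omega)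
  have haQ : a + 1 ≤ Q := by omega
  have hbQ : b + 1 ≤ Q := by omega
  have hlQ : l + 1 ≤ Q := by omega
  have hkQ : kk ≤ Q := by omega
  have e1 : (n + m) * ((kk + P) * 60 + 170) ≤ 600 * (n * m) := by
    have h1 : n * kk ≤ n * m := Nat.mul_le_mul_left _ hkm
    have h2 : n * P ≤ n * m := Nat.mul_le_mul_left _ hPm
    have h3 : m * kk ≤ m * n := Nat.mul_le_mul_left _ hkn
    have h4 : m * P ≤ m * n := Nat.mul_le_mul_left _ hPn
    have h5 : n ≤ n * m := Nat.le_mul_of_pos_right _ hm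
    have h6 : m ≤ n * m := Nat.le_mul_of_pos_left _ hn
    have e : (n + m) * ((kk + P) * 60 + 170) =
      60 * (n * kk) + 60 * (n * P) + 60 * (m * kk) + 60 * (m * P) + 170 * n + 170 * m := by ring
    rw [mul_comm m n] at h3 h4
    rw [e]
    omega
  have hQ1 : 1 ≤ Q := by omega
  have q1 : Q ≤ Q ^ 4 := Nat.le_self_pow (by omega) _
  have q2 : Q ^ 2 ≤ Q ^ 4 := Nat.pow_le_pow_right hQ1 (by omega)
  have q3 : Q ^ 3 ≤ Q ^ 4 := Nat.pow_le_pow_right hQ1 (by omega)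
  have hE : (d + 1) * Q ^ 4 * V = d * (Q ^ 4 * V) + Q ^ 4 * V := by ring
  have hE1 : Q ^ 4 ≤ Q ^ 4 * V := Nat.le_mul_of_pos_right _ hV1
  have e2 : kk * (d * 30 + 60) ≤ 30 * (d * (Q ^ 4 * V)) + 60 * (Q ^ 4 * V) := by
    have h1 : kk * d ≤ (Q ^ 4 * V) * d := Nat.mul_le_mul_right _ (by omega)
    have e : kk * (d * 30 + 60) = 30 * (kk * d) + 60 * kk := by ring
    rw [mul_comm (Q ^ 4 * V)] at h1
    omega
  have e3 : a * ((l + 1) * (a * 100 + 150)) ≤ 150 * Q ^ 3 := by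
    have h1 : a * ((l + 1) * (a * 100 + 150)) ≤ Q * (Q * (150 * Q)) :=
      Nat.mul_le_mul (by omega) (Nat.mul_le_mul hlQ (by omega))
    have e : Q * (Q * (150 * Q)) = 150 * Q ^ 3 := by ring
    omega
  have e4 : a * (a * 90 + 100) ≤ 100 * Q ^ 2 := by
    have h1 : a * (a * 90 + 100) ≤ Q * (100 * Q) := Nat.mul_le_mul (by omega) (by omega)
    have e : Q * (100 * Q) = 100 * Q ^ 2 := by ring
    omega
  have e5 : b * (a * (1000 * ((a + 1) * (b + 1) * V) + 60) + 60) ≤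
      1000 * (Q ^ 4 * V) + 60 * Q ^ 2 + 60 * Q := by
    have h1 : (a + 1) * (b + 1) * V ≤ Q * Q * V :=
      Nat.mul_le_mul_right _ (Nat.mul_le_mul haQ hbQ)
    have h2 : b * (a * (1000 * ((a + 1) * (b + 1) * V) + 60) + 60) ≤
        Q * (Q * (1000 * (Q * Q * V) + 60) + 60) :=
      Nat.mul_le_mul (by omega) (Nat.add_le_add_right (Nat.mul_le_mul (by omega) (by omega)) _)
    have e : Q * (Q * (1000 * (Q * Q * V) + 60) + 60) =
      1000 * (Q ^ 4 * V) + 60 * Q ^ 2 + 60 * Q := by ring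
    omega
  omega

theorem le_sub_of_sum_le {t u v w x y z r : ℕ} (h : u + v + w + x + y + z + r ≤ t) :
    r ≤ t - u - v - w - x - y - z := by
  omega

/-- `hW` isolates the arithmetic: `B` bounds the shell items and `N` the annulus items, for whatever
net size `a`, root `l` and logarithm `lg` the run produces. -/
theorem ends_lSolve {s : State} {kk P W : ℕ} (hk : s.nat nKK 0 = kk) (hk0 : 0 < kk)
    (hkn : kk ≤ I.numClients) (hkm : kk ≤ I.numFacilities) (hd : 0 < I.dim) (hε : 0 < ε)
    (hε1 : ε ≤ 1) (hP : (128 / ε) ^ I.dim < P + 1) (hPn : P ≤ I.numClients)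
    (hPm : P ≤ I.numFacilities)
    (hW : ∀ a l lg : ℕ, a ≤ kk * P → 0 < l → kk ≤ l ^ I.dim → (l - 1) ^ I.dim < kk →
      2 ^ lg ≤ 2 * a → ∃ B N : ℕ, lg * a / l ≤ B ∧
        I.dim * (130 / ε) ^ I.dim * (l : ℝ) ^ (I.dim - 1) ≤ N ∧ B + N ≤ W) :
    Ends I ε lSolve s (1100 * (I.numClients * I.numFacilities) +
      3000 * ((I.dim + 1) * (kk * P + kk + 1) ^ 4 * ((kk + 1) * 2 ^ W + 1) ^ 2))
      (Approx I ε kk) := by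
  have hn : 0 < I.numClients := by omega
  have hm : 0 < I.numFacilities := by omega
  have htime := fun a b l => lSolve_time (a := a) (b := b) (l := l) (d := I.dim)
    (M := (kk + 1) * 2 ^ W) hn hm hkn hkm hPn hPm hk0
  have hM1 : 1 ≤ (kk + 1) * 2 ^ W := Nat.mul_pos (by omega) (by positivity)
  generalize hM : (kk + 1) * 2 ^ W = M at htime hM1 ⊢
  obtain ⟨t, ht⟩ : ∃ t, t = 1100 * (I.numClients * I.numFacilities) +
      3000 * ((I.dim + 1) * (kk * P + kk + 1) ^ 4 * (M + 1) ^ 2) := ⟨_, rfl⟩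
  rw [← ht] at htime ⊢
  obtain ⟨tN, htN⟩ : ∃ tN, tN = (I.numClients + I.numFacilities) * ((kk + P) * 60 + 170) +
      200 * (kk * P + kk + 1) ^ 2 := ⟨_, rfl⟩
  rw [← htN] at htime
  have hbase := htime 0 0 0 (by omega) (by omega) (by omega)
  refine Ends.seq (ends_radius hk hk0 hn hm hkm) (n' := t - 500 * (I.numClients * I.numFacilities))
    ?_ (by omega)
  intro s1 hf1 hs
  set R := s1.real rR 0 with hR
  set c := s1.nat aCen with hc
  have hpack := packBound hd hε hε1 hs.nonneg hP
  have k1 : s1.nat nKK 0 = kk := by rw [hf1.nat _ rfl, hk]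
  refine Ends.seq (ends_nets k1 hk0 rfl rfl hs.nonneg hε.le hpack)
    (n' := t - 500 * (I.numClients * I.numFacilities) - tN) ?_ (by rw [← htN]; omega)
  rintro s2 hf2 ⟨hN, g1, g2⟩
  set a := s2.nat nG 0 with ha
  set b := s2.nat nB 0 with hb
  obtain ⟨hb0, ha0⟩ := hN.pos hs hn
  have k2 : s2.nat nKK 0 = kk := by rw [hf2.nat _ rfl, k1]
  have r2 : s2.real rR 0 = R := by rw [hf2.real _ rfl]
  have hbase2 := htime a b 0 hN.a_le hN.b_le (by omega)
  refine Ends.seq (ends_binLog rfl ha0)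
    (n' := t - 500 * (I.numClients * I.numFacilities) - tN - (a * 30 + 30)) ?_ (by omega)
  rintro s3 hf3 ⟨b1, b2⟩
  set lg := s3.nat gLg 0 with hlg
  have k3 : s3.nat nKK 0 = kk := by rw [hf3.nat _ rfl, k2]
  refine Ends.seq (ends_root k3 hk0 hd) (n' := t - 500 * (I.numClients * I.numFacilities) - tN -
    (a * 30 + 30) - (kk * (I.dim * 30 + 60) + 30)) ?_ (by omega)
  rintro s4 hf4 ⟨l1, l2, l3⟩
  set l := s4.nat gEl 0 with hl
  have hlk : l ≤ kk := by
    have := Nat.le_self_pow hd.ne' (l - 1)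
    omega
  have hbase3 := htime a b l hN.a_le hN.b_le hlk
  obtain ⟨B, N, hB, hN', hBN⟩ := hW a l lg hN.a_le l1 l2 l3 b2
  have c1 : ∀ A, binLog.writesNat A = false → root.writesNat A = false → s4.nat A = s2.nat A :=
    fun A i1 i2 => (hf4.nat A i2).trans (hf3.nat A i1)
  have c2 : ∀ A, root.writesReal A = false → s4.real A = s2.real A :=
    fun A i2 => (hf4.real A i2).trans (hf3.real A rfl)
  refine Ends.seq (ends_cluster (a := a) (l := l) (lg := lg) (H := 8 * R) (by rw [c1 _ rfl rfl])
    (by rw [c2 _ rfl, g2]) (by linarith [hs.nonneg]) rfl l1 (by rw [hf4.nat _ rfl]) b1)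
    (n' := t - 500 * (I.numClients * I.numFacilities) - tN - (a * 30 + 30) -
      (kk * (I.dim * 30 + 60) + 30) - (a * ((l + 1) * (a * 100 + 150)) + a * 200 + 60)) ?_ (by omega)
  intro s5 hf5 hcl
  have d1 : ∀ A, binLog.writesNat A = false → root.writesNat A = false →
      cluster.writesNat A = false → s5.nat A = s2.nat A :=
    fun A i1 i2 i3 => (hf5.nat A i3).trans (c1 A i1 i2)
  refine Ends.seq (ends_arrange (a := a) (by rw [d1 _ rfl rfl rfl]))
    (n' := t - 500 * (I.numClients * I.numFacilities) - tN - (a * 30 + 30) -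
      (kk * (I.dim * 30 + 60) + 30) - (a * ((l + 1) * (a * 100 + 150)) + a * 200 + 60) -
      (a * (a * 90 + 100) + 30)) ?_ (by omega)
  rintro s6 hf6 ⟨m1, m2⟩
  have q1 : ∀ A, binLog.writesNat A = false → root.writesNat A = false →
      cluster.writesNat A = false → arrange.writesNat A = false → s6.nat A = s2.nat A :=
    fun A i1 i2 i3 i4 => (hf6.nat A i4).trans (d1 A i1 i2 i3)
  have q2 : s6.real rR 0 = R := by rw [hf6.real _ rfl, hf5.real _ rfl, c2 _ rfl, r2]
  rw [d1 aG rfl rfl rfl] at m2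
  rw [c1 _ rfl rfl] at hcl
  obtain ⟨⟨lab, key, cen, hL⟩, hF', hF⟩ := hcl.layout hN.sep m2
  have hfew : ((Finset.range a).filter fun z => lab z = 1).card ≤ B :=
    ((Nat.le_div_iff_mul_le l1).2 hL.few).trans hB
  have hlast := htime a b l hN.a_le hN.b_le hlk
  -- The shells have width H = 8R, which is twice the largest threshold.
  have hfront : ∀ t ≤ 4 * R, FrontBound (nearRel I (s2.nat aLC) (s6.nat aLF) t) a b kk M :=
    fun t ht => hL.frontBound (shellBound hd hε hε1 hs.nonneg l1 hN') hfew (by linarith)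
      (hM ▸ Nat.mul_le_mul_left _ (Nat.pow_le_pow_right (by omega) hBN))
  have hsearch := ends_search (ε := ε) (a := a) (b := b) (kk := kk) (M := M) (C := s2.nat aLC)
    (F := s6.nat aLF) (R := R) ha0 hb0 hM1 m1 (congrFun (q1 nB rfl rfl rfl rfl) 0)
    ((congrFun (q1 nKK rfl rfl rfl rfl) 0).trans k2) (q1 aLC rfl rfl rfl rfl) rfl q2 hfront
  exact hsearch.mono (le_sub_of_sum_le hlast) fun s7 _ h7 => hN.approx hε hε1 hs hn hF hF' h7

/-- The best single facility. -/
def single : Program :=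
  assign nBL (.lit 1) ;;
  forUp gI (.lit 0) .numFacilities
    (rassign rS (.cast (.lit 0)) ;;
      forUp gQ (.lit 0) .numClients
        (.cond (.realLt (.var rS) (.dist (.var gQ) (.add .numClients (.var gI))))
          (rassign rS (.dist (.var gQ) (.add .numClients (.var gI)))) .skip) ;;
      .cond (.neg (.conj (.natLe (.lit 1) (.var gI)) (.realLe (.var rBt) (.var rS))))
        (rassign rBt (.var rS) ;; assign aBL (.add .numClients (.var gI))) .skip)

/-- This case is separate because log k = 0 for k = 1: the time bound then contains no term with
(2/ε)^d in the exponent. -/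
theorem ends_single {s : State} (hn : 0 < I.numClients) (hm : 0 < I.numFacilities) :
    Ends I ε single s (300 * (I.numClients * I.numFacilities)) (Optimal I 1) := by
  have hnm : I.numFacilities ≤ I.numClients * I.numFacilities := Nat.le_mul_of_pos_left _ hn
  set n := I.numClients with hn'
  set m := I.numFacilities with hm'
  refine Ends.step (n' := m * (n * 50 + 120) + 20) rfl ((Ends.forUp (k := n * 50 + 80) (a := 0)
    (b := m) (fun j s' => (0 < j → (n ≤ s'.nat aBL 0 ∧ s'.nat aBL 0 < n + m) ∧
      ∀ q < n, pd I q (s'.nat aBL 0) ≤ s'.real rBt 0) ∧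
      ∀ i < j, ∀ t, 0 ≤ t → (∀ q < n, pd I q (n + i) ≤ t) → s'.real rBt 0 ≤ t)
    rfl (Nat.zero_le _) rfl (fun _ _ => rfl) ?_ ?_ ?_).post ?_) ?_
  · exact ⟨fun h => absurd h (by omega), fun i hi => absurd hi (by omega)⟩
  · rintro j s1 - hj hf1 hjj ⟨h1, h2⟩
    refine Ends.step (n' := n * 50 + 70) rfl (Ends.seq (n := n * 50 + 20) (n' := 45)
      (Ends.forUp (k := 30) (a := 0) (b := n) (fun z s' => (∀ q < z, pd I q (n + j) ≤ s'.real rS 0) ∧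
        ∀ t, 0 ≤ t → (∀ q < n, pd I q (n + j) ≤ t) → s'.real rS 0 ≤ t)
        rfl (Nat.zero_le _) rfl (fun _ _ => rfl) ?_ ?_ ?_) ?_ (by omega)) (by simp; omega)
    · exact ⟨fun h => by omega, fun t ht _ => by simpa using ht⟩
    · rintro z s' - hz hf hzz ⟨h3, h4⟩
      have f1 : s'.nat gI = s1.nat gI := hf.nat _ rfl
      refine Ends.straight rfl (by simp) ?_
      simp only [Program.run]
      split_ifs with hc <;> simp only [Test.Holds, NatExpr.eval, RealExpr.eval, hzz, f1, hjj,
        ← hn', not_lt] at hc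
      · simp only [State.real_setNat, State.real_setReal_same, NatExpr.eval, RealExpr.eval,
          Function.update_self, hzz, f1, hjj, ← hn']
        refine ⟨fun q hq => ?_, fun t _ ht => ht z hz⟩
        rcases Nat.lt_succ_iff_lt_or_eq.1 hq with hq | rfl
        · exact (h3 q hq).trans hc.le
        · exact le_rfl
      · refine ⟨fun q hq => ?_, h4⟩
        rcases Nat.lt_succ_iff_lt_or_eq.1 hq with hq | rfl
        · exact h3 q hq
        · exact hc
    · simp; omega
    rintro s2 hf2 ⟨⟨h3, h4⟩, -⟩
    have f1 : s2.nat gI = s1.nat gI := hf2.nat _ rfl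
    have f2 : s2.nat aBL = s1.nat aBL := hf2.nat _ rfl
    have f3 : s2.real rBt 0 = s1.real rBt 0 := by rw [hf2.real _ rfl]; simp
    refine Ends.straight rfl (by simp) ?_
    simp only [Program.run]
    split_ifs with hc <;> simp only [Test.Holds, NatExpr.eval, RealExpr.eval, f1, f3, hjj, not_lt,
      not_and, not_le, not_not, not_forall] at hc
    · have e1 : (((s2.setReal rBt 0 (s2.real rS 0)).setNat aBL 0 (n + j)).setNat gI 0 (j + 1)).nat aBL 0
        = n + j := by simp
      have e2 : (((s2.setReal rBt 0 (s2.real rS 0)).setNat aBL 0 (n + j)).setNat gI 0 (j + 1)).real rBt 0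
        = s2.real rS 0 := by simp
      simp only [NatExpr.eval, RealExpr.eval, State.nat_setReal, f1, hjj, ← hn']
      rw [e1, e2]
      refine ⟨fun _ => ⟨⟨by omega, by omega⟩, h3⟩, fun i hi t ht0 ht => ?_⟩
      rcases Nat.lt_succ_iff_lt_or_eq.1 hi with hi | rfl
      · exact (hc (by omega)).le.trans (h2 i hi t ht0 ht)
      · exact h4 t ht0 ht
    · obtain ⟨h5, h6⟩ := hc
      simp only [State.nat_setNat_ne, State.real_setNat, ne_eq, Nat.reduceEqDiff, not_false_eq_true,
        f2, f3]
      refine ⟨fun _ => h1 (by omega), fun i hi t ht0 ht => ?_⟩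
      rcases Nat.lt_succ_iff_lt_or_eq.1 hi with hi | rfl
      · exact h2 i hi t ht0 ht
      · exact h6.trans (h4 t ht0 ht)
  · have : m * (n * 50 + 80 + 1 + 10) ≤ m * (n * 50 + 120) := Nat.mul_le_mul_left _ (by omega)
    simp; omega
  · rintro s' hf ⟨⟨h1, h2⟩, -⟩
    have e : s'.nat nBL 0 = 1 := by rw [hf.nat _ rfl]; simp
    obtain ⟨h3, h4⟩ := h1 hm
    refine ⟨s'.real rBt 0, ⟨by rw [e], fun z hz => ?_, fun q hq => ⟨0, by omega, h4 q hq⟩⟩, ?_⟩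
    · obtain rfl : z = 0 := by omega
      exact h3
    · rintro t ⟨T, hT, hTk, hTc⟩
      obtain ⟨j, hj, hj'⟩ := hTc 0 hn
      refine h2 j (Finset.mem_range.1 (hT hj)) t (dist_nonneg.trans hj') fun q hq => ?_
      obtain ⟨j', hj1, hj2⟩ := hTc q hq
      rw [Finset.card_le_one.1 hTk j hj j' hj1]
      exact hj2
  · have e : m * (n * 50 + 120) = 50 * (n * m) + 120 * m := by ring
    simp
    omega

end RealRAM

/-! ### The output -/


namespace RealRAM

variable {I : KSupplier} {ε : ℝ}

notation "aOut" => (0 : ℕ)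
notation "aUsed" => (104 : ℕ)

/-- The facility `gP` is put out if it is new. -/
def emit (b : Test) : Program :=
  .cond (.conj (.natLt (.get aUsed (.var gP)) (.lit 1)) b)
    (.setNat aUsed (.var gP) (.lit 1) ;; .setNat aOut (.var gX) (.var gP) ;;
      assign gX (.add (.var gX) (.lit 1))) .skip

/-- The facilities in the list of results and further ones are put out. -/
def output : Program :=
  fill gI aUsed .numFacilities (.lit 0) ;; assign gX (.lit 0) ;;
  forUp gI (.lit 0) (.var nBL)
    (assign gP (.sub (.get aBL (.var gI)) .numClients) ;; emit (.natLt (.lit 0) (.lit 1))) ;;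
  forUp gP (.lit 0) .numFacilities (emit (.natLt (.var gX) .k))

/-- The first `x` cells of `out` contain without repetitions the facilities that are marked. -/
structure OutOK (m : ℕ) (out used : ℕ → ℕ) (x : ℕ) : Prop where
  lt : ∀ i < x, out i < m
  used_of : ∀ i < x, used (out i) ≠ 0
  of_used : ∀ j < m, used j ≠ 0 → ∃ i < x, out i = j
  inj : ∀ i i', i < i' → i' < x → out i ≠ out i'

theorem OutOK.push {m x j : ℕ} {out used : ℕ → ℕ} (h : OutOK m out used x) (hj : j < m)
    (hu : used j = 0) : OutOK m (Function.update out x j) (Function.update used j 1) (x + 1) := by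
  have hold : ∀ i < x, Function.update out x j i = out i := fun i hi => Function.update_of_ne hi.ne _ _
  refine ⟨fun i hi => ?_, fun i hi => ?_, fun j' hj' hu' => ?_, fun i i' hii hi' => ?_⟩
  · rcases Nat.lt_succ_iff_lt_or_eq.1 hi with hi | rfl
    · rw [hold i hi]; exact h.lt i hi
    · rwa [Function.update_self]
  · rcases Nat.lt_succ_iff_lt_or_eq.1 hi with hi | rfl
    · rw [hold i hi]
      by_cases he : out i = j
      · simp [he]
      · rw [Function.update_of_ne he]; exact h.used_of i hi
    · simp
  · by_cases he : j' = j
    · exact ⟨x, by omega, by rw [Function.update_self, he]⟩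
    · rw [Function.update_of_ne he] at hu'
      obtain ⟨i, hi, hi'⟩ := h.of_used j' hj' hu'
      exact ⟨i, by omega, by rw [hold i hi, hi']⟩
  · rw [hold i (by omega)]
    rcases Nat.lt_succ_iff_lt_or_eq.1 hi' with hi' | rfl
    · rw [hold i' hi']; exact h.inj i i' hii hi'
    · rw [Function.update_self]
      intro he
      exact h.used_of i hii (by rw [he]; exact hu)

theorem ends_emit {s : State} {b : Test} {m x j n : ℕ} (hP : s.nat gP 0 = j) (hj : j < m)
    (hx : s.nat gX 0 = x) (h : OutOK m (s.nat aOut) (s.nat aUsed) x) (hn : b.steps + 24 ≤ n) :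
    Ends I ε (emit b) s n fun s' => OutOK m (s'.nat aOut) (s'.nat aUsed) (s'.nat gX 0) ∧
      (∀ i, s.nat aUsed i ≠ 0 → s'.nat aUsed i ≠ 0) ∧ x ≤ s'.nat gX 0 ∧ s'.nat gX 0 ≤ x + 1 ∧
      (x < s'.nat gX 0 → b.Holds I ε s) ∧ (b.Holds I ε s → s'.nat aUsed j ≠ 0) := by
  refine Ends.straight rfl (by simp [emit]; omega) ?_
  simp only [emit, Program.run]
  split_ifs with hc <;> simp only [Test.Holds, NatExpr.eval, hP, Nat.lt_one_iff] at hc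
  · simp only [NatExpr.eval, State.nat_setNat_ne, State.nat_setNat_same, ne_eq, Nat.reduceEqDiff,
      not_false_eq_true, hP, hx, OfNat.zero_ne_ofNat, OfNat.ofNat_ne_zero, Function.update_self]
    refine ⟨h.push hj hc.1, fun i hi => ?_, by omega, le_rfl, fun _ => hc.2, fun _ => by simp⟩
    by_cases he : i = j
    · simp [he]
    · rwa [Function.update_of_ne he]
  · rw [hx]
    exact ⟨h, fun _ hi => hi, le_rfl, by omega, fun h => absurd h (by omega),
      fun hb h0 => hc ⟨h0, hb⟩⟩

/-- Results are first put out without repetitions and then padded by arbitrary facilities to exactly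
`k`, which cannot increase the cost. -/
theorem ends_output {s : State} {N : ℕ} (hN : s.nat nBL 0 = N) (hNk : N ≤ I.k)
    (hkm : I.k ≤ I.numFacilities)
    (hBL : ∀ z < N, I.numClients ≤ s.nat aBL z ∧ s.nat aBL z < I.numClients + I.numFacilities) :
    Ends I ε output s (300 * I.numFacilities + 100) fun s' =>
      (s'.output I).card = I.k ∧ ∀ z < N, ∃ j ∈ s'.output I, s.nat aBL z = I.numClients + j := by
  classical
  set m := I.numFacilities with hm
  set n := I.numClients with hn
  refine Ends.seq (n := m * 20 + 20) (n' := m * 200 + 80)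
    ((ends_fill (X := m) (g := fun _ => 0) (by simp) (fun _ _ => rfl) (fun _ _ _ _ _ => rfl)).le
      (by simp; omega)) ?_ (by omega)
  intro s1 hf1 h1
  have a1 : s1.nat nBL = s.nat nBL := hf1.nat _ rfl
  have a2 : s1.nat aBL = s.nat aBL := hf1.nat _ rfl
  refine Ends.step (n' := m * 200 + 75) rfl (Ends.seq (n := N * 80 + 20) (n' := m * 80 + 20)
    (Ends.forUp (k := 60) (a := 0) (b := N) (fun z s' =>
      OutOK m (s'.nat aOut) (s'.nat aUsed) (s'.nat gX 0) ∧ s'.nat gX 0 ≤ z ∧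
      ∀ z' < z, s'.nat aUsed (s.nat aBL z' - n) ≠ 0) rfl (Nat.zero_le _) rfl ?_ ?_ ?_ ?_) ?_
      (by omega)) (by simp; omega)
  · intro s' hf
    have e : s'.nat nBL = _ := hf.nat _ rfl
    simp [e, a1, hN]
  · have e1 : ∀ A, A ≠ 86 → A ≠ 82 → (((assign gX (.lit 0)).run I ε s1).setNat gI 0 0).nat A = s1.nat A :=
      fun A i1 i2 => by simp [i1, i2]
    have e2 : (((assign gX (.lit 0)).run I ε s1).setNat gI 0 0).nat gX 0 = 0 := by simp
    rw [e1 aOut (by simp) (by simp), e1 aUsed (by simp) (by simp), e2]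
    exact ⟨⟨by simp, by simp, fun j hj hu => absurd (h1 j hj) hu, by simp⟩, le_rfl, by simp⟩
  · rintro z s2 hz0 hz hf2 hzz ⟨h2, h3, h4⟩
    have b1 : s2.nat aBL = s.nat aBL := by rw [hf2.nat aBL rfl, run_nat rfl rfl, a2]
    have hz' := hBL z hz
    have c1 : ∀ A, A ≠ 83 →
        ((assign gP (.sub (.get aBL (.var gI)) .numClients)).run I ε s2).nat A = s2.nat A :=
      fun A i => by simp [i]
    refine Ends.step (n' := 45) rfl ((ends_emit (m := m) (j := s.nat aBL z - n)
      (x := s2.nat gX 0) (by simp [hzz, b1, ← hn]) (by omega) (by simp)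
      (by rw [c1 _ (by simp), c1 _ (by simp)]; exact h2) (by simp)).post ?_) (by simp)
    rintro s3 - ⟨i1, i2, i3, i4, -, i6⟩
    rw [c1 _ (by simp)] at i2
    refine ⟨by simpa using i1, by simp; omega, fun z' hz' => ?_⟩
    simp only [State.nat_setNat_ne, ne_eq, Nat.reduceEqDiff, not_false_eq_true]
    rcases Nat.lt_succ_iff_lt_or_eq.1 hz' with hz' | rfl
    · exact i2 _ (h4 z' hz')
    · exact i6 (by simp)
  · simp; omega
  rintro s2 hf2 ⟨⟨h2, h3, h4⟩, -⟩
  refine (Ends.forUp (k := 60) (a := 0) (b := m) (fun j s' =>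
    OutOK m (s'.nat aOut) (s'.nat aUsed) (s'.nat gX 0) ∧ s'.nat gX 0 ≤ I.k ∧
    (∀ j' < j, s'.nat aUsed j' ≠ 0 ∨ s'.nat gX 0 = I.k) ∧
    ∀ z' < N, s'.nat aUsed (s.nat aBL z' - n) ≠ 0) rfl (Nat.zero_le _) rfl (fun _ _ => rfl)
    ?_ ?_ ?_).post ?_
  · exact ⟨by simpa using h2, by simp; omega, by simp, by simpa using h4⟩
  · rintro j s3 - hj - hjj ⟨h5, h6, h7, h8⟩
    refine (ends_emit hjj hj rfl h5 (by simp)).post ?_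
    rintro s4 - ⟨i1, i2, i3, i4, i5, i6⟩
    simp only [Test.Holds, NatExpr.eval] at i5 i6
    simp only [State.nat_setNat_ne, ne_eq, Nat.reduceEqDiff, not_false_eq_true,
      OfNat.zero_ne_ofNat]
    refine ⟨i1, ?_, fun j' hj' => ?_, fun z hz => i2 _ (h8 z hz)⟩
    · rcases Nat.lt_or_ge (s3.nat gX 0) (s4.nat gX 0) with h | h
      · have := i5 h; omega
      · omega
    · rcases Nat.lt_succ_iff_lt_or_eq.1 hj' with hj' | rfl
      · rcases h7 j' hj' with h | h
        · exact .inl (i2 _ h)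
        · refine .inr ?_
          rcases Nat.lt_or_ge (s3.nat gX 0) (s4.nat gX 0) with h' | h'
          · have := i5 h'; omega
          · omega
      · by_cases hk : s3.nat gX 0 < I.k
        · exact .inl (i6 hk)
        · refine .inr ?_
          rcases Nat.lt_or_ge (s3.nat gX 0) (s4.nat gX 0) with h' | h'
          · have := i5 h'; omega
          · omega
  · simp; omega
  · rintro s3 - ⟨⟨h5, h6, h7, h8⟩, -⟩
    -- With fewer than `k` facilities put out, the second loop would have put out all of them,
    -- contrary to `k ≤ numFacilities`.
    have hx : s3.nat gX 0 = I.k := by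
      by_contra hne
      have hall : ∀ j < m, ∃ i < s3.nat gX 0, s3.nat aOut i = j := fun j hj =>
        h5.of_used j hj ((h7 j hj).resolve_right hne)
      have := Finset.card_le_card_of_surjOn (s := Finset.range (s3.nat gX 0)) (t := Finset.range m)
        (s3.nat aOut) fun j hj => by
          obtain ⟨i, hi, hi'⟩ := hall j (by simpa using hj)
          exact ⟨i, by simpa using hi, hi'⟩
      simp at this
      omega
    rw [hx] at h5
    refine ⟨?_, fun z hz => ?_⟩
    · have : (s3.output I).card = (Finset.range I.k).card := by
        refine (Finset.card_bij (fun i hi => ⟨s3.nat aOut i, h5.lt i (Finset.mem_range.1 hi)⟩)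
          (fun i hi => ?_) (fun i hi i' hi' he => ?_) fun j hj => ?_).symm
        · simp only [State.output, Finset.mem_filter, Finset.mem_univ, true_and]
          exact ⟨i, hi, rfl⟩
        · have he := congrArg Fin.val he
          rcases lt_trichotomy i i' with h | h | h
          · exact absurd he (h5.inj i i' h (Finset.mem_range.1 hi'))
          · exact h
          · exact absurd he.symm (h5.inj i' i h (Finset.mem_range.1 hi))
        · simp only [State.output, Finset.mem_filter, Finset.mem_univ, true_and] at hj
          obtain ⟨i, hi, hi'⟩ := hj
          exact ⟨i, hi, Fin.ext hi'⟩
      simpa using this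
    · have hz' := hBL z hz
      obtain ⟨i, hi, hi'⟩ := h5.of_used _ (show s.nat aBL z - n < m by omega) (h8 z hz)
      refine ⟨⟨s.nat aBL z - n, by omega⟩, ?_, by simp; omega⟩
      simp only [State.output, Finset.mem_filter, Finset.mem_univ, true_and]
      exact ⟨i, Finset.mem_range.2 hi, hi'⟩

/-! ### Feasibility and cost -/

theorem point_client (p : Fin I.numClients) : I.point p = I.client p := by
  simp [KSupplier.point]

theorem point_facility (j : Fin I.numFacilities) : I.point (I.numClients + j) = I.facility j := by
  simp [KSupplier.point]

/-- One nearest facility per client suffices, which gives both bounds on the number of facilities.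
Replacing k by min(k, n) makes it at most the number of clients, as the time bounds need. -/
theorem feas_cost (hI : I.WellPosed) {T : Finset (Fin I.numFacilities)} (hT : T.card = I.k) :
    Feas I (min I.k I.numClients) (I.cost T) := by
  classical
  have hne : (T : Set (Fin I.numFacilities)).Nonempty := by
    rw [Finset.coe_nonempty, ← Finset.card_pos, hT]; exact hI.k_pos
  have hex : ∀ q : Fin I.numClients, ∃ j ∈ T, dist (I.client q) (I.facility j) ≤ I.cost T := by
    intro q
    obtain ⟨y, hy, hy'⟩ := ((T.finite_toSet.image I.facility).isCompact).exists_infDist_eq_dist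
      (hne.image _) (I.client q)
    obtain ⟨j, hj, rfl⟩ := hy
    refine ⟨j, hj, hy' ▸ ?_⟩
    exact le_ciSup (f := fun p : Fin I.numClients => Metric.infDist (I.client p)
      (I.facility '' (T : Set (Fin I.numFacilities)))) (Set.finite_range _).bddAbove q
  choose φ hφT hφ using hex
  refine ⟨(Finset.univ.image φ).image Fin.val, fun j hj => ?_, ?_, fun q hq => ?_⟩
  · obtain ⟨j', -, rfl⟩ := Finset.mem_image.1 hj
    exact Finset.mem_range.2 j'.2
  · refine Finset.card_image_le.trans (le_min ?_ ?_)
    · rw [← hT]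
      refine Finset.card_le_card fun j hj => ?_
      obtain ⟨q, -, rfl⟩ := Finset.mem_image.1 hj
      exact hφT q
    · exact Finset.card_image_le.trans (by simp)
  · refine ⟨φ ⟨q, hq⟩, Finset.mem_image_of_mem _ (Finset.mem_image_of_mem _ (Finset.mem_univ _)), ?_⟩
    rw [point_facility, point_client ⟨q, hq⟩]
    exact hφ ⟨q, hq⟩

theorem cost_le (hI : I.WellPosed) {S : Finset (Fin I.numFacilities)} {t : ℝ}
    (h : ∀ q : Fin I.numClients, ∃ j ∈ S, dist (I.client q) (I.facility j) ≤ t) : I.cost S ≤ t := by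
  have : Nonempty (Fin I.numClients) := ⟨⟨0, hI.clients_pos⟩⟩
  refine ciSup_le fun q => ?_
  obtain ⟨j, hj, hj'⟩ := h q
  exact (Metric.infDist_le_dist_of_mem (Set.mem_image_of_mem _ hj)).trans hj'

theorem ends_output_approx {s : State} (hI : I.WellPosed)
    (h : Approx I ε (min I.k I.numClients) s) :
    Ends I ε output s (300 * I.numFacilities + 100) fun s' =>
      I.IsApproxSolution (1 + ε) (s'.output I) := by
  -- Any set of `k` facilities serves to extract from `Approx` that the list of results is short and
  -- consists of facilities, which does not depend on the cost.
  obtain ⟨T₀, -, hT₀⟩ := Finset.exists_subset_card_eq (s := (Finset.univ : Finset (Fin I.numFacilities)))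
    (n := I.k) (by simpa using hI.k_le)
  obtain ⟨h1, h2, -⟩ := h _ (feas_cost hI hT₀)
  refine (ends_output rfl (h1.trans (min_le_left _ _)) hI.k_le h2).post ?_
  rintro s' - ⟨h3, h4⟩
  refine ⟨h3, fun T hT => cost_le hI fun q => ?_⟩
  obtain ⟨-, -, h5⟩ := h _ (feas_cost hI hT)
  obtain ⟨z, hz, hz'⟩ := h5 q q.2
  obtain ⟨j, hj, hj'⟩ := h4 z hz
  refine ⟨j, hj, ?_⟩
  rwa [hj', point_facility, point_client] at hz'

end RealRAM

/-! ### The algorithm -/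


namespace RealRAM

variable {I : KSupplier} {ε : ℝ}

notation "rPt" => (14 : ℕ)

/-- An exact solution by enumeration of all distances of clients and facilities. -/
def sSolve : Program := sInit ;; sSearch

/-- The algorithm for at least two centers. -/
def general : Program :=
  rassign rPt (.cast (.lit 1)) ;;
  forUp gI (.lit 0) .dim (rassign rPt (.mul (.var rPt) (.div (.cast (.lit 128)) .eps))) ;;
  .cond (.realLt (.cast .numFacilities) (.var rPt))
    (assign sOr (.lit 0) ;; assign sOL (.lit 0) ;; assign sNL .numClients ;;
      assign sOS .numClients ;; assign sNS .numFacilities ;; sSolve)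
    (.cond (.realLt (.cast .numClients) (.var rPt))
      (assign sOr (.lit 1) ;; assign sOL .numClients ;; assign sNL .numFacilities ;;
        assign sOS (.lit 0) ;; assign sNS .numClients ;; sSolve) lSolve)

/-- The algorithm for the `k`-supplier problem. -/
def solve : Program :=
  assign nKK .k ;; .cond (.natLt .numClients .k) (assign nKK .numClients) .skip ;;
  .cond (.natLt (.var nKK) (.lit 2)) single general ;; output

theorem Optimal.approx {kk : ℕ} {s : State} (h : Optimal I kk s) (hε : 0 ≤ ε)
    (hn : 0 < I.numClients) : Approx I ε kk s := by
  obtain ⟨r, hr, hmin⟩ := h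
  intro t ht
  refine hr.mono ((hmin t ht).trans ?_)
  obtain ⟨T, -, -, hT⟩ := ht
  obtain ⟨j, -, hj⟩ := hT 0 hn
  have := mul_nonneg hε (dist_nonneg.trans hj)
  linarith

/-- Nets are affordable only if both sides have at least (128/ε)^d points. If a side has fewer,
solving exactly costs 2^{O((128/ε)^d)} besides n·m, which is within the bound. -/
theorem ends_general {s : State} {kk W : ℕ} (hk : s.nat nKK 0 = kk) (hk0 : 0 < kk)
    (hkn : kk ≤ I.numClients) (hkm : kk ≤ I.numFacilities) (hd : 0 < I.dim) (hε : 0 < ε)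
    (hε1 : ε ≤ 1)
    (hW : ∀ a l lg : ℕ, a ≤ kk * ⌊(128 / ε) ^ I.dim⌋₊ → 0 < l → kk ≤ l ^ I.dim →
      (l - 1) ^ I.dim < kk → 2 ^ lg ≤ 2 * a → ∃ B N : ℕ, lg * a / l ≤ B ∧
        I.dim * (130 / ε) ^ I.dim * (l : ℝ) ^ (I.dim - 1) ≤ N ∧ B + N ≤ W) :
    Ends I ε general s (300500 * (I.numClients * I.numFacilities) +
      300500 * (64 ^ ⌊(128 / ε) ^ I.dim⌋₊ * 64 ^ ⌊(128 / ε) ^ I.dim⌋₊) +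
      3000 * ((I.dim + 1) * (kk * ⌊(128 / ε) ^ I.dim⌋₊ + kk + 1) ^ 4 *
        ((kk + 1) * 2 ^ W + 1) ^ 2) + I.dim * 30 + 100) (Approx I ε kk) := by
  have hn : 0 < I.numClients := by omega
  have hm : 0 < I.numFacilities := by omega
  set D := (128 / ε) ^ I.dim with hD
  set P := ⌊D⌋₊ with hP
  have hD0 : 0 ≤ D := by positivity
  have hsmall : ∀ w : ℕ, (w : ℝ) < D → 64 ^ w * 64 ^ w ≤ 64 ^ P * 64 ^ P := fun w hw => by
    have : w ≤ P := Nat.le_floor hw.le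
    exact Nat.mul_le_mul (Nat.pow_le_pow_right (by omega) this)
      (Nat.pow_le_pow_right (by omega) this)
  obtain ⟨T, hT⟩ : ∃ T, T = 3000 * ((I.dim + 1) * (kk * P + kk + 1) ^ 4 *
    ((kk + 1) * 2 ^ W + 1) ^ 2) := ⟨_, rfl⟩
  obtain ⟨V, hV⟩ : ∃ V, V = 64 ^ P * 64 ^ P := ⟨_, rfl⟩
  rw [← hT, ← hV]
  rw [← hV] at hsmall
  have hS : ∀ s' : State, ∀ L w : ℕ, Sides I (s'.nat sOr 0) (s'.nat sOL 0) L (s'.nat sOS 0) w →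
      s'.nat sNL 0 = L → s'.nat sNS 0 = w → s'.nat nKK 0 = kk → (w : ℝ) < D → kk ≤ w → 0 < L →
      L * w = I.numClients * I.numFacilities →
      Ends I ε sSolve s' (300500 * (I.numClients * I.numFacilities) + 300500 * V)
        (Approx I ε kk) := by
    intro s' L w h1 h2 h3 h4 h5 h6 h7 h8
    refine (ends_sSolve h1 h2 h3 h4 h6 hk0 h7).mono ?_ fun s'' _ h => h.approx hε.le hn
    have := hsmall w h5
    rw [h8]
    omega
  refine Ends.step (n' := 300500 * (I.numClients * I.numFacilities) + 300500 * V + T +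
    I.dim * 30 + 90) rfl (Ends.seq (n := I.dim * 30 + 20) (n' := 300500 *
    (I.numClients * I.numFacilities) + 300500 * V + T + 70) ((Ends.forUp (k := 15) (a := 0)
    (b := I.dim) (fun i s' => s'.real rPt 0 = (128 / ε) ^ i) rfl (Nat.zero_le _) rfl
    (fun _ _ => rfl) ?_ ?_ ?_).post fun s' _ h => h.1) ?_ (by omega)) (by simp; omega)
  · simp
  · rintro i s' - hi hf - h
    exact Ends.straight rfl (by simp) (by simp [h, pow_succ])
  · simp; omega
  intro s1 hf1 h1
  have a1 : s1.nat nKK 0 = kk := by rw [hf1.nat _ rfl]; simpa using hk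
  refine Ends.cond (n := 300500 * (I.numClients * I.numFacilities) + 300500 * V + T + 60)
    (fun hc => ?_) (fun hc => ?_) (by simp; omega)
  · simp only [Test.Holds, RealExpr.eval, NatExpr.eval, h1, ← hD] at hc
    -- The five assignments are grouped so that they are executed symbolically at once.
    refine Ends.assoc (Ends.assoc (Ends.assoc (Ends.assoc ?_)))
    refine Ends.step (c := (((assign sOr (.lit 0) ;; assign sOL (.lit 0)) ;;
      assign sNL .numClients) ;; assign sOS .numClients) ;; assign sNS .numFacilities)
      (n' := 300500 * (I.numClients * I.numFacilities) + 300500 * V) rfl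
      (hS _ I.numClients I.numFacilities (.inl ?_) ?_ ?_ ?_ hc hkm hn rfl) (by simp; omega)
    · simp
    · simp
    · simp
    · simp [a1]
  · simp only [Test.Holds, RealExpr.eval, NatExpr.eval, h1, ← hD, not_lt] at hc
    refine Ends.cond (n := 300500 * (I.numClients * I.numFacilities) + 300500 * V + T + 40)
      (fun hc' => ?_) (fun hc' => ?_) (by simp; omega)
    · simp only [Test.Holds, RealExpr.eval, NatExpr.eval, h1, ← hD] at hc'
      refine Ends.assoc (Ends.assoc (Ends.assoc (Ends.assoc ?_)))
      refine Ends.step (c := (((assign sOr (.lit 1) ;; assign sOL .numClients) ;;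
        assign sNL .numFacilities) ;; assign sOS (.lit 0)) ;; assign sNS .numClients)
        (n' := 300500 * (I.numClients * I.numFacilities) + 300500 * V) rfl
        (hS _ I.numFacilities I.numClients (.inr ?_) ?_ ?_ ?_ hc' hkn hm (mul_comm _ _))
        (by simp; omega)
      · simp
      · simp
      · simp
      · simp [a1]
    · simp only [Test.Holds, RealExpr.eval, NatExpr.eval, h1, ← hD, not_lt] at hc'
      refine (ends_lSolve a1 hk0 hkn hkm hd hε hε1 (Nat.lt_floor_add_one D)
        (Nat.floor_le_of_le hc') (Nat.floor_le_of_le hc) hW).le ?_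
      rw [← hT]
      omega

theorem ends_solve {W : ℕ} (hI : I.WellPosed) (hε : 0 < ε) (hε1 : ε ≤ 1)
    (hW : 2 ≤ I.k → ∀ a l lg : ℕ, a ≤ min I.k I.numClients * ⌊(128 / ε) ^ I.dim⌋₊ → 0 < l →
      min I.k I.numClients ≤ l ^ I.dim → (l - 1) ^ I.dim < min I.k I.numClients →
      2 ^ lg ≤ 2 * a → ∃ B N : ℕ, lg * a / l ≤ B ∧
        I.dim * (130 / ε) ^ I.dim * (l : ℝ) ^ (I.dim - 1) ≤ N ∧ B + N ≤ W) :
    Ends I ε solve .init (300500 * (I.numClients * I.numFacilities) + 300 * I.numFacilities + 300 +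
      if I.k < 2 then 0 else
        300500 * (64 ^ ⌊(128 / ε) ^ I.dim⌋₊ * 64 ^ ⌊(128 / ε) ^ I.dim⌋₊) +
        3000 * ((I.dim + 1) * (min I.k I.numClients * ⌊(128 / ε) ^ I.dim⌋₊ +
          min I.k I.numClients + 1) ^ 4 * ((min I.k I.numClients + 1) * 2 ^ W + 1) ^ 2) +
        I.dim * 30) fun s => I.IsApproxSolution (1 + ε) (s.output I) := by
  have hn : 0 < I.numClients := hI.clients_pos
  have hm : 0 < I.numFacilities := lt_of_lt_of_le hI.k_pos hI.k_le
  have hk := hI.k_pos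
  set kk := min I.k I.numClients with hkk
  have hk0 : 0 < kk := lt_min hI.k_pos hn
  obtain ⟨T, hT⟩ : ∃ T, T = if I.k < 2 then 0 else
        300500 * (64 ^ ⌊(128 / ε) ^ I.dim⌋₊ * 64 ^ ⌊(128 / ε) ^ I.dim⌋₊) +
        3000 * ((I.dim + 1) * (kk * ⌊(128 / ε) ^ I.dim⌋₊ +
          kk + 1) ^ 4 * ((kk + 1) * 2 ^ W + 1) ^ 2) +
        I.dim * 30 := ⟨_, rfl⟩
  rw [← hT]
  refine Ends.assoc (Ends.step (n' := 300500 * (I.numClients * I.numFacilities) +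
    300 * I.numFacilities + 280 + T) rfl (Ends.seq (n := 300500 * (I.numClients * I.numFacilities) +
    T + 120) (Ends.cond (n := 300500 * (I.numClients * I.numFacilities) + T + 110) (fun hc => ?_)
    (fun hc => ?_) (by simp; omega)) (fun s' _ h => ends_output_approx hI h) (by omega)) ?_)
  all_goals
    have e : ((assign nKK .k ;; .cond (.natLt .numClients .k) (assign nKK .numClients) .skip).run I ε
        State.init).nat nKK 0 = kk := by
      by_cases h : I.numClients < I.k
      · simp [h, hkk, h.le]
      · simp [h, hkk, not_lt.1 h]
  · simp only [Test.Holds, NatExpr.eval, e] at hc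
    have h1 : kk = 1 := by omega
    refine (ends_single hn hm).mono (by omega) fun s' _ h => ?_
    rw [← hkk, h1]
    exact h.approx hε.le hn
  · simp only [Test.Holds, NatExpr.eval, e] at hc
    have h2 : 2 ≤ I.k := by have := min_le_left I.k I.numClients; omega
    refine (ends_general e hk0 (min_le_right _ _) ((min_le_left _ _).trans hI.k_le) hI.dim_pos hε hε1
      (hW h2)).le ?_
    rw [hT, if_neg (by omega)]
    omega
  · simp
    omega

end RealRAM

/-! ### The running time -/


namespace RealRAM

variable {I : KSupplier} {ε : ℝ}

section Estimates

variable {d k : ℕ}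

theorem le_two_rpow {x : ℝ} (hx : 1 ≤ x) : x ≤ 2 ^ x := by
  have h := one_add_mul_self_le_rpow_one_add (s := 1) (by norm_num) hx
  rw [show (1 : ℝ) + 1 = 2 by norm_num] at h
  linarith

theorem two_le_div (hε : 0 < ε) (hε1 : ε ≤ 1) : 2 ≤ 2 / ε := by
  rw [le_div_iff₀ hε]; linarith

theorem add_one_le_pow (hε : 0 < ε) (hε1 : ε ≤ 1) (d : ℕ) : (d : ℝ) + 1 ≤ (2 / ε) ^ d := by
  have h1 : ((d + 1 : ℕ) : ℝ) ≤ ((2 ^ d : ℕ) : ℝ) := Nat.cast_le.2 Nat.lt_two_pow_self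
  push_cast at h1
  exact h1.trans (pow_le_pow_left₀ (by norm_num) (two_le_div hε hε1) d)

/-- As 2/ε ≥ 2, constants are absorbed into the exponent: x/ε ≤ (2/ε)^{j+1} as soon as x ≤ 2^{j+1}.
-/
theorem div_pow_le (hε : 0 < ε) (hε1 : ε ≤ 1) {x : ℝ} (j : ℕ) (hx : 0 ≤ x) (hxj : x ≤ 2 ^ (j + 1)) :
    (x / ε) ^ d ≤ ((2 / ε) ^ d) ^ (j + 1) := by
  rw [← pow_mul, mul_comm d, pow_mul]
  refine pow_le_pow_left₀ (by positivity) ?_ d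
  have h1 : (2 : ℝ) ^ j ≤ (2 / ε) ^ j := pow_le_pow_left₀ (by norm_num) (two_le_div hε hε1) j
  have h2 : x / ε ≤ 2 ^ (j + 1) / ε := by gcongr
  have h3 : (2 : ℝ) ^ (j + 1) / ε = 2 ^ j * (2 / ε) := by ring
  rw [pow_succ (2 / ε)]
  have h4 : (2 : ℝ) ^ j * (2 / ε) ≤ (2 / ε) ^ j * (2 / ε) := by gcongr
  linarith

theorem one_le_rpow_one_sub (hd : 0 < d) (hk : 1 ≤ k) : 1 ≤ (k : ℝ) ^ (1 - 1 / (d : ℝ)) := by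
  refine Real.one_le_rpow (by exact_mod_cast hk) ?_
  have : (1 : ℝ) / d ≤ 1 := by
    rw [div_le_one (by exact_mod_cast hd)]
    exact_mod_cast hd
  linarith

theorem one_le_logb (hk : 2 ≤ k) : 1 ≤ Real.logb 2 k := by
  rw [Real.le_logb_iff_rpow_le (by norm_num) (by positivity), Real.rpow_one]
  exact_mod_cast hk

/-- The main term in the exponent of the running time. -/
noncomputable def mainTerm (ε : ℝ) (d k : ℕ) : ℝ :=
  ((2 / ε) ^ d) ^ 10 * (k : ℝ) ^ (1 - 1 / (d : ℝ)) * Real.logb 2 k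

theorem pow_le_mainTerm (hε : 0 < ε) (hε1 : ε ≤ 1) (hd : 0 < d) (hk : 2 ≤ k) {j : ℕ} (hj : j ≤ 10) :
    ((2 / ε) ^ d) ^ j ≤ mainTerm ε d k := by
  have hZ : 1 ≤ (2 / ε) ^ d := by linarith [add_one_le_pow hε hε1 d, Nat.cast_nonneg (α := ℝ) d]
  have h1 : ((2 / ε) ^ d) ^ j ≤ ((2 / ε) ^ d) ^ 10 := pow_le_pow_right₀ hZ hj
  have h2 := one_le_rpow_one_sub hd (show 1 ≤ k by omega)
  have h3 := one_le_logb hk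
  unfold mainTerm
  rw [mul_assoc]
  exact h1.trans (le_mul_of_one_le_right (by positivity) (one_le_mul_of_one_le_of_one_le h2 h3))

/-- The root `l` balances the two parts of the window. With Z = (2/ε)^d and X = k^{1−1/d}, the
shells contain about a·lg/l ≤ X·Z^7·lg items and the annulus about d·(130/ε)^d·l^{d−1} ≤ Z^10·X.
Both are at most a multiple of `mainTerm`, namely 9 and, after rounding up, 2 times it. -/
theorem exists_window (hε : 0 < ε) (hε1 : ε ≤ 1) (hd : 0 < d) (hk : 2 ≤ k) {kk : ℕ} (hk0 : 0 < kk)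
    (hkk : kk ≤ k) {a l lg : ℕ} (ha : a ≤ kk * ⌊(128 / ε) ^ d⌋₊) (hl : 0 < l) (hl1 : kk ≤ l ^ d)
    (hl2 : (l - 1) ^ d < kk) (hlg : 2 ^ lg ≤ 2 * a) :
    ∃ B N : ℕ, lg * a / l ≤ B ∧ d * (130 / ε) ^ d * (l : ℝ) ^ (d - 1) ≤ N ∧
      B + N ≤ ⌊11 * mainTerm ε d k⌋₊ := by
  have hd' : (0 : ℝ) < d := by exact_mod_cast hd
  have hZd := add_one_le_pow hε hε1 d
  have h128 : (128 / ε) ^ d ≤ ((2 / ε) ^ d) ^ 7 := div_pow_le hε hε1 6 (by norm_num) (by norm_num)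
  have h130 : (130 / ε) ^ d ≤ ((2 / ε) ^ d) ^ 8 := div_pow_le hε hε1 7 (by norm_num) (by norm_num)
  have h2d : (2 : ℝ) ^ d ≤ (2 / ε) ^ d := pow_le_pow_left₀ (by norm_num) (two_le_div hε hε1) d
  have hX := one_le_rpow_one_sub hd (show 1 ≤ k by omega)
  have hL := one_le_logb hk
  have hkL : (k : ℝ) = 2 ^ Real.logb 2 k :=
    (Real.rpow_logb (by norm_num) (by norm_num) (by positivity)).symm
  have hmain : mainTerm ε d k =
    ((2 / ε) ^ d) ^ 10 * (k : ℝ) ^ (1 - 1 / (d : ℝ)) * Real.logb 2 k := rfl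
  set Z := (2 / ε) ^ d with hZ
  set X := (k : ℝ) ^ (1 - 1 / (d : ℝ)) with hXdef
  set L := Real.logb 2 k with hLdef
  have hZ1 : 1 ≤ Z := by linarith
  have hZ0 : 0 < Z := by linarith
  set r := (kk : ℝ) ^ ((d : ℝ)⁻¹) with hr
  have hr0 : 0 ≤ r := by positivity
  have hrd : r ^ d = kk := Real.rpow_inv_natCast_pow (by positivity) hd.ne'
  have hr1 : 1 ≤ r := Real.one_le_rpow (by exact_mod_cast hk0) (by positivity)
  have hrl : r ≤ l := by
    refine le_of_pow_le_pow_left₀ hd.ne' (by positivity) ?_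
    rw [hrd]; exact_mod_cast hl1
  -- Rounding the root up costs a factor at most 2 since `r ≥ 1`; its power 2^{d−1} is absorbed by
  -- Z.
  have hlr : (l : ℝ) ≤ 2 * r := by
    have h1 : ((l - 1 : ℕ) : ℝ) ≤ r := by
      refine le_of_pow_le_pow_left₀ hd.ne' hr0 ?_
      rw [hrd]; exact_mod_cast hl2.le
    rw [Nat.cast_sub hl] at h1
    push_cast at h1
    linarith
  have hrX : r ^ (d - 1) ≤ X := by
    rw [hr, ← Real.rpow_natCast, ← Real.rpow_mul (by positivity), Nat.cast_sub hd, Nat.cast_one,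
      mul_sub, inv_mul_cancel₀ hd'.ne', mul_one, ← one_div]
    refine Real.rpow_le_rpow (by positivity) (by exact_mod_cast hkk) ?_
    have : (1 : ℝ) / d ≤ 1 := by rw [div_le_one hd']; exact_mod_cast hd
    linarith
  have hlX : (l : ℝ) ^ (d - 1) ≤ Z * X := by
    refine (pow_le_pow_left₀ (by positivity) hlr _).trans ?_
    rw [mul_pow]
    refine mul_le_mul ?_ hrX (by positivity) hZ0.le
    exact (pow_le_pow_right₀ (by norm_num) (by omega)).trans h2d
  have hP : (⌊(128 / ε) ^ d⌋₊ : ℝ) ≤ Z ^ 7 := (Nat.floor_le (by positivity)).trans h128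
  have haR : (a : ℝ) ≤ kk * Z ^ 7 := by
    have : (a : ℝ) ≤ kk * (⌊(128 / ε) ^ d⌋₊ : ℝ) := by exact_mod_cast ha
    exact this.trans (by gcongr)
  have hal : (a : ℝ) ≤ X * Z ^ 7 * l := by
    have e : (kk : ℝ) = r ^ (d - 1) * r := by rw [← pow_succ, Nat.sub_add_cancel hd, hrd]
    have h1 : (kk : ℝ) ≤ X * l := by
      rw [e]; exact mul_le_mul hrX hrl hr0 (by positivity)
    have h2 : (kk : ℝ) * Z ^ 7 ≤ X * l * Z ^ 7 := by gcongr
    have e2 : X * l * Z ^ 7 = X * Z ^ 7 * l := by ring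
    linarith
  -- From 2^lg ≤ 2a ≤ 2k·Z^7, with Z ≤ 2^Z, one gets lg ≤ 1 + log k + 7Z. Each summand is at most a
  -- multiple of Z·log k.
  have hlgR : (lg : ℝ) ≤ 9 * (Z * L) := by
    have h1 : (2 : ℝ) ^ (lg : ℝ) ≤ 2 ^ (1 + L + 7 * Z) := by
      rw [Real.rpow_natCast, Real.rpow_add (by norm_num), Real.rpow_add (by norm_num), Real.rpow_one,
        ← hkL, mul_comm 7 Z, Real.rpow_mul (by norm_num)]
      have h2 : ((2 : ℝ) ^ lg) ≤ 2 * a := by exact_mod_cast hlg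
      have h3 : Z ^ 7 ≤ ((2 : ℝ) ^ Z) ^ (7 : ℝ) := by
        rw [show (7 : ℝ) = ((7 : ℕ) : ℝ) by norm_num, Real.rpow_natCast]
        exact pow_le_pow_left₀ hZ0.le (le_two_rpow hZ1) 7
      have h4 : (kk : ℝ) * Z ^ 7 ≤ k * ((2 : ℝ) ^ Z) ^ (7 : ℝ) :=
        mul_le_mul (by exact_mod_cast hkk) h3 (by positivity) (by positivity)
      have e : 2 * (k : ℝ) * ((2 : ℝ) ^ Z) ^ (7 : ℝ) = 2 * (k * ((2 : ℝ) ^ Z) ^ (7 : ℝ)) := by ring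
      rw [e]
      linarith
    have h2 := (Real.rpow_le_rpow_left_iff (by norm_num)).1 h1
    have h3 : 1 ≤ Z * L := one_le_mul_of_one_le_of_one_le hZ1 hL
    have h4 : L ≤ Z * L := le_mul_of_one_le_left (by linarith) hZ1
    have h5 : Z ≤ Z * L := le_mul_of_one_le_right hZ0.le hL
    linarith
  refine ⟨lg * a / l, ⌈d * (130 / ε) ^ d * (l : ℝ) ^ (d - 1)⌉₊, le_rfl, Nat.le_ceil _,
    Nat.le_floor ?_⟩
  push_cast
  have hB : ((lg * a / l : ℕ) : ℝ) ≤ 9 * (Z ^ 10 * X * L) := by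
    refine Nat.cast_div_le.trans ?_
    rw [div_le_iff₀ (by exact_mod_cast hl)]
    push_cast
    have h1 : (lg : ℝ) * a ≤ 9 * (Z * L) * (X * Z ^ 7 * l) :=
      mul_le_mul hlgR hal (by positivity) (by positivity)
    have h2 : Z ^ 8 ≤ Z ^ 10 := pow_le_pow_right₀ hZ1 (by norm_num)
    have h3 : Z ^ 8 * (X * L * l) ≤ Z ^ 10 * (X * L * l) := by gcongr
    have e1 : 9 * (Z * L) * (X * Z ^ 7 * l) = 9 * (Z ^ 8 * (X * L * l)) := by ring
    have e2 : 9 * (Z ^ 10 * X * L) * l = 9 * (Z ^ 10 * (X * L * l)) := by ring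
    linarith
  have hN : (⌈d * (130 / ε) ^ d * (l : ℝ) ^ (d - 1)⌉₊ : ℝ) ≤ 2 * (Z ^ 10 * X * L) := by
    have h1 : (d : ℝ) * (130 / ε) ^ d * (l : ℝ) ^ (d - 1) ≤ Z * Z ^ 8 * (Z * X) :=
      mul_le_mul (mul_le_mul (by linarith) h130 (by positivity) hZ0.le) hlX (by positivity)
        (by positivity)
    have h2 := (Nat.ceil_lt_add_one (show 0 ≤ (d : ℝ) * (130 / ε) ^ d * (l : ℝ) ^ (d - 1) by
      positivity)).le
    have e : Z * Z ^ 8 * (Z * X) = Z ^ 10 * X := by ring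
    have h3 : 1 ≤ Z ^ 10 * X := one_le_mul_of_one_le_of_one_le (one_le_pow₀ hZ1) hX
    have h4 : Z ^ 10 * X ≤ Z ^ 10 * X * L := le_mul_of_one_le_right (by linarith) hL
    linarith
  rw [hmain]
  linarith

/-- Everything is measured in powers of e = 2^U with U = `mainTerm`. Since k, d + 1, U and
2^⌊(128/ε)^d⌋ are all at most e, and the front is at most e^14, the total stays below a multiple of
e^45. -/
theorem general_time_le (hε : 0 < ε) (hε1 : ε ≤ 1) (hd : 0 < d) (hk : 2 ≤ k) {kk : ℕ}
    (hkk : kk ≤ k) :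
    ((300500 * (64 ^ ⌊(128 / ε) ^ d⌋₊ * 64 ^ ⌊(128 / ε) ^ d⌋₊) +
      3000 * ((d + 1) * (kk * ⌊(128 / ε) ^ d⌋₊ + kk + 1) ^ 4 *
        ((kk + 1) * 2 ^ ⌊11 * mainTerm ε d k⌋₊ + 1) ^ 2) + d * 30 : ℕ) : ℝ) ≤
    400000 * 2 ^ (45 * mainTerm ε d k) := by
  have hZd := add_one_le_pow hε hε1 d
  have h128 : (128 / ε) ^ d ≤ ((2 / ε) ^ d) ^ 7 := div_pow_le hε hε1 6 (by norm_num) (by norm_num)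
  have hU7 := pow_le_mainTerm hε hε1 hd hk (show 7 ≤ 10 by norm_num)
  have hU1 := pow_le_mainTerm hε hε1 hd hk (show 1 ≤ 10 by norm_num)
  rw [pow_one] at hU1
  have hLU : Real.logb 2 k ≤ mainTerm ε d k := by
    have hX := one_le_rpow_one_sub hd (show 1 ≤ k by omega)
    have hZ1 : 1 ≤ ((2 / ε) ^ d) ^ 10 :=
      one_le_pow₀ (by linarith [Nat.cast_nonneg (α := ℝ) d])
    exact le_mul_of_one_le_left (by linarith [one_le_logb hk])
      (one_le_mul_of_one_le_of_one_le hZ1 hX)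
  have hkL : (k : ℝ) = 2 ^ Real.logb 2 k :=
    (Real.rpow_logb (by norm_num) (by norm_num) (by positivity)).symm
  set U := mainTerm ε d k with hU
  have hd' : (1 : ℝ) ≤ d := by exact_mod_cast hd
  have hU2 : 1 ≤ U := by linarith
  set P := ⌊(128 / ε) ^ d⌋₊ with hP
  have hPU : (P : ℝ) ≤ U := (Nat.floor_le (by positivity)).trans (h128.trans hU7)
  set e := (2 : ℝ) ^ U with he
  have hmono : ∀ {x y : ℝ}, x ≤ y → (2 : ℝ) ^ x ≤ 2 ^ y := fun h =>
    Real.rpow_le_rpow_of_exponent_le (by norm_num) h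
  have he2 : 2 ≤ e := by
    have := hmono hU2
    rwa [Real.rpow_one] at this
  have hUe : U ≤ e := le_two_rpow hU2
  have hke : (kk : ℝ) ≤ e := by
    have h1 : (kk : ℝ) ≤ k := by exact_mod_cast hkk
    have h2 := hmono hLU
    rw [← hkL] at h2
    linarith
  have h2P : (2 : ℝ) ^ P ≤ e := by
    rw [← Real.rpow_natCast]; exact hmono hPU
  have h64 : (64 : ℝ) ^ P ≤ e ^ 6 := by
    rw [show (64 : ℝ) = 2 ^ 6 by norm_num, ← pow_mul, mul_comm 6, pow_mul]
    exact pow_le_pow_left₀ (by positivity) h2P 6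
  have h2W : (2 : ℝ) ^ ⌊11 * U⌋₊ ≤ e ^ 11 := by
    rw [← Real.rpow_natCast, ← Real.rpow_natCast, he, ← Real.rpow_mul (by norm_num)]
    refine hmono ((Nat.floor_le (by linarith)).trans ?_)
    push_cast
    linarith
  have he0 : 0 ≤ e := by linarith
  have h45 : (2 : ℝ) ^ (45 * U) = e ^ 45 := by
    rw [← Real.rpow_natCast, he, ← Real.rpow_mul (by norm_num)]
    congr 1
    push_cast
    ring
  have hpow : ∀ i ≤ 45, e ^ i ≤ e ^ 45 := fun i hi => pow_le_pow_right₀ (by linarith) hi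
  have t1 : (64 : ℝ) ^ P * 64 ^ P ≤ e ^ 45 := by
    have : (64 : ℝ) ^ P * 64 ^ P ≤ e ^ 6 * e ^ 6 := mul_le_mul h64 h64 (by positivity) (by positivity)
    have e1 : e ^ 6 * e ^ 6 = e ^ 12 := by ring
    exact (this.trans e1.le).trans (hpow 12 (by norm_num))
  have t2 : (kk : ℝ) * P + kk + 1 ≤ e ^ 4 := by
    have h1 : (kk : ℝ) * P ≤ e * e := mul_le_mul hke (by linarith) (by positivity) he0
    nlinarith [mul_le_mul he2 he2 (by norm_num) he0, mul_nonneg he0 he0]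
  have t3 : ((kk : ℝ) + 1) * 2 ^ ⌊11 * U⌋₊ + 1 ≤ e ^ 14 := by
    have h1 : ((kk : ℝ) + 1) * 2 ^ ⌊11 * U⌋₊ ≤ (e + 1) * e ^ 11 :=
      mul_le_mul (by linarith) h2W (by positivity) (by positivity)
    have h2 : 1 ≤ e ^ 11 := one_le_pow₀ (by linarith)
    have h3 : e + 2 ≤ e ^ 3 := by
      have : 4 ≤ e * e := by nlinarith
      nlinarith
    have h4 : (e + 2) * e ^ 11 ≤ e ^ 3 * e ^ 11 := mul_le_mul_of_nonneg_right h3 (by positivity)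
    have e2 : e ^ 3 * e ^ 11 = e ^ 14 := by ring
    have e3 : (e + 2) * e ^ 11 = (e + 1) * e ^ 11 + e ^ 11 := by ring
    linarith
  -- The exponent 45 is 1 + 4·4 + 2·14.
  have t4 : ((d : ℝ) + 1) * (kk * P + kk + 1) ^ 4 * (((kk : ℝ) + 1) * 2 ^ ⌊11 * U⌋₊ + 1) ^ 2 ≤
      e ^ 45 := by
    have h1 : ((d : ℝ) + 1) * (kk * P + kk + 1) ^ 4 * (((kk : ℝ) + 1) * 2 ^ ⌊11 * U⌋₊ + 1) ^ 2 ≤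
        e * (e ^ 4) ^ 4 * (e ^ 14) ^ 2 := by
      refine mul_le_mul (mul_le_mul (by linarith) ?_ (by positivity) he0) ?_ (by positivity)
        (by positivity)
      · exact pow_le_pow_left₀ (by positivity) t2 4
      · exact pow_le_pow_left₀ (by positivity) t3 2
    have h2 : e * (e ^ 4) ^ 4 * (e ^ 14) ^ 2 = e ^ 45 := by ring
    linarith
  have t5 : (d : ℝ) ≤ e ^ 45 := by
    have := hpow 1 (by norm_num)
    rw [pow_one] at this
    linarith
  rw [h45]
  push_cast
  linarith

end Estimates

end RealRAM

theorem theorem2p1 :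
    ∃ (P : RealRAM.Program) (K₁ K₂ K₃ : ℝ),
      ∀ (ε : ℝ), 0 < ε → ε ≤ 1 → ∀ I : KSupplier, I.WellPosed →
        ∃ (s : RealRAM.State) (t : ℕ),
          RealRAM.Exec I ε P RealRAM.State.init s t ∧
          I.IsApproxSolution (1 + ε) (s.output I) ∧
          (t : ℝ) ≤ K₁ * ((I.numClients : ℝ) * (I.numFacilities : ℝ) +
            (2 : ℝ) ^ (K₂ * ((2 / ε) ^ (K₃ * (I.dim : ℝ)) *
                (I.k : ℝ) ^ (1 - 1 / (I.dim : ℝ)) * Real.logb 2 (I.k : ℝ) +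
              (I.dim : ℝ) * Real.logb 2 (I.dim : ℝ)))) := by
  -- The 10 is the exponent of (2/ε)^d in `mainTerm`, the 45 comes from `general_time_le`, and
  -- 400000 exceeds all the linear constants.
  refine ⟨RealRAM.solve, 400000, 45, 10, fun ε hε hε1 I hI => ?_⟩
  have hd : 0 < I.dim := hI.dim_pos
  have hm : 0 < I.numFacilities := lt_of_lt_of_le hI.k_pos hI.k_le
  obtain ⟨s, t, he, ht, hs⟩ := RealRAM.ends_solve hI hε hε1 fun hk a l lg ha hl hl1 hl2 hlg =>
    RealRAM.exists_window hε hε1 hd hk (lt_min hI.k_pos hI.clients_pos) (min_le_left _ _) ha hl hl1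
      hl2 hlg
  refine ⟨s, t, he, hs, ?_⟩
  have hnm : 300500 * (I.numClients * I.numFacilities) + 300 * I.numFacilities + 300 ≤
      400000 * (I.numClients * I.numFacilities) := by
    have h1 : I.numFacilities ≤ I.numClients * I.numFacilities :=
      Nat.le_mul_of_pos_left _ hI.clients_pos
    omega
  have hnm' : (((300500 * (I.numClients * I.numFacilities) + 300 * I.numFacilities + 300 : ℕ)) : ℝ) ≤
      400000 * ((I.numClients : ℝ) * I.numFacilities) := by exact_mod_cast hnm
  have ht' := (Nat.cast_le (α := ℝ)).2 ht
  rw [Nat.cast_add] at ht'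
  rw [mul_add]
  refine ht'.trans (add_le_add hnm' ?_)
  by_cases hk : I.k < 2
  · rw [if_pos hk, Nat.cast_zero]
    positivity
  · rw [if_neg hk]
    rw [not_lt] at hk
    refine (RealRAM.general_time_le hε hε1 hd hk (min_le_left _ _)).trans ?_
    refine mul_le_mul_of_nonneg_left (Real.rpow_le_rpow_of_exponent_le (by norm_num) ?_)
      (by norm_num)
    have e : (2 / ε) ^ ((10 : ℝ) * I.dim) = ((2 / ε) ^ I.dim) ^ 10 := by
      rw [mul_comm, Real.rpow_mul (by positivity), Real.rpow_natCast]
      exact_mod_cast Real.rpow_natCast _ 10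
    -- The term d·log d only enlarges the exponent; the polynomial dependence on d is already
    -- covered by d + 1 ≤ (2/ε)^d.
    have h0 : 0 ≤ (I.dim : ℝ) * Real.logb 2 I.dim :=
      mul_nonneg (by positivity) (Real.logb_nonneg (by norm_num) (by exact_mod_cast hd))
    rw [e]
    unfold RealRAM.mainTerm
    linarith
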